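/- Let $n\ge 0$ be an integer and let $g,g_0,g_1,g_0',g_1'\ge 0$ be real numbers. For real $\beta$ and $z\in\mathbb C$ put $\gamma=i\beta/2$, $$v_a(z)=\frac{\sin\frac12(i\beta g+z)}{\sin\frac12 z},\qquad v_b(z)=\frac{\sin\frac12(i\beta g_0+z)}{\sin\frac12 z}\,\frac{\cos\frac12(i\beta g_1+z)}{\cos\frac12 z}\,\frac{\sin\frac12(i\beta g_0'+\gamma+z)}{\sin\frac12(\gamma+z)}\,\frac{\cos\frac12(i\beta g_1'+\gamma+z)}{\cos\frac12(\gamma+z)},$$ and for disjoint $J,K\subset\{1,\dots,n\}$ and signs $\varepsilon_j=\pm1$ $$V_{\varepsilon J;K}=\prod_{j\in J}v_b(\varepsilon_jx_j)\prod_{\substack{j,j'\in J\\ j<j'}}v_a(\varepsilon_jx_j+\varepsilon_{j'}x_{j'})\,v_a(\varepsilon_jx_j+\varepsilon_{j'}x_{j'}+2\gamma)\prod_{\substack{j\in J\\ k\in K}}v_a(\varepsilon_jx_j+x_k)\,v_a(\varepsilon_jx_j-x_k).$$ For $1\le r\le n$ let $$\hat D_{r,\beta}=\sum_{\substack{|J|=r\\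 \varepsilon_j=\pm1,\,j\in J}}\ \sum_{\substack{\emptyset=J_0\subsetneq J_1\subsetneq\cdots\subsetneq J_s=J\\ 1\le s\le r}}(-1)^{s-1}\prod_{s'=1}^{s}V_{\varepsilon(J_{s'}\setminus J_{s'-1});J_{s'}^c}\,\bigl(e^{-\beta\hat\theta_{\varepsilon J_1}}-1\bigr),\qquad \hat\theta_{\varepsilon J}=\sum_{j\in J}\varepsilon_j\hat\theta_j,\quad \hat\theta_j=\frac1i\frac{\partial}{\partial x_j},$$ where $e^{-\beta\hat\theta_{\varepsilon J}}$ acts on analytic functions by $x_j\mapsto x_j+i\beta\varepsilon_j$ ($j\in J$). Let $U\subset\mathbb R^n$ be the set of $x$ with $x_j\notin\pi\mathbb Z$ for all $j$ and $x_j\pm x_k\notin2\pi\mathbb Z$ for $j\ne k$. Expanding the coefficients at $\beta=0$ and the exponentials as formal series gives a formal power series $\hat D_{r,\beta}=\sum_{m\ge0}\hat D_r^{(m)}\beta^m$ whose coefficients are partial differential operators with smooth coefficients on $U$, acting on $C^\infty(U)$. Let $m_r=\min\{m:\hat D_r^{(m)}\ne0\}$ and $\hat D_{r,0}=\hat D_r^{(m_r)}$.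 Let $\mathcal P^+=\{\lambda\in\mathbb Z^n:\lambda_1\ge\cdots\ge\lambda_n\ge0\}$, partially ordered by $\lambda'\le\lambda$ iff $\sum_{j\le k}\lambda_j'\le\sum_{j\le k}\lambda_j$ for $k=1,\dots,n$. Let $m_\lambda(x)=\sum_{\nu\in W\lambda}e^{i\sum_j\nu_jx_j}$, where $W$ is the group of permutations and sign changes, and $$\Delta_0(x)=\prod_{j<k}\bigl|\sin\tfrac12(x_j+x_k)\sin\tfrac12(x_j-x_k)\bigr|^{2g}\prod_j\bigl|\sin\tfrac12x_j\bigr|^{2(g_0+g_0')}\bigl|\cos\tfrac12x_j\bigr|^{2(g_1+g_1')}.$$ The $BC_n$ Jacobi polynomial $p_{\lambda,0}$, $\lambda\in\mathcal P^+$, is determined by $p_{\lambda,0}\in m_\lambda+\mathrm{span}_{\mathbb C}\{m_{\lambda'}:\lambda'\in\mathcal P^+,\lambda'<\lambda\}$ and $\int_{\mathbb R^n/2\pi\mathbb Z^n}p_{\lambda,0}\,\overline{m_{\lambda'}}\,\Delta_0\,dx=0$ for all $\lambda'\in\mathcal P^+$ with $\lambda'<\lambda$. Put $\rho_j=(n-j)g+\frac12(g_0+g_1+g_0'+g_1')$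 and $$E_{r,n}(t_1,\dots,t_n;q_r,\dots,q_n)=\sum_{s=0}^{r}(-1)^{r+s}\Bigl(\sum_{|J|=s}\prod_{j\in J}t_j\Bigr)\Bigl(\sum_{r\le i_1\le\cdots\le i_{r-s}\le n}q_{i_1}\cdots q_{i_{r-s}}\Bigr).$$ Then: (0) For every $\lambda\in\mathcal P^+$ there is exactly one such $p_{\lambda,0}$. (1) For $1\le r\le n$ one has $m_r=2r$. Moreover $\hat D_{r,0}=\lim_{\beta\downarrow0}\beta^{-2r}\hat D_{r,\beta}$: for every function $f$ that is analytic in a neighbourhood of $U$ in $\mathbb C^n$ and every $x\in U$, $\beta^{-2r}(\hat D_{r,\beta}f)(x)\to(\hat D_{r,0}f)(x)$. (2) For $1\le r\le n$ and $\lambda\in\mathcal P^+$, $$\hat D_{r,0}\,p_{\lambda,0}=E_{r,n}\bigl((\lambda_1+\rho_1)^2,\dots,(\lambda_n+\rho_n)^2;\rho_r^2,\dots,\rho_n^2\bigr)\,p_{\lambda,0}.$$ (3) The operators $\hat D_{1,0},\dots,\hat D_{n,0}$ commute. (4) Let $\mathbb D_0=\mathbb R[\hat D_{1,0},\dots,\hat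 D_{n,0}]$. For every $S\in\mathbb R[\theta_1^2,\dots,\theta_n^2]^{S_n}$ there is a unique $\hat D_0\in\mathbb D_0$ with $\hat D_0\,p_{\lambda,0}=S(\lambda+\rho)\,p_{\lambda,0}$ for all $\lambda\in\mathcal P^+$, and this correspondence is an isomorphism of real algebras $\mathbb D_0\cong\mathbb R[\theta_1^2,\dots,\theta_n^2]^{S_n}$. -/

import Mathlib

open Set Filter Topology MeasureTheory
open scoped BigOperators ContDiff Nat

namespace BCn

noncomputable section

/-! ### Parameters and the difference operators -/

/-- The coupling constants `g, g₀, g₁, g₀', g₁'` (they do not depend on the step size `β`). -/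
structure Couplings where
  g : ℝ
  g₀ : ℝ
  g₁ : ℝ
  g₀' : ℝ
  g₁' : ℝ

/-- `γ = iβ/2`. -/
def gam (β : ℝ) : ℂ := Complex.I * β / 2

/-- `v_a(z) = sin α(μ + z) / sin αz`, with `α = 1/2` and `μ = iβg`. -/
def vA (P : Couplings) (β : ℝ) (z : ℂ) : ℂ :=
  Complex.sin ((Complex.I * β * P.g + z) / 2) / Complex.sin (z / 2)

/-- `v_b(z)`, with `α = 1/2`, `μ_δ = iβ g_δ`, `μ_δ' = iβ g_δ'`. -/
def vB (P : Couplings) (β : ℝ) (z : ℂ) : ℂ :=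
  (Complex.sin ((Complex.I * β * P.g₀ + z) / 2) / Complex.sin (z / 2)) *
  (Complex.cos ((Complex.I * β * P.g₁ + z) / 2) / Complex.cos (z / 2)) *
  (Complex.sin ((Complex.I * β * P.g₀' + gam β + z) / 2) / Complex.sin ((gam β + z) / 2)) *
  (Complex.cos ((Complex.I * β * P.g₁' + gam β + z) / 2) / Complex.cos ((gam β + z) / 2))

variable {n : ℕ}

/-- `ε_j x_j`. -/
def signed (ε : Fin n → ℤˣ) (x : Fin n → ℂ) (j : Fin n) : ℂ := ((ε j : ℤ) : ℂ) * x j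

/-- The function `V_{εJ;K}`. -/
def V (P : Couplings) (β : ℝ) (ε : Fin n → ℤˣ) (J K : Finset (Fin n)) (x : Fin n → ℂ) : ℂ :=
  (∏ j ∈ J, vB P β (signed ε x j)) *
  (∏ q ∈ (J ×ˢ J).filter (fun q => q.1 < q.2),
    vA P β (signed ε x q.1 + signed ε x q.2) *
    vA P β (signed ε x q.1 + signed ε x q.2 + 2 * gam β)) *
  (∏ j ∈ J, ∏ k ∈ K, vA P β (signed ε x j + x k) * vA P β (signed ε x j - x k))

/-- The sign configurations on `J`, as functions on all indices that are `1` off `J`. -/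
def signs (J : Finset (Fin n)) : Finset (Fin n → ℤˣ) :=
  Finset.univ.filter (fun ε => ∀ j, j ∉ J → ε j = 1)

open scoped Classical in
/-- The strictly increasing sequences `∅ = J₀ ⊊ J₁ ⊊ ⋯ ⊊ J_s = J`. -/
def chains (J : Finset (Fin n)) (s : ℕ) : Finset (Fin (s + 1) → Finset (Fin n)) :=
  Finset.univ.filter (fun c => StrictMono c ∧ c 0 = ∅ ∧ c (Fin.last s) = J)

/-- The double sum that defines the `r`th operator: over all `J` with `|J| = r`, all signs on `J`,
and all sequences `∅ = J₀ ⊊ J₁ ⊊ ⋯ ⊊ J_s = J` with `1 ≤ s ≤ r`. -/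
def cellSum {M : Type*} [AddCommMonoid M] (n r : ℕ)
    (F : (Fin n → ℤˣ) → (s : ℕ) → (Fin (s + 1) → Finset (Fin n)) → M) : M :=
  ∑ J ∈ Finset.powersetCard r (Finset.univ : Finset (Fin n)),
    ∑ ε ∈ signs J, ∑ s ∈ Finset.Icc 1 r, ∑ c ∈ chains J s, F ε s c

/-- `(-1)^{s-1} ∏_{1 ≤ s' ≤ s} V_{ε(J_{s'} ∖ J_{s'-1}); J_{s'}^c}`. -/
def chainCoeff (P : Couplings) (β : ℝ) (ε : Fin n → ℤˣ) (s : ℕ)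
    (c : Fin (s + 1) → Finset (Fin n)) (x : Fin n → ℂ) : ℂ :=
  (-1) ^ (s - 1) * ∏ i : Fin s, V P β ε (c i.succ \ c i.castSucc) (c i.succ)ᶜ x

/-- The analytic difference operator `D̂_{r,β}`; the translator `exp(-β θ̂_{εJ₁})` shifts `x_j`,
`j ∈ J₁`, by `iβ ε_j`. -/
def differenceOp (P : Couplings) (r : ℕ) (β : ℝ) (f : (Fin n → ℂ) → ℂ) (x : Fin n → ℂ) : ℂ :=
  cellSum n r fun ε s c => chainCoeff P β ε s c x *
    (f (fun j => x j + if j ∈ c 1 then Complex.I * β * ((ε j : ℤ) : ℂ) else 0) - f x)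

/-! ### Smooth functions on the regular set -/

/-- The inclusion of `ℝⁿ` in `ℂⁿ`. -/
def toC (x : Fin n → ℝ) : Fin n → ℂ := fun j => (x j : ℂ)

/-- The open dense set of `x ∈ ℝⁿ` at which no denominator vanishes:
`x_j ∉ πℤ`, and `x_j ± x_k ∉ 2πℤ` for `j ≠ k`. -/
def regularSet (n : ℕ) : Set (Fin n → ℝ) :=
  {x | (∀ j, Real.sin (x j / 2) ≠ 0 ∧ Real.cos (x j / 2) ≠ 0) ∧
    ∀ j k, j ≠ k → Real.sin ((x j + x k) / 2) ≠ 0 ∧ Real.sin ((x j - x k) / 2) ≠ 0}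

theorem isOpen_regularSet (n : ℕ) : IsOpen (regularSet n) := by
  have h : regularSet n =
      (⋂ j : Fin n, {x | Real.sin (x j / 2) ≠ 0} ∩ {x | Real.cos (x j / 2) ≠ 0}) ∩
      (⋂ j : Fin n, ⋂ k : Fin n, ⋂ _ : j ≠ k,
        {x | Real.sin ((x j + x k) / 2) ≠ 0} ∩ {x | Real.sin ((x j - x k) / 2) ≠ 0}) := by
    ext x; simp [regularSet]
  rw [h]
  refine IsOpen.inter (isOpen_iInter_of_finite fun j => ?_)
    (isOpen_iInter_of_finite fun j => isOpen_iInter_of_finite fun k =>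
      isOpen_iInter_of_finite fun _ => ?_)
  · exact (isOpen_ne_fun (by fun_prop) (by fun_prop)).inter
      (isOpen_ne_fun (by fun_prop) (by fun_prop))
  · exact (isOpen_ne_fun (by fun_prop) (by fun_prop)).inter
      (isOpen_ne_fun (by fun_prop) (by fun_prop))

/-- The complex vector space `C^∞(U)`, `U` the regular set; a function on `U` is represented by its
extension by zero to `ℝⁿ`. -/
def SmoothFn (n : ℕ) : Submodule ℂ ((Fin n → ℝ) → ℂ) where
  carrier := {f | ContDiffOn ℝ ∞ f (regularSet n) ∧ ∀ x, x ∉ regularSet n → f x = 0}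
  add_mem' := by
    rintro f h ⟨hf, hf0⟩ ⟨hh, hh0⟩
    exact ⟨hf.add hh, fun x hx => by simp [hf0 x hx, hh0 x hx]⟩
  zero_mem' := ⟨contDiffOn_const, fun _ _ => rfl⟩
  smul_mem' := by
    rintro a f ⟨hf, hf0⟩
    exact ⟨contDiffOn_const.smul hf, fun x hx => by simp [hf0 x hx]⟩

/-- The element of `C^∞(U)` given by a function that is smooth on `U`. -/
def toSmooth (f : (Fin n → ℝ) → ℂ) (hf : ContDiffOn ℝ ∞ f (regularSet n)) : SmoothFn n :=
  ⟨(regularSet n).indicator f,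
    hf.congr fun _ hx => indicator_of_mem hx f,
    fun _ hx => indicator_of_notMem hx f⟩

/-- Multiplication by a function that is smooth on `U`. -/
def mulOp (a : (Fin n → ℝ) → ℂ) (ha : ContDiffOn ℝ ∞ a (regularSet n)) :
    Module.End ℂ (SmoothFn n) where
  toFun f := ⟨fun x => a x * (f : (Fin n → ℝ) → ℂ) x,
    ha.mul f.2.1, fun x hx => by simp [f.2.2 x hx]⟩
  map_add' f h := by ext x; simp [mul_add]
  map_smul' t f := by ext x; simp [mul_left_comm]

theorem differentiableAt_smoothFn (f : SmoothFn n) {x : Fin n → ℝ} (hx : x ∈ regularSet n) :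
    DifferentiableAt ℝ (f : (Fin n → ℝ) → ℂ) x :=
  (f.2.1.contDiffAt ((isOpen_regularSet n).mem_nhds hx)).differentiableAt (by simp)

/-- The partial derivative `∂/∂x_j` on `C^∞(U)`. -/
def partialOp (j : Fin n) : Module.End ℂ (SmoothFn n) where
  toFun f := toSmooth (fun x => fderiv ℝ (f : (Fin n → ℝ) → ℂ) x (Pi.single j 1))
    ((f.2.1.fderiv_of_isOpen (m := ∞) (isOpen_regularSet n) (by simp)).clm_apply
      contDiffOn_const)
  map_add' f h := by
    ext x
    by_cases hx : x ∈ regularSet n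
    · simp [toSmooth, hx, fderiv_add (differentiableAt_smoothFn f hx) (differentiableAt_smoothFn h hx)]
    · simp [toSmooth, hx]
  map_smul' t f := by
    ext x
    by_cases hx : x ∈ regularSet n
    · simp [toSmooth, hx, fderiv_const_smul (differentiableAt_smoothFn f hx) t]
    · simp [toSmooth, hx]

/-- `θ̂_{εJ} = ∑_{j ∈ J} ε_j θ̂_j` with `θ̂_j = (1/i) ∂/∂x_j`. -/
def thetaOp (ε : Fin n → ℤˣ) (J : Finset (Fin n)) : Module.End ℂ (SmoothFn n) :=
  ∑ j ∈ J, ((ε j : ℤ) : ℂ) • ((1 / Complex.I) • partialOp j)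

/-! ### The formal expansion in `β` -/

theorem sin_ne_zero_of_re {z : ℂ} (h : Real.sin z.re ≠ 0) : Complex.sin z ≠ 0 := by
  intro hz
  obtain ⟨k, hk⟩ := Complex.sin_eq_zero_iff.1 hz
  apply h
  rw [hk]
  simp [Complex.mul_re]

theorem cos_ne_zero_of_re {z : ℂ} (h : Real.cos z.re ≠ 0) : Complex.cos z ≠ 0 := by
  rw [← Complex.sin_add_pi_div_two]
  apply sin_ne_zero_of_re
  have : (z + (Real.pi : ℂ) / 2).re = z.re + Real.pi / 2 := by
    rw [Complex.add_re, show ((Real.pi : ℂ) / 2) = ((Real.pi / 2 : ℝ) : ℂ) by push_cast; rfl,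
      Complex.ofReal_re]
  rwa [this, Real.sin_add_pi_div_two]

section smoothness

variable {s : Set ((Fin n → ℝ) × ℝ)}

theorem contDiffOn_ofReal {f : (Fin n → ℝ) × ℝ → ℝ} (hf : ContDiffOn ℝ ∞ f s) :
    ContDiffOn ℝ ∞ (fun q => (f q : ℂ)) s :=
  (Complex.ofRealCLM.contDiff (n := ∞)).comp_contDiffOn hf

theorem contDiffOn_sin {f : (Fin n → ℝ) × ℝ → ℂ} (hf : ContDiffOn ℝ ∞ f s) :
    ContDiffOn ℝ ∞ (fun q => Complex.sin (f q)) s :=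
  ((Complex.contDiff_sin (n := ∞)).restrict_scalars ℝ).comp_contDiffOn hf

theorem contDiffOn_cos {f : (Fin n → ℝ) × ℝ → ℂ} (hf : ContDiffOn ℝ ∞ f s) :
    ContDiffOn ℝ ∞ (fun q => Complex.cos (f q)) s :=
  ((Complex.contDiff_cos (n := ∞)).restrict_scalars ℝ).comp_contDiffOn hf

theorem contDiffOn_div {f h : (Fin n → ℝ) × ℝ → ℂ} (hf : ContDiffOn ℝ ∞ f s)
    (hh : ContDiffOn ℝ ∞ h s) (h0 : ∀ q ∈ s, h q ≠ 0) :
    ContDiffOn ℝ ∞ (fun q => f q / h q) s := by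
  simp only [div_eq_mul_inv]
  exact hf.mul (hh.inv h0)

theorem contDiffOn_beta (a : ℝ) :
    ContDiffOn ℝ ∞ (fun q : (Fin n → ℝ) × ℝ => Complex.I * (q.2 : ℂ) * (a : ℂ)) s :=
  (contDiffOn_const.mul (contDiffOn_ofReal contDiffOn_snd)).mul contDiffOn_const

theorem contDiffOn_gam : ContDiffOn ℝ ∞ (fun q : (Fin n → ℝ) × ℝ => gam q.2) s :=
  (contDiffOn_const.mul (contDiffOn_ofReal contDiffOn_snd)).div_const 2

theorem contDiffOn_vA (P : Couplings) {z : (Fin n → ℝ) × ℝ → ℂ} (hz : ContDiffOn ℝ ∞ z s)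
    (h0 : ∀ q ∈ s, Real.sin ((z q).re / 2) ≠ 0) :
    ContDiffOn ℝ ∞ (fun q => vA P q.2 (z q)) s := by
  unfold vA
  refine contDiffOn_div (contDiffOn_sin (((contDiffOn_beta _).add hz).div_const 2))
    (contDiffOn_sin (hz.div_const 2)) fun q hq => sin_ne_zero_of_re ?_
  simpa using h0 q hq

theorem contDiffOn_vB (P : Couplings) {z : (Fin n → ℝ) × ℝ → ℂ} (hz : ContDiffOn ℝ ∞ z s)
    (h0 : ∀ q ∈ s, Real.sin ((z q).re / 2) ≠ 0) (h1 : ∀ q ∈ s, Real.cos ((z q).re / 2) ≠ 0) :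
    ContDiffOn ℝ ∞ (fun q => vB P q.2 (z q)) s := by
  unfold vB
  refine ContDiffOn.mul (ContDiffOn.mul (ContDiffOn.mul ?_ ?_) ?_) ?_
  · refine contDiffOn_div (contDiffOn_sin (((contDiffOn_beta _).add hz).div_const 2))
      (contDiffOn_sin (hz.div_const 2)) fun q hq => sin_ne_zero_of_re ?_
    simpa using h0 q hq
  · refine contDiffOn_div (contDiffOn_cos (((contDiffOn_beta _).add hz).div_const 2))
      (contDiffOn_cos (hz.div_const 2)) fun q hq => cos_ne_zero_of_re ?_
    simpa using h1 q hq
  · refine contDiffOn_div (contDiffOn_sin ((((contDiffOn_beta _).add contDiffOn_gam).add hz).div_const 2))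
      (contDiffOn_sin ((contDiffOn_gam.add hz).div_const 2)) fun q hq => sin_ne_zero_of_re ?_
    simpa [gam] using h0 q hq
  · refine contDiffOn_div (contDiffOn_cos ((((contDiffOn_beta _).add contDiffOn_gam).add hz).div_const 2))
      (contDiffOn_cos ((contDiffOn_gam.add hz).div_const 2)) fun q hq => cos_ne_zero_of_re ?_
    simpa [gam] using h1 q hq

theorem contDiffOn_coord (k : Fin n) :
    ContDiffOn ℝ ∞ (fun q : (Fin n → ℝ) × ℝ => toC q.1 k) s :=
  contDiffOn_ofReal (((contDiff_apply ℝ ℝ k).comp contDiff_fst).contDiffOn)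

theorem contDiffOn_signed (ε : Fin n → ℤˣ) (k : Fin n) :
    ContDiffOn ℝ ∞ (fun q : (Fin n → ℝ) × ℝ => signed ε (toC q.1) k) s :=
  contDiffOn_const.mul (contDiffOn_coord k)

theorem regular_signed {x : Fin n → ℝ} (hx : x ∈ regularSet n) (ε : Fin n → ℤˣ) (j : Fin n) :
    Real.sin ((signed ε (toC x) j).re / 2) ≠ 0 ∧ Real.cos ((signed ε (toC x) j).re / 2) ≠ 0 := by
  have h := hx.1 j
  rcases Int.units_eq_one_or (ε j) with e | e <;> simpa [signed, toC, e, neg_div] using h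

theorem regular_add {x : Fin n → ℝ} (hx : x ∈ regularSet n) (ε : Fin n → ℤˣ) {j k : Fin n}
    (hjk : j ≠ k) :
    Real.sin ((signed ε (toC x) j + toC x k).re / 2) ≠ 0 ∧
    Real.sin ((signed ε (toC x) j - toC x k).re / 2) ≠ 0 := by
  have h := hx.2 j k hjk
  rcases Int.units_eq_one_or (ε j) with e | e
  · simpa [signed, toC, e] using h
  · have e1 : (-x j + x k) / 2 = -((x j - x k) / 2) := by ring
    have e2 : (-x j - x k) / 2 = -((x j + x k) / 2) := by ring
    simp only [signed, toC, e, Units.val_neg, Units.val_one, Int.cast_neg, Int.cast_one,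
      neg_mul, one_mul, Complex.add_re, Complex.sub_re, Complex.neg_re, Complex.ofReal_re, e1, e2,
      Real.sin_neg, neg_ne_zero]
    exact ⟨h.2, h.1⟩

theorem regular_signed_add {x : Fin n → ℝ} (hx : x ∈ regularSet n) (ε : Fin n → ℤˣ)
    {j k : Fin n} (hjk : j ≠ k) :
    Real.sin ((signed ε (toC x) j + signed ε (toC x) k).re / 2) ≠ 0 := by
  have h := regular_add hx ε hjk
  rcases Int.units_eq_one_or (ε k) with e | e
  · simpa [signed, toC, e] using h.1
  · have := h.2
    simpa [signed, toC, e, sub_eq_add_neg] using this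

theorem contDiffOn_V (P : Couplings) (ε : Fin n → ℤˣ) (J K : Finset (Fin n))
    (hJK : Disjoint J K) :
    ContDiffOn ℝ ∞ (fun q : (Fin n → ℝ) × ℝ => V P q.2 ε J K (toC q.1))
      (regularSet n ×ˢ univ) := by
  unfold V
  refine ContDiffOn.mul (ContDiffOn.mul ?_ ?_) ?_
  · exact contDiffOn_prod fun j _ => contDiffOn_vB P (contDiffOn_signed ε j)
      (fun q hq => (regular_signed hq.1 ε j).1) (fun q hq => (regular_signed hq.1 ε j).2)
  · refine contDiffOn_prod fun p hp => ContDiffOn.mul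
      (contDiffOn_vA P ((contDiffOn_signed ε _).add (contDiffOn_signed ε _)) fun q hq =>
        regular_signed_add hq.1 ε (ne_of_lt (Finset.mem_filter.1 hp).2))
      (contDiffOn_vA P (((contDiffOn_signed ε _).add (contDiffOn_signed ε _)).add
        (contDiffOn_const.mul contDiffOn_gam)) fun q hq => ?_)
    have := regular_signed_add hq.1 ε (ne_of_lt (Finset.mem_filter.1 hp).2)
    simpa [gam] using this
  · refine contDiffOn_prod fun j hj => contDiffOn_prod fun k hk => ?_
    have hjk : j ≠ k := fun h => Finset.disjoint_left.1 hJK hj (h ▸ hk)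
    exact ContDiffOn.mul
      (contDiffOn_vA P ((contDiffOn_signed ε j).add (contDiffOn_coord k)) fun q hq =>
        (regular_add hq.1 ε hjk).1)
      (contDiffOn_vA P ((contDiffOn_signed ε j).sub (contDiffOn_coord k)) fun q hq =>
        (regular_add hq.1 ε hjk).2)

theorem contDiffOn_chainCoeff (P : Couplings) (ε : Fin n → ℤˣ) (s : ℕ)
    (c : Fin (s + 1) → Finset (Fin n)) :
    ContDiffOn ℝ ∞ (fun q : (Fin n → ℝ) × ℝ => chainCoeff P q.2 ε s c (toC q.1))
      (regularSet n ×ˢ univ) := by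
  unfold chainCoeff
  refine contDiffOn_const.mul (contDiffOn_prod fun i _ => contDiffOn_V P ε _ _ ?_)
  exact Finset.disjoint_left.2 fun j hj hk =>
    (Finset.mem_compl.1 hk) (Finset.mem_sdiff.1 hj).1

theorem contDiffOn_iteratedDeriv {U : Set (Fin n → ℝ)} (hU : IsOpen U)
    (F : (Fin n → ℝ) → ℝ → ℂ)
    (hF : ContDiffOn ℝ ∞ (fun q : (Fin n → ℝ) × ℝ => F q.1 q.2) (U ×ˢ univ)) (k : ℕ) :
    ContDiffOn ℝ ∞ (fun q : (Fin n → ℝ) × ℝ => iteratedDeriv k (F q.1) q.2) (U ×ˢ univ) := by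
  induction k with
  | zero => simpa using hF
  | succ k ih =>
    have ho : IsOpen (U ×ˢ (univ : Set ℝ)) := hU.prod isOpen_univ
    have h1 : ContDiffOn ℝ ∞ (fun q : (Fin n → ℝ) × ℝ =>
        fderiv ℝ (fun q : (Fin n → ℝ) × ℝ => iteratedDeriv k (F q.1) q.2) q
          ((0 : Fin n → ℝ), (1 : ℝ))) (U ×ˢ univ) :=
      (ih.fderiv_of_isOpen (m := ∞) ho (by simp)).clm_apply contDiffOn_const
    refine h1.congr ?_
    rintro ⟨x, b⟩ hq
    have hd : HasFDerivAt (fun q : (Fin n → ℝ) × ℝ => iteratedDeriv k (F q.1) q.2)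
        (fderiv ℝ (fun q : (Fin n → ℝ) × ℝ => iteratedDeriv k (F q.1) q.2) (x, b)) (x, b) :=
      ((ih.contDiffAt (ho.mem_nhds hq)).differentiableAt (by simp)).hasFDerivAt
    have hc : HasDerivAt (fun t : ℝ => ((x, t) : (Fin n → ℝ) × ℝ)) (0, 1) b :=
      (hasDerivAt_const b x).prodMk (hasDerivAt_id b)
    have := hd.comp_hasDerivAt b hc
    simp only [iteratedDeriv_succ]
    exact this.deriv

end smoothness

/-- The coefficient of `β^k` in the Taylor expansion at `β = 0` of the coefficient of a chain, as a
function of `x`. -/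
def taylorCoeff (P : Couplings) (ε : Fin n → ℤˣ) (s : ℕ) (c : Fin (s + 1) → Finset (Fin n))
    (k : ℕ) (x : Fin n → ℝ) : ℂ :=
  iteratedDeriv k (fun β : ℝ => chainCoeff P β ε s c (toC x)) 0 / (k ! : ℂ)

theorem contDiffOn_taylorCoeff (P : Couplings) (ε : Fin n → ℤˣ) (s : ℕ)
    (c : Fin (s + 1) → Finset (Fin n)) (k : ℕ) :
    ContDiffOn ℝ ∞ (taylorCoeff P ε s c k) (regularSet n) := by
  have h := contDiffOn_iteratedDeriv (isOpen_regularSet n)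
    (fun x β => chainCoeff P β ε s c (toC x)) (contDiffOn_chainCoeff P ε s c) k
  have h2 : ContDiffOn ℝ ∞ (fun x : Fin n → ℝ => ((x, (0 : ℝ)) : (Fin n → ℝ) × ℝ))
      (regularSet n) := contDiffOn_id.prodMk contDiffOn_const
  exact (h.comp h2 fun x hx => ⟨hx, mem_univ _⟩).div_const _

/-- The formal power series `∑_l (-β)^l θ̂_{εJ}^l / l!` of the translator `exp(-β θ̂_{εJ})`. -/
def translatorSeries (ε : Fin n → ℤˣ) (J : Finset (Fin n)) :
    PowerSeries (Module.End ℂ (SmoothFn n)) :=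
  PowerSeries.mk fun l => ((-1 : ℂ) ^ l / (l ! : ℂ)) • thetaOp ε J ^ l

/-- The formal power series expansion in `β` of `D̂_{r,β}`. Its coefficients are partial
differential operators on the regular set. -/
def expansion (n : ℕ) (P : Couplings) (r : ℕ) : PowerSeries (Module.End ℂ (SmoothFn n)) :=
  cellSum n r fun ε s c =>
    (PowerSeries.mk fun k => mulOp (taylorCoeff P ε s c k) (contDiffOn_taylorCoeff P ε s c k)) *
      (translatorSeries ε (c 1) - 1)

/-- `m_r`: the least `m` such that the coefficient of `β^m` in the expansion is nonzero
(a positive value cannot come from the convention `sInf ∅ = 0`). -/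
def leadingOrder (n : ℕ) (P : Couplings) (r : ℕ) : ℕ :=
  sInf {m : ℕ | PowerSeries.coeff m (expansion n P r) ≠ 0}

/-- The leading partial differential operator `D̂_{r,0}`. -/
def leadingPDO (n : ℕ) (P : Couplings) (r : ℕ) : Module.End ℂ (SmoothFn n) :=
  PowerSeries.coeff (leadingOrder n P r) (expansion n P r)

/-- The real algebra `𝔻₀ = ℝ[D̂_{1,0}, …, D̂_{n,0}]`. -/
def pdoAlgebra (n : ℕ) (P : Couplings) : Subalgebra ℝ (Module.End ℂ (SmoothFn n)) :=
  Algebra.adjoin ℝ {D | ∃ r, 1 ≤ r ∧ r ≤ n ∧ D = leadingPDO n P r}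

/-! ### Jacobi polynomials -/

/-- The cone of dominant weights `λ₁ ≥ ⋯ ≥ λ_n ≥ 0`. -/
def IsDominant (lam : Fin n → ℤ) : Prop := Antitone lam ∧ ∀ j, 0 ≤ lam j

/-- `λ' < λ` for the partial order by partial sums. -/
def DomLT (lam' lam : Fin n → ℤ) : Prop :=
  (∀ k : Fin n, ∑ j ∈ Finset.Iic k, lam' j ≤ ∑ j ∈ Finset.Iic k, lam j) ∧ lam' ≠ lam

/-- The orbit of a weight under permutations and sign flips. -/
def weylOrbit (lam : Fin n → ℤ) : Finset (Fin n → ℤ) :=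
  Finset.univ.image fun w : Equiv.Perm (Fin n) × (Fin n → ℤˣ) =>
    fun j => (w.2 j : ℤ) * lam (w.1 j)

/-- The monomial symmetric function `m_λ`. -/
def monomialSymm (lam : Fin n → ℤ) (x : Fin n → ℝ) : ℂ :=
  ∑ nu ∈ weylOrbit lam, Complex.exp (Complex.I * ∑ j, (nu j : ℂ) * (x j : ℂ))

/-- The weight function `Δ₀`, with `g̃₀ = g₀ + g₀'` and `g̃₁ = g₁ + g₁'`. -/
def weight (P : Couplings) (x : Fin n → ℝ) : ℝ :=
  (∏ q ∈ (Finset.univ : Finset (Fin n × Fin n)).filter (fun q => q.1 < q.2),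
    |Real.sin ((x q.1 + x q.2) / 2) * Real.sin ((x q.1 - x q.2) / 2)| ^ (2 * P.g)) *
  ∏ j, |Real.sin (x j / 2)| ^ (2 * (P.g₀ + P.g₀')) * |Real.cos (x j / 2)| ^ (2 * (P.g₁ + P.g₁'))

/-- `⟨f, h⟩ = ∫_{ℝⁿ/2πℤⁿ} f h̄ Δ₀ dx`. -/
def innerWeight (P : Couplings) (f h : (Fin n → ℝ) → ℂ) : ℂ :=
  ∫ x in Set.Icc (fun _ : Fin n => -Real.pi) (fun _ => Real.pi),
    f x * (starRingEnd ℂ) (h x) * (weight P x : ℂ)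

/-- `p` is the `BC_n` Jacobi polynomial `p_{λ,0}`. -/
structure IsJacobi (P : Couplings) (lam : Fin n → ℤ) (p : (Fin n → ℝ) → ℂ) : Prop where
  dominant : IsDominant lam
  triangular : p - monomialSymm lam ∈
    Submodule.span ℂ {f | ∃ lam', IsDominant lam' ∧ DomLT lam' lam ∧ f = monomialSymm lam'}
  orthogonal : ∀ lam', IsDominant lam' → DomLT lam' lam →
    innerWeight P p (monomialSymm lam') = 0

theorem contDiff_monomialSymm (lam : Fin n → ℤ) : ContDiff ℝ ∞ (monomialSymm lam) := by
  unfold monomialSymm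
  refine ContDiff.sum fun nu _ => ContDiff.cexp (contDiff_const.mul (ContDiff.sum fun j _ =>
    contDiff_const.mul ?_))
  exact Complex.ofRealCLM.contDiff.comp (contDiff_apply ℝ ℝ j)

theorem IsJacobi.contDiffOn {P : Couplings} {lam : Fin n → ℤ} {p : (Fin n → ℝ) → ℂ}
    (h : IsJacobi P lam p) : ContDiffOn ℝ ∞ p (regularSet n) := by
  have h1 : ContDiff ℝ ∞ (p - monomialSymm lam) := by
    refine Submodule.span_induction (p := fun f _ => ContDiff ℝ ∞ f) ?_ contDiff_const
      (fun _ _ _ _ hf hh => hf.add hh) (fun a _ _ hf => contDiff_const.smul hf) h.triangular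
    rintro f ⟨lam', -, -, rfl⟩
    exact contDiff_monomialSymm lam'
  have h2 := h1.add (contDiff_monomialSymm lam)
  have h3 : (fun x => (p - monomialSymm lam) x + monomialSymm lam x) = p := by
    ext x; simp
  exact (h3 ▸ h2).contDiffOn

/-- The Jacobi polynomial as an element of `C^∞(U)`. -/
def IsJacobi.fn {P : Couplings} {lam : Fin n → ℤ} {p : (Fin n → ℝ) → ℂ}
    (h : IsJacobi P lam p) : SmoothFn n := toSmooth p h.contDiffOn

/-! ### Eigenvalues -/

/-- `ρ_j = (n - j) g + (g₀ + g₁ + g₀' + g₁')/2` for `j = 1, …, n` (index `j` is stored at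
`j - 1 : Fin n`). -/
def rho (n : ℕ) (P : Couplings) (j : Fin n) : ℝ :=
  ((n : ℝ) - ((j : ℕ) + 1)) * P.g + (P.g₀ + P.g₁ + P.g₀' + P.g₁') / 2

/-- `λ + ρ`. -/
def shifted (P : Couplings) (lam : Fin n → ℤ) (j : Fin n) : ℝ := (lam j : ℝ) + rho n P j

/-- `E_{r,n}(t₁,…,t_n; p_r,…,p_n) = ∑_{0 ≤ s ≤ r} (-1)^{r+s} (∑_{|J| = s} ∏_{j ∈ J} t_j)
(∑_{r ≤ i_1 ≤ ⋯ ≤ i_{r-s} ≤ n} p_{i_1} ⋯ p_{i_{r-s}})`; only `p_r, …, p_n` are used. -/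
def E (n r : ℕ) (t p : Fin n → ℝ) : ℝ :=
  open scoped Classical in
  ∑ s ∈ Finset.range (r + 1), (-1) ^ (r + s) *
    (∑ J ∈ Finset.powersetCard s (Finset.univ : Finset (Fin n)), ∏ j ∈ J, t j) *
    (∑ i ∈ (Finset.univ : Finset (Fin (r - s) → Fin n)).filter
      (fun i : Fin (r - s) → Fin n => Monotone i ∧ ∀ a, r ≤ (i a : ℕ) + 1), ∏ a, p (i a))

/-- The algebra `ℝ[θ₁², …, θ_n²]^{S_n}`, as a subalgebra of `ℝ[θ₁, …, θ_n]`. -/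
def symmSquares (n : ℕ) : Subalgebra ℝ (MvPolynomial (Fin n) ℝ) :=
  (MvPolynomial.symmetricSubalgebra (Fin n) ℝ).map (MvPolynomial.expand 2)

theorem contDiffOn_of_analytic {f : (Fin n → ℂ) → ℂ}
    (hf : AnalyticOnNhd ℂ f (toC '' regularSet n)) :
    ContDiffOn ℝ ∞ (fun x => f (toC x)) (regularSet n) := by
  intro x hx
  have h1 : ContDiffAt ℝ ∞ f (toC x) :=
    ((hf _ ⟨x, hx, rfl⟩).contDiffAt (n := ∞)).restrict_scalars ℝ
  have h2 : ContDiff ℝ ∞ (toC : (Fin n → ℝ) → Fin n → ℂ) :=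
    contDiff_pi.2 fun j => Complex.ofRealCLM.contDiff.comp (contDiff_apply ℝ ℝ j)
  exact (h1.comp x h2.contDiffAt).contDiffWithinAt

/-- The restriction to `U` of a function that is analytic near every point of `U`. -/
def restrictReal (f : (Fin n → ℂ) → ℂ) (hf : AnalyticOnNhd ℂ f (toC '' regularSet n)) :
    SmoothFn n := toSmooth (fun x => f (toC x)) (contDiffOn_of_analytic hf)

end

end BCn

namespace BCn

noncomputable section

variable {n : ℕ} (P : Couplings) (β : ℝ) {f : (Fin n → ℂ) → ℂ} {x : Fin n → ℝ} {K : Finset (Fin n)}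
  {τ : Fin n → SignType} {lam : Fin n → ℤ}

open Finset (prod_filter prod_mul_distrib prod_congr mem_filter mem_product prod_map
  sum_fiberwise_of_maps_to sum_congr card_eq_zero sum_sigma' sum_bij' mem_sigma mem_erase
  disjoint_sdiff card_union_of_disjoint add_sum_erase mul_sum sum_eq_zero subset_empty
  union_sdiff_of_subset sum_comm sum_neg_distrib sum_sub_distrib card_pos mem_powersetCard sum_mul
  card_map sum_add_distrib sum_insert mem_insert_self mem_of_mem_erase sum_coe_sort
  ne_of_mem_erase prod_pair prod_range_succ prod_const sum_filter filter_true_of_mem prod_subset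
  card_univ filter_congr sum_le_sum sum_subset sum_const sum_eq_single sum_div sum_range_succ
  prod_pos prod_nonneg prod_eq_zero sum_product' sum_subtype smul_sum prod_ne_zero_iff)
open Equiv (Perm swap sum_comp)
open Real (sin_add_pi_div_two sin_neg cosh sinh pi_pos mul_rpow)
open Complex (I cos sin_add_pi exp exp_add exp_ne_zero exp_neg exp_int_mul exp_pi_mul_I
  exp_nat_mul I_sq I_ne_zero continuous_sin exp_zero I_mul_I ofReal_zero continuous_ofReal
  ofReal_mul ofReal_sum ofRealCLM add_re neg_re ofReal_re real_smul div_I normSq norm_real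
  ofReal_sin ofReal_ne_zero ofReal_cos sin)
open SignType (coe_neg_one)
open Int (units_eq_one_or)
open Pi (single_apply single_eq_same single_eq_of_ne single)
open Submodule (span subset_span span_induction smul_mem)
open Function (Injective ne_iff comp_def iterate_one Surjective)
open PowerSeries (coeff coeff_mul coeff_mk coeff_one)
open Finsupp (mem_support_iff finsetSum_apply)
open LinearMap (proj proj_apply pi_apply)
open Module (End)
open Fintype (prod_prod_type prod_bool sum_prod_type sum_bool)
open MvPolynomial (aeval eval coe_aeval_eq_eval algHom_ext funext_set bind₁ aeval_bind₁ expand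
  esymm eval_C algHom_C aeval_X IsHomogeneous expand_C)
open Algebra (adjoin subset_adjoin)

local notation "𝔓ⁿ" => Finset (Fin n)
local notation "ℂⁿ" => Fin n → ℂ
local notation "ℝⁿ" => Fin n → ℝ
local notation "ℤⁿ" => Fin n → ℤ
local notation "𝕎ⁿ" => Perm (Fin n) × (Fin n → ℤˣ)
local notation "𝕊ⁿ" => Fin n → SignType

/-! ### Products over unordered pairs -/

/-- The product of `Φ i j` over the pairs `i < j` in `K`. -/
def pairProd {M : Type*} [CommMonoid M] (K : 𝔓ⁿ) (Φ : Fin n → Fin n → M) : M :=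
  ∏ q ∈ (K ×ˢ K).filter (fun q => q.1 < q.2), Φ q.1 q.2

lemma pairProd_eq {M : Type*} [CommMonoid M] (K : 𝔓ⁿ) (Φ : Fin n → Fin n → M) :
    pairProd K Φ = ∏ i ∈ K, ∏ j ∈ K, if i < j then Φ i j else 1 := by
  rw [pairProd, prod_filter, Finset.prod_product]

@[simp] lemma pairProd_empty {M : Type*} [CommMonoid M] (Φ : Fin n → Fin n → M) :
    pairProd ∅ Φ = 1 := by simp [pairProd]

lemma pairProd_insert {M : Type*} [CommMonoid M] {a : Fin n} (ha : a ∉ K)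
    {Φ : Fin n → Fin n → M} (hΦ : ∀ i j, Φ i j = Φ j i) :
    pairProd (insert a K) Φ = pairProd K Φ * ∏ b ∈ K, Φ a b := by
  simp only [pairProd_eq, Finset.prod_insert ha, lt_irrefl, if_false, one_mul, prod_mul_distrib]
  rw [mul_comm (∏ i ∈ K, ite (i < a) _ _), mul_left_comm, ← prod_mul_distrib]
  congr 1
  refine prod_congr rfl fun b hb => ?_
  grind

lemma pairProd_congr {M : Type*} [CommMonoid M]
    {Φ Ψ : Fin n → Fin n → M} (h : ∀ i ∈ K, ∀ j ∈ K, i < j → Φ i j = Ψ i j) :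
    pairProd K Φ = pairProd K Ψ :=
  prod_congr rfl fun q hq => by simp_all

lemma pairProd_mul {M : Type*} [CommMonoid M] (K : 𝔓ⁿ) (Φ Ψ : Fin n → Fin n → M) :
    pairProd K (fun i j => Φ i j * Ψ i j) = pairProd K Φ * pairProd K Ψ :=
  prod_mul_distrib

lemma pairProd_union {M : Type*} [CommMonoid M] {S T : 𝔓ⁿ} (hST : Disjoint S T)
    {Φ : Fin n → Fin n → M} (hΦ : ∀ i j, Φ i j = Φ j i) :
    pairProd (S ∪ T) Φ = pairProd S Φ * pairProd T Φ * ∏ s ∈ S, ∏ t ∈ T, Φ s t := by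
  induction S using Finset.induction_on with
  | empty => simp
  | insert a S ha ih =>
    rw [Finset.disjoint_insert_left] at hST
    have h1 : a ∉ S ∪ T := by simp [ha, hST.1]
    rw [Finset.insert_union, pairProd_insert h1 hΦ, ih hST.2, pairProd_insert ha hΦ,
      Finset.prod_insert ha, Finset.prod_union hST.2]
    ac_rfl

lemma pairProd_map {M : Type*} [CommMonoid M] (K : 𝔓ⁿ) (σ : Perm (Fin n))
    {Φ : Fin n → Fin n → M} (hΦ : ∀ i j, Φ i j = Φ j i) :
    pairProd (K.map σ.toEmbedding) Φ = pairProd K fun i j => Φ (σ i) (σ j) := by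
  induction K using Finset.induction_on with
  | empty => simp
  | insert a K ha ih =>
    have h1 : σ.toEmbedding a ∉ K.map σ.toEmbedding := by simpa using ha
    rw [Finset.map_insert, pairProd_insert h1 hΦ, ih, pairProd_insert ha fun i j => hΦ _ _,
      prod_map]
    rfl

/-! ### Sign vectors -/

/-- The support of a sign vector. -/
def supp (τ : 𝕊ⁿ) : 𝔓ⁿ := Finset.univ.filter fun j => τ j ≠ 0

@[simp] lemma mem_supp {τ : 𝕊ⁿ} {j : Fin n} : j ∈ supp τ ↔ τ j ≠ 0 := by simp [supp]

@[simp] lemma supp_zero : supp (0 : 𝕊ⁿ) = ∅ := by ext; simp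

lemma supp_eq_empty : supp τ = ∅ ↔ τ = 0 := by
  rw [Finset.eq_empty_iff_forall_notMem, funext_iff]; simp

/-- The sign vectors supported in `K` with support of size at most `m`. -/
def cells (K : 𝔓ⁿ) (m : ℕ) : Finset 𝕊ⁿ := Finset.univ.filter fun τ => supp τ ⊆ K ∧ (supp τ).card ≤ m

/-- The sign vectors supported in `K` with support of size `m`. -/
def cellsEq (K : 𝔓ⁿ) (m : ℕ) : Finset 𝕊ⁿ :=
  Finset.univ.filter fun τ => supp τ ⊆ K ∧ (supp τ).card = m

lemma mem_cells {m : ℕ} : τ ∈ cells K m ↔ supp τ ⊆ K ∧ (supp τ).card ≤ m := by simp [cells]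

lemma mem_cellsEq {m : ℕ} : τ ∈ cellsEq K m ↔ supp τ ⊆ K ∧ (supp τ).card = m := by simp [cellsEq]

lemma zero_mem_cells (K : 𝔓ⁿ) (m : ℕ) : 0 ∈ cells K m := by simp [mem_cells]

/-- The restriction of a sign vector to a set of indices. -/
def restr (σ : 𝕊ⁿ) (S : 𝔓ⁿ) : 𝕊ⁿ := fun j => if j ∈ S then σ j else 0

lemma supp_restr (σ : 𝕊ⁿ) (S : 𝔓ⁿ) : supp (restr σ S) = supp σ ∩ S := by
  ext j; by_cases h : j ∈ S <;> simp [restr, h]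

lemma sum_cells_eq {R : Type*} [AddCommMonoid R] (K : 𝔓ⁿ) (m : ℕ) (F : 𝕊ⁿ → R) :
    ∑ τ ∈ cells K m, F τ = ∑ i ∈ Finset.range (m + 1), ∑ τ ∈ cellsEq K i, F τ := by
  rw [← sum_fiberwise_of_maps_to (g := fun τ => (supp τ).card) (t := Finset.range (m + 1))]
  · refine sum_congr rfl fun i hi => sum_congr ?_ fun _ _ => rfl
    ext τ
    have : i ≤ m := by simpa [Nat.lt_succ_iff] using hi
    simp only [mem_filter, mem_cells, mem_cellsEq]
    simp_all
  · intro τ hτ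
    simpa [Nat.lt_succ_iff] using (mem_cells.1 hτ).2

lemma cellsEq_zero (K : 𝔓ⁿ) : cellsEq K 0 = {0} := by
  ext τ
  simp only [mem_cellsEq, card_eq_zero, Finset.mem_singleton, ← supp_eq_empty]
  simp_all

lemma sum_split {R : Type*} [AddCommMonoid R] (K : 𝔓ⁿ) (m : ℕ) (Φ : 𝕊ⁿ → 𝕊ⁿ → R) :
    ∑ σ ∈ cellsEq K m, ∑ S ∈ (supp σ).powerset.erase ∅, Φ (restr σ S) (restr σ Sᶜ) =
      ∑ τ ∈ (cells K m).erase 0, ∑ σ ∈ cellsEq (K \ supp τ) (m - (supp τ).card), Φ τ σ := by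
  rw [sum_sigma', sum_sigma']
  refine sum_bij' (fun a _ => ⟨restr a.1 a.2, restr a.1 a.2ᶜ⟩)
    (fun b _ => ⟨fun j => if b.1 j = 0 then b.2 j else b.1 j, supp b.1⟩) ?_ ?_ ?_ ?_ ?_
  · rintro ⟨σ, S⟩ h
    simp only [mem_sigma, mem_cellsEq, mem_erase, Finset.mem_powerset, ne_eq,
      mem_cells, supp_restr, ← supp_eq_empty] at h ⊢
    obtain ⟨⟨h1, h2⟩, h3, h4⟩ := h
    have e1 : supp σ ∩ S = S := Finset.inter_eq_right.2 h4
    have e2 : supp σ ∩ Sᶜ = supp σ \ S := by ext; simp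
    grind
  · rintro ⟨τ, σ⟩ h
    simp only [mem_sigma, mem_cellsEq, mem_erase, Finset.mem_powerset, ne_eq, mem_cells] at h ⊢
    obtain ⟨⟨h1, h2, h3⟩, h4, h5⟩ := h
    have e : supp (fun j => if τ j = 0 then σ j else τ j) = supp τ ∪ supp σ := by
      ext j; by_cases hj : τ j = 0 <;> simp [hj]
    have hd : Disjoint (supp τ) (supp σ) := Finset.disjoint_of_subset_right h4 disjoint_sdiff
    rw [e, card_union_of_disjoint hd, h5]
    refine ⟨⟨Finset.union_subset h2 (h4.trans Finset.sdiff_subset), by omega⟩, ?_,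
      Finset.subset_union_left⟩
    rwa [supp_eq_empty]
  · rintro ⟨σ, S⟩ h
    simp only [mem_sigma, mem_cellsEq, mem_erase, Finset.mem_powerset] at h
    have e1 : supp σ ∩ S = S := Finset.inter_eq_right.2 h.2.2
    simp only [Sigma.mk.injEq, supp_restr, e1, heq_eq_eq, and_true]
    ext j
    by_cases hj : j ∈ S <;> by_cases h0 : σ j = 0 <;> simp [restr, hj, h0]
  · rintro ⟨τ, σ⟩ h
    simp only [mem_sigma, mem_cellsEq, mem_erase, mem_cells] at h
    have h4 := h.2.1
    simp only [Sigma.mk.injEq, heq_eq_eq]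
    constructor
    · ext j; by_cases hj : τ j = 0 <;> simp [restr, hj]
    · ext j
      by_cases hj : τ j = 0
      · simp [restr, hj]
      · have : σ j = 0 := by
          by_contra h0
          have := h4 (mem_supp.2 h0)
          simp [hj] at this
        simp [restr, hj, this]
  · intros; rfl

/-! ### The recursion for the sums over chains -/

section recursion

variable {R : Type*} [CommRing R] (w : Finset (Fin n) → (Fin n → SignType) → R)

/-- The sum over all chains in `K` of total size `m`, defined by splitting off the first step. -/
def chainSum : ℕ → 𝔓ⁿ → R
  | 0, _ => 1
  | m + 1, K => -∑ i : Fin (m + 1), ∑ τ ∈ cellsEq K (i + 1), w K τ * chainSum (m - i) (K \ supp τ)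

lemma chainSum_zero (K : 𝔓ⁿ) : chainSum w 0 K = 1 := by rw [chainSum]

lemma chainSum_eq_neg {m : ℕ} (hm : m ≠ 0) (K : 𝔓ⁿ) : chainSum w m K =
      -∑ τ ∈ (cells K m).erase 0, w K τ * chainSum w (m - (supp τ).card) (K \ supp τ) := by
  obtain ⟨m, rfl⟩ := Nat.exists_eq_succ_of_ne_zero hm
  have h := add_sum_erase (cells K (m + 1))
    (fun τ => w K τ * chainSum w (m + 1 - (supp τ).card) (K \ supp τ)) (zero_mem_cells K (m + 1))
  rw [sum_cells_eq, Finset.sum_range_succ', cellsEq_zero, Finset.sum_singleton, add_comm] at h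
  simp only [supp_zero, Finset.card_empty, Nat.sub_zero, Finset.sdiff_empty] at h
  rw [add_right_cancel h, chainSum, Finset.sum_range]
  refine congrArg _ (sum_congr rfl fun i _ => sum_congr rfl fun τ hτ => ?_)
  rw [(mem_cellsEq.1 hτ).2]
  congr 2
  omega

lemma sum_chainSum_eq_zero {m : ℕ} (hm : m ≠ 0) (K : 𝔓ⁿ) (hw : w K 0 = 1) :
    ∑ τ ∈ cells K m, w K τ * chainSum w (m - (supp τ).card) (K \ supp τ) = 0 := by
  rw [← add_sum_erase _ _ (zero_mem_cells K m)]
  conv_lhs => rw [hw]; simp only [supp_zero, Finset.card_empty, Nat.sub_zero, Finset.sdiff_empty]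
  rw [chainSum_eq_neg w hm]
  ring

open scoped Classical in
/-- The strictly increasing sequences from `A` to `J` with `s` steps. -/
def paths (A J : 𝔓ⁿ) (s : ℕ) : Finset (Fin (s + 1) → 𝔓ⁿ) :=
  Finset.univ.filter (fun c => StrictMono c ∧ c 0 = A ∧ c (Fin.last s) = J)

/-- The sum over paths of the product of the weights of the steps. -/
def pathSum (u : 𝔓ⁿ → 𝔓ⁿ → R) (s : ℕ) (A J : 𝔓ⁿ) : R :=
  ∑ c ∈ paths A J s, ∏ i : Fin s, u (c i.castSucc) (c i.succ)

lemma pathSum_zero (u : 𝔓ⁿ → 𝔓ⁿ → R) (A J : 𝔓ⁿ) : pathSum u 0 A J = if A = J then 1 else 0 := by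
  have : paths A J 0 = if A = J then {fun _ => A} else ∅ := by
    ext c
    have hc : StrictMono c := fun i j hij => by omega
    simp only [paths, mem_filter, Finset.mem_univ, true_and, hc]
    split_ifs with h
    · simp only [Finset.mem_singleton, h]
      constructor
      · rintro ⟨h1, -⟩
        ext1 i
        rw [← h1, Fin.eq_zero i]
      · rintro rfl; exact ⟨rfl, rfl⟩
    · simp_all
  rw [pathSum, this]
  split_ifs <;> simp

lemma sum_paths_succ (T : 𝔓ⁿ → R) (u : 𝔓ⁿ → 𝔓ⁿ → R) (s : ℕ) (A J : 𝔓ⁿ) :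
    ∑ c ∈ paths A J (s + 1), (∏ i : Fin (s + 1), u (c i.castSucc) (c i.succ)) * T (c 1) =
      ∑ B ∈ Finset.univ.filter (fun B => A ⊂ B), u A B * T B * pathSum u s B J := by
  classical
  simp only [pathSum, mul_sum]
  rw [sum_sigma']
  refine sum_bij' (fun c _ => ⟨c 1, Fin.tail c⟩) (fun b _ => Fin.cons A b.2) ?_ ?_ ?_ ?_ ?_
  · intro c hc
    simp only [paths, mem_filter, Finset.mem_univ, true_and, mem_sigma] at hc ⊢
    obtain ⟨h1, h2, h3⟩ := hc
    refine ⟨?_, fun i j hij => h1 (Fin.succ_lt_succ_iff.2 hij), rfl, ?_⟩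
    · rw [← h2]; exact h1 (by simp)
    · rw [← h3]; rfl
  · rintro ⟨B, c⟩ hb
    simp only [paths, mem_filter, Finset.mem_univ, true_and, mem_sigma] at hb ⊢
    obtain ⟨h1, h2, h3, h4⟩ := hb
    refine ⟨?_, rfl, ?_⟩
    · rw [Fin.strictMono_iff_lt_succ]
      intro i
      refine Fin.cases ?_ (fun i => ?_) i
      · simpa [h3] using h1
      · tauto
    · rw [← Fin.succ_last, Fin.cons_succ, h4]
  · intro c hc
    simp only [paths, mem_filter, Finset.mem_univ, true_and] at hc
    aesop
  · rintro ⟨B, c⟩ hb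
    simp only [paths, mem_filter, Finset.mem_univ, true_and, mem_sigma] at hb
    tauto
  · intro c hc
    simp only [paths, mem_filter, Finset.mem_univ, true_and] at hc
    rw [Fin.prod_univ_succ]
    simp only [Fin.castSucc_zero, hc.2.1, Fin.succ_zero_eq_one, Fin.tail, Fin.castSucc_succ]
    ring

lemma pathSum_succ (u : 𝔓ⁿ → 𝔓ⁿ → R) (s : ℕ) (A J : 𝔓ⁿ) : pathSum u (s + 1) A J =
      ∑ B ∈ Finset.univ.filter (fun B => A ⊂ B), u A B * pathSum u s B J := by
  simpa [pathSum] using sum_paths_succ (fun _ => 1) u s A J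

lemma pathSum_eq_zero (u : 𝔓ⁿ → 𝔓ⁿ → R) (s : ℕ) {A J : 𝔓ⁿ}
    (h : ¬ A ⊆ J) : pathSum u s A J = 0 := by
  refine sum_eq_zero fun c hc => (h ?_).elim
  simp only [paths, mem_filter] at hc
  rw [← hc.2.2.1, ← hc.2.2.2]
  exact hc.2.1.monotone (Fin.zero_le _)

lemma pathSum_congr {u u' : 𝔓ⁿ → 𝔓ⁿ → R} (s : ℕ)
    {A J : 𝔓ⁿ} (h : ∀ B C, A ⊆ B → B ⊂ C → u B C = u' B C) :
    pathSum u s A J = pathSum u' s A J := by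
  refine sum_congr rfl fun c hc => prod_congr rfl fun i _ => ?_
  simp only [paths, mem_filter] at hc
  refine h _ _ ?_ (hc.2.1 (Fin.castSucc_lt_succ))
  rw [← hc.2.2.1]
  exact hc.2.1.monotone (Fin.zero_le _)

lemma sum_ssubset_eq {A L : 𝔓ⁿ} (hAL : Disjoint L A) (F : 𝔓ⁿ → R)
    (hF : ∀ B, ¬ B ⊆ A ∪ L → F B = 0) :
    ∑ B ∈ Finset.univ.filter (fun B => A ⊂ B), F B = ∑ S ∈ L.powerset.erase ∅, F (A ∪ S) := by
  rw [← Finset.sum_filter_of_ne (p := fun B => B ⊆ A ∪ L)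
    (fun B _ hB => by_contra fun h => hB (hF B h))]
  refine sum_bij' (fun B _ => B \ A) (fun S _ => A ∪ S) ?_ ?_ ?_ ?_ ?_
  · grind
  · intro S hS
    simp only [mem_filter, Finset.mem_univ, true_and, mem_erase, Finset.mem_powerset] at hS ⊢
    refine ⟨⟨Finset.subset_union_left, fun h => hS.1 ?_⟩, Finset.union_subset_union le_rfl hS.2⟩
    have h1 : S ⊆ A := (Finset.union_subset_iff.1 h).2
    grind
  · grind
  · intro S hS
    simp only [mem_erase, Finset.mem_powerset] at hS
    exact Finset.union_sdiff_cancel_left (Finset.disjoint_of_subset_left hS.2 hAL).symm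
  · intro B hB
    simp only [mem_filter, Finset.mem_univ, true_and] at hB
    rw [union_sdiff_of_subset hB.1.1]

/-- The weight of the step from `A` to `B` with the signs of `σ`. -/
def stepWeight (σ : 𝕊ⁿ) (A B : 𝔓ⁿ) : R := w Aᶜ (restr σ (B \ A))

lemma sum_pathSum_eq_chainSum (m : ℕ) : ∀ (A : 𝔓ⁿ) (N : ℕ), m < N →
      ∑ σ ∈ cellsEq Aᶜ m, ∑ s ∈ Finset.range N,
        (-1) ^ s * pathSum (stepWeight w σ) s A (A ∪ supp σ) = chainSum w m Aᶜ := by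
  induction m using Nat.strong_induction_on with | _ m ih =>
  intro A N hN
  obtain ⟨N, rfl⟩ := Nat.exists_eq_succ_of_ne_zero (Nat.ne_zero_of_lt hN)
  have key : ∀ σ ∈ cellsEq Aᶜ m, ∑ s ∈ Finset.range (N + 1),
      (-1) ^ s * pathSum (stepWeight w σ) s A (A ∪ supp σ) =
      (if m = 0 then 1 else 0) - ∑ S ∈ (supp σ).powerset.erase ∅,
        w Aᶜ (restr σ S) * ∑ s ∈ Finset.range N, (-1) ^ s *
          pathSum (stepWeight w (restr σ Sᶜ)) s (A ∪ supp (restr σ S))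
            (A ∪ supp (restr σ S) ∪ supp (restr σ Sᶜ)) := by
    intro σ hσ
    rw [mem_cellsEq] at hσ
    have hd : Disjoint (supp σ) A := Finset.subset_compl_iff_disjoint_right.1 hσ.1
    rw [Finset.sum_range_succ', pathSum_zero, add_comm, sub_eq_add_neg]
    congr 1
    · have : A = A ∪ supp σ ↔ m = 0 := by
        rw [← hσ.2, card_eq_zero]
        constructor
        · intro h
          have h1 : supp σ ⊆ A := by rw [h]; exact Finset.subset_union_right
          exact subset_empty.1 (hd le_rfl h1)
        · intro h; simp [h]
      simp [this]
    · simp only [pathSum_succ, mul_sum]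
      rw [sum_comm, ← sum_neg_distrib, sum_ssubset_eq hd]
      · refine sum_congr rfl fun S hS => ?_
        simp only [mem_erase, Finset.mem_powerset] at hS
        have hSA : Disjoint A S := (Finset.disjoint_of_subset_left hS.2 hd).symm
        have e1 : supp (restr σ S) = S := by rw [supp_restr]; exact Finset.inter_eq_right.2 hS.2
        have e2 : A ∪ S ∪ supp (restr σ Sᶜ) = A ∪ supp σ := by
          rw [supp_restr, Finset.union_assoc]
          congr 1
          ext j
          have := @hS.2 j
          simp only [Finset.mem_union, Finset.mem_inter, Finset.mem_compl]
          tauto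
        rw [← sum_neg_distrib]
        refine sum_congr rfl fun s _ => ?_
        have e3 : pathSum (stepWeight w (restr σ Sᶜ)) s (A ∪ S) (A ∪ supp σ) =
            pathSum (stepWeight w σ) s (A ∪ S) (A ∪ supp σ) := by
          refine pathSum_congr s fun B C hB _ => ?_
          simp only [stepWeight]
          congr 1
          ext j
          simp only [restr, Finset.mem_sdiff, Finset.mem_compl]
          grind
        rw [e1, e2, e3, stepWeight, Finset.union_sdiff_cancel_left hSA]
        ring
      · intro B hB
        exact sum_eq_zero fun s _ => by rw [pathSum_eq_zero _ _ hB]; ring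
  rw [sum_congr rfl key, sum_sub_distrib,
    sum_split Aᶜ m fun τ σ => w Aᶜ τ * ∑ s ∈ Finset.range N, (-1) ^ s *
          pathSum (stepWeight w σ) s (A ∪ supp τ) (A ∪ supp τ ∪ supp σ)]
  rcases eq_or_ne m 0 with rfl | hm
  · have : (cells Aᶜ 0).erase 0 = (∅ : Finset 𝕊ⁿ) := by
      ext τ
      simp only [mem_erase, mem_cells, nonpos_iff_eq_zero, card_eq_zero,
        supp_eq_empty, Finset.notMem_empty, iff_false]
      tauto
    rw [this, cellsEq_zero, chainSum_zero]
    simp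
  · rw [chainSum_eq_neg w hm]
    simp only [hm, if_false, Finset.sum_const_zero, zero_sub]
    refine congrArg _ (sum_congr rfl fun τ hτ => ?_)
    rw [mem_erase, mem_cells, ne_eq, ← supp_eq_empty] at hτ
    have hc : 0 < (supp τ).card := card_pos.2 (Finset.nonempty_iff_ne_empty.2 hτ.1)
    have e : (Aᶜ \ supp τ) = (A ∪ supp τ)ᶜ := by ext; simp
    rw [← mul_sum, e, ih (m - (supp τ).card) (by omega) (A ∪ supp τ) N (by omega)]

end recursion

/-! ### The coefficients in terms of sign vectors -/

/-- The ratio `sin ½(iβκ + z) / sin ½z`. -/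
def sineRatio (β κ : ℝ) (z : ℂ) : ℂ := sin ((I * β * κ + z) / 2) / sin (z / 2)

lemma vA_eq (z : ℂ) : vA P β z = sineRatio β P.g z := rfl

lemma cos_eq_sin_half (z : ℂ) : cos (z / 2) = sin ((z + Real.pi) / 2) := by
  rw [← Complex.sin_add_pi_div_two]; congr 1; ring

lemma vB_eq (z : ℂ) : vB P β z = sineRatio β P.g₀ z * sineRatio β P.g₁ (z + Real.pi) *
      sineRatio β P.g₀' (z + gam β) * sineRatio β P.g₁' (z + gam β + Real.pi) := by
  simp only [vB, sineRatio, cos_eq_sin_half]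
  grind

lemma sineRatio_add_two_pi (β κ : ℝ) (z : ℂ) :
    sineRatio β κ (z + 2 * Real.pi) = sineRatio β κ z := by
  simp only [sineRatio]
  rw [show (I * β * κ + (z + 2 * Real.pi)) / 2 = (I * β * κ + z) / 2 + Real.pi by
    ring, show (z + 2 * Real.pi) / 2 = z / 2 + Real.pi by ring, sin_add_pi,
    sin_add_pi, neg_div_neg_eq]

/-- The one-variable factor for the sign `a`. -/
def siteW (a : SignType) (x : ℂ) : ℂ := if a = 0 then 1 else vB P β ((a : ℂ) * x)

/-- The two-variable factor for the signs `a` and `b`. -/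
def pairW (a b : SignType) (x y : ℂ) : ℂ :=
  if a = 0 then if b = 0 then 1 else vA P β ((b : ℂ) * y + x) * vA P β ((b : ℂ) * y - x)
  else if b = 0 then vA P β ((a : ℂ) * x + y) * vA P β ((a : ℂ) * x - y)
  else vA P β ((a : ℂ) * x + (b : ℂ) * y) * vA P β ((a : ℂ) * x + (b : ℂ) * y + 2 * gam β)

lemma pairW_comm (a b : SignType) (x y : ℂ) : pairW P β a b x y = pairW P β b a y x := by
  unfold pairW
  grind

@[simp] lemma siteW_zero (P : Couplings) (β : ℝ) (x : ℂ) : siteW P β 0 x = 1 := by simp [siteW]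

@[simp] lemma pairW_zero (P : Couplings) (β : ℝ) (x y : ℂ) : pairW P β 0 0 x y = 1 := by
  simp [pairW]

/-- The function `V_{εI; K ∖ I}`, with the signs on `I` given by a sign vector. -/
def cellW (x : ℂⁿ) (K : 𝔓ⁿ) (τ : 𝕊ⁿ) : ℂ := (∏ j ∈ K, siteW P β (τ j) (x j)) *
    pairProd K fun i j => pairW P β (τ i) (τ j) (x i) (x j)

@[simp] lemma cellW_zero (P : Couplings) (β : ℝ) (x : ℂⁿ) (K : 𝔓ⁿ) : cellW P β x K 0 = 1 := by
  simp [cellW, pairProd]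

lemma cellW_union (x : ℂⁿ) {S T : 𝔓ⁿ} (h : Disjoint S T) (τ : 𝕊ⁿ) :
    cellW P β x (S ∪ T) τ = cellW P β x S τ * cellW P β x T τ *
      ∏ s ∈ S, ∏ t ∈ T, pairW P β (τ s) (τ t) (x s) (x t) := by
  rw [cellW, Finset.prod_union h, pairProd_union h fun i j => pairW_comm ..]
  simp only [cellW]; ring

lemma cellW_congr {x y : ℂⁿ} {τ τ' : 𝕊ⁿ} (hx : ∀ j ∈ K, x j = y j) (h : ∀ j ∈ K, τ j = τ' j) :
    cellW P β x K τ = cellW P β y K τ' := by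
  unfold cellW
  congr 1
  · simp_all
  · exact pairProd_congr fun i hi j hj _ => by rw [h i hi, h j hj, hx i hi, hx j hj]

lemma V_eq_cellW (ε : Fin n → ℤˣ) {L K : 𝔓ⁿ} (hL : L ⊆ K) (hτ : ∀ j, τ j ≠ 0 ↔ j ∈ L)
    (h : ∀ j ∈ L, ((ε j : ℤ) : ℂ) = (τ j : ℂ)) (x : ℂⁿ) :
    V P β ε L (K \ L) x = cellW P β x K τ := by
  have hd : Disjoint L (K \ L) := disjoint_sdiff
  have e : K = L ∪ K \ L := (union_sdiff_of_subset hL).symm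
  conv_rhs => rw [e, cellW_union P β x hd]
  have h0 : ∀ j ∈ K \ L, τ j = 0 := fun j hj => by grind
  have h1 : cellW P β x (K \ L) τ = 1 := by
    rw [cellW_congr P β (y := x) (τ' := 0) (fun _ _ => rfl) fun j hj => by simp [h0 j hj],
      cellW_zero]
  rw [h1, mul_one, V, cellW]
  congr 1
  · congr 1
    · refine prod_congr rfl fun j hj => ?_
      rw [siteW, if_neg ((hτ j).2 hj), signed, h j hj]
    · refine prod_congr rfl fun q hq => ?_
      simp only [mem_filter, mem_product] at hq
      change _ = pairW P β (τ q.1) (τ q.2) (x q.1) (x q.2)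
      rw [pairW, if_neg ((hτ _).2 hq.1.1), if_neg ((hτ _).2 hq.1.2), signed, signed, h _ hq.1.1,
        h _ hq.1.2]
  · refine prod_congr rfl fun j hj => prod_congr rfl fun k hk => ?_
    rw [pairW, if_neg ((hτ j).2 hj), if_pos (h0 k hk), signed, h j hj]

/-- The shift by `iβτ`. -/
def shift (τ : 𝕊ⁿ) (x : ℂⁿ) : ℂⁿ := fun j => x j + I * β * (τ j : ℂ)

@[simp] lemma shift_zero (β : ℝ) (x : ℂⁿ) : shift β 0 x = x := by ext; simp [shift]

/-- The signs of a sign vector, with `1` off the support. -/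
def toUnits (σ : 𝕊ⁿ) : Fin n → ℤˣ := fun j => if σ j = -1 then -1 else 1

lemma toUnits_cast (σ : 𝕊ⁿ) {j : Fin n} (h : σ j ≠ 0) : ((toUnits σ j : ℤ) : ℂ) = (σ j : ℂ) := by
  unfold toUnits
  rcases SignType.trichotomy (σ j) with e | e | e
  · simp [e]
  · exact (h e).elim
  · simp [e]

lemma sum_powersetCard_signs {M : Type*} [AddCommMonoid M] (r : ℕ) (G : 𝔓ⁿ → (Fin n → ℤˣ) → M) :
    ∑ J ∈ Finset.powersetCard r (Finset.univ : 𝔓ⁿ), ∑ ε ∈ signs J, G J ε =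
      ∑ σ ∈ cellsEq Finset.univ r, G (supp σ) (toUnits σ) := by
  rw [sum_sigma']
  have e1 : (1 : SignType) ≠ -1 := by decide
  refine sum_bij' (fun b _ => fun j => if j ∈ b.1 then if b.2 j = -1 then -1 else 1 else 0)
    (fun σ _ => ⟨supp σ, toUnits σ⟩) ?_ ?_ ?_ ?_ ?_
  · rintro ⟨J, ε⟩ h
    simp only [mem_sigma, mem_powersetCard] at h
    rw [mem_cellsEq]
    refine ⟨Finset.subset_univ _, ?_⟩
    rw [← h.1.2]
    congr 1
    aesop
  · intro σ hσ
    rw [mem_cellsEq] at hσ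
    simp only [mem_sigma, mem_powersetCard, signs, mem_filter, Finset.mem_univ, true_and]
    refine ⟨⟨Finset.subset_univ _, hσ.2⟩, fun j hj => ?_⟩
    have : σ j = 0 := by simpa using hj
    simp [toUnits, this]
  · rintro ⟨J, ε⟩ h
    simp only [mem_sigma, signs, mem_filter, Finset.mem_univ, true_and] at h
    have hJ : supp (fun j => if j ∈ J then if ε j = -1 then (-1 : SignType) else 1 else 0) = J := by
      ext j
      by_cases hj : j ∈ J <;> by_cases he : ε j = -1 <;> simp [hj, he]
    simp only [hJ, Sigma.mk.injEq, heq_eq_eq, true_and]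
    ext j
    rcases units_eq_one_or (ε j) with he | he
    · by_cases hj : j ∈ J <;> simp [toUnits, hj, he]
    · by_cases hj : j ∈ J
      · simp [toUnits, hj, he]
      · rw [h.2 j hj] at he; exact absurd he (by decide)
  · intro σ hσ
    ext j
    simp only [mem_supp, toUnits]
    rcases SignType.trichotomy (σ j) with e | e | e <;> simp [e]
  · rintro ⟨J, ε⟩ h
    simp only [mem_sigma, signs, mem_filter, Finset.mem_univ, true_and] at h
    have hJ : supp (fun j => if j ∈ J then if ε j = -1 then (-1 : SignType) else 1 else 0) = J := by
      ext j
      by_cases hj : j ∈ J <;> by_cases he : ε j = -1 <;> simp [hj, he]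
    simp only [hJ]
    congr 1
    ext j
    rcases units_eq_one_or (ε j) with he | he
    · by_cases hj : j ∈ J <;> simp [toUnits, hj, he]
    · by_cases hj : j ∈ J
      · simp [toUnits, hj, he]
      · rw [h.2 j hj] at he; exact absurd he (by decide)

lemma differenceOp_eq (r : ℕ) (β : ℝ) (f : ℂⁿ → ℂ) (x : ℂⁿ) :
    differenceOp P r β f x = ∑ τ ∈ (cells Finset.univ r).erase 0, cellW P β x Finset.univ τ *
        chainSum (cellW P β x) (r - (supp τ).card) (Finset.univ \ supp τ) *
        (f (shift β τ x) - f x) := by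
  have key : ∀ σ ∈ cellsEq (Finset.univ : 𝔓ⁿ) r,
      ∑ s ∈ Finset.Icc 1 r, ∑ c ∈ chains (supp σ) s, chainCoeff P β (toUnits σ) s c x *
        (f (fun j => x j + if j ∈ c 1 then I * β * ((toUnits σ j : ℤ) : ℂ) else 0) - f x) =
      ∑ S ∈ (supp σ).powerset.erase ∅,
        cellW P β x Finset.univ (restr σ S) * (f (shift β (restr σ S) x) - f x) *
          ∑ s ∈ Finset.range r, (-1) ^ s * pathSum (stepWeight (cellW P β x) (restr σ Sᶜ)) s
            (supp (restr σ S)) (supp (restr σ S) ∪ supp (restr σ Sᶜ)) := by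
    intro σ hσ
    rw [show Finset.Icc 1 r = Finset.Ico 1 (r + 1) from rfl, Finset.sum_Ico_eq_sum_range]
    simp only [Nat.add_sub_cancel, mul_sum]
    rw [sum_comm]
    refine sum_congr rfl fun s _ => ?_
    rw [add_comm 1 s]
    have e1 : ∀ c ∈ chains (supp σ) (s + 1), chainCoeff P β (toUnits σ) (s + 1) c x *
        (f (fun j => x j + if j ∈ c 1 then I * β * ((toUnits σ j : ℤ) : ℂ) else 0) - f x) =
        (-1) ^ s * ((∏ i : Fin (s + 1), stepWeight (cellW P β x) σ (c i.castSucc) (c i.succ)) *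
            (f (shift β (restr σ (c 1)) x) - f x)) := by
      intro c hc
      simp only [chains, mem_filter, Finset.mem_univ, true_and] at hc
      obtain ⟨h1, h2, h3⟩ := hc
      have hs : ∀ i, c i ⊆ supp σ := fun i => by rw [← h3]; exact h1.monotone (Fin.le_last _)
      have e2 : (fun j => x j + if j ∈ c 1 then I * β * ((toUnits σ j : ℤ) : ℂ) else 0) =
          shift β (restr σ (c 1)) x := by
        ext j
        by_cases hj : j ∈ c 1
        · simp [shift, restr, hj, toUnits_cast σ (mem_supp.1 (hs _ hj))]
        · simp [shift, restr, hj]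
      rw [e2, chainCoeff, Nat.add_sub_cancel, mul_assoc]
      congr 2
      refine prod_congr rfl fun i _ => ?_
      have hlt : c i.castSucc ⊆ c i.succ := (h1 (Fin.castSucc_lt_succ)).le
      have e3 : (c i.succ)ᶜ = (c i.castSucc)ᶜ \ (c i.succ \ c i.castSucc) := by
        ext j
        have := @hlt j
        aesop
      rw [e3, stepWeight, V_eq_cellW P β (toUnits σ) (τ := restr σ (c i.succ \ c i.castSucc))]
      · simp
      · intro j
        have := @hs i.succ j
        simp only [mem_supp] at this
        simp only [restr]
        simp_all
      · intro j hj
        rw [restr, if_pos hj, toUnits_cast σ (mem_supp.1 (hs _ (Finset.mem_sdiff.1 hj).1))]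
    rw [sum_congr rfl e1, ← mul_sum]
    have e4 := sum_paths_succ (fun B => f (shift β (restr σ B) x) - f x)
      (stepWeight (cellW P β x) σ) s ∅ (supp σ)
    rw [show chains (supp σ) (s + 1) = paths ∅ (supp σ) (s + 1) from rfl, e4,
      sum_ssubset_eq (L := supp σ) (by simp), mul_sum]
    · refine sum_congr rfl fun S hS => ?_
      simp only [mem_erase, Finset.mem_powerset] at hS
      have e5 : supp (restr σ S) = S := by rw [supp_restr]; exact Finset.inter_eq_right.2 hS.2
      have e6 : S ∪ supp (restr σ Sᶜ) = supp σ := by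
        rw [supp_restr]
        ext j
        have := @hS.2 j
        simp only [Finset.mem_union, Finset.mem_inter, Finset.mem_compl]
        tauto
      have e7 : pathSum (stepWeight (cellW P β x) (restr σ Sᶜ)) s S (supp σ) =
          pathSum (stepWeight (cellW P β x) σ) s S (supp σ) := by
        refine pathSum_congr s fun B C hB _ => ?_
        simp only [stepWeight]
        congr 1
        ext j
        simp only [restr, Finset.mem_sdiff, Finset.mem_compl]
        grind
      rw [e5, e6, e7, stepWeight]
      simp only [Finset.empty_union, Finset.sdiff_empty, Finset.compl_empty]
      ring
    · intro B hB
      rw [Finset.empty_union] at hB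
      rw [pathSum_eq_zero _ _ hB, mul_zero]
  rw [differenceOp, cellSum, sum_powersetCard_signs r fun J ε => ∑ s ∈ Finset.Icc 1 r,
    ∑ c ∈ chains J s, chainCoeff P β ε s c x *
        (f (fun j => x j + if j ∈ c 1 then I * β * ((ε j : ℤ) : ℂ) else 0) - f x),
    sum_congr rfl key,
    sum_split Finset.univ r fun τ σ => cellW P β x Finset.univ τ * (f (shift β τ x) - f x) *
          ∑ s ∈ Finset.range r, (-1) ^ s * pathSum (stepWeight (cellW P β x) σ) s
            (supp τ) (supp τ ∪ supp σ)]
  refine sum_congr rfl fun τ hτ => ?_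
  rw [mem_erase, mem_cells, ne_eq, ← supp_eq_empty] at hτ
  have hc : 0 < (supp τ).card := card_pos.2 (Finset.nonempty_iff_ne_empty.2 hτ.1)
  rw [← mul_sum, ← Finset.compl_eq_univ_sdiff, sum_pathSum_eq_chainSum _ _ _ _ (by omega)]
  ring

lemma differenceOp_eq_sum {r : ℕ} (hr : r ≠ 0) (β : ℝ) (f : ℂⁿ → ℂ) (x : ℂⁿ) :
    differenceOp P r β f x = ∑ τ ∈ cells Finset.univ r, cellW P β x Finset.univ τ *
        chainSum (cellW P β x) (r - (supp τ).card) (Finset.univ \ supp τ) * f (shift β τ x) := by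
  have h := sum_chainSum_eq_zero (cellW P β x) hr Finset.univ (cellW_zero ..)
  have h2 : ∑ τ ∈ cells Finset.univ r, cellW P β x Finset.univ τ *
        chainSum (cellW P β x) (r - (supp τ).card) (Finset.univ \ supp τ) *
        (f (shift β τ x) - f x) = ∑ τ ∈ cells Finset.univ r,
      cellW P β x Finset.univ τ *
        chainSum (cellW P β x) (r - (supp τ).card) (Finset.univ \ supp τ) * f (shift β τ x) := by
    simp only [mul_sub, sum_sub_distrib]
    rw [← sum_mul, h, zero_mul, sub_zero]
  rw [← h2, differenceOp_eq, ← add_sum_erase _ _ (zero_mem_cells Finset.univ r)]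
  simp

/-! ### Equivariance under permutations and sign changes -/

/-- The action of a signed permutation. -/
def weylAct (w : 𝕎ⁿ) (x : ℂⁿ) : ℂⁿ := fun j => ((w.2 j : ℤ) : ℂ) * x (w.1 j)

/-- The action of a signed permutation on sign vectors. -/
def weylActSign (w : 𝕎ⁿ) (τ : 𝕊ⁿ) : 𝕊ⁿ := fun j => if w.2 j = -1 then -τ (w.1 j) else τ (w.1 j)

lemma coe_neg_signType (a : SignType) : ((-a : SignType) : ℂ) = -(a : ℂ) := by cases a <;> simp

lemma weylActSign_cast (w : 𝕎ⁿ) (τ : 𝕊ⁿ)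
    (j : Fin n) : (weylActSign w τ j : ℂ) = ((w.2 j : ℤ) : ℂ) * (τ (w.1 j) : ℂ) := by
  rcases units_eq_one_or (w.2 j) with h | h
  · have : (1 : ℤˣ) ≠ -1 := by decide
    simp [weylActSign, h, this]
  · simp [weylActSign, h]

lemma weylActSign_eq_zero (w : 𝕎ⁿ) (τ : 𝕊ⁿ)
    (j : Fin n) : weylActSign w τ j = 0 ↔ τ (w.1 j) = 0 := by
  have h : ∀ a : SignType, -a = 0 ↔ a = 0 := by decide
  unfold weylActSign
  split_ifs <;> simp [h]

lemma supp_weylActSign (w : 𝕎ⁿ) (τ : 𝕊ⁿ) :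
    (supp (weylActSign w τ)).map w.1.toEmbedding = supp τ := by
  ext j
  simp only [Finset.mem_map_equiv, mem_supp, ne_eq, weylActSign_eq_zero, Equiv.apply_symm_apply]

lemma unit_mul_self (e : ℤˣ) (z y : ℂ) : ((e : ℤ) : ℂ) * z * (((e : ℤ) : ℂ) * y) = z * y := by
  rcases units_eq_one_or e with h | h <;> simp [h]

lemma cellW_weylAct (w : 𝕎ⁿ) (x : ℂⁿ) (K : 𝔓ⁿ) (τ : 𝕊ⁿ) :
    cellW P β (weylAct w x) K (weylActSign w τ) = cellW P β x (K.map w.1.toEmbedding) τ := by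
  unfold cellW
  rw [prod_map, pairProd_map _ _ fun i j => pairW_comm ..]
  congr 1
  · refine prod_congr rfl fun j _ => ?_
    simp only [siteW, weylActSign_eq_zero, weylActSign_cast, weylAct, unit_mul_self]
    rfl
  · refine pairProd_congr fun i _ j _ _ => ?_
    simp only [pairW, weylActSign_eq_zero, weylActSign_cast, weylAct, unit_mul_self]
    congr 1
    · congr 1
      rcases units_eq_one_or (w.2 i) with h | h <;> simp [h, mul_comm, sub_eq_add_neg]
    · congr 1
      rcases units_eq_one_or (w.2 j) with h | h <;> simp [h, mul_comm, sub_eq_add_neg]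

lemma weylActSign_bijective (w : 𝕎ⁿ) : Function.Bijective (weylActSign w) := by
  rw [← Finite.injective_iff_bijective]
  intro τ τ' h
  have hn : ∀ a b : SignType, -a = -b → a = b := by decide
  ext j
  have := congrFun h (w.1.symm j)
  simp only [weylActSign, Equiv.apply_symm_apply] at this
  grind

lemma sum_cells_weyl {R : Type*} [AddCommMonoid R] (w : 𝕎ⁿ) (K : 𝔓ⁿ) (m : ℕ) (F : 𝕊ⁿ → R) :
    ∑ τ ∈ cells K m, F τ = ∑ τ ∈ cells (K.map w.1.toEmbedding) m, F (weylActSign w τ) := by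
  symm
  refine Finset.sum_bijective (weylActSign w) (weylActSign_bijective w) (fun τ => ?_)
    (fun _ _ => rfl)
  rw [mem_cells, mem_cells, ← supp_weylActSign w τ, Finset.map_subset_map, card_map]

lemma chainSum_weylAct (w : 𝕎ⁿ) (x : ℂⁿ) (m : ℕ) : ∀ K : 𝔓ⁿ,
    chainSum (cellW P β (weylAct w x)) m K = chainSum (cellW P β x) m (K.map w.1.toEmbedding) := by
  induction m using Nat.strong_induction_on with | _ m ih =>
  intro K
  rcases eq_or_ne m 0 with rfl | hm
  · simp [chainSum_zero]
  · have h1 := sum_chainSum_eq_zero (cellW P β (weylAct w x)) hm K (cellW_zero ..)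
    have h2 := sum_chainSum_eq_zero (cellW P β x) hm (K.map w.1.toEmbedding) (cellW_zero ..)
    rw [sum_cells_weyl w] at h1
    rw [← add_sum_erase _ _ (zero_mem_cells _ m)] at h1 h2
    have h0 : weylActSign w (0 : 𝕊ⁿ) = 0 := by ext j; simp [weylActSign_eq_zero]
    have h3 : ∀ τ ∈ (cells (K.map w.1.toEmbedding) m).erase 0,
        cellW P β (weylAct w x) K (weylActSign w τ) *
          chainSum (cellW P β (weylAct w x)) (m - (supp (weylActSign w τ)).card)
            (K \ supp (weylActSign w τ)) =
        cellW P β x (K.map w.1.toEmbedding) τ * chainSum (cellW P β x) (m - (supp τ).card)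
          (K.map w.1.toEmbedding \ supp τ) := by
      intro τ hτ
      rw [mem_erase, mem_cells, ne_eq, ← supp_eq_empty] at hτ
      have hc : 0 < (supp τ).card := card_pos.2 (Finset.nonempty_iff_ne_empty.2 hτ.1)
      have hc2 : (supp (weylActSign w τ)).card = (supp τ).card := by
        rw [← supp_weylActSign w τ, card_map]
      rw [cellW_weylAct, hc2, ih _ (by omega), Finset.map_sdiff, supp_weylActSign]
    rw [sum_congr rfl h3] at h1
    simp only [h0, cellW_zero, supp_zero, Finset.card_empty, Nat.sub_zero, Finset.sdiff_empty,
      one_mul] at h1 h2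
    exact add_right_cancel (h1.trans h2.symm)

lemma weylAct_shift (w : 𝕎ⁿ) (β : ℝ) (τ : 𝕊ⁿ)
    (x : ℂⁿ) : shift β (weylActSign w τ) (weylAct w x) = weylAct w (shift β τ x) := by
  ext j
  simp only [shift, weylActSign_cast, weylAct]; ring

lemma differenceOp_weylAct {r : ℕ} (hr : r ≠ 0) (β : ℝ) (w : 𝕎ⁿ)
    (hf : ∀ x, f (weylAct w x) = f x) (x : ℂⁿ) :
    differenceOp P r β f (weylAct w x) = differenceOp P r β f x := by
  rw [differenceOp_eq_sum P hr, differenceOp_eq_sum P hr, sum_cells_weyl w, Finset.map_univ_equiv]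
  refine sum_congr rfl fun τ _ => ?_
  have hc2 : (supp (weylActSign w τ)).card = (supp τ).card := by
    rw [← supp_weylActSign w τ, card_map]
  rw [weylAct_shift, hf, cellW_weylAct, hc2, chainSum_weylAct, Finset.map_sdiff, supp_weylActSign,
    Finset.map_univ_equiv]

/-! ### Trigonometric polynomials -/

/-- The linear form with integer coefficients `ν`. -/
def lin (ν : ℤⁿ) (x : ℂⁿ) : ℂ := ∑ j, (ν j : ℂ) * x j

lemma lin_add (ν : ℤⁿ) (x y : ℂⁿ) : lin ν (x + y) = lin ν x + lin ν y := by
  simp [lin, mul_add, sum_add_distrib]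

lemma lin_add_left (ν μ : ℤⁿ) (x : ℂⁿ) : lin (ν + μ) x = lin ν x + lin μ x := by
  simp [lin, add_mul, sum_add_distrib]

lemma lin_neg_left (ν : ℤⁿ) (x : ℂⁿ) : lin (-ν) x = -lin ν x := by simp [lin]

lemma lin_smul (ν : ℤⁿ) (t : ℂ) (x : ℂⁿ) : lin ν (t • x) = t * lin ν x := by
  simp only [lin, Pi.smul_apply, smul_eq_mul, mul_sum]
  exact sum_congr rfl fun _ _ => by ring

lemma lin_single (ν : ℤⁿ) (j : Fin n) (t : ℂ) : lin ν (single j t) = ν j * t := by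
  simp [lin, single_apply]

lemma lin_single_left (j : Fin n) (a : ℤ) (x : ℂⁿ) : lin (single j a) x = a * x j := by
  simp [lin, single_apply]

@[fun_prop] lemma contDiff_lin (ν : ℤⁿ) {m : WithTop ℕ∞} : ContDiff ℂ m (lin ν) := by
  unfold lin; fun_prop

@[fun_prop] lemma continuous_lin (ν : ℤⁿ) : Continuous (lin ν) := by unfold lin; fun_prop

/-- The exponential `e^{i⟨ν,x⟩}`. -/
def expo (ν : ℤⁿ) (x : ℂⁿ) : ℂ := exp (I * lin ν x)

lemma expo_add_left (ν μ : ℤⁿ) (x : ℂⁿ) : expo (ν + μ) x = expo ν x * expo μ x := by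
  rw [expo, lin_add_left, mul_add, exp_add]; rfl

lemma expo_add (ν : ℤⁿ) (x y : ℂⁿ) : expo ν (x + y) = expo ν x * expo ν y := by
  rw [expo, lin_add, mul_add, exp_add]; rfl

@[simp] lemma expo_zero_left (x : ℂⁿ) : expo 0 x = 1 := by simp [expo, lin]

lemma expo_ne_zero (ν : ℤⁿ) (x : ℂⁿ) : expo ν x ≠ 0 := exp_ne_zero _

lemma expo_neg_left (ν : ℤⁿ) (x : ℂⁿ) : expo (-ν) x = (expo ν x)⁻¹ := by
  rw [expo, lin_neg_left, mul_neg, exp_neg]; rfl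

/-- The algebra of trigonometric polynomials, as entire functions on `ℂⁿ`. -/
def trigPoly (n : ℕ) : Subalgebra ℂ ((Fin n → ℂ) → ℂ) :=
  (span ℂ (range (expo (n := n)))).toSubalgebra (subset_span ⟨0, by ext; simp⟩) (by
      intro f h hf hh
      induction hf using span_induction with
      | mem f hf =>
        obtain ⟨ν, rfl⟩ := hf
        induction hh using span_induction with
        | mem h hh =>
          obtain ⟨μ, rfl⟩ := hh
          exact subset_span ⟨ν + μ, by ext x; simp [expo_add_left]⟩
        | zero => simp
        | add f h _ _ h1 h2 => rw [mul_add]; exact add_mem h1 h2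
        | smul a f _ h1 => rw [mul_smul_comm]; exact smul_mem _ _ h1
      | zero => simp
      | add f h _ _ h1 h2 => rw [add_mul]; exact add_mem h1 h2
      | smul a f _ h1 => rw [smul_mul_assoc]; exact smul_mem _ _ h1)

lemma expo_mem (ν : ℤⁿ) : expo ν ∈ trigPoly n := subset_span ⟨ν, rfl⟩

lemma const_mem_trigPoly (a : ℂ) : (fun _ => a) ∈ trigPoly n := (trigPoly n).algebraMap_mem a

lemma trigPoly_induction {p : (ℂⁿ → ℂ) → Prop}
    (hf : f ∈ trigPoly n) (h1 : ∀ ν, p (expo ν)) (h0 : p 0)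
    (h2 : ∀ f h, p f → p h → p (f + h)) (h3 : ∀ (a : ℂ) f, p f → p (a • f)) : p f := by
  change f ∈ span ℂ (range (expo (n := n))) at hf
  induction hf using span_induction with
  | mem f hf => obtain ⟨ν, rfl⟩ := hf; exact h1 ν
  | zero => exact h0
  | add f h _ _ hf hh => exact h2 f h hf hh
  | smul a f _ hf => exact h3 a f hf

lemma exists_finsupp_of_mem (hf : f ∈ trigPoly n) :
    ∃ a : ℤⁿ →₀ ℂ, ∀ x, f x = ∑ ν ∈ a.support, a ν * expo ν x := by
  change f ∈ span ℂ (range (expo (n := n))) at hf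
  obtain ⟨a, rfl⟩ := Finsupp.mem_span_range_iff_exists_finsupp.1 hf
  exact ⟨a, fun x => by simp [Finsupp.sum, Finset.sum_apply]⟩

lemma contDiff_trigPoly (hf : f ∈ trigPoly n) {m : WithTop ℕ∞} : ContDiff ℂ m f := by
  refine trigPoly_induction hf (fun ν => ?_) contDiff_const (fun _ _ h1 h2 => h1.add h2)
    fun a f h => contDiff_const.smul h
  unfold expo; fun_prop

lemma continuous_trigPoly (hf : f ∈ trigPoly n) : Continuous f :=
  (contDiff_trigPoly hf (m := 0)).continuous

lemma trigPoly_translate (hf : f ∈ trigPoly n) (y : ℂⁿ) : (fun x => f (x + y)) ∈ trigPoly n := by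
  refine trigPoly_induction (p := fun f => (fun x => f (x + y)) ∈ trigPoly n) hf (fun ν => ?_)
    (zero_mem _) (fun _ _ h1 h2 => add_mem h1 h2) fun a f h => Subalgebra.smul_mem _ h a
  have : (fun x => expo ν (x + y)) = expo ν y • expo ν := by ext x; simp [expo_add, mul_comm]
  rw [this]
  exact Subalgebra.smul_mem _ (expo_mem ν) _

lemma dense_ne_zero {𝕜 E : Type*} [RCLike 𝕜] [NormedAddCommGroup E] [NormedSpace 𝕜 E]
    {f : E → ℂ} [NormedSpace 𝕜 ℂ] (hf : AnalyticOnNhd 𝕜 f univ) {x₀ : E} (h0 : f x₀ ≠ 0) :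
    Dense {x | f x ≠ 0} := by
  let _ : NormedSpace ℝ E := NormedSpace.restrictScalars ℝ 𝕜 E
  by_contra h
  obtain ⟨x, hx⟩ : ∃ x, x ∉ closure {x | f x ≠ 0} := by simpa [Dense] using h
  have h1 : f =ᶠ[𝓝 x] 0 := by
    filter_upwards [isClosed_closure.isOpen_compl.mem_nhds hx] with y hy
    by_contra h2
    exact hy (subset_closure h2)
  exact h0 (hf.eqOn_zero_of_preconnected_of_eventuallyEq_zero isPreconnected_univ (mem_univ x) h1
    (mem_univ x₀))

/-! ### Walls -/

/-- The function `e^{i(⟨ν,x⟩ + c)} - 1`, which vanishes on the wall `⟨ν,x⟩ + c ∈ 2πℤ`. -/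
def wallZ (ν : ℤⁿ) (c : ℂ) (x : ℂⁿ) : ℂ := exp (I * (lin ν x + c)) - 1

lemma exp_lin_eq (ν : ℤⁿ) (c : ℂ) (x : ℂⁿ) :
    exp (I * (lin ν x + c)) = exp (I * c) * expo ν x := by
  rw [mul_add, exp_add, mul_comm]; rfl

lemma exp_lin_mem (ν : ℤⁿ) (c : ℂ) : (fun x => exp (I * (lin ν x + c))) ∈ trigPoly n := by
  simp only [exp_lin_eq]
  exact mul_mem (const_mem_trigPoly _) (expo_mem ν)

lemma wallZ_mem (ν : ℤⁿ) (c : ℂ) : wallZ ν c ∈ trigPoly n :=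
  sub_mem (exp_lin_mem ν c) (const_mem_trigPoly 1)

lemma exists_zpow_sub_one (ν : ℤⁿ) (c : ℂ) (k : ℤ) : ∃ h ∈ trigPoly n, ∀ x,
    exp (I * (lin ν x + c)) ^ k - 1 = wallZ ν c x * h x := by
  have hinv : (fun x => (exp (I * (lin ν x + c)))⁻¹) ∈ trigPoly n := by
    have := exp_lin_mem (-ν) (-c)
    convert this using 2 with x
    rw [← exp_neg, lin_neg_left]; congr 1; ring
  induction k using Int.induction_on with
  | zero => exact ⟨0, zero_mem _, fun x => by simp⟩
  | succ k ih =>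
    obtain ⟨h, hh, hx⟩ := ih
    refine ⟨_, add_mem (mul_mem hh (exp_lin_mem ν c)) (one_mem _), fun x => ?_⟩
    rw [zpow_add₀ (exp_ne_zero _), zpow_one]
    have := hx x
    simp only [wallZ, Pi.add_apply, Pi.mul_apply, Pi.one_apply] at this ⊢
    grind
  | pred k ih =>
    obtain ⟨h, hh, hx⟩ := ih
    refine ⟨_, sub_mem (mul_mem hh hinv) hinv, fun x => ?_⟩
    rw [zpow_sub₀ (exp_ne_zero _), zpow_one]
    have := hx x
    have h0 := exp_ne_zero (I * (lin ν x + c))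
    simp only [wallZ, Pi.sub_apply, Pi.mul_apply] at this ⊢
    field_simp
    linear_combination this

/-- The projection to the hyperplane `⟨ν,x⟩ + c = 0` along the `j`th coordinate axis. -/
def wallProj (ν : ℤⁿ) (c : ℂ) (j : Fin n) (x : ℂⁿ) : ℂⁿ := x + single j (-(ν j * (lin ν x + c)))

lemma lin_wallProj (ν μ : ℤⁿ) (c : ℂ) (j : Fin n) (x : ℂⁿ) :
    lin μ (wallProj ν c j x) = lin μ x - ((μ j * ν j : ℤ) : ℂ) * (lin ν x + c) := by
  rw [wallProj, lin_add, lin_single]; push_cast; ring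

lemma wallProj_mem {ν : ℤⁿ} (c : ℂ) {j : Fin n} (hj : ν j * ν j = 1) (x : ℂⁿ) :
    lin ν (wallProj ν c j x) + c = 0 := by
  rw [lin_wallProj, hj]; simp

lemma wallProj_eq_self {ν : ℤⁿ} {c : ℂ} {j : Fin n} {x : ℂⁿ}
    (hx : lin ν x + c = 0) : wallProj ν c j x = x := by
  simp [wallProj, hx]

@[fun_prop] lemma contDiff_wallProj (ν : ℤⁿ) (c : ℂ) (j : Fin n) {m : WithTop ℕ∞} :
    ContDiff ℂ m (wallProj ν c j) := by
  unfold wallProj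
  refine contDiff_id.add ?_
  rw [contDiff_pi]
  intro i
  by_cases h : i = j
  · subst h; simp only [single_eq_same]; fun_prop
  · simp only [single_eq_of_ne h]; fun_prop

lemma exists_factor {ν : ℤⁿ} {c : ℂ} {j : Fin n} (hj : ν j * ν j = 1)
    (hf : f ∈ trigPoly n) (h0 : ∀ p, lin ν p + c = 0 → f p = 0) :
    ∃ h ∈ trigPoly n, ∀ x, f x = wallZ ν c x * h x := by
  have key : ∃ h ∈ trigPoly n, ∀ x, f x - f (wallProj ν c j x) = wallZ ν c x * h x := by
    refine trigPoly_induction (p := fun f => ∃ h ∈ trigPoly n, ∀ x,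
      f x - f (wallProj ν c j x) = wallZ ν c x * h x) hf (fun μ => ?_)
      ⟨0, zero_mem _, fun x => by simp⟩ ?_ ?_
    · obtain ⟨h, hh, hx⟩ := exists_zpow_sub_one ν c (-(μ j * ν j))
      refine ⟨_, neg_mem (mul_mem (expo_mem μ) hh), fun x => ?_⟩
      have e : expo μ (wallProj ν c j x) = expo μ x * exp (I * (lin ν x + c)) ^ (-(μ j * ν j)) := by
        rw [expo, lin_wallProj, ← exp_int_mul, expo, ← exp_add]
        congr 1
        push_cast; ring
      rw [e]
      simp only [Pi.neg_apply, Pi.mul_apply]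
      linear_combination -(expo μ x) * hx x
    · rintro f g ⟨h1, m1, e1⟩ ⟨h2, m2, e2⟩
      exact ⟨_, add_mem m1 m2, fun x => by simp only [Pi.add_apply]; linear_combination e1 x + e2 x⟩
    · rintro a f ⟨h1, m1, e1⟩
      exact ⟨_, Subalgebra.smul_mem _ m1 a, fun x => by
        simp only [Pi.smul_apply, smul_eq_mul]; linear_combination a * e1 x⟩
  obtain ⟨h, hh, hx⟩ := key
  exact ⟨h, hh, fun x => by rw [← hx x, h0 _ (wallProj_mem c hj x), sub_zero]⟩

section arrangement

variable {ι : Type*} (ν : ι → Fin n → ℤ) (c : ι → ℂ)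

/-- The complement of the walls. -/
def offWalls : Set ℂⁿ := {x | ∀ w, wallZ (ν w) (c w) x ≠ 0}

/-- The points of the wall `w` that lie on no other wall unless that contains the whole of `w`. -/
def IsGeneric (w : ι) (p : ℂⁿ) : Prop :=
  lin (ν w) p + c w = 0 ∧ ∀ w', (∃ q, lin (ν w) q + c w = 0 ∧ wallZ (ν w') (c w') q ≠ 0) →
    wallZ (ν w') (c w') p ≠ 0

/-- The functions that become trigonometric polynomials after multiplication with equations of
walls. -/
def IsRat (f : ℂⁿ → ℂ) : Prop := ∃ (l : List ι) (h : ℂⁿ → ℂ), h ∈ trigPoly n ∧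
    ∀ x ∈ offWalls ν c, (l.map fun w => wallZ (ν w) (c w) x).prod * f x = h x

variable {ν c}

lemma IsRat.of_mem (hf : f ∈ trigPoly n) : IsRat ν c f := ⟨[], f, hf, fun x _ => by simp⟩

lemma list_prod_mem (l : List ι) :
    (fun x => (l.map fun w => wallZ (ν w) (c w) x).prod) ∈ trigPoly n := by
  induction l with
  | nil => simpa using const_mem_trigPoly 1
  | cons w l ih =>
    simp only [List.map_cons, List.prod_cons]
    exact mul_mem (wallZ_mem (ν w) (c w)) ih

lemma IsRat.mul {f h : ℂⁿ → ℂ} (hf : IsRat ν c f) (hh : IsRat ν c h) :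
    IsRat ν c fun x => f x * h x := by
  obtain ⟨l1, h1, m1, e1⟩ := hf
  obtain ⟨l2, h2, m2, e2⟩ := hh
  refine ⟨l1 ++ l2, _, mul_mem m1 m2, fun x hx => ?_⟩
  rw [List.map_append, List.prod_append, Pi.mul_apply, ← e1 x hx, ← e2 x hx]; ring

lemma IsRat.add {f h : ℂⁿ → ℂ} (hf : IsRat ν c f) (hh : IsRat ν c h) :
    IsRat ν c fun x => f x + h x := by
  obtain ⟨l1, h1, m1, e1⟩ := hf
  obtain ⟨l2, h2, m2, e2⟩ := hh
  refine ⟨l1 ++ l2, _, add_mem (mul_mem (list_prod_mem (ν := ν) (c := c) l2) m1)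
    (mul_mem (list_prod_mem (ν := ν) (c := c) l1) m2),
    fun x hx => ?_⟩
  simp only [List.map_append, List.prod_append, Pi.mul_apply, Pi.add_apply, ← e1 x hx, ← e2 x hx]
  ring

lemma IsRat.sum {κ : Type*} (s : Finset κ) {f : κ → ℂⁿ → ℂ}
    (hf : ∀ i ∈ s, IsRat ν c (f i)) : IsRat ν c fun x => ∑ i ∈ s, f i x := by
  classical
  induction s using Finset.induction_on with
  | empty => simpa using IsRat.of_mem (const_mem_trigPoly 0)
  | insert a s ha ih =>
    simp only [sum_insert ha]
    exact (hf a (mem_insert_self ..)).add (ih fun i hi => hf i (Finset.mem_insert_of_mem hi))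

lemma IsRat.prod {κ : Type*} (s : Finset κ) {f : κ → ℂⁿ → ℂ}
    (hf : ∀ i ∈ s, IsRat ν c (f i)) : IsRat ν c fun x => ∏ i ∈ s, f i x := by
  classical
  induction s using Finset.induction_on with
  | empty => simpa using IsRat.of_mem (const_mem_trigPoly 1)
  | insert a s ha ih =>
    simp only [Finset.prod_insert ha]
    exact (hf a (mem_insert_self ..)).mul (ih fun i hi => hf i (Finset.mem_insert_of_mem hi))

lemma analyticOnNhd_trigPoly (hf : f ∈ trigPoly n) : AnalyticOnNhd ℂ f univ :=
  fun _ _ => (contDiff_trigPoly hf (m := ω)).contDiffAt.analyticAt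

lemma dense_forall_ne_zero [Finite ι] {f : ι → ℂⁿ → ℂ}
    (hf : ∀ i, ContDiff ℂ ω (f i)) (h0 : ∀ i, ∃ x, f i x ≠ 0) : Dense {x | ∀ i, f i x ≠ 0} := by
  have : {x | ∀ i, f i x ≠ 0} = ⋂ i, {x | f i x ≠ 0} := by ext; simp
  rw [this]
  refine dense_iInter_of_isOpen (fun i => ?_) fun i => ?_
  · exact isOpen_ne_fun (hf i).continuous continuous_const
  · obtain ⟨x, hx⟩ := h0 i
    exact dense_ne_zero (𝕜 := ℂ) (fun y _ => (hf i).contDiffAt.analyticAt) hx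

lemma dense_offWalls [Finite ι] (hν : ∀ w, ∃ j, ν w j * ν w j = 1) : Dense (offWalls ν c) := by
  refine dense_forall_ne_zero (fun w => contDiff_trigPoly (wallZ_mem _ _)) fun w => ?_
  obtain ⟨j, hj⟩ := hν w
  refine ⟨single j (ν w j * (Real.pi - c w)), ?_⟩
  have : ((ν w j : ℂ)) * ν w j = 1 := by exact_mod_cast hj
  rw [wallZ, lin_single, ← mul_assoc, this, one_mul, sub_add_cancel, mul_comm, exp_pi_mul_I]
  norm_num

lemma eq_zero_of_generic [Finite ι] {w : ι} {j : Fin n} (hj : ν w j * ν w j = 1)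
    (hf : f ∈ trigPoly n) (h0 : ∀ p, IsGeneric ν c w p → f p = 0)
    (p : ℂⁿ) (hp : lin (ν w) p + c w = 0) : f p = 0 := by
  set T := {w' : ι // ∃ q, lin (ν w) q + c w = 0 ∧ wallZ (ν w') (c w') q ≠ 0}
  have hd : Dense {x | ∀ w' : T, wallZ (ν w'.1) (c w'.1) (wallProj (ν w) (c w) j x) ≠ 0} := by
    refine dense_forall_ne_zero (f := fun w' : T => fun x =>
      wallZ (ν w'.1) (c w'.1) (wallProj (ν w) (c w) j x)) (fun w' => ?_) fun w' => ?_
    · exact (contDiff_trigPoly (wallZ_mem _ _)).comp (contDiff_wallProj _ _ _)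
    · obtain ⟨q, h1, h2⟩ := w'.2
      exact ⟨q, by rwa [wallProj_eq_self h1]⟩
  have h1 : (fun x => f (wallProj (ν w) (c w) j x)) = fun _ => 0 := by
    refine Continuous.ext_on hd ?_ continuous_const fun x hx => h0 _ ⟨wallProj_mem _ hj _, ?_⟩
    · exact (continuous_trigPoly hf).comp (contDiff_wallProj _ _ _ (m := 0)).continuous
    · exact fun w' hw' => hx ⟨w', hw'⟩
  have := congrFun h1 p
  rwa [wallProj_eq_self hp] at this

lemma exists_trigPoly_of_isRat [Finite ι] (hν : ∀ w, ∃ j, ν w j * ν w j = 1) (hf : IsRat ν c f)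
    (h0 : ∀ w p, IsGeneric ν c w p →
      Tendsto (fun x => wallZ (ν w) (c w) x * f x) (𝓝[offWalls ν c] p) (𝓝 0)) :
    ∃ h ∈ trigPoly n, ∀ x ∈ offWalls ν c, f x = h x := by
  obtain ⟨l, h, hh, hx⟩ := hf
  induction l generalizing h with
  | nil => exact ⟨h, hh, fun x hx' => by simpa using hx x hx'⟩
  | cons w l ih =>
    obtain ⟨j, hj⟩ := hν w
    have h1 : ∀ p, IsGeneric ν c w p → h p = 0 := by
      intro p hp
      have : (𝓝[offWalls ν c] p).NeBot := mem_closure_iff_nhdsWithin_neBot.1 (dense_offWalls hν p)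
      have t1 : Tendsto h (𝓝[offWalls ν c] p) (𝓝 (h p)) :=
        (continuous_trigPoly hh).continuousWithinAt
      have t2 := ((continuous_trigPoly (list_prod_mem (ν := ν) (c := c) l)).continuousWithinAt
        (s := offWalls ν c) (x := p)).tendsto.mul (h0 w p hp)
      rw [mul_zero] at t2
      refine tendsto_nhds_unique (t1.congr' ?_) t2
      filter_upwards [self_mem_nhdsWithin] with x hx'
      grind
    obtain ⟨h', m', e'⟩ := exists_factor hj hh (eq_zero_of_generic hj hh h1)
    refine ih h' m' fun x hx' => mul_left_cancel₀ (hx' w) ?_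
    grind

end arrangement

/-! ### Linear independence -/

lemma expo_real_injective : Injective (fun (ν : ℤⁿ) (x : ℝⁿ) => expo ν (toC x)) := by
  intro ν μ h
  by_contra hne
  obtain ⟨j, hj⟩ := ne_iff.1 hne
  have hk : ((ν j - μ j : ℤ) : ℂ) ≠ 0 := by exact_mod_cast sub_ne_zero.2 hj
  have h1 := congrFun h (single j (Real.pi / ((ν j - μ j : ℤ) : ℝ)))
  have e : toC (single j (Real.pi / ((ν j - μ j : ℤ) : ℝ))) =
      single j ((Real.pi : ℂ) / ((ν j - μ j : ℤ) : ℂ)) := by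
    ext i
    by_cases hi : i = j
    · subst hi; simp [toC]
    · simp [toC, hi]
  have h2 : expo (ν - μ) (single j ((Real.pi : ℂ) / ((ν j - μ j : ℤ) : ℂ))) = 1 := by
    simp only [e] at h1
    rw [sub_eq_add_neg, expo_add_left, expo_neg_left, h1, mul_inv_cancel₀ (expo_ne_zero _ _)]
  rw [expo, lin_single, Pi.sub_apply, mul_div_cancel₀ _ hk, mul_comm, exp_pi_mul_I] at h2
  norm_num at h2

lemma linearIndependent_expo_real :
    LinearIndependent ℂ (fun (ν : ℤⁿ) (x : ℝⁿ) => expo ν (toC x)) := by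
  let g : ℤⁿ → (Multiplicative ℝⁿ →* ℂ) := fun ν =>
    { toFun := fun x => expo ν (toC (Multiplicative.toAdd x))
      map_one' := by simp [expo, lin, toC]
      map_mul' := fun x y => by rw [← expo_add]; congr 1; ext j; simp [toC] }
  have hg : Injective g := fun ν μ h => by
    apply expo_real_injective
    aesop
  exact (linearIndependent_monoidHom (Multiplicative ℝⁿ) ℂ).comp g hg

/-! ### The walls of the difference operators -/

/-- The nonzero signs. -/
abbrev NZSign := {a : SignType // a ≠ 0}

lemma sign_sq {a : SignType} (ha : a ≠ 0) : (a : ℂ) * (a : ℂ) = 1 := by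
  rcases SignType.trichotomy a with h | h | h
  · simp [h]
  · exact (ha h).elim
  · simp [h]

lemma sign_ne_zero' {a : SignType} (ha : a ≠ 0) : (a : ℂ) ≠ 0 := fun h => by
  simpa [h] using sign_sq ha

lemma sign_cast_int (a : SignType) : (((a : ℤ)) : ℂ) = (a : ℂ) := by cases a <;> simp

/-- The walls of the coefficients of the difference operators. -/
abbrev WallIx (n : ℕ) :=
  (Fin n × NZSign × Bool × Bool) ⊕ ({q : Fin n × Fin n // q.1 ≠ q.2} × NZSign × NZSign × Bool)

/-- The linear part of the equation of a wall. -/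
def wNu : WallIx n → ℤⁿ
  | .inl (j, a, _, _) => single j (a.1 : ℤ)
  | .inr (q, a, b, _) => single q.1.1 (a.1 : ℤ) + single q.1.2 (b.1 : ℤ)

/-- The constant part of the equation of a wall. -/
def wC : WallIx n → ℂ
  | .inl (_, _, s, t) => (if s then gam β else 0) + (if t then (Real.pi : ℂ) else 0)
  | .inr (_, _, _, s) => if s then 2 * gam β else 0

lemma lin_inl (j : Fin n) (a : NZSign) (s t : Bool) (x : ℂⁿ) :
    lin (wNu (.inl (j, a, s, t))) x = (a.1 : ℂ) * x j := by
  rw [wNu, lin_single_left, sign_cast_int]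

lemma lin_inr (q : {q : Fin n × Fin n // q.1 ≠ q.2}) (a b : NZSign) (s : Bool) (x : ℂⁿ) :
    lin (wNu (.inr (q, a, b, s))) x = (a.1 : ℂ) * x q.1.1 + (b.1 : ℂ) * x q.1.2 := by
  rw [wNu, lin_add_left, lin_single_left, lin_single_left, sign_cast_int, sign_cast_int]

lemma exists_wNu_sq (w : WallIx n) : ∃ j, wNu w j * wNu w j = 1 := by
  have h : ∀ a : NZSign, (a.1 : ℤ) * (a.1 : ℤ) = 1 := fun a => by
    exact_mod_cast (by simpa [sign_cast_int] using sign_sq a.2 :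
      (((a.1 : ℤ) * (a.1 : ℤ) : ℤ) : ℂ) = 1)
  rcases w with ⟨j, a, s, t⟩ | ⟨q, a, b, s⟩
  · exact ⟨j, by simp [wNu, h]⟩
  · exact ⟨q.1.1, by simp [wNu, q.2, h]⟩

/-- The complement of all walls. -/
abbrev regularC (n : ℕ) (β : ℝ) : Set (Fin n → ℂ) := offWalls wNu (wC (n := n) β)

/-- `w` is not contained in the wall `w'`. -/
def Transv (w w' : WallIx n) : Prop :=
  ∃ q, lin (wNu w) q + wC β w = 0 ∧ wallZ (wNu w') (wC β w') q ≠ 0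

lemma exists_mem_wall (w : WallIx n) : ∃ q, lin (wNu w) q + wC β w = 0 := by
  obtain ⟨j, hj⟩ := exists_wNu_sq w
  exact ⟨_, wallProj_mem _ hj 0⟩

lemma transv_of_dir {β : ℝ} {w w' : WallIx n} (v : ℂⁿ) (h0 : lin (wNu w) v = 0)
    (h1 : lin (wNu w') v ≠ 0) : Transv β w w' := by
  obtain ⟨q, hq⟩ := exists_mem_wall β w
  refine ⟨q + ((Real.pi - (lin (wNu w') q + wC β w')) / lin (wNu w') v) • v, ?_, ?_⟩
  · rw [lin_add, lin_smul, h0, mul_zero, add_zero, hq]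
  · rw [wallZ, lin_add, lin_smul, div_mul_cancel₀ _ h1,
      show lin (wNu w') q + (↑Real.pi - (lin (wNu w') q + wC β w')) + wC β w' = Real.pi by ring,
      mul_comm, exp_pi_mul_I]
    norm_num

lemma transv_of_par {β : ℝ} {w w' : WallIx n} (t : ℂ)
    (h : ∀ x, lin (wNu w') x = t * lin (wNu w) x)
    (he : exp (I * (wC β w' - t * wC β w)) ≠ 1) : Transv β w w' := by
  obtain ⟨q, hq⟩ := exists_mem_wall β w
  refine ⟨q, hq, ?_⟩
  rw [wallZ, h, sub_ne_zero, eq_neg_of_add_eq_zero_left hq]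
  convert he using 3; ring

lemma exists_exp_gam {β : ℝ} (hβ : β ≠ 0) : ∃ q : ℝ, 0 < q ∧ (∀ k ≠ 0, q ^ k ≠ 1) ∧
    exp (I * gam β) = q := by
  refine ⟨Real.exp (-β / 2), Real.exp_pos _, fun k hk => ?_, ?_⟩
  · rw [Ne, pow_eq_one_iff_of_nonneg (Real.exp_pos _).le hk]; simpa using hβ
  · rw [Complex.ofReal_exp, gam]
    congr 1
    push_cast
    linear_combination (β / 2 : ℂ) * I_sq

lemma exp_wC_inl {β q : ℝ} (hq : exp (I * gam β) = q) (j : Fin n) (a : NZSign) (s t : Bool) :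
    exp (I * wC β (.inl (j, a, s, t))) =
      (((if s then q else 1) * if t then -1 else 1 : ℝ) : ℂ) := by
  cases s <;> cases t <;> simp [wC, mul_add, exp_add, mul_comm I Real.pi, exp_pi_mul_I, hq]

lemma exp_wC_inr {β q : ℝ} (hq : exp (I * gam β) = q) (i) (a b : NZSign) (s : Bool) :
    exp (I * wC (n := n) β (.inr (i, a, b, s))) = ((if s then q ^ 2 else 1 : ℝ) : ℂ) := by
  cases s
  · simp [wC]
  · simp [wC, ← hq, ← exp_nat_mul, mul_left_comm I]

lemma sign_mul_cases (a b : NZSign) :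
    (a = b ∧ (a.1 : ℂ) * (b.1 : ℂ) = 1) ∨ (a ≠ b ∧ (a.1 : ℂ) * (b.1 : ℂ) = -1) := by
  obtain ⟨a, ha⟩ := a
  obtain ⟨b, hb⟩ := b
  rcases SignType.trichotomy a with h | h | h <;> rcases SignType.trichotomy b with h' | h' | h' <;>
    first
    | exact absurd h ha
    | exact absurd h' hb
    | (subst h h'; simp)

lemma transv_inl {β : ℝ} (hβ : β ≠ 0) {j : Fin n} {a : NZSign} {s t : Bool} {w' : WallIx n}
    (h : ∀ a', w' = .inl (j, a', s, t) → a' ≠ a ∧ s = true) :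
    Transv β (.inl (j, a, s, t)) w' := by
  rcases w' with ⟨i, a', s', t'⟩ | ⟨⟨⟨i, l⟩, hil⟩, a', b', s'⟩
  · by_cases hij : i = j
    · subst hij
      refine transv_of_par ((a'.1 : ℂ) * a.1) (fun x => ?_) ?_
      · rw [lin_inl, lin_inl]
        linear_combination (-(a'.1 : ℂ) * x i) * sign_sq a.2
      · obtain ⟨q, h0, hk, hq⟩ := exists_exp_gam hβ
        have h1 := hk 1 one_ne_zero
        have h2 := hk 2 two_ne_zero
        have h3 := pow_pos h0 2
        rcases sign_mul_cases a' a with ⟨rfl, e⟩ | ⟨ha, e⟩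
        · rw [e, one_mul, mul_sub, Complex.exp_sub, Ne, div_eq_one_iff_eq (exp_ne_zero _),
            exp_wC_inl hq, exp_wC_inl hq, Complex.ofReal_inj]
          have := h a'
          cases s <;> cases s' <;> cases t <;> cases t' <;> grind
        · rw [e, neg_one_mul, sub_neg_eq_add, mul_add, exp_add, exp_wC_inl hq, exp_wC_inl hq]
          norm_cast
          have := h a'
          cases s <;> cases s' <;> cases t <;> cases t' <;> grind
    · refine transv_of_dir (single i 1) ?_ ?_
      · rw [lin_inl, single_eq_of_ne (Ne.symm hij), mul_zero]
      · rw [lin_inl, single_eq_same, mul_one]; exact sign_ne_zero' a'.2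
  · change i ≠ l at hil
    by_cases hij : i = j
    · refine transv_of_dir (single l 1) ?_ ?_
      · rw [lin_inl, single_eq_of_ne (fun h => hil (hij.trans h)), mul_zero]
      · rw [lin_inr]
        simp [hil, sign_ne_zero' b'.2]
    · refine transv_of_dir (single i 1) ?_ ?_
      · rw [lin_inl, single_eq_of_ne (Ne.symm hij), mul_zero]
      · rw [lin_inr]
        simp [hil.symm, sign_ne_zero' a'.2]

lemma transv_inr {β : ℝ} (hβ : β ≠ 0) {j k : Fin n} {hjk : j ≠ k} {a b : NZSign} {s : Bool}
    {w' : WallIx n}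
    (h : ∀ a' b' s', w' = .inr (⟨(j, k), hjk⟩, a', b', s') →
      (a'.1 : ℂ) * a.1 = (b'.1 : ℂ) * b.1 → s' = s → s = true ∧ a' ≠ a)
    (hw : ∀ a' b' s', w' ≠ .inr (⟨(k, j), hjk.symm⟩, a', b', s')) :
    Transv β (.inr (⟨(j, k), hjk⟩, a, b, s)) w' := by
  have hdir : lin (wNu (.inr (⟨(j, k), hjk⟩, a, b, s)))
      (single j (a.1 : ℂ) - single k (b.1 : ℂ)) = 0 := by
    rw [lin_inr]
    simp [hjk, hjk.symm, sign_sq a.2, sign_sq b.2]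
  have hfree : ∀ i, i ≠ j → i ≠ k → lin (wNu (.inr (⟨(j, k), hjk⟩, a, b, s))) (single i 1) = 0 := by
    intro i h1 h2
    rw [lin_inr]
    simp [h1.symm, h2.symm]
  rcases w' with ⟨i, a', s', t'⟩ | ⟨⟨⟨i, l⟩, hil⟩, a', b', s'⟩
  · by_cases h1 : i = j
    · refine transv_of_dir _ hdir ?_
      rw [lin_inl]
      simp [h1, hjk, sign_ne_zero' a.2, sign_ne_zero' a'.2]
    · by_cases h2 : i = k
      · refine transv_of_dir _ hdir ?_
        rw [lin_inl]
        simp [h2, hjk.symm, sign_ne_zero' b.2, sign_ne_zero' a'.2]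
      · refine transv_of_dir _ (hfree i h1 h2) ?_
        rw [lin_inl]
        simp [sign_ne_zero' a'.2]
  · change i ≠ l at hil
    by_cases hi : i ≠ j ∧ i ≠ k
    · refine transv_of_dir _ (hfree i hi.1 hi.2) ?_
      rw [lin_inr]; simp [hil.symm, sign_ne_zero' a'.2]
    by_cases hl : l ≠ j ∧ l ≠ k
    · refine transv_of_dir _ (hfree l hl.1 hl.2) ?_
      rw [lin_inr]; simp [hil, sign_ne_zero' b'.2]
    have hcase : (i = j ∧ l = k) ∨ (i = k ∧ l = j) := by omega
    rcases hcase with ⟨rfl, rfl⟩ | ⟨rfl, rfl⟩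
    · by_cases hab : (a'.1 : ℂ) * a.1 = (b'.1 : ℂ) * b.1
      · refine transv_of_par ((a'.1 : ℂ) * a.1) (fun x => ?_) ?_
        · rw [lin_inr, lin_inr]
          linear_combination (-(a'.1 : ℂ) * x i) * sign_sq a.2 - (b'.1 : ℂ) * x l * sign_sq b.2
            - (b.1 : ℂ) * x l * hab
        · obtain ⟨q, h0, hk, hq⟩ := exists_exp_gam hβ
          have h2 := hk 2 two_ne_zero
          have h4 := hk 4 four_ne_zero
          have := h a' b' s' rfl hab
          rcases sign_mul_cases a' a with ⟨rfl, e⟩ | ⟨ha, e⟩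
          · rw [e, one_mul, mul_sub, Complex.exp_sub, Ne, div_eq_one_iff_eq (exp_ne_zero _),
              exp_wC_inr hq, exp_wC_inr hq, Complex.ofReal_inj]
            cases s <;> cases s' <;> grind
          · rw [e, neg_one_mul, sub_neg_eq_add, mul_add, exp_add, exp_wC_inr hq, exp_wC_inr hq]
            norm_cast
            cases s <;> cases s' <;> grind
      · refine transv_of_dir _ hdir ?_
        rw [lin_inr]
        simp only [Pi.sub_apply, single_eq_same, single_eq_of_ne hjk,
          single_eq_of_ne hjk.symm, sub_zero, zero_sub, mul_neg, ← sub_eq_add_neg]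
        exact sub_ne_zero.2 hab
    · exact absurd rfl (hw a' b' s')

/-! ### The factors of the coefficients -/

/-- The factor of the coefficients with a pole at the wall `w`. -/
def wallRatio (β κ : ℝ) (w : WallIx n) (x : ℂⁿ) : ℂ := sineRatio β κ (lin (wNu w) x + wC β w)

lemma siteW_eq {a : SignType} (ha : a ≠ 0) (j : Fin n) (x : ℂⁿ) :
    siteW P β a (x j) = wallRatio β P.g₀ (.inl (j, ⟨a, ha⟩, false, false)) x *
      wallRatio β P.g₁ (.inl (j, ⟨a, ha⟩, false, true)) x *
      wallRatio β P.g₀' (.inl (j, ⟨a, ha⟩, true, false)) x *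
      wallRatio β P.g₁' (.inl (j, ⟨a, ha⟩, true, true)) x := by
  rw [siteW, if_neg ha, vB_eq]
  simp [wallRatio, lin_inl, wC, add_assoc]

lemma pairW_eq {a b : SignType} (ha : a ≠ 0) (hb : b ≠ 0) {j k : Fin n} (hjk : j ≠ k) (x : ℂⁿ) :
    pairW P β a b (x j) (x k) = wallRatio β P.g (.inr (⟨(j, k), hjk⟩, ⟨a, ha⟩, ⟨b, hb⟩, false)) x *
      wallRatio β P.g (.inr (⟨(j, k), hjk⟩, ⟨a, ha⟩, ⟨b, hb⟩, true)) x := by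
  rw [pairW, if_neg ha, if_neg hb, vA_eq, vA_eq]
  simp [wallRatio, lin_inr, wC]

/-- The sign `1`. -/
def posSign : NZSign := ⟨1, by decide⟩

/-- The sign `-1`. -/
def negSign : NZSign := ⟨-1, by decide⟩

lemma pairW_right_zero {a : SignType} (ha : a ≠ 0) {j k : Fin n} (hjk : j ≠ k) (x : ℂⁿ) :
    pairW P β a 0 (x j) (x k) = wallRatio β P.g (.inr (⟨(j, k), hjk⟩, ⟨a, ha⟩, posSign, false)) x *
      wallRatio β P.g (.inr (⟨(j, k), hjk⟩, ⟨a, ha⟩, negSign, false)) x := by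
  rw [pairW, if_neg ha, if_pos rfl, vA_eq, vA_eq]
  simp [wallRatio, lin_inr, wC, posSign, negSign, sub_eq_add_neg]

lemma sin_half_eq (z : ℂ) : sin (z / 2) =
    (exp (I * z) - 1) * (-(I / 2) * exp (-(I * z / 2))) := by
  have h : exp (I * z) = exp (z / 2 * I) ^ 2 := by rw [← exp_nat_mul]; congr 1; push_cast; ring
  have h2 : exp (-(I * z / 2)) = (exp (z / 2 * I))⁻¹ := by rw [← exp_neg]; congr 1; ring
  rw [sin, h, h2, neg_mul, exp_neg]
  field_simp [exp_ne_zero]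
  ring

lemma sin_half_ne_zero {z : ℂ} (h : exp (I * z) - 1 ≠ 0) : sin (z / 2) ≠ 0 := by
  rw [sin_half_eq]
  simp_all

lemma wallZ_mul_wallRatio (β κ : ℝ) (w : WallIx n) {x : ℂⁿ} (hx : wallZ (wNu w) (wC β w) x ≠ 0) :
    wallZ (wNu w) (wC β w) x * wallRatio β κ w x =
      exp (-(β * κ / 2)) * exp (I * (lin (wNu w) x + wC β w)) - exp (β * κ / 2) := by
  rw [wallRatio, sineRatio, sin_half_eq (I * β * κ + _), sin_half_eq (lin _ _ + _)]
  set z := lin (wNu w) x + wC β w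
  have hz : wallZ (wNu w) (wC β w) x = exp (I * z) - 1 := rfl
  rw [hz] at hx ⊢
  have e1 : exp (I * (I * β * κ + z)) = exp (-(β * κ / 2)) ^ 2 * exp (I * z) := by
    rw [← exp_nat_mul, ← exp_add]; congr 1
    push_cast
    linear_combination (β * κ : ℂ) * I_sq
  have e2 : exp (-(I * (I * β * κ + z) / 2)) = exp (β * κ / 2) * exp (-(I * z / 2)) := by
    rw [← exp_add]; congr 1
    linear_combination (-(β * κ / 2) : ℂ) * I_sq
  have e3 : exp (-(β * κ / 2 : ℂ)) * exp (β * κ / 2) = 1 := by rw [← exp_add]; simp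
  rw [e1, e2]
  have hI := I_ne_zero
  have he := exp_ne_zero (-(I * z / 2))
  grind

lemma isRat_wallRatio (β κ : ℝ) (w : WallIx n) : IsRat wNu (wC β) (wallRatio β κ w) := by
  refine ⟨[w], _, sub_mem (mul_mem (const_mem_trigPoly (exp (-(β * κ / 2))))
    (exp_lin_mem (wNu w) (wC β w))) (const_mem_trigPoly (exp (β * κ / 2))), fun x hx => ?_⟩
  simpa using wallZ_mul_wallRatio β κ w (hx w)

lemma continuousAt_wallRatio (β κ : ℝ) {w : WallIx n} {p : ℂⁿ}
    (hp : wallZ (wNu w) (wC β w) p ≠ 0) : ContinuousAt (wallRatio β κ w) p := by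
  have h1 : ContinuousAt (fun x => lin (wNu w) x + wC β w) p := by fun_prop
  refine ContinuousAt.div ?_ ?_ (sin_half_ne_zero hp)
  · fun_prop
  · fun_prop

lemma tendsto_wallZ_mul_wallRatio (β κ : ℝ) (w : WallIx n) (p : ℂⁿ) :
    ∃ L, Tendsto (fun x => wallZ (wNu w) (wC β w) x * wallRatio β κ w x)
      (𝓝[regularC n β] p) (𝓝 L) := by
  have h1 : Continuous fun x : ℂⁿ => exp (-(β * κ / 2)) *
      exp (I * (lin (wNu w) x + wC β w)) - exp (β * κ / 2) := by fun_prop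
  refine ⟨_, Tendsto.congr' ?_ (h1.continuousWithinAt (s := regularC n β) (x := p))⟩
  filter_upwards [self_mem_nhdsWithin] with x hx
  exact (wallZ_mul_wallRatio β κ w (hx w)).symm

lemma isRat_siteW (a : SignType) (j : Fin n) :
    IsRat wNu (wC β) fun x : ℂⁿ => siteW P β a (x j) := by
  by_cases ha : a = 0
  · subst ha; simpa using IsRat.of_mem (const_mem_trigPoly 1)
  · simp only [siteW_eq P β ha]
    exact (((isRat_wallRatio ..).mul (isRat_wallRatio ..)).mul (isRat_wallRatio ..)).mul
      (isRat_wallRatio ..)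

lemma isRat_pairW (a b : SignType) {j k : Fin n} (hjk : j ≠ k) :
    IsRat wNu (wC β) fun x : ℂⁿ => pairW P β a b (x j) (x k) := by
  by_cases ha : a = 0
  · by_cases hb : b = 0
    · subst ha hb; simpa using IsRat.of_mem (const_mem_trigPoly 1)
    · have e : (fun x : ℂⁿ => pairW P β a b (x j) (x k)) = _ :=
        funext fun x => by rw [pairW_comm, ha, pairW_right_zero P β hb hjk.symm]
      rw [e]
      exact (isRat_wallRatio ..).mul (isRat_wallRatio ..)
  · by_cases hb : b = 0
    · simp only [hb, pairW_right_zero P β ha hjk]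
      exact (isRat_wallRatio ..).mul (isRat_wallRatio ..)
    · simp only [pairW_eq P β ha hb hjk]
      exact (isRat_wallRatio ..).mul (isRat_wallRatio ..)

lemma isRat_cellW (K : 𝔓ⁿ) (τ : 𝕊ⁿ) : IsRat wNu (wC β) fun x => cellW P β x K τ := by
  refine IsRat.mul (IsRat.prod _ fun j _ => isRat_siteW ..) (IsRat.prod _ fun q hq => ?_)
  exact isRat_pairW P β _ _ (mem_filter.1 hq).2.ne

lemma isRat_chainSum (m : ℕ) : ∀ K : 𝔓ⁿ,
    IsRat wNu (wC β) fun x => chainSum (cellW P β x) m K := by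
  induction m using Nat.strong_induction_on with | _ m ih =>
  intro K
  rcases eq_or_ne m 0 with rfl | hm
  · simpa only [chainSum_zero] using IsRat.of_mem (const_mem_trigPoly 1)
  · simp only [chainSum_eq_neg _ hm]
    have h := IsRat.sum (ν := wNu) (c := wC β) ((cells K m).erase 0)
      (f := fun τ x => cellW P β x K τ *
        chainSum (cellW P β x) (m - (supp τ).card) (K \ supp τ)) fun τ hτ => by
      rw [mem_erase, mem_cells, ne_eq, ← supp_eq_empty] at hτ
      have hc : 0 < (supp τ).card := card_pos.2 (Finset.nonempty_iff_ne_empty.2 hτ.1)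
      exact (isRat_cellW ..).mul (ih _ (by omega) _)
    simpa using (IsRat.of_mem (ν := wNu) (c := wC β) (const_mem_trigPoly (-1))).mul h

/-! ### Cancellation of residues -/

section residues

variable (S : Finset (Fin n)) (σ : Fin n → SignType)

/-- The sign vector that agrees with `σ` on `S` and with `τ` off `S`. -/
def mergeOn (τ : 𝕊ⁿ) : 𝕊ⁿ := fun j => if j ∈ S then σ j else τ j

/-- The sign vector `σ` agrees with `τ` on `S`. -/
def Matches (τ : 𝕊ⁿ) : Prop := ∀ j ∈ S, τ j = σ j

variable {S σ}

lemma mergeOn_clear (h : Matches S σ τ) : mergeOn S σ (mergeOn S 0 τ) = τ := by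
  ext j
  by_cases hj : j ∈ S
  · simp [mergeOn, hj, h j hj]
  · simp [mergeOn, hj]

lemma clear_mergeOn (h : ∀ j ∈ S, τ j = 0) : mergeOn S 0 (mergeOn S σ τ) = τ := by
  ext j
  by_cases hj : j ∈ S
  · simp [mergeOn, hj, h j hj]
  · simp [mergeOn, hj]

lemma matches_mergeOn (τ : 𝕊ⁿ) : Matches S σ (mergeOn S σ τ) := fun j hj => by simp [mergeOn, hj]

lemma supp_mergeOn (hσ : ∀ j ∈ S, σ j ≠ 0) (τ : 𝕊ⁿ) : supp (mergeOn S σ τ) = (supp τ) ∪ S := by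
  ext j
  by_cases hj : j ∈ S
  · simp [mergeOn, hj, hσ j hj]
  · simp [mergeOn, hj]

lemma subset_supp_of_matches (hσ : ∀ j ∈ S, σ j ≠ 0)
    (h : Matches S σ τ) : S ⊆ supp τ := fun j hj => by
  rw [mem_supp, h j hj]; exact hσ j hj

open scoped Classical in
/-- The residue of the sum over chains. -/
def chainRes (S : 𝔓ⁿ) (W0 : 𝔓ⁿ → 𝕊ⁿ → ℂ) (R : 𝔓ⁿ → ℂ) (m : ℕ) (K : 𝔓ⁿ) : ℂ :=
  if S ⊆ K ∧ S.card ≤ m then -R K * chainSum W0 (m - S.card) (K \ S) else 0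

open scoped Classical in
/-- The residue of a term of the difference operator. -/
def termRes (S : 𝔓ⁿ) (σ : 𝕊ⁿ) (W0 : 𝔓ⁿ → 𝕊ⁿ → ℂ) (R : 𝔓ⁿ → ℂ) (g : 𝕊ⁿ → ℂ) (m : ℕ) (K : 𝔓ⁿ)
    (τ : 𝕊ⁿ) : ℂ :=
  if S ⊆ K ∧ Matches S σ τ then W0 K (mergeOn S 0 τ) * R (K \ supp (mergeOn S 0 τ)) *
      chainSum W0 (m - (supp τ).card) (K \ supp τ) * g τ
  else W0 K τ * chainRes S W0 R (m - (supp τ).card) (K \ supp τ) * g τ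

variable {W0 : Finset (Fin n) → (Fin n → SignType) → ℂ} {R : Finset (Fin n) → ℂ}

lemma termRes_add (hS : S.Nonempty) (hσ : ∀ j ∈ S, σ j ≠ 0) {g : 𝕊ⁿ → ℂ}
    {m : ℕ} (hK : S ⊆ K) (h0 : ∀ j ∈ S, τ j = 0)
    (hg : g (mergeOn S σ τ) = g τ) (hm : (supp τ).card + S.card ≤ m) :
    termRes S σ W0 R g m K τ + termRes S σ W0 R g m K (mergeOn S σ τ) = 0 := by
  have hd : Disjoint (supp τ) S := Finset.disjoint_right.2 fun j hj => by simp [h0 j hj]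
  have h1 : ¬ Matches S σ τ := fun h => by
    obtain ⟨j, hj⟩ := hS
    exact hσ j hj (by rw [← h j hj, h0 j hj])
  have h2 : S ⊆ K \ supp τ := fun j hj => Finset.mem_sdiff.2 ⟨hK hj, by simp [h0 j hj]⟩
  have e : K \ (supp τ ∪ S) = (K \ supp τ) \ S := by ext j; simp; tauto
  rw [termRes, if_neg fun h => h1 h.2, termRes, if_pos ⟨hK, matches_mergeOn τ⟩,
    clear_mergeOn h0, chainRes, if_pos ⟨h2, by omega⟩, hg, supp_mergeOn hσ,
    card_union_of_disjoint hd, ← Nat.sub_sub, e]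
  ring

lemma sum_termRes (hS : S.Nonempty) (hσ : ∀ j ∈ S, σ j ≠ 0) {g : 𝕊ⁿ → ℂ}
    (m : ℕ) (K : 𝔓ⁿ) (hg : ∀ τ, (∀ j ∈ S, τ j = 0) → g (mergeOn S σ τ) = g τ) :
    ∑ τ ∈ cells K m, termRes S σ W0 R g m K τ = 0 := by
  classical
  have hdis : ∀ τ : 𝕊ⁿ, (∀ j ∈ S, τ j = 0) → Disjoint (supp τ) S := fun τ h0 =>
    Finset.disjoint_right.2 fun j hj => by simp [h0 j hj]
  have hnm : ∀ τ : 𝕊ⁿ, (∀ j ∈ S, τ j = 0) → ¬ Matches S σ τ := fun τ h0 h => by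
    obtain ⟨j, hj⟩ := hS
    exact hσ j hj (by rw [← h j hj, h0 j hj])
  have hclr : ∀ τ : 𝕊ⁿ, ∀ j ∈ S, mergeOn S 0 τ j = 0 := fun τ j hj => by simp [mergeOn, hj]
  have hcard : ∀ τ : 𝕊ⁿ, Matches S σ τ →
      supp (mergeOn S 0 τ) ⊆ supp τ ∧ (supp (mergeOn S 0 τ)).card + S.card = (supp τ).card := by
    intro τ h
    have : supp τ = supp (mergeOn S 0 τ) ∪ S := by rw [← supp_mergeOn hσ, mergeOn_clear h]
    rw [this, card_union_of_disjoint (hdis _ (hclr τ))]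
    exact ⟨Finset.subset_union_left, rfl⟩
  let A : 𝕊ⁿ → Prop := fun τ => S ⊆ K ∧ Matches S σ τ
  let Z : 𝕊ⁿ → Prop := fun τ => S ⊆ K ∧ (∀ j ∈ S, τ j = 0) ∧ (supp τ).card + S.card ≤ m
  have hother : ∀ τ, ¬ A τ → ¬ Z τ → termRes S σ W0 R g m K τ = 0 := by
    intro τ hA hZ
    rw [termRes, if_neg hA, chainRes, if_neg]
    · simp
    · rintro ⟨h1, h2⟩
      have h0 : ∀ j ∈ S, τ j = 0 := fun j hj => by simpa using (Finset.mem_sdiff.1 (h1 hj)).2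
      grind
  have hAZ : ∀ τ ∈ cells K m, A τ → Z (mergeOn S 0 τ) := fun τ hτ hA =>
    ⟨hA.1, hclr τ, by rw [(hcard τ hA.2).2]; exact (mem_cells.1 hτ).2⟩
  have hZA : ∀ τ, Z τ → A (mergeOn S σ τ) := fun τ hZ => ⟨hZ.1, matches_mergeOn τ⟩
  refine Finset.sum_involution
    (fun τ _ => if A τ then mergeOn S 0 τ else if Z τ then mergeOn S σ τ else τ) ?_ ?_ ?_ ?_
  · intro τ hτ
    by_cases hA : A τ
    · simp only [hA, if_true]
      have hz := hAZ τ hτ hA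
      have := termRes_add (W0 := W0) (R := R) hS hσ hz.1 hz.2.1 (hg _ hz.2.1) hz.2.2
      rwa [mergeOn_clear hA.2, add_comm] at this
    · by_cases hZ : Z τ
      · simp only [hA, if_false, hZ, if_true]
        exact termRes_add hS hσ hZ.1 hZ.2.1 (hg _ hZ.2.1) hZ.2.2
      · simp [hA, hZ, hother τ hA hZ]
  · intro τ hτ hne
    by_cases hA : A τ
    · grind
    · grind
  · intro τ hτ
    rw [mem_cells] at hτ ⊢
    by_cases hA : A τ
    · grind
    · by_cases hZ : Z τ
      · simp only [hA, if_false, hZ, if_true]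
        rw [supp_mergeOn hσ, card_union_of_disjoint (hdis _ hZ.2.1)]
        exact ⟨Finset.union_subset hτ.1 hZ.1, hZ.2.2⟩
      · simpa [hA, hZ] using hτ
  · intro τ hτ
    by_cases hA : A τ
    · have h1 : ¬ A (mergeOn S 0 τ) := fun h => hnm _ (hclr τ) h.2
      simp [hA, h1, hAZ τ hτ hA, mergeOn_clear hA.2]
    · by_cases hZ : Z τ
      · simp [hA, hZ, hZA τ hZ, clear_mergeOn hZ.2.1]
      · simp [hA, hZ]

variable {X : Type*} {l : Filter X} {z : X → ℂ}
  {W : X → Finset (Fin n) → (Fin n → SignType) → ℂ}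

lemma tendsto_term (hS : S.Nonempty) (hσ : ∀ j ∈ S, σ j ≠ 0)
    (h1 : ∀ K τ, ¬ (S ⊆ K ∧ Matches S σ τ) → Tendsto (fun x => W x K τ) l (𝓝 (W0 K τ)))
    (h2 : ∀ K τ, S ⊆ K → (∀ j ∈ S, τ j = 0) →
      Tendsto (fun x => z x * W x K (mergeOn S σ τ)) l (𝓝 (W0 K τ * R (K \ supp τ))))
    {g : X → 𝕊ⁿ → ℂ} {g0 : 𝕊ⁿ → ℂ}
    {m : ℕ}
    (hg : Tendsto (fun x => g x τ) l (𝓝 (g0 τ)))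
    (c1 : Tendsto (fun x => z x * chainSum (W x) (m - (supp τ).card) (K \ supp τ)) l
      (𝓝 (chainRes S W0 R (m - (supp τ).card) (K \ supp τ))))
    (c2 : ¬ (S ⊆ K \ supp τ ∧ S.card ≤ m - (supp τ).card) →
      Tendsto (fun x => chainSum (W x) (m - (supp τ).card) (K \ supp τ)) l
      (𝓝 (chainSum W0 (m - (supp τ).card) (K \ supp τ)))) :
    Tendsto (fun x => z x * (W x K τ * chainSum (W x) (m - (supp τ).card) (K \ supp τ) * g x τ)) l
      (𝓝 (termRes S σ W0 R g0 m K τ)) := by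
  by_cases hA : S ⊆ K ∧ Matches S σ τ
  · rw [termRes, if_pos hA]
    have h3 := h2 K (mergeOn S 0 τ) hA.1 fun j hj => by simp [mergeOn, hj]
    rw [mergeOn_clear hA.2] at h3
    have h4 := c2 fun h => by
      obtain ⟨j, hj⟩ := hS
      exact (Finset.mem_sdiff.1 (h.1 hj)).2 (subset_supp_of_matches hσ hA.2 hj)
    refine ((h3.mul h4).mul hg).congr fun x => ?_
    ring
  · rw [termRes, if_neg hA]
    refine (((h1 K τ hA).mul c1).mul hg).congr fun x => ?_
    ring

lemma tendsto_chainSum (hS : S.Nonempty) (hσ : ∀ j ∈ S, σ j ≠ 0)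
    (h1 : ∀ K τ, ¬ (S ⊆ K ∧ Matches S σ τ) → Tendsto (fun x => W x K τ) l (𝓝 (W0 K τ)))
    (h2 : ∀ K τ, S ⊆ K → (∀ j ∈ S, τ j = 0) →
      Tendsto (fun x => z x * W x K (mergeOn S σ τ)) l (𝓝 (W0 K τ * R (K \ supp τ))))
    (hz : Tendsto z l (𝓝 0)) (hW0 : ∀ K, W0 K 0 = 1) (m : ℕ) :
    ∀ K : 𝔓ⁿ, Tendsto (fun x => z x * chainSum (W x) m K) l (𝓝 (chainRes S W0 R m K)) ∧
      (¬ (S ⊆ K ∧ S.card ≤ m) → Tendsto (fun x => chainSum (W x) m K) l (𝓝 (chainSum W0 m K))) := by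
  have hpos := card_pos.2 hS
  induction m using Nat.strong_induction_on with | _ m ih =>
  intro K
  rcases eq_or_ne m 0 with rfl | hm
  · simp only [chainSum_zero, mul_one]
    rw [chainRes, if_neg (by omega)]
    exact ⟨hz, fun _ => tendsto_const_nhds⟩
  · have hlt : ∀ τ ∈ (cells K m).erase 0, m - (supp τ).card < m := fun τ hτ => by
      rw [mem_erase, mem_cells, ne_eq, ← supp_eq_empty] at hτ
      grind
    constructor
    · have e1 := sum_termRes (W0 := W0) (R := R) (g := fun _ => 1) hS hσ m K fun _ _ => rfl
      rw [← add_sum_erase _ _ (zero_mem_cells K m)] at e1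
      have e2 : termRes S σ W0 R (fun _ => 1) m K 0 = chainRes S W0 R m K := by
        rw [termRes, if_neg]
        · simp [hW0]
        · rintro ⟨-, h⟩
          obtain ⟨j, hj⟩ := hS
          exact hσ j hj (h j hj).symm
      rw [e2] at e1
      rw [eq_neg_of_add_eq_zero_left e1]
      have e3 : (fun x => z x * chainSum (W x) m K) = fun x => -∑ τ ∈ (cells K m).erase 0,
          z x * (W x K τ * chainSum (W x) (m - (supp τ).card) (K \ supp τ) * 1) := by
        ext x
        rw [chainSum_eq_neg (W x) hm, ← mul_sum]
        simp
      rw [e3]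
      refine (tendsto_finsetSum _ fun τ hτ => ?_).neg
      obtain ⟨c1, c2⟩ := ih _ (hlt τ hτ) (K \ supp τ)
      exact tendsto_term hS hσ h1 h2 (g := fun _ _ => 1) (g0 := fun _ => 1) tendsto_const_nhds
        c1 c2
    · intro hn
      simp only [fun x => chainSum_eq_neg (W x) hm K, chainSum_eq_neg W0 hm K]
      refine (tendsto_finsetSum _ fun τ hτ => ?_).neg
      have hτ' := mem_cells.1 (mem_of_mem_erase hτ)
      refine (h1 K τ fun hA => hn ⟨hA.1, ?_⟩).mul ((ih _ (hlt τ hτ) (K \ supp τ)).2 fun h => ?_)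
      · exact (Finset.card_le_card (subset_supp_of_matches hσ hA.2)).trans hτ'.2
      · exact hn ⟨h.1.trans Finset.sdiff_subset, by omega⟩

lemma tendsto_sum_zero (hS : S.Nonempty) (hσ : ∀ j ∈ S, σ j ≠ 0)
    (h1 : ∀ K τ, ¬ (S ⊆ K ∧ Matches S σ τ) → Tendsto (fun x => W x K τ) l (𝓝 (W0 K τ)))
    (h2 : ∀ K τ, S ⊆ K → (∀ j ∈ S, τ j = 0) →
      Tendsto (fun x => z x * W x K (mergeOn S σ τ)) l (𝓝 (W0 K τ * R (K \ supp τ))))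
    (hz : Tendsto z l (𝓝 0)) (hW0 : ∀ K, W0 K 0 = 1)
    {g : X → 𝕊ⁿ → ℂ} {g0 : 𝕊ⁿ → ℂ}
    (hg : ∀ τ, Tendsto (fun x => g x τ) l (𝓝 (g0 τ)))
    (hg0 : ∀ τ, (∀ j ∈ S, τ j = 0) → g0 (mergeOn S σ τ) = g0 τ) (m : ℕ) (K : 𝔓ⁿ) :
    Tendsto (fun x => z x * ∑ τ ∈ cells K m,
      W x K τ * chainSum (W x) (m - (supp τ).card) (K \ supp τ) * g x τ) l (𝓝 0) := by
  rw [← sum_termRes (W0 := W0) (R := R) hS hσ m K hg0]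
  simp only [mul_sum]
  refine tendsto_finsetSum _ fun τ _ => ?_
  obtain ⟨c1, c2⟩ := tendsto_chainSum hS hσ h1 h2 hz hW0 (m - (supp τ).card) (K \ supp τ)
  exact tendsto_term hS hσ h1 h2 (hg τ) c1 c2

lemma exists_tendsto_chainSum
    (h1 : ∀ K τ, (∀ j ∈ S, τ j = 0) ∨ ¬ S ⊆ K → ∃ L, Tendsto (fun x => W x K τ) l (𝓝 L))
    (h2 : ∀ K τ, ∃ L, Tendsto (fun x => z x * W x K τ) l (𝓝 L))
    (hz : Tendsto z l (𝓝 0)) (m : ℕ) :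
    ∀ K : 𝔓ⁿ, (∃ L, Tendsto (fun x => z x * chainSum (W x) m K) l (𝓝 L)) ∧
      (¬ S ⊆ K → ∃ L, Tendsto (fun x => chainSum (W x) m K) l (𝓝 L)) := by
  induction m using Nat.strong_induction_on with | _ m ih =>
  intro K
  rcases eq_or_ne m 0 with rfl | hm
  · simp only [chainSum_zero, mul_one]
    exact ⟨⟨0, hz⟩, fun _ => ⟨1, tendsto_const_nhds⟩⟩
  · have hlt : ∀ τ : {τ // τ ∈ (cells K m).erase 0}, m - (supp τ.1).card < m := fun τ => by
      have hτ := τ.2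
      rw [mem_erase, mem_cells, ne_eq, ← supp_eq_empty] at hτ
      grind
    simp only [fun x => chainSum_eq_neg (W x) hm K]
    constructor
    · have h3 : ∀ τ : {τ // τ ∈ (cells K m).erase 0}, ∃ L, Tendsto (fun x => z x *
          (W x K τ.1 * chainSum (W x) (m - (supp τ.1).card) (K \ supp τ.1))) l (𝓝 L) := by
        intro τ
        obtain ⟨c1, c2⟩ := ih _ (hlt τ) (K \ supp τ.1)
        by_cases h0 : ∀ j ∈ S, τ.1 j = 0
        · obtain ⟨L1, t1⟩ := h1 K τ.1 (Or.inl h0)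
          obtain ⟨L2, t2⟩ := c1
          exact ⟨_, (t1.mul t2).congr fun x => by ring⟩
        · obtain ⟨L1, t1⟩ := h2 K τ.1
          push Not at h0
          obtain ⟨j, hj, h0⟩ := h0
          obtain ⟨L2, t2⟩ := c2 fun h => (Finset.mem_sdiff.1 (h hj)).2 (mem_supp.2 h0)
          exact ⟨_, (t1.mul t2).congr fun x => by ring⟩
      choose L hL using h3
      refine ⟨_, (tendsto_finsetSum Finset.univ fun τ _ => hL τ).neg.congr fun x => ?_⟩
      rw [← mul_sum, sum_coe_sort _ fun τ =>
        W x K τ * chainSum (W x) (m - (supp τ).card) (K \ supp τ), mul_neg]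
    · intro hn
      have h3 : ∀ τ : {τ // τ ∈ (cells K m).erase 0}, ∃ L, Tendsto (fun x =>
          (W x K τ.1 * chainSum (W x) (m - (supp τ.1).card) (K \ supp τ.1))) l (𝓝 L) := by
        intro τ
        obtain ⟨L1, t1⟩ := h1 K τ.1 (Or.inr hn)
        obtain ⟨L2, t2⟩ := (ih _ (hlt τ) (K \ supp τ.1)).2 fun h =>
          hn (h.trans Finset.sdiff_subset)
        exact ⟨_, t1.mul t2⟩
      choose L hL using h3
      refine ⟨_, (tendsto_finsetSum Finset.univ fun τ _ => hL τ).neg.congr fun x => ?_⟩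
      rw [sum_coe_sort _ fun τ => W x K τ * chainSum (W x) (m - (supp τ).card) (K \ supp τ)]

lemma exists_tendsto_sum
    (h1 : ∀ K τ, (∀ j ∈ S, τ j = 0) ∨ ¬ S ⊆ K → ∃ L, Tendsto (fun x => W x K τ) l (𝓝 L))
    (h2 : ∀ K τ, ∃ L, Tendsto (fun x => z x * W x K τ) l (𝓝 L))
    (hz : Tendsto z l (𝓝 0)) {g : X → 𝕊ⁿ → ℂ} {g0 : 𝕊ⁿ → ℂ}
    (hg : ∀ τ, Tendsto (fun x => g x τ) l (𝓝 (g0 τ))) (m : ℕ) (K : 𝔓ⁿ) :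
    ∃ L, Tendsto (fun x => z x * ∑ τ ∈ cells K m,
      W x K τ * chainSum (W x) (m - (supp τ).card) (K \ supp τ) * g x τ) l (𝓝 L) := by
  have h3 : ∀ τ, ∃ L, Tendsto (fun x => z x *
      (W x K τ * chainSum (W x) (m - (supp τ).card) (K \ supp τ) * g x τ)) l (𝓝 L) := by
    intro τ
    obtain ⟨c1, c2⟩ := exists_tendsto_chainSum h1 h2 hz (m - (supp τ).card) (K \ supp τ)
    by_cases h0 : ∀ j ∈ S, τ j = 0
    · obtain ⟨L1, t1⟩ := h1 K τ (Or.inl h0)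
      obtain ⟨L2, t2⟩ := c1
      exact ⟨_, ((t1.mul t2).mul (hg τ)).congr fun x => by ring⟩
    · obtain ⟨L1, t1⟩ := h2 K τ
      push Not at h0
      obtain ⟨j, hj, h0⟩ := h0
      obtain ⟨L2, t2⟩ := c2 fun h => (Finset.mem_sdiff.1 (h hj)).2 (mem_supp.2 h0)
      exact ⟨_, ((t1.mul t2).mul (hg τ)).congr fun x => by ring⟩
  choose L hL using h3
  refine ⟨_, (tendsto_finsetSum (cells K m) fun τ _ => hL τ).congr fun x => ?_⟩
  rw [mul_sum]

end residues

/-! ### Local behaviour of the coefficients at the walls -/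

lemma continuousAt_cellW {P : Couplings} {β : ℝ} {p : ℂⁿ}
    (h1 : ∀ j ∈ K, ContinuousAt (fun x : ℂⁿ => siteW P β (τ j) (x j)) p)
    (h2 : ∀ i ∈ K, ∀ j ∈ K, i ≠ j →
      ContinuousAt (fun x : ℂⁿ => pairW P β (τ i) (τ j) (x i) (x j)) p) :
    ContinuousAt (fun x => cellW P β x K τ) p := by
  refine ContinuousAt.mul (tendsto_finsetProd _ fun j hj => h1 j hj)
    (tendsto_finsetProd _ fun q hq => ?_)
  simp only [mem_filter, mem_product] at hq
  exact h2 _ hq.1.1 _ hq.1.2 hq.2.ne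

section generic

variable {β : ℝ} {p : Fin n → ℂ}

lemma IsGeneric.continuousAt {w w' : WallIx n} (hp : IsGeneric wNu (wC β) w p)
    (h : Transv β w w') (κ : ℝ) : ContinuousAt (wallRatio β κ w') p :=
  continuousAt_wallRatio β κ (hp.2 w' h)

lemma IsGeneric.tendsto_wallZ {w : WallIx n} (hp : IsGeneric wNu (wC β) w p) :
    Tendsto (wallZ (wNu w) (wC β w)) (𝓝[regularC n β] p) (𝓝 0) := by
  have h := (continuous_trigPoly (wallZ_mem (wNu w) (wC β w))).continuousWithinAt
    (s := regularC n β) (x := p)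
  have e : wallZ (wNu w) (wC β w) p = 0 := by simp [wallZ, hp.1]
  rw [← e]; exact h

variable (P : Couplings)

lemma siteW_cont_inl (hβ : β ≠ 0) {j : Fin n} {a : NZSign} {s t : Bool}
    (hp : IsGeneric wNu (wC β) (.inl (j, a, s, t)) p) {i : Fin n} {b : SignType}
    (h : i = j → b ≠ 0 → b ≠ a.1 ∧ s = true) :
    ContinuousAt (fun x : ℂⁿ => siteW P β b (x i)) p := by
  by_cases hb : b = 0
  · subst hb; simpa using continuousAt_const
  simp only [siteW_eq P β hb]
  have key : ∀ κ s' t', ContinuousAt (wallRatio β κ (.inl (i, ⟨b, hb⟩, s', t'))) p := by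
    intro κ s' t'
    refine hp.continuousAt (transv_inl hβ fun a' ha' => ?_) κ
    grind
  exact (((key _ _ _).mul (key _ _ _)).mul (key _ _ _)).mul (key _ _ _)

lemma pairW_cont_of {i l : Fin n} (hil : i ≠ l) {a b : SignType}
    (h1 : ∀ (ha : a ≠ 0) (hb : b ≠ 0) κ s,
      ContinuousAt (wallRatio β κ (.inr (⟨(i, l), hil⟩, ⟨a, ha⟩, ⟨b, hb⟩, s))) p)
    (h2 : ∀ (ha : a ≠ 0) (b' : NZSign) κ, b = 0 →
      ContinuousAt (wallRatio β κ (.inr (⟨(i, l), hil⟩, ⟨a, ha⟩, b', false))) p)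
    (h3 : ∀ (hb : b ≠ 0) (a' : NZSign) κ, a = 0 →
      ContinuousAt (wallRatio β κ (.inr (⟨(l, i), hil.symm⟩, ⟨b, hb⟩, a', false))) p) :
    ContinuousAt (fun x : ℂⁿ => pairW P β a b (x i) (x l)) p := by
  by_cases ha : a = 0
  · by_cases hb : b = 0
    · subst ha hb; simpa using continuousAt_const
    · have e : (fun x : ℂⁿ => pairW P β a b (x i) (x l)) = _ :=
        funext fun x => by rw [pairW_comm, ha, pairW_right_zero P β hb hil.symm]
      rw [e]
      exact (h3 hb _ _ ha).mul (h3 hb _ _ ha)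
  · by_cases hb : b = 0
    · simp only [hb, pairW_right_zero P β ha hil]
      exact (h2 ha _ _ hb).mul (h2 ha _ _ hb)
    · simp only [pairW_eq P β ha hb hil]
      exact (h1 ha hb _ _).mul (h1 ha hb _ _)

lemma pairW_cont_inl (hβ : β ≠ 0) {j : Fin n} {a : NZSign} {s t : Bool}
    (hp : IsGeneric wNu (wC β) (.inl (j, a, s, t)) p) {i l : Fin n} (hil : i ≠ l)
    (b c : SignType) : ContinuousAt (fun x : ℂⁿ => pairW P β b c (x i) (x l)) p := by
  have key : ∀ κ q, ContinuousAt (wallRatio β κ (.inr q : WallIx n)) p := fun κ q =>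
    hp.continuousAt (transv_inl hβ fun a' ha' => by simp at ha') κ
  exact pairW_cont_of P hil (fun _ _ _ _ => key _ _) (fun _ _ _ _ => key _ _) fun _ _ _ _ => key _ _

lemma siteW_cont_inr (hβ : β ≠ 0) {j k : Fin n} {hjk : j ≠ k} {a b : NZSign} {s : Bool}
    (hp : IsGeneric wNu (wC β) (.inr (⟨(j, k), hjk⟩, a, b, s)) p) (i : Fin n) (c : SignType) :
    ContinuousAt (fun x : ℂⁿ => siteW P β c (x i)) p := by
  by_cases hc : c = 0
  · subst hc; simpa using continuousAt_const
  simp only [siteW_eq P β hc]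
  have key : ∀ κ q, ContinuousAt (wallRatio β κ (.inl q : WallIx n)) p := fun κ q =>
    hp.continuousAt (transv_inr hβ (fun _ _ _ h => by simp at h) fun _ _ _ h => by simp at h) κ
  exact (((key _ _).mul (key _ _)).mul (key _ _)).mul (key _ _)

lemma pairW_cont_inr (hβ : β ≠ 0) {j k : Fin n} {hjk : j ≠ k} {a b : NZSign} {s : Bool}
    (hp : IsGeneric wNu (wC β) (.inr (⟨(j, k), hjk⟩, a, b, s)) p) {i l : Fin n} (hil : i ≠ l)
    (h1 : ¬ (i = j ∧ l = k)) (h2 : ¬ (i = k ∧ l = j)) (c d : SignType) :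
    ContinuousAt (fun x : ℂⁿ => pairW P β c d (x i) (x l)) p := by
  refine pairW_cont_of P hil (fun _ _ κ _ => ?_) (fun _ _ κ _ => ?_) fun _ _ κ _ => ?_ <;>
  refine hp.continuousAt (transv_inr hβ (fun a' b' s' h => ?_) fun a' b' s' h => ?_) κ <;>
  · simp_all

lemma pairW_left_zero (β : ℝ) {b : SignType} (hb : b ≠ 0) {j k : Fin n} (hjk : j ≠ k) (x : ℂⁿ) :
    pairW P β 0 b (x j) (x k) = wallRatio β P.g (.inr (⟨(j, k), hjk⟩, posSign, ⟨b, hb⟩, false)) x *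
      wallRatio β P.g (.inr (⟨(j, k), hjk⟩, negSign, ⟨b, hb⟩, false)) x := by
  rw [pairW, if_pos rfl, if_neg hb, vA_eq, vA_eq]
  simp [wallRatio, lin_inr, wC, posSign, negSign, sub_eq_add_neg, add_comm]

lemma pairW_cont_inr_shifted (hβ : β ≠ 0) {j k : Fin n} {hjk : j ≠ k} {a b : NZSign}
    (hp : IsGeneric wNu (wC β) (.inr (⟨(j, k), hjk⟩, a, b, true)) p) {c d : SignType}
    (hcd : ¬ (c = a.1 ∧ d = b.1)) :
    ContinuousAt (fun x : ℂⁿ => pairW P β c d (x j) (x k)) p := by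
  have key : ∀ κ a' b' s', ¬ (a' = a ∧ b' = b ∧ s' = true) → ContinuousAt (wallRatio β κ
      (.inr (⟨(j, k), hjk⟩, a', b', s'))) p := by
    intro κ a' b' s' hne
    refine hp.continuousAt (transv_inr hβ (fun a'' b'' s'' h e hs => ⟨rfl, ?_⟩)
      fun a' b' s' h => ?_) κ
    · simp only [Sum.inr.injEq, Prod.mk.injEq, true_and] at h
      obtain ⟨rfl, rfl, rfl⟩ := h
      rintro rfl
      rw [sign_sq a'.2] at e
      refine hne ⟨rfl, ?_, hs⟩
      rcases sign_mul_cases b' b with ⟨h, -⟩ | ⟨-, h⟩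
      · exact h
      · rw [h] at e; norm_num at e
    · simp only [Sum.inr.injEq, Prod.mk.injEq, Subtype.mk.injEq] at h
      exact hjk h.1.1
  by_cases hc : c = 0
  · by_cases hd : d = 0
    · subst hc hd; simpa using continuousAt_const
    · simp only [hc, pairW_left_zero P β hd hjk]
      exact (key _ _ _ _ (by simp)).mul (key _ _ _ _ (by simp))
  · by_cases hd : d = 0
    · simp only [hd, pairW_right_zero P β hc hjk]
      exact (key _ _ _ _ (by simp)).mul (key _ _ _ _ (by simp))
    · simp only [pairW_eq P β hc hd hjk]
      refine (key _ _ _ _ (by simp)).mul (key _ _ _ _ ?_)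
      rintro ⟨rfl, rfl, -⟩
      exact hcd ⟨rfl, rfl⟩

lemma exists_tendsto_of_unit {w w' : WallIx n} (κ : ℝ) {u : ℂⁿ → ℂ}
    (hu : Continuous u) (h : ∀ x, wallZ (wNu w) (wC β w) x = u x * wallZ (wNu w') (wC β w') x) :
    ∃ L, Tendsto (fun x => wallZ (wNu w) (wC β w) x * wallRatio β κ w' x)
      (𝓝[regularC n β] p) (𝓝 L) := by
  obtain ⟨L, hL⟩ := tendsto_wallZ_mul_wallRatio β κ w' p
  refine ⟨_, ((hu.continuousWithinAt (s := regularC n β) (x := p)).tendsto.mul hL).congr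
    fun x => ?_⟩
  rw [h]; ring

lemma wallZ_eq_of_neg {ν ν' : ℤⁿ} {c c' : ℂ} (h : ∀ x, lin ν' x = -lin ν x)
    (hc : exp (I * (c + c')) = 1) (x : ℂⁿ) :
    wallZ ν c x = -exp (I * (lin ν x + c)) * wallZ ν' c' x := by
  rw [wallZ, wallZ, h, neg_mul, mul_sub, ← exp_add]
  grind

lemma exists_tendsto_pairW_mirror (hβ : β ≠ 0) {j k : Fin n} {hjk : j ≠ k} {a b : NZSign}
    (hp : IsGeneric wNu (wC β) (.inr (⟨(j, k), hjk⟩, a, b, false)) p) (c d : SignType) :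
    ∃ L, Tendsto (fun x : ℂⁿ =>
      wallZ (wNu (.inr (⟨(j, k), hjk⟩, a, b, false))) (wC β (.inr (⟨(j, k), hjk⟩, a, b, false))) x *
      pairW P β c d (x j) (x k)) (𝓝[regularC n β] p) (𝓝 L) := by
  have hz := hp.tendsto_wallZ
  have cont : ∀ κ a' b' s', ¬ ((a'.1 : ℂ) * a.1 = (b'.1 : ℂ) * b.1 ∧ s' = false) →
      ContinuousAt (wallRatio β κ (.inr (⟨(j, k), hjk⟩, a', b', s'))) p := by
    intro κ a' b' s' hne
    refine hp.continuousAt (transv_inr hβ (fun a'' b'' s'' h e hs => ?_) fun a' b' s' h => ?_) κ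
    · simp_all
    · simp only [Sum.inr.injEq, Prod.mk.injEq, Subtype.mk.injEq] at h
      exact hjk h.1.1
  have lim : ∀ κ a' b', ∃ L, Tendsto (fun x : ℂⁿ =>
      wallZ (wNu (.inr (⟨(j, k), hjk⟩, a, b, false))) (wC β (.inr (⟨(j, k), hjk⟩, a, b, false))) x *
      wallRatio β κ (.inr (⟨(j, k), hjk⟩, a', b', false)) x) (𝓝[regularC n β] p) (𝓝 L) := by
    intro κ a' b'
    by_cases hab : (a'.1 : ℂ) * a.1 = (b'.1 : ℂ) * b.1
    · rcases sign_mul_cases a' a with ⟨rfl, e1⟩ | ⟨-, e1⟩ <;>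
        rcases sign_mul_cases b' b with ⟨rfl, e2⟩ | ⟨-, e2⟩
      · exact tendsto_wallZ_mul_wallRatio ..
      · rw [e1, e2] at hab; norm_num at hab
      · rw [e1, e2] at hab; norm_num at hab
      · refine exists_tendsto_of_unit κ (u := fun x => -exp (I *
          (lin (wNu (.inr (⟨(j, k), hjk⟩, a, b, false))) x + wC β (.inr (⟨(j, k), hjk⟩, a, b, false)))))
          (by fun_prop) (wallZ_eq_of_neg (fun x => ?_) (by simp [wC]))
        rw [lin_inr, lin_inr]
        linear_combination (a.1 : ℂ) * x j * e1 + (b.1 : ℂ) * x k * e2 -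
          (a'.1 : ℂ) * x j * sign_sq a.2 - (b'.1 : ℂ) * x k * sign_sq b.2
    · exact ⟨_, hz.mul ((cont κ a' b' false fun h => hab h.1).continuousWithinAt.tendsto)⟩
  have two : ∀ κ a' b' a'' b'' s'', ¬ ((a''.1 : ℂ) * a.1 = (b''.1 : ℂ) * b.1 ∧ s'' = false) →
      ∃ L, Tendsto (fun x : ℂⁿ =>
      wallZ (wNu (.inr (⟨(j, k), hjk⟩, a, b, false))) (wC β (.inr (⟨(j, k), hjk⟩, a, b, false))) x *
      (wallRatio β κ (.inr (⟨(j, k), hjk⟩, a', b', false)) x *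
        wallRatio β κ (.inr (⟨(j, k), hjk⟩, a'', b'', s'')) x)) (𝓝[regularC n β] p) (𝓝 L) := by
    intro κ a' b' a'' b'' s'' hne
    obtain ⟨L, hL⟩ := lim κ a' b'
    exact ⟨_, (hL.mul (cont κ a'' b'' s'' hne).continuousWithinAt.tendsto).congr fun x => by ring⟩
  by_cases hc : c = 0
  · by_cases hd : d = 0
    · subst hc hd; exact ⟨0, by simpa using hz⟩
    · simp only [hc, pairW_left_zero P β hd hjk]
      by_cases h : (posSign.1 : ℂ) * a.1 = (d : ℂ) * b.1
      · refine two _ _ _ _ _ _ fun h' => ?_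
        have h1 := h'.1
        have : (negSign.1 : ℂ) = -(posSign.1 : ℂ) := by simp [negSign, posSign]
        rw [this, neg_mul, h] at h1
        have h2 := mul_ne_zero (sign_ne_zero' hd) (sign_ne_zero' b.2)
        exact h2 (self_eq_neg.1 h1.symm)
      · simp only [mul_comm (wallRatio β P.g (.inr (⟨(j, k), hjk⟩, posSign, ⟨d, hd⟩, false)) _)]
        exact two _ _ _ _ _ _ fun h' => h h'.1
  · by_cases hd : d = 0
    · simp only [hd, pairW_right_zero P β hc hjk]
      by_cases h : (c : ℂ) * a.1 = (posSign.1 : ℂ) * b.1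
      · refine two _ _ _ _ _ _ fun h' => ?_
        have h1 := h'.1
        have : (negSign.1 : ℂ) = -(posSign.1 : ℂ) := by simp [negSign, posSign]
        rw [this, neg_mul, h] at h1
        have h2 := mul_ne_zero (sign_ne_zero' posSign.2) (sign_ne_zero' b.2)
        exact h2 (self_eq_neg.1 h1)
      · simp only [mul_comm (wallRatio β P.g (.inr (⟨(j, k), hjk⟩, ⟨c, hc⟩, posSign, false)) _)]
        exact two _ _ _ _ _ _ fun h' => h h'.1
    · simp only [pairW_eq P β hc hd hjk]
      exact two _ _ _ _ _ _ (by simp)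

lemma exists_tendsto_siteW (hβ : β ≠ 0) {j : Fin n} {a : NZSign} {s t : Bool}
    (hp : IsGeneric wNu (wC β) (.inl (j, a, s, t)) p) (b : SignType) (hs : s = true → b = a.1) :
    ∃ L, Tendsto (fun x : ℂⁿ => wallZ (wNu (.inl (j, a, s, t))) (wC β (.inl (j, a, s, t))) x *
      siteW P β b (x j)) (𝓝[regularC n β] p) (𝓝 L) := by
  have hz := hp.tendsto_wallZ
  by_cases hb : b = 0
  · subst hb; exact ⟨0, by simpa using hz⟩
  have cont : ∀ κ s' t', (s', t') ≠ (s, t) →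
      ContinuousAt (wallRatio β κ (.inl (j, ⟨b, hb⟩, s', t'))) p := by
    intro κ s' t' hne
    refine hp.continuousAt (transv_inl hβ fun a' ha' => ?_) κ
    simp_all
  have lim : ∀ κ, ∃ L, Tendsto (fun x : ℂⁿ =>
      wallZ (wNu (.inl (j, a, s, t))) (wC β (.inl (j, a, s, t))) x *
      wallRatio β κ (.inl (j, ⟨b, hb⟩, s, t)) x) (𝓝[regularC n β] p) (𝓝 L) := by
    intro κ
    rcases sign_mul_cases ⟨b, hb⟩ a with ⟨rfl, -⟩ | ⟨hne, e⟩
    · exact tendsto_wallZ_mul_wallRatio ..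
    · have hs' : s = false := by
        by_contra h
        exact hne (Subtype.ext (hs (by simpa using h)))
      subst hs'
      refine exists_tendsto_of_unit κ (u := fun x => -exp (I *
          (lin (wNu (.inl (j, a, false, t))) x + wC β (.inl (j, a, false, t)))))
          (by fun_prop) (wallZ_eq_of_neg (fun x => ?_) ?_)
      · rw [lin_inl, lin_inl]
        linear_combination (a.1 : ℂ) * x j * e - (b : ℂ) * x j * sign_sq a.2
      · cases t
        · simp [wC]
        · simp only [wC, if_true, Bool.false_eq_true, if_false, zero_add]
          rw [← Complex.exp_two_pi_mul_I]; congr 1; ring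
  simp only [siteW_eq P β hb]
  cases s <;> cases t
  · obtain ⟨L, hL⟩ := lim P.g₀
    exact ⟨_, (hL.mul (((cont P.g₁ false true (by simp)).mul (cont P.g₀' true false (by simp))).mul
      (cont P.g₁' true true (by simp))).continuousWithinAt.tendsto).congr fun x => by
      simp only [Pi.mul_apply]; ring⟩
  · obtain ⟨L, hL⟩ := lim P.g₁
    exact ⟨_, (hL.mul (((cont P.g₀ false false (by simp)).mul (cont P.g₀' true false (by simp))).mul
      (cont P.g₁' true true (by simp))).continuousWithinAt.tendsto).congr fun x => by
      simp only [Pi.mul_apply]; ring⟩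
  · obtain ⟨L, hL⟩ := lim P.g₀'
    exact ⟨_, (hL.mul (((cont P.g₀ false false (by simp)).mul (cont P.g₁ false true (by simp))).mul
      (cont P.g₁' true true (by simp))).continuousWithinAt.tendsto).congr fun x => by
      simp only [Pi.mul_apply]; ring⟩
  · obtain ⟨L, hL⟩ := lim P.g₁'
    exact ⟨_, (hL.mul (((cont P.g₀ false false (by simp)).mul (cont P.g₁ false true (by simp))).mul
      (cont P.g₀' true false (by simp))).continuousWithinAt.tendsto).congr fun x => by
      simp only [Pi.mul_apply]; ring⟩

lemma exists_tendsto_pairW_shifted (hβ : β ≠ 0) {j k : Fin n} {hjk : j ≠ k} {a b : NZSign}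
    (hp : IsGeneric wNu (wC β) (.inr (⟨(j, k), hjk⟩, a, b, true)) p) :
    ∃ L, Tendsto (fun x : ℂⁿ =>
      wallZ (wNu (.inr (⟨(j, k), hjk⟩, a, b, true))) (wC β (.inr (⟨(j, k), hjk⟩, a, b, true))) x *
      pairW P β a.1 b.1 (x j) (x k)) (𝓝[regularC n β] p) (𝓝 L) := by
  obtain ⟨L, hL⟩ := tendsto_wallZ_mul_wallRatio β P.g (.inr (⟨(j, k), hjk⟩, a, b, true)) p
  have h : ContinuousAt (wallRatio β P.g (.inr (⟨(j, k), hjk⟩, a, b, false))) p := by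
    refine hp.continuousAt (transv_inr hβ (fun a'' b'' s'' h e hs => ?_) fun a' b' s' h => ?_) _
    · simp_all
    · simp only [Sum.inr.injEq, Prod.mk.injEq, Subtype.mk.injEq] at h
      exact hjk h.1.1
  simp only [pairW_eq P β a.2 b.2 hjk]
  exact ⟨_, (hL.mul h.continuousWithinAt.tendsto).congr fun x => by ring⟩

end generic

/-! ### Invariance under the affine Weyl group -/

/-- Translation by a vector of the period lattice. -/
def period (m : ℤⁿ) : ℂⁿ := fun j => (m j : ℂ) * (2 * Real.pi)

lemma sineRatio_periodic (β κ : ℝ) (k : ℤ) (z : ℂ) :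
    sineRatio β κ (z + k * (2 * Real.pi)) = sineRatio β κ z :=
  (Function.Periodic.int_mul (fun z => sineRatio_add_two_pi β κ z) k) z

lemma sineRatio_congr (β κ : ℝ) {z w : ℂ} (k : ℤ) (h : w = z + k * (2 * Real.pi)) :
    sineRatio β κ w = sineRatio β κ z := by
  rw [h, sineRatio_periodic]

lemma siteW_period (a : SignType) (x : ℂ) (k : ℤ) :
    siteW P β a (x + k * (2 * Real.pi)) = siteW P β a x := by
  unfold siteW
  split_ifs
  · rfl
  · rw [vB_eq, vB_eq]
    refine congrArg₂ _ (congrArg₂ _ (congrArg₂ _ ?_ ?_) ?_) ?_ <;>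
    exact sineRatio_congr _ _ ((a : ℤ) * k) (by push_cast; ring)

lemma pairW_period (a b : SignType) (x y : ℂ) (k l : ℤ) :
    pairW P β a b (x + k * (2 * Real.pi)) (y + l * (2 * Real.pi)) = pairW P β a b x y := by
  unfold pairW
  simp only [vA_eq]
  split_ifs
  · rfl
  · exact congrArg₂ _ (sineRatio_congr _ _ ((b : ℤ) * l + k) (by push_cast; ring))
      (sineRatio_congr _ _ ((b : ℤ) * l - k) (by push_cast; ring))
  · exact congrArg₂ _ (sineRatio_congr _ _ ((a : ℤ) * k + l) (by push_cast; ring))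
      (sineRatio_congr _ _ ((a : ℤ) * k - l) (by push_cast; ring))
  · congr 1 <;> exact sineRatio_congr _ _ ((a : ℤ) * k + (b : ℤ) * l) (by push_cast; ring)

lemma cellW_period (x : ℂⁿ) (m : ℤⁿ) : cellW P β (x + period m) = cellW P β x := by
  ext K τ
  simp only [cellW, Pi.add_apply, period, siteW_period, pairW_period]

lemma shift_add (τ : 𝕊ⁿ) (x y : ℂⁿ) : shift β τ (x + y) = shift β τ x + y := by
  ext j; simp only [shift, Pi.add_apply]; ring

lemma lin_period (ν m : ℤⁿ) : lin ν (period m) = ((∑ j, ν j * m j : ℤ) : ℂ) * (2 * Real.pi) := by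
  simp only [lin, period, Int.cast_sum, Int.cast_mul, sum_mul, mul_assoc]

lemma expo_period (ν m : ℤⁿ) : expo ν (period m) = 1 := by
  rw [expo, lin_period, Complex.exp_eq_one_iff]
  exact ⟨_, by ring⟩

lemma trigPoly_period (hf : f ∈ trigPoly n) (x : ℂⁿ) (m : ℤⁿ) : f (x + period m) = f x := by
  refine trigPoly_induction (p := fun f => f (x + period m) = f x) hf (fun ν => ?_) rfl
    (fun f h hf hh => by simp [hf, hh]) fun a f hf => by simp [hf]
  rw [expo_add, expo_period, mul_one]

lemma wallZ_period (ν : ℤⁿ) (c : ℂ) (x : ℂⁿ) (m : ℤⁿ) : wallZ ν c (x + period m) = wallZ ν c x :=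
  trigPoly_period (wallZ_mem ν c) x m

lemma differenceOp_period {r : ℕ} (hr : r ≠ 0) (β : ℝ) (hf : f ∈ trigPoly n) (x : ℂⁿ) (m : ℤⁿ) :
    differenceOp P r β f (x + period m) = differenceOp P r β f x := by
  simp only [differenceOp_eq_sum P hr, cellW_period, shift_add, trigPoly_period hf]

/-- Invariance under permutations and sign changes of the coordinates. -/
def IsWeylInv (f : ℂⁿ → ℂ) : Prop := ∀ w x, f (weylAct w x) = f x

lemma exists_lin_weylAct (w : WallIx n) (g : 𝕎ⁿ) (β : ℝ) :
    ∃ w' : WallIx n, wC β w' = wC β w ∧ ∀ x, lin (wNu w) (weylAct g x) = lin (wNu w') x := by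
  have key : ∀ (a : NZSign) (e : ℤˣ), ∃ a' : NZSign, (a'.1 : ℂ) = (a.1 : ℂ) * ((e : ℤ) : ℂ) := by
    intro a e
    rcases units_eq_one_or e with rfl | rfl
    · exact ⟨a, by simp⟩
    · refine ⟨⟨-a.1, by simpa using a.2⟩, ?_⟩
      rw [coe_neg_signType]; simp
  rcases w with ⟨j, a, s, t⟩ | ⟨⟨⟨j, k⟩, hjk⟩, a, b, s⟩
  · obtain ⟨a', ha'⟩ := key a (g.2 j)
    refine ⟨.inl (g.1 j, a', s, t), rfl, fun x => ?_⟩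
    rw [lin_inl, lin_inl, ha', weylAct, mul_assoc]
  · obtain ⟨a', ha'⟩ := key a (g.2 j)
    obtain ⟨b', hb'⟩ := key b (g.2 k)
    refine ⟨.inr (⟨(g.1 j, g.1 k), fun h => hjk (g.1.injective h)⟩, a', b', s), rfl, fun x => ?_⟩
    rw [lin_inr, lin_inr, ha', hb']
    simp only [weylAct]; ring

lemma weylAct_mem_regularC {β : ℝ} {x : ℂⁿ} (hx : x ∈ regularC n β)
    (g : 𝕎ⁿ) : weylAct g x ∈ regularC n β := by
  intro w
  obtain ⟨w', h1, h2⟩ := exists_lin_weylAct w g β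
  have := hx w'
  rwa [wallZ, h1, ← h2] at this

lemma add_period_mem_regularC {β : ℝ} {x : ℂⁿ} (hx : x ∈ regularC n β)
    (m : ℤⁿ) : x + period m ∈ regularC n β := fun w => by
  rw [wallZ_period]; exact hx w

lemma continuous_weylAct (g : 𝕎ⁿ) : Continuous (weylAct g) := by unfold weylAct; fun_prop

/-- The sign change of the `j`th coordinate. -/
def flipAt (j : Fin n) : 𝕎ⁿ := (1, fun i => if i = j then -1 else 1)

/-- The exchange of two coordinates, with a common sign. -/
def swapWith (j k : Fin n) (e : ℤˣ) : 𝕎ⁿ := (swap j k, fun i => if i = j ∨ i = k then e else 1)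

lemma weylAct_flipAt_self (j : Fin n) (x : ℂⁿ) : weylAct (flipAt j) x j = -x j := by
  simp [weylAct, flipAt]

lemma weylAct_flipAt_of_ne {i j : Fin n} (h : i ≠ j) (x : ℂⁿ) : weylAct (flipAt j) x i = x i := by
  simp [weylAct, flipAt, h]

lemma weylAct_swapWith_left (j k : Fin n) (e : ℤˣ) (x : ℂⁿ) :
    weylAct (swapWith j k e) x j = ((e : ℤ) : ℂ) * x k := by
  simp [weylAct, swapWith]

lemma weylAct_swapWith_right (j k : Fin n) (e : ℤˣ) (x : ℂⁿ) :
    weylAct (swapWith j k e) x k = ((e : ℤ) : ℂ) * x j := by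
  simp [weylAct, swapWith]

lemma weylAct_swapWith_of_ne {i j k : Fin n} (e : ℤˣ) (h1 : i ≠ j) (h2 : i ≠ k)
    (x : ℂⁿ) : weylAct (swapWith j k e) x i = x i := by
  simp [weylAct, swapWith, h1, h2, Equiv.swap_apply_of_ne_of_ne]

lemma exists_unit_eq_neg_mul (a b : NZSign) :
    ∃ e : ℤˣ, ((e : ℤ) : ℂ) = -((a.1 : ℂ) * (b.1 : ℂ)) := by
  rcases sign_mul_cases a b with ⟨-, h⟩ | ⟨-, h⟩
  · exact ⟨-1, by simp [h]⟩
  · exact ⟨1, by simp [h]⟩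

/-! ### Cancellation on the walls -/

section wall

variable (P : Couplings) {β : ℝ} {p : Fin n → ℂ} {r : ℕ} {f : (Fin n → ℂ) → ℂ}

/-- The difference operator has no residue along the wall `w` at the point `p`. -/
def NoResidue (P : Couplings) (β : ℝ) (r : ℕ) (f : ℂⁿ → ℂ) (w : WallIx n) (p : ℂⁿ) : Prop :=
  Tendsto (fun x => wallZ (wNu w) (wC β w) x * differenceOp P r β f x) (𝓝[regularC n β] p) (𝓝 0)

lemma noResidue_of_mirror (hr : r ≠ 0) (hf : f ∈ trigPoly n) (hW : IsWeylInv f) {w : WallIx n}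
    (hp : lin (wNu w) p + wC β w = 0) (g : 𝕎ⁿ) (m : ℤⁿ) (hfix : weylAct g p + period m = p)
    (hlin : ∀ x, lin (wNu w) (weylAct g x + period m) + wC β w = -(lin (wNu w) x + wC β w))
    (hL : ∃ L, Tendsto (fun x => wallZ (wNu w) (wC β w) x * differenceOp P r β f x)
      (𝓝[regularC n β] p) (𝓝 L)) : NoResidue P β r f w p := by
  set ν := wNu w
  set c := wC β w
  obtain ⟨L, hL⟩ := hL
  have hne : (𝓝[regularC n β] p).NeBot :=
    mem_closure_iff_nhdsWithin_neBot.1 ((dense_offWalls exists_wNu_sq) p)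
  have hs : Tendsto (fun x => weylAct g x + period m) (𝓝[regularC n β] p) (𝓝[regularC n β] p) := by
    refine tendsto_nhdsWithin_iff.2 ⟨?_, ?_⟩
    · have : Continuous fun x : ℂⁿ => weylAct g x + period m :=
        (continuous_weylAct g).add continuous_const
      have h := this.tendsto p
      rw [hfix] at h
      exact h.mono_left nhdsWithin_le_nhds
    · filter_upwards [self_mem_nhdsWithin] with x hx
      exact add_period_mem_regularC (weylAct_mem_regularC hx g) m
  have hu : Tendsto (fun x : ℂⁿ => -exp (-(I * (lin ν x + c)))) (𝓝[regularC n β] p) (𝓝 (-1)) := by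
    have : Continuous fun x : ℂⁿ => -exp (-(I * (lin ν x + c))) := by fun_prop
    have h := this.tendsto p
    rw [hp] at h
    simp only [mul_zero, neg_zero, exp_zero] at h
    exact h.mono_left nhdsWithin_le_nhds
  have h2 := (hu.mul hL).congr' (f₂ := fun x => wallZ ν c (weylAct g x + period m) *
      differenceOp P r β f (weylAct g x + period m)) (by
    refine Eventually.of_forall fun x => ?_
    simp only
    rw [differenceOp_period P hr β hf, differenceOp_weylAct P hr β g (hW g)]
    unfold wallZ
    rw [hlin]
    have e : exp (-(I * (lin ν x + c))) * exp (I * (lin ν x + c)) = 1 := by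
      rw [← exp_add, neg_add_cancel, exp_zero]
    rw [mul_neg]
    linear_combination (-differenceOp P r β f x) * e)
  have h3 := tendsto_nhds_unique h2 (hL.comp hs)
  have : L = 0 := by grind
  subst this; exact hL

lemma continuous_shift (β : ℝ) (τ : 𝕊ⁿ) : Continuous (shift β τ) := by unfold shift; fun_prop

lemma tendsto_shift (hf : f ∈ trigPoly n) (τ : 𝕊ⁿ) :
    Tendsto (fun x => f (shift β τ x)) (𝓝[regularC n β] p) (𝓝 (f (shift β τ p))) :=
  (((continuous_trigPoly hf).comp (continuous_shift β τ)).tendsto p).mono_left nhdsWithin_le_nhds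

lemma exists_tendsto_cellW_of_site {z : ℂⁿ → ℂ} {j : Fin n} (hj : j ∈ K)
    (h : ∃ L, Tendsto (fun x : ℂⁿ => z x * siteW P β (τ j) (x j)) (𝓝[regularC n β] p) (𝓝 L))
    (h1 : ∀ i ∈ K, i ≠ j → ContinuousAt (fun x : ℂⁿ => siteW P β (τ i) (x i)) p)
    (h2 : ∀ i ∈ K, ∀ l ∈ K, i ≠ l →
      ContinuousAt (fun x : ℂⁿ => pairW P β (τ i) (τ l) (x i) (x l)) p) :
    ∃ L, Tendsto (fun x => z x * cellW P β x K τ) (𝓝[regularC n β] p) (𝓝 L) := by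
  obtain ⟨L, hL⟩ := h
  have c1 : ContinuousAt (fun x : ℂⁿ => ∏ i ∈ K.erase j, siteW P β (τ i) (x i)) p :=
    tendsto_finsetProd _ fun i hi => h1 i (mem_of_mem_erase hi) (ne_of_mem_erase hi)
  have c2 : ContinuousAt (fun x : ℂⁿ =>
      pairProd K fun i l => pairW P β (τ i) (τ l) (x i) (x l)) p :=
    tendsto_finsetProd _ fun q hq => by
      simp only [mem_filter, mem_product] at hq
      exact h2 _ hq.1.1 _ hq.1.2 hq.2.ne
  refine ⟨_, (hL.mul (c1.mul c2).continuousWithinAt.tendsto).congr fun x => ?_⟩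
  simp only [Pi.mul_apply, cellW]
  rw [← Finset.mul_prod_erase K _ hj]; ring

lemma exists_tendsto_cellW_of_pair {z : ℂⁿ → ℂ}
    {j k : Fin n} (hj : j ∈ K) (hk : k ∈ K) (hjk : j ≠ k)
    (h : ∃ L, Tendsto (fun x : ℂⁿ => z x * pairW P β (τ j) (τ k) (x j) (x k))
      (𝓝[regularC n β] p) (𝓝 L))
    (h1 : ∀ i ∈ K, ContinuousAt (fun x : ℂⁿ => siteW P β (τ i) (x i)) p)
    (h2 : ∀ i ∈ K, ∀ l ∈ K, i ≠ l → ¬ (i = j ∧ l = k) → ¬ (i = k ∧ l = j) →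
      ContinuousAt (fun x : ℂⁿ => pairW P β (τ i) (τ l) (x i) (x l)) p) :
    ∃ L, Tendsto (fun x => z x * cellW P β x K τ) (𝓝[regularC n β] p) (𝓝 L) := by
  wlog hlt : j < k generalizing j k
  · exact this hk hj hjk.symm (by simpa only [pairW_comm P β (τ j)] using h)
      (fun i hi l hl hil a b => h2 i hi l hl hil b a) (lt_of_le_of_ne (not_lt.1 hlt) hjk.symm)
  obtain ⟨L, hL⟩ := h
  have hq : (j, k) ∈ (K ×ˢ K).filter fun q => q.1 < q.2 := by simp [hj, hk, hlt]
  have c1 : ContinuousAt (fun x : ℂⁿ => ∏ i ∈ K, siteW P β (τ i) (x i)) p :=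
    tendsto_finsetProd _ fun i hi => h1 i hi
  have c2 : ContinuousAt (fun x : ℂⁿ => ∏ q ∈ ((K ×ˢ K).filter fun q => q.1 < q.2).erase (j, k),
        pairW P β (τ q.1) (τ q.2) (x q.1) (x q.2)) p :=
    tendsto_finsetProd _ fun q hq => by
      simp only [mem_erase, mem_filter, mem_product] at hq
      refine h2 _ hq.2.1.1 _ hq.2.1.2 hq.2.2.ne (fun h => hq.1 (Prod.ext h.1 h.2)) fun h => ?_
      omega
  refine ⟨_, (hL.mul (c1.mul c2).continuousWithinAt.tendsto).congr fun x => ?_⟩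
  simp only [Pi.mul_apply, cellW, pairProd]
  rw [← Finset.mul_prod_erase _ _ hq]; ring

lemma noResidue_mirror_inl (hβ : β ≠ 0) (hr : r ≠ 0) (hf : f ∈ trigPoly n) (hW : IsWeylInv f)
    {j : Fin n} {a : NZSign} {t : Bool} (hp : IsGeneric wNu (wC β) (.inl (j, a, false, t)) p) :
    NoResidue P β r f (.inl (j, a, false, t)) p := by
  have hp1 := hp.1
  rw [lin_inl] at hp1
  have ha := sign_sq a.2
  refine noResidue_of_mirror P hr hf hW hp.1 (flipAt j)
    (single j (-(a.1 : ℤ) * (if t then 1 else 0))) ?_ (fun x => ?_) ?_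
  · ext i
    by_cases hi : i = j
    · subst hi
      simp only [Pi.add_apply, weylAct_flipAt_self, period, single_eq_same]
      push_cast
      simp only [wC] at hp1
      grind
    · simp [weylAct_flipAt_of_ne hi, period, hi]
  · rw [lin_inl, lin_inl, Pi.add_apply, weylAct_flipAt_self, period, single_eq_same]
    push_cast
    simp only [wC]
    grind
  · simp only [differenceOp_eq_sum P hr]
    refine exists_tendsto_sum (S := {j}) (fun K τ h => ?_) (fun K τ => ?_) hp.tendsto_wallZ
      (fun τ => tendsto_shift hf τ) _ _
    · refine ⟨_, (continuousAt_cellW (fun i hi => siteW_cont_inl P hβ hp fun hij h0 => ?_)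
        fun i _ l _ hil => pairW_cont_inl P hβ hp hil _ _).continuousWithinAt.tendsto⟩
      simp_all
    · by_cases hj : j ∈ K
      · exact exists_tendsto_cellW_of_site P hj
          (exists_tendsto_siteW P hβ hp _ (by simp)) (fun i _ hij => siteW_cont_inl P hβ hp
            fun h => absurd h hij) fun i _ l _ hil => pairW_cont_inl P hβ hp hil _ _
      · exact ⟨_, hp.tendsto_wallZ.mul (continuousAt_cellW (fun i hi => siteW_cont_inl P hβ hp
          fun hij => absurd (hij ▸ hi) hj) fun i _ l _ hil =>
            pairW_cont_inl P hβ hp hil _ _).continuousWithinAt.tendsto⟩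

lemma noResidue_mirror_inr (hβ : β ≠ 0) (hr : r ≠ 0) (hf : f ∈ trigPoly n) (hW : IsWeylInv f)
    {j k : Fin n} {hjk : j ≠ k} {a b : NZSign}
    (hp : IsGeneric wNu (wC β) (.inr (⟨(j, k), hjk⟩, a, b, false)) p) :
    NoResidue P β r f (.inr (⟨(j, k), hjk⟩, a, b, false)) p := by
  have hp1 := hp.1
  rw [lin_inr] at hp1
  simp only [wC, Bool.false_eq_true, if_false, add_zero] at hp1
  have ha := sign_sq a.2
  have hb := sign_sq b.2
  obtain ⟨e, he⟩ := exists_unit_eq_neg_mul a b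
  have h0 : period (n := n) 0 = 0 := by ext; simp [period]
  refine noResidue_of_mirror P hr hf hW hp.1 (swapWith j k e) 0 ?_ (fun x => ?_) ?_
  · rw [h0, add_zero]
    ext i
    by_cases hi : i = j
    · rw [hi, weylAct_swapWith_left, he]
      linear_combination (-(a.1 : ℂ)) * hp1 + p j * ha
    · by_cases hk : i = k
      · rw [hk, weylAct_swapWith_right, he]
        linear_combination (-(b.1 : ℂ)) * hp1 + p k * hb
      · exact weylAct_swapWith_of_ne e hi hk p
  · rw [h0, add_zero, lin_inr, lin_inr, weylAct_swapWith_left, weylAct_swapWith_right, he]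
    simp only [wC, Bool.false_eq_true, if_false, add_zero]
    linear_combination (-(b.1 : ℂ) * x k) * ha + (-(a.1 : ℂ) * x j) * hb
  · simp only [differenceOp_eq_sum P hr]
    have pc : ∀ (τ : 𝕊ⁿ) (K : 𝔓ⁿ), ((τ j = 0 ∧ τ k = 0) ∨
        ¬ ({j, k} : 𝔓ⁿ) ⊆ K) → ∀ i ∈ K, ∀ l ∈ K, i ≠ l →
        ContinuousAt (fun x : ℂⁿ => pairW P β (τ i) (τ l) (x i) (x l)) p := by
      intro τ K h i hi l hl hil
      by_cases h1 : (i = j ∧ l = k) ∨ (i = k ∧ l = j)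
      · have h2 : τ i = 0 ∧ τ l = 0 := by
          rcases h1 with ⟨rfl, rfl⟩ | ⟨rfl, rfl⟩ <;>
          simpa [Finset.insert_subset_iff, hi, hl, and_comm] using h
        simpa [h2.1, h2.2] using continuousAt_const
      · exact pairW_cont_inr P hβ hp hil (fun e => h1 (.inl e)) (fun e => h1 (.inr e)) _ _
    refine exists_tendsto_sum (S := {j, k}) (fun K τ h => ?_) (fun K τ => ?_) hp.tendsto_wallZ
      (fun τ => tendsto_shift hf τ) _ _
    · exact ⟨_, (continuousAt_cellW (fun i _ => siteW_cont_inr P hβ hp i _)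
        (pc τ K (h.imp_left fun h => ⟨h j (by simp), h k (by simp)⟩))).continuousWithinAt.tendsto⟩
    · by_cases hK : ({j, k} : 𝔓ⁿ) ⊆ K
      · refine exists_tendsto_cellW_of_pair P (hK (by simp)) (hK (by simp)) hjk
          (exists_tendsto_pairW_mirror P hβ hp _ _) (fun i _ => siteW_cont_inr P hβ hp i _)
          fun i _ l _ hil h1 h2 => pairW_cont_inr P hβ hp hil h1 h2 _ _
      · exact ⟨_, hp.tendsto_wallZ.mul (continuousAt_cellW (fun i _ => siteW_cont_inr P hβ hp i _)
          (pc τ K (.inr hK))).continuousWithinAt.tendsto⟩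

lemma tendsto_cellW_mergeOn {z : ℂⁿ → ℂ} {S : 𝔓ⁿ} {σ : 𝕊ⁿ}
    {R₀ : ℂ} (hR : Tendsto (fun x => z x * cellW P β x S σ) (𝓝[regularC n β] p) (𝓝 R₀))
    (hc : ∀ T, Disjoint S T → ∀ τ, ContinuousAt (fun x => cellW P β x T τ) p)
    (hs : ∀ s ∈ S, ∀ t ∉ S, ∀ b, ContinuousAt (fun x : ℂⁿ => pairW P β (σ s) b (x s) (x t)) p)
    (hfac : ∀ t ∉ S, ∀ b, b ≠ 0 →
      ∏ s ∈ S, pairW P β (σ s) b (p s) (p t) = ∏ s ∈ S, pairW P β 0 b (p s) (p t))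
    (hK : S ⊆ K) (h0 : ∀ j ∈ S, τ j = 0) :
    Tendsto (fun x => z x * cellW P β x K (mergeOn S σ τ)) (𝓝[regularC n β] p) (𝓝 (cellW P β p K τ *
        (R₀ * ∏ t ∈ (K \ supp τ) \ S, ∏ s ∈ S, pairW P β (σ s) 0 (p s) (p t)))) := by
  have hd : Disjoint S (K \ S) := disjoint_sdiff
  have e : ∀ x, cellW P β x K (mergeOn S σ τ) = cellW P β x S σ * cellW P β x (K \ S) τ *
      ∏ s ∈ S, ∏ t ∈ K \ S, pairW P β (σ s) (τ t) (x s) (x t) := by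
    intro x
    conv_lhs => rw [← union_sdiff_of_subset hK]
    rw [cellW_union P β x hd]
    congr 1
    · congr 1
      · exact cellW_congr P β (fun _ _ => rfl) fun j hj => by simp [mergeOn, hj]
      · exact cellW_congr P β (fun _ _ => rfl) fun j hj => by
          simp [mergeOn, (Finset.mem_sdiff.1 hj).2]
    · exact prod_congr rfl fun s hs' => prod_congr rfl fun t ht => by
        simp [mergeOn, hs', (Finset.mem_sdiff.1 ht).2]
  have e0 : cellW P β p K τ = cellW P β p (K \ S) τ *
      ∏ t ∈ K \ S, ∏ s ∈ S, pairW P β 0 (τ t) (p s) (p t) := by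
    conv_lhs => rw [← union_sdiff_of_subset hK]
    rw [cellW_union P β p hd, cellW_congr P β (τ' := 0) (fun _ _ => rfl) h0, cellW_zero, one_mul,
      Finset.prod_comm]
    simp_all
  simp only [e]
  have lim := (hR.mul ((hc _ hd τ).continuousWithinAt (s := regularC n β)).tendsto).mul
    (tendsto_finsetProd (x := 𝓝[regularC n β] p) S fun s hs' =>
      tendsto_finsetProd (K \ S) fun t ht =>
        ((hs s hs' t (Finset.mem_sdiff.1 ht).2 (τ t)).continuousWithinAt (s := regularC n β)).tendsto)
  refine (lim.congr fun x => by ring).trans_eq ?_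
  congr 1
  rw [e0, Finset.prod_comm]
  have : ∏ t ∈ K \ S, ∏ s ∈ S, pairW P β (σ s) (τ t) (p s) (p t) =
      (∏ t ∈ K \ S, ∏ s ∈ S, pairW P β 0 (τ t) (p s) (p t)) *
      ∏ t ∈ (K \ supp τ) \ S, ∏ s ∈ S, pairW P β (σ s) 0 (p s) (p t) := by
    have e1 : (K \ supp τ) \ S = (K \ S).filter fun t => τ t = 0 := by ext t; simp [mem_supp]; tauto
    rw [e1, prod_filter, ← prod_mul_distrib]
    refine prod_congr rfl fun t ht => ?_
    split_ifs with h
    · simp [h]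
    · rw [mul_one]; exact hfac t (Finset.mem_sdiff.1 ht).2 _ h
  rw [this]; ring

lemma continuousAt_cellW_of_disjoint {S : 𝔓ⁿ}
    (h1 : ∀ j ∉ S, ∀ a, ContinuousAt (fun x : ℂⁿ => siteW P β a (x j)) p)
    (h2 : ∀ i ∉ S, ∀ j ∉ S, i ≠ j → ∀ a b, ContinuousAt (fun x : ℂⁿ => pairW P β a b (x i) (x j)) p)
    {T : 𝔓ⁿ} (hT : Disjoint S T) (τ : 𝕊ⁿ) :
    ContinuousAt (fun x => cellW P β x T τ) p :=
  continuousAt_cellW (fun j hj => h1 j (Finset.disjoint_right.1 hT hj) _)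
    fun i hi j hj hij => h2 i (Finset.disjoint_right.1 hT hi) j (Finset.disjoint_right.1 hT hj) hij _ _

lemma cellW_singleton (β : ℝ) (x : ℂⁿ) (j : Fin n) (τ : 𝕊ⁿ) :
    cellW P β x {j} τ = siteW P β (τ j) (x j) := by
  simp [cellW, pairProd_eq]

lemma cellW_pair (β : ℝ) (x : ℂⁿ) {j k : Fin n} (hjk : j ≠ k) (τ : 𝕊ⁿ) :
    cellW P β x {j, k} τ = siteW P β (τ j) (x j) * siteW P β (τ k) (x k) *
      pairW P β (τ j) (τ k) (x j) (x k) := by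
  have := cellW_union P β x (S := {j}) (T := {k}) (by simpa using hjk) τ
  rw [cellW_singleton, cellW_singleton] at this
  simpa using this

lemma vA_mul_sign (β : ℝ) (d : NZSign) (y z : ℂ) :
    vA P β (y + d.1 * z) * vA P β (y - d.1 * z) = vA P β (y + z) * vA P β (y - z) := by
  rcases sign_mul_cases d posSign with ⟨rfl, -⟩ | ⟨-, h⟩
  · simp [posSign]
  · have : (d.1 : ℂ) = -1 := by simpa [posSign] using h
    rw [this, mul_comm]; congr 2 <;> ring

lemma apply_eq_of_reflection (hf : f ∈ trigPoly n) (hW : IsWeylInv f) {x y : ℂⁿ}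
    (g : 𝕎ⁿ) (m : ℤⁿ) (h : y = weylAct g x + period m) :
    f y = f x := by
  rw [h, trigPoly_period hf, hW g]

lemma noResidue_shifted_inl (hβ : β ≠ 0) (hr : r ≠ 0) (hf : f ∈ trigPoly n) (hW : IsWeylInv f)
    {j : Fin n} {a : NZSign} {t : Bool} (hp : IsGeneric wNu (wC β) (.inl (j, a, true, t)) p) :
    NoResidue P β r f (.inl (j, a, true, t)) p := by
  have hp1 := hp.1
  rw [lin_inl] at hp1
  have ha := sign_sq a.2
  obtain ⟨R₀, hR⟩ := exists_tendsto_siteW P hβ hp a.1 fun _ => rfl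
  simp only [NoResidue, differenceOp_eq_sum P hr]
  refine tendsto_sum_zero (S := {j}) (σ := fun _ => a.1) (W0 := cellW P β p)
    (R := fun K' => R₀ * ∏ t ∈ K' \ {j}, ∏ s ∈ {j}, pairW P β a.1 0 (p s) (p t))
    (by simp) (fun _ _ => a.2) (fun K τ h => ?_) (fun K τ hK h0 => ?_) hp.tendsto_wallZ
    (fun K => cellW_zero ..) (fun τ => tendsto_shift hf τ) (fun τ h0 => ?_) _ _
  · refine (continuousAt_cellW (fun i hi => siteW_cont_inl P hβ hp fun hij h0 => ⟨?_, rfl⟩)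
        fun i _ l _ hil => pairW_cont_inl P hβ hp hil _ _).continuousWithinAt.tendsto
    subst hij
    refine fun e => h ⟨by simpa using hi, fun l hl => ?_⟩
    rw [Finset.mem_singleton] at hl
    rw [hl]; exact e
  · refine tendsto_cellW_mergeOn P (S := {j}) (σ := fun _ => a.1) (by simpa [cellW_singleton] using hR)
      (fun T hT τ => continuousAt_cellW_of_disjoint P (fun i hi b => siteW_cont_inl P hβ hp
        fun h => absurd (by simp [h]) hi) (fun i _ l _ hil _ _ => pairW_cont_inl P hβ hp hil _ _) hT τ)
      (fun s hs l hl b => pairW_cont_inl P hβ hp (fun h => hl (by rw [← h]; exact hs)) _ _) (fun l hl b hb => ?_) hK h0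
    rw [Finset.prod_singleton, Finset.prod_singleton, pairW, pairW, if_neg a.2, if_neg hb, if_pos rfl,
      if_neg hb]
    simp only [vA_eq]
    simp only [wC, if_true] at hp1
    simp only [← vA_eq]
    rw [← vA_mul_sign P β a, add_comm ((a.1 : ℂ) * p j)]
    simp only [vA_eq]
    congr 1
    refine sineRatio_congr _ _ (-(if t then 1 else 0)) ?_
    cases t <;> simp only [Bool.false_eq_true, if_false, if_true] at hp1 ⊢ <;>
    · push_cast
      linear_combination 2 * hp1
  · refine apply_eq_of_reflection hf hW (flipAt j) (single j (-(a.1 : ℤ) * (if t then 1 else 0))) ?_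
    ext i
    by_cases hi : i = j
    · subst hi
      simp only [Pi.add_apply, weylAct_flipAt_self, period, single_eq_same, shift, mergeOn,
        h0 i (by simp), Finset.mem_singleton, if_true]
      simp only [wC, gam] at hp1
      cases t <;> simp only [Bool.false_eq_true, if_false, if_true] at hp1 ⊢ <;>
      · push_cast
        simp
        linear_combination (2 * (a.1 : ℂ)) * hp1 - 2 * p i * ha
    · simp [weylAct_flipAt_of_ne hi, period, hi, shift, mergeOn]

lemma noResidue_shifted_inr (hβ : β ≠ 0) (hr : r ≠ 0) (hf : f ∈ trigPoly n) (hW : IsWeylInv f)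
    {j k : Fin n} {hjk : j ≠ k} {a b : NZSign}
    (hp : IsGeneric wNu (wC β) (.inr (⟨(j, k), hjk⟩, a, b, true)) p) :
    NoResidue P β r f (.inr (⟨(j, k), hjk⟩, a, b, true)) p := by
  have hp1 := hp.1
  rw [lin_inr] at hp1
  simp only [wC, if_true] at hp1
  have ha := sign_sq a.2
  have hb := sign_sq b.2
  have hkj := hjk.symm
  obtain ⟨e, he⟩ := exists_unit_eq_neg_mul a b
  set σ : 𝕊ⁿ := fun i => if i = j then a.1 else b.1 with hσ
  have hσj : σ j = a.1 := by simp [hσ]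
  have hσk : σ k = b.1 := by simp [hσ, hkj]
  obtain ⟨R₁, hR₁⟩ := exists_tendsto_pairW_shifted P hβ hp
  have hR : Tendsto (fun x => wallZ (wNu (.inr (⟨(j, k), hjk⟩, a, b, true)))
      (wC β (.inr (⟨(j, k), hjk⟩, a, b, true))) x * cellW P β x {j, k} σ) (𝓝[regularC n β] p)
      (𝓝 (siteW P β (σ j) (p j) * siteW P β (σ k) (p k) * R₁)) := by
    refine (((((siteW_cont_inr P hβ hp j (σ j)).mul (siteW_cont_inr P hβ hp k (σ k)))
      ).continuousWithinAt.tendsto).mul hR₁).congr fun x => ?_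
    simp only [Pi.mul_apply]
    rw [cellW_pair P β x hjk, hσj, hσk]; ring
  have hS : ∀ {i}, i ∉ ({j, k} : 𝔓ⁿ) ↔ i ≠ j ∧ i ≠ k := by simp
  simp only [NoResidue, differenceOp_eq_sum P hr]
  refine tendsto_sum_zero (S := {j, k}) (σ := σ) (W0 := cellW P β p)
    (R := fun K' => siteW P β (σ j) (p j) * siteW P β (σ k) (p k) * R₁ *
      ∏ t ∈ K' \ {j, k}, ∏ s ∈ {j, k}, pairW P β (σ s) 0 (p s) (p t))
    (by simp) (fun i _ => ?_) (fun K τ h => ?_) (fun K τ hK h0 => ?_) hp.tendsto_wallZ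
    (fun K => cellW_zero ..) (fun τ => tendsto_shift hf τ) (fun τ h0 => ?_) _ _
  · simp only [hσ]; split_ifs
    · exact a.2
    · exact b.2
  · refine (continuousAt_cellW (fun i hi => siteW_cont_inr P hβ hp i _)
        fun i hi l hl hil => ?_).continuousWithinAt.tendsto
    have key : ({j, k} : 𝔓ⁿ) ⊆ K → ¬ (τ j = a.1 ∧ τ k = b.1) := fun hK e =>
      h ⟨hK, by simpa [Matches, hσj, hσk] using e⟩
    by_cases h1 : i = j ∧ l = k
    · obtain ⟨rfl, rfl⟩ := h1
      exact pairW_cont_inr_shifted P hβ hp (key (by simp [Finset.insert_subset_iff, hi, hl]))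
    by_cases h2 : i = k ∧ l = j
    · obtain ⟨rfl, rfl⟩ := h2
      simp only [pairW_comm P β (τ i)]
      exact pairW_cont_inr_shifted P hβ hp (key (by simp [Finset.insert_subset_iff, hi, hl]))
    exact pairW_cont_inr P hβ hp hil h1 h2 _ _
  · refine tendsto_cellW_mergeOn P hR
      (fun T hT τ => continuousAt_cellW_of_disjoint P (fun i _ b => siteW_cont_inr P hβ hp i b)
        (fun i hi l hl hil _ _ => pairW_cont_inr P hβ hp hil (fun h => (hS.1 hi).1 h.1)
          (fun h => (hS.1 hi).2 h.1) _ _) hT τ)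
      (fun s hs l hl b => pairW_cont_inr P hβ hp (fun h => hl (by rw [← h]; exact hs)) (fun h => (hS.1 hl).2 h.2)
        (fun h => (hS.1 hl).1 h.2) _ _) (fun l hl c hc => ?_) hK h0
    rw [prod_pair hjk, prod_pair hjk, hσj, hσk]
    simp only [pairW, if_neg a.2, if_neg b.2, if_neg hc, if_true]
    have e1 : (a.1 : ℂ) * p j + 2 * gam β = -((b.1 : ℂ) * p k) := by linear_combination hp1
    have e2 : (b.1 : ℂ) * p k + 2 * gam β = -((a.1 : ℂ) * p j) := by linear_combination hp1
    rw [show (a.1 : ℂ) * p j + c * p l + 2 * gam β = c * p l - b.1 * p k by linear_combination e1,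
      show (b.1 : ℂ) * p k + c * p l + 2 * gam β = c * p l - a.1 * p j by linear_combination e2,
      add_comm ((a.1 : ℂ) * p j), add_comm ((b.1 : ℂ) * p k)]
    rw [← vA_mul_sign P β a _ (p j), ← vA_mul_sign P β b _ (p k)]; ring
  · refine apply_eq_of_reflection hf hW (swapWith j k e) 0 ?_
    ext i
    by_cases hi : i = j
    · rw [hi]
      simp only [Pi.add_apply, weylAct_swapWith_left, he, period, shift, mergeOn, h0 k (by simp),
        hσj, Finset.mem_insert, true_or, if_true, Pi.zero_apply]
      simp [gam] at hp1 ⊢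
      linear_combination (a.1 : ℂ) * hp1 - p j * ha
    · by_cases hk : i = k
      · rw [hk]
        simp only [Pi.add_apply, weylAct_swapWith_right, he, period, shift, mergeOn, h0 j (by simp),
          hσk, Finset.mem_insert, Finset.mem_singleton, or_true, if_true, Pi.zero_apply]
        simp [gam] at hp1 ⊢
        linear_combination (b.1 : ℂ) * hp1 - p k * hb
      · simp [weylAct_swapWith_of_ne e hi hk, period, shift, mergeOn, hi, hk]

lemma exists_differenceOp_eq (hβ : β ≠ 0) (hr : r ≠ 0) (hf : f ∈ trigPoly n) (hW : IsWeylInv f) :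
    ∃ h ∈ trigPoly n, ∀ x ∈ regularC n β, differenceOp P r β f x = h x := by
  refine exists_trigPoly_of_isRat exists_wNu_sq ?_ ?_
  · simp only [funext fun x => differenceOp_eq_sum P hr β f x]
    refine IsRat.sum _ fun τ _ => ((isRat_cellW P β _ τ).mul (isRat_chainSum P β _ _)).mul
      (IsRat.of_mem ?_)
    have : (fun x => f (shift β τ x)) = fun x => f (x + fun j => I * β * (τ j : ℂ)) := rfl
    rw [this]
    exact trigPoly_translate hf _
  · rintro (⟨j, a, s, t⟩ | ⟨⟨⟨j, k⟩, hjk⟩, a, b, s⟩) p hp <;> cases s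
    · exact noResidue_mirror_inl P hβ hr hf hW hp
    · exact noResidue_shifted_inl P hβ hr hf hW hp
    · exact noResidue_mirror_inr P hβ hr hf hW hp
    · exact noResidue_shifted_inr P hβ hr hf hW hp

end wall

/-! ### The eigenvalue polynomials -/

section genSeries

variable {𝕜 : Type*} [Field 𝕜]

open PowerSeries in
/-- `∏_{j < N} (1 + t_j u) / ∏_{i < d} (1 + c_i u)`. -/
def genSeries (N d : ℕ) (t c : ℕ → 𝕜) : PowerSeries 𝕜 :=
  (∏ j ∈ Finset.range N, (1 + C (t j) * X)) * ∏ i ∈ Finset.range d, (1 + C (c i) * X)⁻¹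

open PowerSeries

lemma one_add_mul_inv (a : 𝕜) : (1 + C a * X : PowerSeries 𝕜) * (1 + C a * X)⁻¹ = 1 :=
  PowerSeries.mul_inv_cancel _ (by simp)

lemma genSeries_succ_succ (N d : ℕ) (t c : ℕ → 𝕜) : genSeries (N + 1) (d + 1) t c =
      genSeries N d t c + C (t N - c d) * X * genSeries N (d + 1) t c := by
  have h := one_add_mul_inv (c d)
  simp only [genSeries, prod_range_succ, map_sub]
  grind

lemma coeff_prod_eq_zero {ι : Type*} (s : Finset ι) (t : ι → 𝕜) {m : ℕ} (hm : s.card < m) :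
    coeff m (∏ j ∈ s, (1 + C (t j) * X : PowerSeries 𝕜)) = 0 := by
  classical
  induction s using Finset.induction_on generalizing m with
  | empty => rw [Finset.prod_empty, coeff_one, if_neg (by simp at hm; omega)]
  | insert a s ha ih =>
    rw [Finset.card_insert_of_notMem ha] at hm
    obtain ⟨k, rfl⟩ : ∃ k, m = k + 1 := ⟨m - 1, by omega⟩
    rw [Finset.prod_insert ha, add_mul, one_mul, map_add, mul_assoc, coeff_C_mul, coeff_succ_X_mul,
      ih (by omega), ih (by omega)]
    simp

lemma coeff_zero_genSeries (N d : ℕ) (t c : ℕ → 𝕜) : coeff 0 (genSeries N d t c) = 1 := by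
  simp [genSeries, map_prod]

lemma coeff_genSeries_translate (t c : ℕ → 𝕜) (s : 𝕜) : ∀ N r d : ℕ, d + r = N + 1 →
    coeff r (genSeries N d (fun j => t j + s) fun i => c i + s) = coeff r (genSeries N d t c) := by
  intro N
  induction N with
  | zero =>
    intro r d h
    rcases Nat.eq_zero_or_pos r with rfl | hr
    · simp [coeff_zero_genSeries]
    · obtain ⟨rfl, rfl⟩ : d = 0 ∧ r = 1 := by omega
      simp [genSeries, coeff_one]
  | succ N ih =>
    intro r d h
    rcases r with _ | r
    · simp [coeff_zero_genSeries]
    rcases d with _ | d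
    · simp only [genSeries, Finset.range_zero, Finset.prod_empty, mul_one]
      rw [coeff_prod_eq_zero _ _ (by simp; omega), coeff_prod_eq_zero _ _ (by simp; omega)]
    · rw [genSeries_succ_succ, genSeries_succ_succ, map_add, map_add, mul_assoc, mul_assoc,
        coeff_C_mul, coeff_C_mul, coeff_succ_X_mul, coeff_succ_X_mul, ih _ _ (by omega),
        ih _ _ (by omega)]
      simp

lemma rescale_one_add (s a : 𝕜) :
    rescale s (1 + C a * X : PowerSeries 𝕜) = 1 + C (s * a) * X := by
  ext k
  rw [coeff_rescale, map_add, map_add, coeff_C_mul, coeff_C_mul, coeff_X, coeff_one]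
  rcases k with _ | _ | k <;> simp

lemma coeff_genSeries_scale (t c : ℕ → 𝕜) (s : 𝕜) (N d r : ℕ) :
    coeff r (genSeries N d (fun j => s * t j) fun i => s * c i) =
      s ^ r * coeff r (genSeries N d t c) := by
  rw [← coeff_rescale]
  congr 1
  unfold genSeries
  simp only [map_mul (rescale s), map_prod, rescale_one_add]
  congr 1
  refine prod_congr rfl fun i _ => ?_
  have h1 := one_add_mul_inv (s * c i)
  have h2 := congrArg (rescale s) (one_add_mul_inv (c i))
  rw [map_mul, rescale_one_add, map_one] at h2
  calc (1 + C (s * c i) * X : PowerSeries 𝕜)⁻¹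
      = ((1 + C (s * c i) * X) * rescale s (1 + C (c i) * X)⁻¹) *
        (1 + C (s * c i) * X)⁻¹ := by rw [h2, one_mul]
    _ = _ := by linear_combination (rescale s (1 + C (c i) * X)⁻¹) * h1

lemma coeff_genSeries_self (c : ℕ → 𝕜) {N d r : ℕ} (h : d + r = N + 1) (hr : r ≠ 0) :
    coeff r (genSeries N d c c) = 0 := by
  have hd : d ≤ N := by omega
  rw [genSeries, ← Finset.prod_range_mul_prod_Ico _ hd, mul_right_comm, ← prod_mul_distrib,
    prod_congr rfl fun i _ => one_add_mul_inv (c i), Finset.prod_const_one, one_mul]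
  exact coeff_prod_eq_zero _ _ (by simp; omega)

lemma prod_one_add_eq_sum {ι : Type*} (s : Finset ι) (t : ι → 𝕜) :
    ∏ j ∈ s, (1 + C (t j) * X : PowerSeries 𝕜) =
      ∑ S ∈ s.powerset, C (∏ j ∈ S, t j) * X ^ S.card := by
  classical
  rw [Finset.prod_one_add]
  refine sum_congr rfl fun S _ => ?_
  rw [prod_mul_distrib, prod_const, map_prod]

lemma coeff_prod_one_add_mul {ι : Type*} (s : Finset ι) (t : ι → 𝕜) (H : PowerSeries 𝕜) (m : ℕ) :
    coeff m ((∏ j ∈ s, (1 + C (t j) * X)) * H) =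
      ∑ S ∈ s.powerset.filter (fun S => S.card ≤ m), (∏ j ∈ S, t j) * coeff (m - S.card) H := by
  rw [prod_one_add_eq_sum, sum_mul, map_sum, sum_filter]
  refine sum_congr rfl fun S _ => ?_
  rw [mul_assoc, coeff_C_mul, coeff_X_pow_mul']
  split_ifs <;> simp

/-! ### Chain sums of the asymptotic weights -/

/-- The number of elements of `K` above `j`. -/
def rankIn (K : 𝔓ⁿ) (j : Fin n) : ℕ := (K.filter fun k => j < k).card

lemma prod_rankIn {M : Type*} [CommMonoid M] (f : ℕ → M) (K : 𝔓ⁿ) :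
    ∏ j ∈ K, f (rankIn K j) = ∏ i ∈ Finset.range K.card, f i := by
  induction K using Finset.induction_on_min with
  | empty => simp
  | insert a K ha ih =>
    have hn : a ∉ K := fun h => lt_irrefl _ (ha a h)
    rw [Finset.prod_insert hn, Finset.card_insert_of_notMem hn, prod_range_succ, ← ih, mul_comm]
    congr 1
    · refine prod_congr rfl fun j hj => ?_
      rw [rankIn, rankIn, Finset.filter_insert, if_neg (ha j hj).not_gt]
    · rw [rankIn, Finset.filter_insert, if_neg (lt_irrefl _), filter_true_of_mem ha]

lemma sum_supp_eq (S K : 𝔓ⁿ) (hS : S ⊆ K) (y : Fin n → 𝕜) :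
    ∑ τ ∈ (Finset.univ : Finset 𝕊ⁿ).filter (fun τ => supp τ = S),
      ∏ j ∈ K, y j ^ (τ j : ℤ) = ∏ j ∈ S, (y j + (y j)⁻¹) := by
  have e : (Finset.univ : Finset 𝕊ⁿ).filter (fun τ => supp τ = S) =
      Fintype.piFinset fun j => if j ∈ S then {1, -1} else {0} := by
    ext τ
    simp only [mem_filter, Finset.mem_univ, true_and, Fintype.mem_piFinset, Finset.ext_iff,
      mem_supp]
    refine forall_congr' fun j => ?_
    split_ifs with h
    · simp only [h, iff_true]
      generalize τ j = a
      revert a; decide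
    · simp [h]
  have e2 : ∀ τ ∈ (Finset.univ : Finset 𝕊ⁿ).filter (fun τ => supp τ = S),
      ∏ j ∈ K, y j ^ (τ j : ℤ) = ∏ j, y j ^ (τ j : ℤ) := by
    intro τ hτ
    refine prod_subset (Finset.subset_univ _) fun j _ hj => ?_
    have : τ j = 0 := by grind
    simp [this]
  rw [sum_congr rfl e2, e,
    ← Finset.prod_univ_sum (fun j => if j ∈ S then {1, -1} else {0}) fun j (a : SignType) => y j ^ (a : ℤ),
    ← prod_subset (Finset.subset_univ S) fun j _ hj => by simp [hj]]
  simp_all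

lemma sum_cells_supp (K : 𝔓ⁿ) (m : ℕ) (y : Fin n → 𝕜) (F : 𝔓ⁿ → 𝕜) :
    ∑ τ ∈ cells K m, (∏ j ∈ K, y j ^ (τ j : ℤ)) * F (supp τ) =
      ∑ S ∈ K.powerset.filter (fun S => S.card ≤ m), (∏ j ∈ S, (y j + (y j)⁻¹)) * F S := by
  rw [← sum_fiberwise_of_maps_to (g := supp)
    (t := K.powerset.filter (fun S => S.card ≤ m)) (fun τ hτ => by
      simpa [Finset.mem_powerset] using mem_cells.1 hτ)]
  refine sum_congr rfl fun S hS => ?_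
  simp only [mem_filter, Finset.mem_powerset] at hS
  rw [← sum_supp_eq S K hS.1, sum_mul]
  have : (cells K m).filter (fun τ => supp τ = S) =
      (Finset.univ : Finset 𝕊ⁿ).filter (fun τ => supp τ = S) := by
    ext τ
    simp only [mem_filter, mem_cells, Finset.mem_univ, true_and, and_iff_right_iff_imp]
    rintro rfl; exact hS
  rw [this]
  refine sum_congr rfl fun τ hτ => ?_
  rw [(mem_filter.1 hτ).2]

variable (q : ℕ → 𝕜)

/-- The asymptotic form of the coefficients. -/
def asympW (K : 𝔓ⁿ) (τ : 𝕊ⁿ) : 𝕜 := ∏ j ∈ K, q (rankIn K j) ^ (τ j : ℤ)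

lemma chainSum_asympW (m : ℕ) : ∀ (K : 𝔓ⁿ) (d : ℕ), d + m = K.card + 1 → chainSum (asympW q) m K =
      coeff m (∏ i ∈ Finset.range d, (1 + C (q i + (q i)⁻¹) * X)⁻¹) := by
  induction m using Nat.strong_induction_on with | _ m ih =>
  intro K d hd
  rcases Nat.eq_zero_or_pos m with rfl | hm
  · simp [chainSum_zero, map_prod]
  set H : PowerSeries 𝕜 := ∏ i ∈ Finset.range d, (1 + C (q i + (q i)⁻¹) * X)⁻¹ with hH
  have key : ∑ τ ∈ cells K m, asympW q K τ * coeff (m - (supp τ).card) H = 0 := by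
    have h1 := sum_cells_supp K m (fun j => q (rankIn K j)) fun S => coeff (m - S.card) H
    have h2 := coeff_prod_one_add_mul K (fun j => q (rankIn K j) + (q (rankIn K j))⁻¹) H m
    rw [prod_rankIn (fun i => 1 + C (q i + (q i)⁻¹) * X)] at h2
    exact (h1.trans h2.symm).trans (coeff_genSeries_self (fun i => q i + (q i)⁻¹) hd hm.ne')
  rw [chainSum_eq_neg _ hm.ne']
  rw [← add_sum_erase _ _ (zero_mem_cells K m)] at key
  have h0 : asympW q K 0 = 1 := by simp [asympW]
  rw [h0, one_mul, supp_zero, Finset.card_empty, Nat.sub_zero] at key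
  rw [eq_neg_of_add_eq_zero_left key]
  congr 1
  refine sum_congr rfl fun τ hτ => ?_
  rw [mem_erase, mem_cells] at hτ
  have hpos : 0 < (supp τ).card := card_pos.2
    (Finset.nonempty_iff_ne_empty.2 fun h => hτ.1 (supp_eq_empty.1 h))
  have hc := Finset.card_sdiff_of_subset hτ.2.1
  have hle := Finset.card_le_card hτ.2.1
  rw [ih _ (by omega) _ d (by omega)]

lemma sum_asympW_eq {r d : ℕ} (hd : d + r = n + 1) (y : Fin n → 𝕜) :
    ∑ τ ∈ cells (Finset.univ : 𝔓ⁿ) r, asympW q Finset.univ τ *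
      chainSum (asympW q) (r - (supp τ).card) (Finset.univ \ supp τ) * ∏ j, y j ^ (τ j : ℤ) =
    coeff r ((∏ j : Fin n, (1 + C (q (rankIn Finset.univ j) * y j +
        (q (rankIn Finset.univ j) * y j)⁻¹) * X)) *
      ∏ i ∈ Finset.range d, (1 + C (q i + (q i)⁻¹) * X)⁻¹) := by
  rw [coeff_prod_one_add_mul, ← sum_cells_supp]
  refine sum_congr rfl fun τ hτ => ?_
  rw [mem_cells] at hτ
  have hc := Finset.card_sdiff_of_subset hτ.1
  have hle := Finset.card_le_card hτ.1
  rw [card_univ, Fintype.card_fin] at hc hle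
  rw [chainSum_asympW q _ _ d (by rw [hc]; omega), asympW]
  simp only [mul_zpow, prod_mul_distrib]
  ring

lemma rankIn_univ (j : Fin n) : rankIn Finset.univ j = n - 1 - j := by
  rw [rankIn]
  have : (Finset.univ.filter fun k => j < k) = Finset.Ioi j := by ext; simp
  rw [this, Fin.card_Ioi]

/-! ### The polynomials `E` as coefficients -/

/-- The complete homogeneous sum over the variables with index at least `a`. -/
def completeSum (n a m : ℕ) (p : Fin n → 𝕜) : 𝕜 := open scoped Classical in
  ∑ i ∈ (Finset.univ : Finset (Fin m → Fin n)).filter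
      (fun i : Fin m → Fin n => Monotone i ∧ ∀ x, a ≤ (i x : ℕ)), ∏ x, p (i x)

lemma completeSum_zero (a : ℕ) (p : Fin n → 𝕜) : completeSum n a 0 p = 1 := by
  rw [completeSum, filter_true_of_mem]
  · simp
  · exact fun i _ => ⟨fun x => x.elim0, fun x => x.elim0⟩

lemma completeSum_of_le {a : ℕ} (ha : n ≤ a) (m : ℕ) (p : Fin n → 𝕜) :
    completeSum n a (m + 1) p = 0 := by
  rw [completeSum, Finset.filter_false_of_mem, Finset.sum_empty]
  rintro i - ⟨-, h⟩
  have := h 0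
  have := (i 0).2
  omega

lemma completeSum_succ {a : ℕ} (ha : a < n) (m : ℕ) (p : Fin n → 𝕜) : completeSum n a (m + 1) p =
      completeSum n (a + 1) (m + 1) p + p ⟨a, ha⟩ * completeSum n a m p := by
  classical
  rw [completeSum, ← Finset.sum_filter_add_sum_filter_not _
    (fun i : Fin (m + 1) → Fin n => a + 1 ≤ (i 0 : ℕ)), Finset.filter_filter, Finset.filter_filter]
  congr 1
  · rw [completeSum]
    refine sum_congr (filter_congr fun i _ => ?_) fun _ _ => rfl
    constructor
    · rintro ⟨⟨h1, -⟩, h3⟩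
      exact ⟨h1, fun x => h3.trans (h1 (Fin.zero_le x))⟩
    · grind
  · rw [completeSum, mul_sum]
    refine sum_bij' (fun i _ => Fin.tail i) (fun i _ => Fin.cons ⟨a, ha⟩ i) ?_ ?_ ?_ ?_ ?_
    · intro i hi
      simp only [mem_filter, Finset.mem_univ, true_and] at hi ⊢
      exact ⟨fun x y hxy => hi.1.1 (Fin.succ_le_succ_iff.2 hxy), fun x => hi.1.2 x.succ⟩
    · intro i hi
      simp only [mem_filter, Finset.mem_univ, true_and] at hi ⊢
      refine ⟨⟨fun x y hxy => ?_, fun x => ?_⟩, by simp⟩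
      · induction x using Fin.cases with
        | zero =>
          induction y using Fin.cases with
          | zero => exact le_rfl
          | succ y => simpa [Fin.le_def] using hi.2 y
        | succ x =>
          induction y using Fin.cases with
          | zero => exact absurd hxy (by simp)
          | succ y => simpa using hi.1 (Fin.succ_le_succ_iff.1 hxy)
      · induction x using Fin.cases with
        | zero => simp
        | succ x => simpa using hi.2 x
    · intro i hi
      simp only [mem_filter, Finset.mem_univ, true_and] at hi
      have h0 := hi.1.2 0
      have : i 0 = ⟨a, ha⟩ := Fin.ext (by simp; omega)
      rw [← this]; exact Fin.cons_self_tail i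
    · intro i hi
      exact Fin.tail_cons _ _
    · intro i hi
      simp only [mem_filter, Finset.mem_univ, true_and] at hi
      have h0 := hi.1.2 0
      have : i 0 = ⟨a, ha⟩ := Fin.ext (by simp; omega)
      rw [Fin.prod_univ_succ, this]; rfl

lemma coeff_prod_inv {p : Fin n → 𝕜} {c : ℕ → 𝕜} (hc : ∀ j : Fin n, p j = c (n - 1 - j)) (d : ℕ) :
    ∀ a, a + d = n → ∀ m, coeff m (∏ i ∈ Finset.range d, (1 + C (c i) * X : PowerSeries 𝕜)⁻¹) =
      (-1) ^ m * completeSum n a m p := by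
  induction d with
  | zero =>
    intro a ha m
    rcases m with _ | m
    · simp [completeSum_zero]
    · rw [completeSum_of_le (by omega)]; simp [coeff_one]
  | succ d ih =>
    intro a ha m
    have key : (1 + C (c d) * X) * ∏ i ∈ Finset.range (d + 1), (1 + C (c i) * X : PowerSeries 𝕜)⁻¹ =
        ∏ i ∈ Finset.range d, (1 + C (c i) * X : PowerSeries 𝕜)⁻¹ := by
      rw [prod_range_succ]
      linear_combination (∏ i ∈ Finset.range d, (1 + C (c i) * X : PowerSeries 𝕜)⁻¹) *
        one_add_mul_inv (c d)
    induction m with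
    | zero => simp [completeSum_zero, map_prod]
    | succ m ihm =>
      have h := congrArg (coeff (m + 1)) key
      rw [add_mul, one_mul, map_add, mul_assoc, coeff_C_mul, coeff_succ_X_mul, ihm,
        ih (a + 1) (by omega)] at h
      have hca : c d = p ⟨a, by omega⟩ := by rw [hc]; congr 1; simp only; omega
      rw [completeSum_succ (show a < n by omega), ← hca]
      rw [eq_sub_of_add_eq h]; ring

lemma sum_powersetCard_eq_coeff {r d : ℕ} (hr : 1 ≤ r) (hd : d + r = n + 1) (t p : Fin n → 𝕜)
    {c : ℕ → 𝕜} (hc : ∀ j : Fin n, p j = c (n - 1 - j)) :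
    ∑ s ∈ Finset.range (r + 1), (-1) ^ (r + s) *
      (∑ J ∈ Finset.powersetCard s (Finset.univ : 𝔓ⁿ), ∏ j ∈ J, t j) *
      completeSum n (r - 1) (r - s) p =
    coeff r ((∏ j : Fin n, (1 + C (t j) * X)) * ∏ i ∈ Finset.range d, (1 + C (c i) * X)⁻¹) := by
  classical
  rw [coeff_prod_one_add_mul, ← sum_fiberwise_of_maps_to (g := Finset.card)
    (t := Finset.range (r + 1)) (fun S hS => by simpa [Nat.lt_succ_iff] using (mem_filter.1 hS).2)]
  refine sum_congr rfl fun s hs => ?_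
  rw [Finset.mem_range, Nat.lt_succ_iff] at hs
  have : ((Finset.univ.powerset.filter fun S : 𝔓ⁿ => S.card ≤ r).filter
      fun S => S.card = s) = Finset.powersetCard s Finset.univ := by
    grind
  rw [this, mul_assoc, sum_mul, mul_sum]
  refine sum_congr rfl fun S hS => ?_
  rw [(mem_powersetCard.1 hS).2, coeff_prod_inv hc d (r - 1) (by omega)]
  have : (-1 : 𝕜) ^ (r + s) = (-1) ^ (r - s) := by
    rw [show r + s = (r - s) + 2 * s by omega, pow_add, pow_mul]; simp
  rw [this]; ring

end genSeries

lemma E_eq_coeff {r d : ℕ} (hr : 1 ≤ r) (hd : d + r = n + 1) (t p : ℝⁿ)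
    {c : ℕ → ℝ} (hc : ∀ j : Fin n, p j = c (n - 1 - j)) :
    E n r t p = coeff r ((∏ j : Fin n, (1 + PowerSeries.C (t j) * PowerSeries.X)) *
      ∏ i ∈ Finset.range d, (1 + PowerSeries.C (c i) * PowerSeries.X)⁻¹) := by
  classical
  rw [← sum_powersetCard_eq_coeff hr hd t p hc, E]
  refine sum_congr rfl fun s _ => ?_
  congr 1
  rw [completeSum]
  simp

/-! ### Asymptotics along imaginary rays -/

/-- The point `y - i t c`. -/
def ray (y : ℂⁿ) (c : ℝⁿ) (t : ℝ) : ℂⁿ := fun j => y j + -(I * t * c j)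

lemma sineRatio_eq_exp (β κ : ℝ) (z : ℂ) : sineRatio β κ z =
    (exp (-(β * κ / 2)) * exp (I * z) - exp (β * κ / 2)) / (exp (I * z) - 1) := by
  rw [sineRatio, sin_half_eq, sin_half_eq]
  have e1 : exp (I * (I * β * κ + z)) = exp (-(β * κ / 2)) * exp (-(β * κ / 2)) * exp (I * z) := by
    rw [← exp_add, ← exp_add]; congr 1
    linear_combination (β * κ : ℂ) * I_mul_I
  have e2 : exp (-(I * (I * β * κ + z) / 2)) = exp (β * κ / 2) * exp (-(I * z / 2)) := by
    rw [← exp_add]; congr 1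
    linear_combination (-(β * κ : ℂ) / 2) * I_mul_I
  have e3 : exp (-(β * κ / 2)) * exp (β * κ / 2) = (1 : ℂ) := by
    rw [← exp_add, neg_add_cancel, exp_zero]
  have h0 := exp_ne_zero (-(I * z / 2))
  have hI := I_ne_zero
  grind

lemma exp_ray (z : ℂ) (s t : ℝ) : exp (I * (z + -(I * t * s))) =
    exp (I * z) * exp ((t * s : ℝ) : ℂ) := by
  rw [← exp_add]; congr 1; push_cast
  linear_combination (-(t * s : ℂ)) * I_mul_I

lemma tendsto_exp_zero {s : ℝ} (hs : s < 0) :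
    Tendsto (fun t : ℝ => exp ((t * s : ℝ) : ℂ)) atTop (𝓝 0) := by
  simp only [← Complex.ofReal_exp]
  rw [← ofReal_zero]
  refine (continuous_ofReal.tendsto 0).comp (Real.tendsto_exp_atBot.comp ?_)
  exact tendsto_id.atTop_mul_const_of_neg hs

lemma tendsto_sineRatio_neg (β κ : ℝ) (z : ℂ) {s : ℝ} (hs : s < 0) :
    Tendsto (fun t : ℝ => sineRatio β κ (z + -(I * t * s))) atTop (𝓝 (exp (β * κ / 2))) := by
  simp only [sineRatio_eq_exp, exp_ray]
  have h := (tendsto_exp_zero hs).const_mul (exp (I * z))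
  rw [mul_zero] at h
  have := ((h.const_mul (exp (-(β * κ / 2)))).sub_const (exp (β * κ / 2))).div
    (h.sub_const 1) (by simp)
  simpa [Pi.div_def] using this

lemma tendsto_sineRatio_pos (β κ : ℝ) (z : ℂ) {s : ℝ} (hs : 0 < s) :
    Tendsto (fun t : ℝ => sineRatio β κ (z + -(I * t * s))) atTop (𝓝 (exp (-(β * κ / 2)))) := by
  simp only [sineRatio_eq_exp, exp_ray]
  have h := (tendsto_exp_zero (neg_neg_of_pos hs)).const_mul (exp (-(I * z)))
  rw [mul_zero] at h
  have := ((h.const_mul (-exp (β * κ / 2))).add_const (exp (-(β * κ / 2)))).div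
    ((h.const_mul (-1)).add_const 1) (by simp)
  simp only [mul_zero, zero_add, div_one, Pi.div_def] at this
  refine this.congr fun t => ?_
  have e : exp (-(I * z)) * exp ((t * -s : ℝ) : ℂ) * (exp (I * z) * exp ((t * s : ℝ) : ℂ)) = 1 := by
    rw [← exp_add, ← exp_add, ← exp_add, ← exp_zero]
    congr 1; push_cast; ring
  grind

lemma exists_tendsto_sineRatio (β κ : ℝ) (z : ℂ) (s : ℝ) :
    ∃ L, Tendsto (fun t : ℝ => sineRatio β κ (z + -(I * t * s))) atTop (𝓝 L) := by
  rcases lt_trichotomy s 0 with h | rfl | h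
  · exact ⟨_, tendsto_sineRatio_neg β κ z h⟩
  · exact ⟨sineRatio β κ z, by simp⟩
  · exact ⟨_, tendsto_sineRatio_pos β κ z h⟩

lemma sign_cast_real (a : SignType) : (((a : ℝ)) : ℂ) = (a : ℂ) := by cases a <;> simp

variable (P : Couplings) (β : ℝ) (y : Fin n → ℂ) (c : Fin n → ℝ)

lemma exists_tendsto_siteW_ray (a : SignType) (j : Fin n) :
    ∃ L, Tendsto (fun t => siteW P β a (ray y c t j)) atTop (𝓝 L) := by
  by_cases ha : a = 0
  · subst ha; exact ⟨1, by simp⟩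
  have key : ∀ κ w, ∃ L, Tendsto (fun t => sineRatio β κ ((a : ℂ) * ray y c t j + w)) atTop (𝓝 L) := by
    intro κ w
    obtain ⟨L, hL⟩ := exists_tendsto_sineRatio β κ ((a : ℂ) * y j + w) (a * c j)
    refine ⟨L, hL.congr fun t => ?_⟩
    congr 1; simp only [ray]; push_cast; rw [sign_cast_real]; ring
  obtain ⟨L1, h1⟩ := key P.g₀ 0
  obtain ⟨L2, h2⟩ := key P.g₁ Real.pi
  obtain ⟨L3, h3⟩ := key P.g₀' (gam β)
  obtain ⟨L4, h4⟩ := key P.g₁' (gam β + Real.pi)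
  refine ⟨_, (((h1.mul h2).mul h3).mul h4).congr fun t => ?_⟩
  rw [siteW, if_neg ha, vB_eq]
  simp only [add_zero, add_assoc]

lemma exists_tendsto_pairW_ray (a b : SignType) (j k : Fin n) :
    ∃ L, Tendsto (fun t => pairW P β a b (ray y c t j) (ray y c t k)) atTop (𝓝 L) := by
  have key : ∀ (a b : SignType) w, ∃ L, Tendsto (fun t => vA P β
      ((a : ℂ) * ray y c t j + (b : ℂ) * ray y c t k + w)) atTop (𝓝 L) := by
    intro a b w
    obtain ⟨L, hL⟩ := exists_tendsto_sineRatio β P.g ((a : ℂ) * y j + (b : ℂ) * y k + w)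
      (a * c j + b * c k)
    refine ⟨L, hL.congr fun t => ?_⟩
    rw [vA_eq]
    congr 1; simp only [ray]; push_cast; rw [sign_cast_real, sign_cast_real]; ring
  unfold pairW
  split_ifs with ha hb hb
  · exact ⟨1, tendsto_const_nhds⟩
  · obtain ⟨L1, h1⟩ := key 1 b 0
    obtain ⟨L2, h2⟩ := key (-1) b 0
    refine ⟨_, (h1.mul h2).congr fun t => ?_⟩
    congr 2 <;> simp <;> ring
  · obtain ⟨L1, h1⟩ := key a 1 0
    obtain ⟨L2, h2⟩ := key a (-1) 0
    refine ⟨_, (h1.mul h2).congr fun t => ?_⟩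
    congr 2 <;> simp; ring
  · obtain ⟨L1, h1⟩ := key a b 0
    obtain ⟨L2, h2⟩ := key a b (2 * gam β)
    refine ⟨_, (h1.mul h2).congr fun t => ?_⟩
    simp

lemma exists_tendsto_cellW_ray (K : 𝔓ⁿ) (τ : 𝕊ⁿ) :
    ∃ L, Tendsto (fun t => cellW P β (ray y c t) K τ) atTop (𝓝 L) := by
  choose L1 h1 using fun j => exists_tendsto_siteW_ray P β y c (τ j) j
  choose L2 h2 using fun i j => exists_tendsto_pairW_ray P β y c (τ i) (τ j) i j
  exact ⟨_, (tendsto_finsetProd K fun j _ => h1 j).mul (tendsto_finsetProd _ fun q _ => h2 q.1 q.2)⟩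

lemma tendsto_chainSum_of_tendsto {X : Type*} {l : Filter X} {W : X → 𝔓ⁿ → 𝕊ⁿ → ℂ}
    {W0 : 𝔓ⁿ → 𝕊ⁿ → ℂ}
    (h : ∀ K τ, Tendsto (fun x => W x K τ) l (𝓝 (W0 K τ))) (m : ℕ) :
    ∀ K, Tendsto (fun x => chainSum (W x) m K) l (𝓝 (chainSum W0 m K)) := by
  induction m using Nat.strong_induction_on with | _ m ih =>
  intro K
  rcases Nat.eq_zero_or_pos m with rfl | hm
  · simp only [chainSum_zero]; exact tendsto_const_nhds
  · simp only [chainSum_eq_neg _ hm.ne']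
    refine (tendsto_finsetSum _ fun τ hτ => (h K τ).mul (ih _ ?_ _)).neg
    have : 0 < (supp τ).card := card_pos.2 (Finset.nonempty_iff_ne_empty.2 fun h =>
      (mem_erase.1 hτ).1 (supp_eq_empty.1 h))
    omega

/-! ### Growth of trigonometric polynomials along rays -/

/-- The pairing of a weight with a real direction. -/
def pairing (ν : ℤⁿ) (c : ℝⁿ) : ℝ := ∑ j, (ν j : ℝ) * c j

lemma expo_ray (ν : ℤⁿ) (t : ℝ) :
    expo ν (ray y c t) = expo ν y * exp ((t * pairing ν c : ℝ) : ℂ) := by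
  have : ray y c t = y + fun j => -(I * t * c j) := rfl
  rw [this, expo_add]
  congr 1
  rw [expo]
  congr 1
  simp only [lin, pairing, ofReal_mul, ofReal_sum, mul_sum, Complex.ofReal_intCast]
  refine sum_congr rfl fun j _ => ?_
  linear_combination (-(ν j : ℂ) * t * c j) * I_mul_I

lemma tendsto_expo_ray {ν : ℤⁿ} {M : ℝ} (h : pairing ν c ≤ M) :
    Tendsto (fun t : ℝ => expo ν (ray y c t) * exp (-((t * M : ℝ) : ℂ))) atTop
      (𝓝 (if pairing ν c = M then expo ν y else 0)) := by
  have e : ∀ t : ℝ, expo ν (ray y c t) * exp (-((t * M : ℝ) : ℂ)) =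
      expo ν y * exp ((t * (pairing ν c - M) : ℝ) : ℂ) := by
    intro t
    rw [expo_ray, mul_assoc, ← exp_add]; congr 2; push_cast; ring
  simp only [e]
  split_ifs with h1
  · simp [h1]
  · simpa using (tendsto_exp_zero (sub_neg_of_lt (lt_of_le_of_ne h h1))).const_mul (expo ν y)

lemma contDiff_toC {m : WithTop ℕ∞} : ContDiff ℝ m (toC : ℝⁿ → ℂⁿ) :=
  contDiff_pi.2 fun j => ofRealCLM.contDiff.comp (contDiff_apply ℝ ℝ j)

lemma continuous_toC : Continuous (toC : ℝⁿ → ℂⁿ) := (contDiff_toC (m := 0)).continuous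

lemma mem_regularC_of_re {β : ℝ} {z : ℂⁿ} (hx : x ∈ regularSet n)
    (hz : ∀ j, (z j).re = x j) : z ∈ regularC n β := by
  have key : ∀ w : ℂ, Real.sin (w.re / 2) ≠ 0 → exp (I * w) - 1 ≠ 0 := by
    intro w hw h
    have := sin_ne_zero_of_re (z := w / 2) (by simpa using hw)
    rw [sin_half_eq, h, zero_mul] at this
    exact this rfl
  have sc : ∀ a : NZSign, (a.1 = 1 ∧ (a.1 : ℂ) = 1) ∨ (a.1 = -1 ∧ (a.1 : ℂ) = -1) := by
    rintro ⟨a, ha⟩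
    cases a
    · exact absurd rfl ha
    · right; simp
    · left; simp
  rintro (⟨j, a, s, t⟩ | ⟨⟨⟨j, k⟩, hjk⟩, a, b, s⟩)
  · refine key _ ?_
    have h := hx.1 j
    rw [lin_inl]
    have hg : (if s then gam β else 0 : ℂ).re = 0 := by cases s <;> simp [gam]
    rcases sc a with ⟨-, e⟩ | ⟨-, e⟩ <;> rw [e] <;> cases t <;>
      simp only [wC, add_re, hg, Bool.false_eq_true, if_false, if_true,
        one_mul, neg_mul, neg_re, hz, ofReal_re, zero_add, add_zero]
    · exact h.1
    · rw [add_div, sin_add_pi_div_two]; exact h.2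
    · rw [neg_div, sin_neg]; exact neg_ne_zero.2 h.1
    · rw [add_div, sin_add_pi_div_two, neg_div, Real.cos_neg]; exact h.2
  · refine key _ ?_
    have h := hx.2 j k hjk
    rw [lin_inr]
    have hg : (if s then 2 * gam β else 0 : ℂ).re = 0 := by cases s <;> simp [gam]
    rcases sc a with ⟨-, e⟩ | ⟨-, e⟩ <;> rw [e] <;> rcases sc b with ⟨-, e'⟩ | ⟨-, e'⟩ <;> rw [e'] <;>
      simp only [wC, add_re, hg, one_mul, neg_mul, neg_re, hz, add_zero]
    · exact h.1
    · exact h.2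
    · rw [show (-x j + x k) / 2 = -((x j - x k) / 2) by ring, sin_neg]
      exact neg_ne_zero.2 h.2
    · rw [show (-x j + -x k) / 2 = -((x j + x k) / 2) by ring, sin_neg]
      exact neg_ne_zero.2 h.1

lemma toC_mem_regularC {β : ℝ} (hx : x ∈ regularSet n) : toC x ∈ regularC n β :=
  mem_regularC_of_re hx fun _ => rfl

lemma ray_mem_regularC {β : ℝ} (hx : x ∈ regularSet n) (c : ℝⁿ) (t : ℝ) :
    ray (toC x) c t ∈ regularC n β :=
  mem_regularC_of_re hx fun j => by simp [ray, toC]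

lemma mem_regularSet_of_wallZ
    (h : ∀ w : WallIx n, wallZ (wNu w) (wC 0 w) (toC x) ≠ 0) : x ∈ regularSet n := by
  have key : ∀ (w : WallIx n) (u : ℝ), lin (wNu w) (toC x) + wC 0 w = u → Real.sin (u / 2) ≠ 0 := by
    intro w u hu h0
    refine sin_half_ne_zero (h w) ?_
    rw [hu]
    exact_mod_cast congrArg (fun r : ℝ => (r : ℂ)) h0
  refine ⟨fun j => ⟨?_, ?_⟩, fun j k hjk => ⟨?_, ?_⟩⟩
  · refine key (.inl (j, posSign, false, false)) _ ?_
    rw [lin_inl]; simp [wC, posSign, toC]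
  · rw [← sin_add_pi_div_two, ← add_div]
    refine key (.inl (j, posSign, false, true)) _ ?_
    rw [lin_inl]; simp [wC, posSign, toC]
  · refine key (.inr (⟨(j, k), hjk⟩, posSign, posSign, false)) _ ?_
    rw [lin_inr]; simp [wC, posSign, toC]
  · refine key (.inr (⟨(j, k), hjk⟩, posSign, negSign, false)) _ ?_
    rw [lin_inr]; simp [wC, posSign, negSign, toC, sub_eq_add_neg]

lemma dense_regularSet (n : ℕ) : Dense (regularSet n) := by
  have h : Dense {x : Fin n → ℝ | ∀ w : WallIx n, wallZ (wNu w) (wC 0 w) (toC x) ≠ 0} := by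
    have e : {x : Fin n → ℝ | ∀ w : WallIx n, wallZ (wNu w) (wC 0 w) (toC x) ≠ 0} =
        ⋂ w : WallIx n, {x | wallZ (wNu w) (wC 0 w) (toC x) ≠ 0} := by ext; simp
    rw [e]
    have hd : ∀ w : WallIx n, ContDiff ℝ ω fun x : Fin n → ℝ => wallZ (wNu w) (wC 0 w) (toC x) :=
      fun w => ((contDiff_trigPoly (wallZ_mem _ _)).restrict_scalars ℝ).comp contDiff_toC
    refine dense_iInter_of_isOpen (fun w => isOpen_ne_fun (hd w).continuous continuous_const)
      fun w => ?_
    obtain ⟨j, hj⟩ := exists_wNu_sq w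
    obtain ⟨u, hu⟩ : ∃ u : ℝ, wC 0 w = (u : ℂ) := by
      rcases w with ⟨j, a, s, t⟩ | ⟨q, a, b, s⟩
      · exact ⟨if t then Real.pi else 0, by cases s <;> cases t <;> simp [wC, gam]⟩
      · exact ⟨0, by simp [wC, gam]⟩
    refine dense_ne_zero (𝕜 := ℝ) (x₀ := single j ((wNu w j : ℝ) * (Real.pi - u)))
      (fun y _ => (hd w).contDiffAt.analyticAt) ?_
    have e1 : toC (single j ((wNu w j : ℝ) * (Real.pi - u))) =
        (single j ((wNu w j : ℂ) * (Real.pi - u)) : Fin n → ℂ) := by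
      ext i
      by_cases hi : i = j
      · subst hi; simp [toC]
      · simp [toC, hi]
    have e2 : ((wNu w j : ℂ)) * wNu w j = 1 := by exact_mod_cast hj
    rw [e1, wallZ, lin_single, ← mul_assoc, e2, one_mul, hu, sub_add_cancel, mul_comm, exp_pi_mul_I]
    norm_num
  exact h.mono fun x hx => mem_regularSet_of_wallZ hx

lemma finsupp_eq_zero_of_regular {a : ℤⁿ →₀ ℂ}
    (h : ∀ x ∈ regularSet n, (a.sum fun ν b => b * expo ν (toC x)) = 0) : a = 0 := by
  refine linearIndependent_iff.1 linearIndependent_expo_real a ?_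
  have hc : Continuous fun x : ℝⁿ => a.sum fun ν b => b * expo ν (toC x) :=
    continuous_finsetSum _ fun ν _ => continuous_const.mul
      ((continuous_trigPoly (expo_mem ν)).comp continuous_toC)
  have := Continuous.ext_on (dense_regularSet n) hc continuous_const h
  ext x
  have hx := congrFun this x
  rw [Finsupp.linearCombination_apply]
  simpa [Finsupp.sum, Finset.sum_apply] using hx

lemma pairing_le_of_tendsto {a : ℤⁿ →₀ ℂ} {M : ℝ}
    (h : ∀ x ∈ regularSet n, ∃ L, Tendsto (fun t : ℝ =>
      (a.sum fun ν b => b * expo ν (ray (toC x) c t)) * exp (-((t * M : ℝ) : ℂ))) atTop (𝓝 L))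
    (ν : ℤⁿ) (hν : ν ∈ a.support) : pairing ν c ≤ M := by
  obtain ⟨ν₀, h₀, hmax⟩ := Finset.exists_max_image a.support (fun ν => pairing ν c) ⟨ν, hν⟩
  refine (hmax ν hν).trans ?_
  by_contra hlt
  rw [not_le] at hlt
  set M' := pairing ν₀ c
  have key : a.filter (fun ν => pairing ν c = M') = 0 := by
    refine finsupp_eq_zero_of_regular fun x hx => ?_
    obtain ⟨L, hL⟩ := h x hx
    have h1 := hL.mul (tendsto_exp_zero (sub_neg_of_lt hlt))
    rw [mul_zero] at h1
    have h2 : Tendsto (fun t : ℝ => a.sum fun ν b =>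
        b * (expo ν (ray (toC x) c t) * exp (-((t * M' : ℝ) : ℂ)))) atTop
        (𝓝 (a.sum fun ν b => b * if pairing ν c = M' then expo ν (toC x) else 0)) :=
      tendsto_finsetSum _ fun ν hν => (tendsto_expo_ray _ _ (hmax ν hν)).const_mul _
    have h3 := tendsto_nhds_unique h2 (h1.congr fun t => by
      rw [mul_assoc, ← exp_add, Finsupp.sum, Finsupp.sum, sum_mul]
      refine sum_congr rfl fun ν _ => ?_
      rw [mul_assoc]; congr 3; push_cast; ring)
    rw [← h3, Finsupp.sum, Finsupp.sum, Finsupp.support_filter, sum_filter]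
    simp_all
  have : a ν₀ = 0 := by
    have := DFunLike.congr_fun key ν₀
    rwa [Finsupp.filter_apply, if_pos rfl] at this
  exact (mem_support_iff.1 h₀) this

/-! ### Weights and dominance -/

/-- The action of signed permutations on weights. -/
def actZ (w : 𝕎ⁿ) (ν : ℤⁿ) : ℤⁿ := fun j => (w.2 j : ℤ) * ν (w.1 j)

lemma units_mul_self (e : ℤˣ) : (e : ℤ) * (e : ℤ) = 1 := by
  rcases units_eq_one_or e with rfl | rfl <;> norm_num

lemma actZ_actZ (w w' : 𝕎ⁿ) (ν : ℤⁿ) :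
    actZ w (actZ w' ν) = actZ (w'.1 * w.1, fun j => w.2 j * w'.2 (w.1 j)) ν := by
  ext j; simp [actZ, mul_assoc]

lemma actZ_one (ν : ℤⁿ) : actZ (1, fun _ => 1) ν = ν := by ext j; simp [actZ]

lemma actZ_inv_left (w : 𝕎ⁿ) (ν : ℤⁿ) : actZ (w.1⁻¹, fun j => w.2 (w.1⁻¹ j)) (actZ w ν) = ν := by
  ext j; simp [actZ, ← mul_assoc]

lemma actZ_inv_right (w : 𝕎ⁿ) (ν : ℤⁿ) : actZ w (actZ (w.1⁻¹, fun j => w.2 (w.1⁻¹ j)) ν) = ν := by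
  ext j; simp [actZ, ← mul_assoc]

/-- The action of a signed permutation as an equivalence. -/
def actZEquiv (w : 𝕎ⁿ) : ℤⁿ ≃ ℤⁿ where
  toFun := actZ w
  invFun := actZ (w.1⁻¹, fun j => w.2 (w.1⁻¹ j))
  left_inv := actZ_inv_left w
  right_inv := actZ_inv_right w

lemma expo_actZ (w : 𝕎ⁿ) (ν : ℤⁿ) (x : ℂⁿ) : expo (actZ w ν) (weylAct w x) = expo ν x := by
  rw [expo, expo]
  congr 2
  rw [lin, lin, ← sum_comp w.1 fun j => (ν j : ℂ) * x j]
  refine sum_congr rfl fun j _ => ?_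
  rw [actZ, weylAct]
  push_cast
  exact unit_mul_self _ _ _

lemma mem_weylOrbit {lam ν : ℤⁿ} : ν ∈ weylOrbit lam ↔ ∃ w, actZ w lam = ν := by
  simp only [weylOrbit, Finset.mem_image, Finset.mem_univ, true_and]; rfl

lemma self_mem_weylOrbit (lam : ℤⁿ) : lam ∈ weylOrbit lam := mem_weylOrbit.2 ⟨_, actZ_one lam⟩

lemma actZ_mem_weylOrbit {lam ν : ℤⁿ} (w : 𝕎ⁿ) :
    actZ w ν ∈ weylOrbit lam ↔ ν ∈ weylOrbit lam := by
  constructor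
  · intro h
    obtain ⟨w', hw'⟩ := mem_weylOrbit.1 h
    have := actZ_inv_left w ν
    rw [← hw', actZ_actZ] at this
    exact mem_weylOrbit.2 ⟨_, this⟩
  · intro h
    obtain ⟨w', rfl⟩ := mem_weylOrbit.1 h
    rw [actZ_actZ]
    exact mem_weylOrbit.2 ⟨_, rfl⟩

lemma weylOrbit_symm {lam ν : ℤⁿ} (h : ν ∈ weylOrbit lam) : lam ∈ weylOrbit ν := by
  obtain ⟨w, rfl⟩ := mem_weylOrbit.1 h
  exact mem_weylOrbit.2 ⟨_, actZ_inv_left w lam⟩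

/-- The orbit sums, as functions on `ℂⁿ`. -/
def monoC (lam : ℤⁿ) (x : ℂⁿ) : ℂ := ∑ ν ∈ weylOrbit lam, expo ν x

lemma monomialSymm_eq (lam : ℤⁿ) (x : ℝⁿ) : monomialSymm lam x = monoC lam (toC x) := rfl

lemma monoC_mem (lam : ℤⁿ) : monoC lam ∈ trigPoly n := by
  have : monoC lam = ∑ ν ∈ weylOrbit lam, expo ν := by ext x; simp [monoC]
  rw [this]; exact sum_mem fun ν _ => expo_mem ν

lemma isWeylInv_monoC (lam : ℤⁿ) : IsWeylInv (monoC lam) := fun w x =>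
  (Finset.sum_equiv (actZEquiv w) (fun _ => (actZ_mem_weylOrbit w).symm)
    fun ν _ => (expo_actZ w ν x).symm).symm

/-- The partial sums of a weight. -/
def partSum (k : Fin n) (ν : ℤⁿ) : ℤ := ∑ j ∈ Finset.Iic k, ν j

lemma partSum_actZ_le (h : IsDominant lam) (w : 𝕎ⁿ) (k : Fin n) :
    partSum k (actZ w lam) ≤ partSum k lam := by
  have h1 : partSum k (actZ w lam) ≤ ∑ j ∈ Finset.Iic k, lam (w.1 j) := by
    refine sum_le_sum fun j _ => ?_
    have := h.2 (w.1 j)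
    rcases units_eq_one_or (w.2 j) with e | e <;> simp [actZ, e]
    exact this
  refine h1.trans ?_
  have hm : Monovary (fun j : Fin n => if j ∈ Finset.Iic k then (1 : ℤ) else 0) lam := by
    intro i j hij
    have hji : j < i := by
      by_contra hle
      exact absurd (h.1 (not_lt.1 hle)) hij.not_ge
    grind
  have := hm.sum_mul_comp_perm_le_sum_mul (σ := w.1)
  simpa only [partSum, ite_mul, one_mul, zero_mul, Finset.sum_ite_mem, Finset.univ_inter] using this

lemma partSum_le_of_mem {lam ν : ℤⁿ} (h : IsDominant lam) (hν : ν ∈ weylOrbit lam)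
    (k : Fin n) : partSum k ν ≤ partSum k lam := by
  obtain ⟨w, rfl⟩ := mem_weylOrbit.1 hν
  exact partSum_actZ_le h w k

lemma eq_of_partSum_eq {ν μ : ℤⁿ} (h : ∀ k, partSum k ν = partSum k μ) : ν = μ := by
  ext j
  induction j using WellFoundedLT.induction with
  | _ j ih =>
    have hj := h j
    have hn : j ∉ Finset.Iio j := by simp
    rw [partSum, partSum, ← Finset.Iio_insert, sum_insert hn, sum_insert hn,
      sum_congr rfl fun i hi => ih i (Finset.mem_Iio.1 hi)] at hj
    exact add_right_cancel hj

lemma eq_of_mem_weylOrbit {lam μ : ℤⁿ} (h : IsDominant lam) (hμ : IsDominant μ)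
    (hm : μ ∈ weylOrbit lam) : μ = lam :=
  eq_of_partSum_eq fun k => le_antisymm (partSum_le_of_mem h hm k)
    (partSum_le_of_mem hμ (weylOrbit_symm hm) k)

lemma exists_dominant (ν : ℤⁿ) : ∃ μ, IsDominant μ ∧ ν ∈ weylOrbit μ := by
  set σ := Tuple.sort fun j => -|ν j| with hσ
  have hs : Monotone ((fun j => -|ν j|) ∘ σ) := Tuple.monotone_sort _
  set ε : Fin n → ℤˣ := fun j => if 0 ≤ ν (σ j) then 1 else -1
  have e : ∀ j, actZ (σ, ε) ν j = |ν (σ j)| := by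
    intro j
    simp only [actZ, ε]
    split_ifs with h
    · simp [abs_of_nonneg h]
    · simp [abs_of_neg (not_le.1 h)]
  refine ⟨actZ (σ, ε) ν, ⟨fun i j hij => ?_, fun j => ?_⟩, weylOrbit_symm (mem_weylOrbit.2 ⟨_, rfl⟩)⟩
  · rw [e, e]; exact neg_le_neg_iff.1 (hs hij)
  · rw [e]; exact abs_nonneg _

/-- The dominant representative of the orbit of a weight. -/
def domRep (ν : ℤⁿ) : ℤⁿ := (exists_dominant ν).choose

lemma isDominant_domRep (ν : ℤⁿ) : IsDominant (domRep ν) := (exists_dominant ν).choose_spec.1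

lemma mem_weylOrbit_domRep (ν : ℤⁿ) : ν ∈ weylOrbit (domRep ν) :=
  (exists_dominant ν).choose_spec.2

lemma domRep_eq_iff {ν μ : ℤⁿ} (hμ : IsDominant μ) : domRep ν = μ ↔ ν ∈ weylOrbit μ := by
  constructor
  · rintro rfl; exact mem_weylOrbit_domRep ν
  · intro h
    refine eq_of_mem_weylOrbit hμ (isDominant_domRep ν) ?_
    obtain ⟨w, hw⟩ := mem_weylOrbit.1 (weylOrbit_symm (mem_weylOrbit_domRep ν))
    rw [← hw, actZ_mem_weylOrbit]; exact h

lemma finite_lower (lam : ℤⁿ) :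
    {μ : ℤⁿ | IsDominant μ ∧ ∀ k, partSum k μ ≤ partSum k lam}.Finite := by
  refine (Set.finite_Icc (0 : ℤⁿ) fun k => partSum k lam).subset ?_
  rintro μ ⟨h1, h2⟩
  refine ⟨h1.2, fun k => le_trans ?_ (h2 k)⟩
  exact Finset.single_le_sum (f := μ) (fun j _ => h1.2 j) (by simp)

/-- The dominant weights below `lam`. -/
def lower (lam : ℤⁿ) : Finset ℤⁿ := (finite_lower lam).toFinset

lemma mem_lower {lam μ : ℤⁿ} :
    μ ∈ lower lam ↔ IsDominant μ ∧ ∀ k, partSum k μ ≤ partSum k lam := by simp [lower]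

lemma self_mem_lower (h : IsDominant lam) : lam ∈ lower lam := mem_lower.2 ⟨h, fun _ => le_rfl⟩

lemma mem_lower_erase {lam μ : ℤⁿ} : μ ∈ (lower lam).erase lam ↔ IsDominant μ ∧ DomLT μ lam := by
  rw [mem_erase, mem_lower, DomLT]
  simp only [partSum]; tauto

lemma lower_trans {lam μ ν : ℤⁿ} (h1 : ν ∈ lower μ) (h2 : μ ∈ lower lam) : ν ∈ lower lam :=
  mem_lower.2 ⟨(mem_lower.1 h1).1, fun k => ((mem_lower.1 h1).2 k).trans ((mem_lower.1 h2).2 k)⟩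

/-! ### Invariant trigonometric polynomials -/

lemma coeff_actZ {a : ℤⁿ →₀ ℂ} {G : ℂⁿ → ℂ}
    (ha : ∀ x, G x = a.sum fun ν b => b * expo ν x) (hG : IsWeylInv G)
    (w : 𝕎ⁿ) (ν : ℤⁿ) : a (actZ w ν) = a ν := by
  set b := a.equivMapDomain (actZEquiv w).symm with hb
  have hbν : ∀ ν, b ν = a (actZ w ν) := fun ν => by simp [hb, Finsupp.equivMapDomain_apply]; rfl
  have key : b - a = 0 := by
    refine finsupp_eq_zero_of_regular fun x _ => ?_
    rw [Finsupp.sum_sub_index (fun _ _ _ => sub_mul _ _ _), ← ha, hb, Finsupp.equivMapDomain_eq_mapDomain,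
      Finsupp.sum_mapDomain_index (fun _ => zero_mul _) (fun _ _ _ => add_mul _ _ _), sub_eq_zero,
      ← hG w, ha]
    refine sum_congr rfl fun ν _ => ?_
    simp only
    rw [← expo_actZ w]
    congr 2
    exact (actZEquiv w).apply_symm_apply ν
  rw [← hbν, sub_eq_zero.1 key]

lemma eq_sum_monoC {a : ℤⁿ →₀ ℂ} {G : ℂⁿ → ℂ}
    (ha : ∀ x, G x = a.sum fun ν b => b * expo ν x) (hG : IsWeylInv G)
    {s : Finset ℤⁿ} (hs : ∀ μ, IsDominant μ → μ ∈ a.support → μ ∈ s)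
    (hd : ∀ μ ∈ s, IsDominant μ) (x : ℂⁿ) : G x = ∑ μ ∈ s, a μ * monoC μ x := by
  have hinv : ∀ {ν μ}, ν ∈ weylOrbit μ → a ν = a μ := by
    intro ν μ h
    obtain ⟨w, rfl⟩ := mem_weylOrbit.1 h
    exact coeff_actZ ha hG w μ
  rw [ha, Finsupp.sum, ← sum_fiberwise_of_maps_to (g := domRep) (t := s) (fun ν hν =>
    hs _ (isDominant_domRep ν) (mem_support_iff.2 (by
      rw [← hinv (mem_weylOrbit_domRep ν)]; exact mem_support_iff.1 hν)))]
  refine sum_congr rfl fun μ hμ => ?_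
  rw [monoC, mul_sum]
  have : a.support.filter (fun ν => domRep ν = μ) ⊆ weylOrbit μ := fun ν hν =>
    (domRep_eq_iff (hd μ hμ)).1 (mem_filter.1 hν).2
  rw [← sum_subset this]
  · refine sum_congr rfl fun ν hν => ?_
    rw [hinv (this hν)]
  · intro ν hν hn
    by_contra h0
    refine hn (mem_filter.2 ⟨mem_support_iff.2 ?_, (domRep_eq_iff (hd μ hμ)).2 hν⟩)
    rw [hinv hν]; exact left_ne_zero_of_mul h0

/-! ### Triangularity of the difference operators -/

section triangular

variable (P : Couplings) (β : ℝ)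

lemma ray_add (x v : ℂⁿ) (c : ℝⁿ) (t : ℝ) : ray x c t + v = ray (x + v) c t := by
  ext j; simp only [ray, Pi.add_apply]; ring

lemma tendsto_differenceOp_ray {r : ℕ} (hr : r ≠ 0) {c : ℝⁿ} {M : ℝ}
    (hM : ∀ ν ∈ weylOrbit lam, pairing ν c ≤ M) (y : ℂⁿ)
    {W0 : 𝔓ⁿ → 𝕊ⁿ → ℂ}
    (hW : ∀ K τ, Tendsto (fun t => cellW P β (ray y c t) K τ) atTop (𝓝 (W0 K τ))) :
    Tendsto (fun t : ℝ => differenceOp P r β (monoC lam) (ray y c t) *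
        exp (-((t * M : ℝ) : ℂ))) atTop
      (𝓝 (∑ τ ∈ cells Finset.univ r, W0 Finset.univ τ *
        chainSum W0 (r - (supp τ).card) (Finset.univ \ supp τ) *
        ∑ ν ∈ weylOrbit lam, if pairing ν c = M then expo ν (shift β τ y) else 0)) := by
  simp only [differenceOp_eq_sum P hr, sum_mul, mul_assoc]
  refine tendsto_finsetSum _ fun τ _ => (hW _ _).mul ((tendsto_chainSum_of_tendsto hW _ _).mul ?_)
  simp only [monoC, sum_mul]
  refine tendsto_finsetSum _ fun ν hν => ?_
  have : ∀ t, shift β τ (ray y c t) = ray (shift β τ y) c t := fun t => ray_add y _ c t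
  simp only [this]
  exact tendsto_expo_ray _ _ (hM ν hν)

/-- The direction `(n, n - 1, …, 1)`. -/
def dir0 (n : ℕ) (j : Fin n) : ℝ := (n : ℝ) - (j : ℕ)

lemma dir0_pos (j : Fin n) : 0 < dir0 n j := by
  have : ((j : ℕ) : ℝ) < n := by exact_mod_cast j.2
  rw [dir0]; linarith

lemma dir0_lt {i j : Fin n} (h : i < j) : dir0 n j < dir0 n i := by
  have : ((i : ℕ) : ℝ) < (j : ℕ) := by exact_mod_cast h
  rw [dir0, dir0]; linarith

/-- Half the sum of the coupling constants of the one-particle terms. -/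
def Couplings.half (P : Couplings) : ℝ := (P.g₀ + P.g₁ + P.g₀' + P.g₁') / 2

/-- The asymptotic values of the coefficients. -/
def asympQ (i : ℕ) : ℂ := exp (-(β * P.half)) * exp (-(β * P.g)) ^ i

lemma sign_cases (a : SignType) : a = 0 ∨ a = 1 ∨ a = -1 := by revert a; decide

lemma tendsto_siteW_ray (y : ℂⁿ) (a : SignType) (j : Fin n) :
    Tendsto (fun t => siteW P β a (ray y (dir0 n) t j)) atTop
      (𝓝 (exp (-(β * P.half)) ^ (a : ℤ))) := by
  by_cases ha : a = 0
  · subst ha; simp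
  have hr : ∀ κ w t, sineRatio β κ ((a : ℂ) * ray y (dir0 n) t j + w) =
      sineRatio β κ ((a : ℂ) * y j + w + -(I * t * ((a * dir0 n j : ℝ) : ℂ))) := by
    intro κ w t
    congr 1; simp only [ray]; push_cast; rw [sign_cast_real]; ring
  have e : ∀ t, siteW P β a (ray y (dir0 n) t j) =
      sineRatio β P.g₀ ((a : ℂ) * ray y (dir0 n) t j + 0) *
      sineRatio β P.g₁ ((a : ℂ) * ray y (dir0 n) t j + Real.pi) *
      sineRatio β P.g₀' ((a : ℂ) * ray y (dir0 n) t j + gam β) *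
      sineRatio β P.g₁' ((a : ℂ) * ray y (dir0 n) t j + (gam β + Real.pi)) := by
    intro t
    rw [siteW, if_neg ha, vB_eq]
    simp only [add_zero, add_assoc]
  simp only [e, hr]
  rcases (sign_cases a).resolve_left ha with rfl | rfl
  · have hs : 0 < ((1 : SignType) : ℝ) * dir0 n j := by simpa using dir0_pos j
    convert (((tendsto_sineRatio_pos β P.g₀ _ hs).mul (tendsto_sineRatio_pos β P.g₁ _ hs)).mul
      (tendsto_sineRatio_pos β P.g₀' _ hs)).mul (tendsto_sineRatio_pos β P.g₁' _ hs) using 2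
    rw [← exp_add, ← exp_add, ← exp_add]
    simp only [SignType.coe_one, zpow_one]
    congr 1; rw [Couplings.half]; push_cast; ring
  · have hs : ((-1 : SignType) : ℝ) * dir0 n j < 0 := by simpa using dir0_pos j
    convert (((tendsto_sineRatio_neg β P.g₀ _ hs).mul (tendsto_sineRatio_neg β P.g₁ _ hs)).mul
      (tendsto_sineRatio_neg β P.g₀' _ hs)).mul (tendsto_sineRatio_neg β P.g₁' _ hs) using 2
    rw [← exp_add, ← exp_add, ← exp_add]
    simp only [coe_neg_one, zpow_neg, zpow_one, ← exp_neg]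
    congr 1; rw [Couplings.half]; push_cast; ring

lemma tendsto_pairW_ray (y : ℂⁿ) (a b : SignType) {i j : Fin n} (hij : i < j) :
    Tendsto (fun t => pairW P β a b (ray y (dir0 n) t i) (ray y (dir0 n) t j)) atTop
      (𝓝 (exp (-(β * P.g)) ^ (a : ℤ))) := by
  have h1 := dir0_lt hij
  have h2 := dir0_pos j
  have pos : ∀ (a b : ℝ) (w : ℂ), 0 < a * dir0 n i + b * dir0 n j → Tendsto (fun t => vA P β
      ((a : ℂ) * ray y (dir0 n) t i + (b : ℂ) * ray y (dir0 n) t j + w)) atTop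
      (𝓝 (exp (-(β * P.g / 2)))) := by
    intro a b w h
    refine (tendsto_sineRatio_pos β P.g ((a : ℂ) * y i + (b : ℂ) * y j + w) h).congr fun t => ?_
    rw [vA_eq]
    congr 1; simp only [ray]; push_cast; ring
  have neg : ∀ (a b : ℝ) (w : ℂ), a * dir0 n i + b * dir0 n j < 0 → Tendsto (fun t => vA P β
      ((a : ℂ) * ray y (dir0 n) t i + (b : ℂ) * ray y (dir0 n) t j + w)) atTop
      (𝓝 (exp (β * P.g / 2))) := by
    intro a b w h
    refine (tendsto_sineRatio_neg β P.g ((a : ℂ) * y i + (b : ℂ) * y j + w) h).congr fun t => ?_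
    rw [vA_eq]
    congr 1; simp only [ray]; push_cast; ring
  have two : exp (-(β * P.g / 2)) * exp (-(β * P.g / 2)) =
      exp (-(β * P.g)) := by rw [← exp_add]; congr 1; ring
  have two' : exp (β * P.g / 2) * exp (β * P.g / 2) =
      (exp (-(β * P.g)))⁻¹ := by rw [← exp_add, ← exp_neg]; congr 1; ring
  have one : exp (-(β * P.g / 2)) * exp (β * P.g / 2) = 1 := by
    rw [← exp_add, neg_add_cancel, exp_zero]
  have h10 : ((1 : SignType) = 0) = False := eq_false (by decide)
  have hm10 : ((-1 : SignType) = 0) = False := eq_false (by decide)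
  unfold pairW
  rcases sign_cases a with rfl | rfl | rfl
  · simp only [if_true]
    simp only [SignType.coe_zero, zpow_zero]
    rcases sign_cases b with rfl | rfl | rfl
    · simp
    · rw [← one, mul_comm]
      simp only [h10, if_false]
      refine ((neg (-1) 1 0 (by linarith)).mul (pos 1 1 0 (by linarith))).congr fun t => ?_
      rw [mul_comm]; congr 2 <;> push_cast <;> simp <;> ring
    · rw [← one]
      simp only [hm10, if_false]
      refine ((pos 1 (-1) 0 (by linarith)).mul (neg (-1) (-1) 0 (by linarith))).congr fun t => ?_
      congr 2 <;> push_cast <;> simp <;> ring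
  · simp only [h10, if_false]
    simp only [SignType.coe_one, zpow_one]
    rw [← two]
    rcases sign_cases b with rfl | rfl | rfl
    · simp only [if_true]
      refine ((pos 1 1 0 (by linarith)).mul (pos 1 (-1) 0 (by linarith))).congr fun t => ?_
      congr 2 <;> push_cast <;> simp <;> ring
    · simp only [h10, if_false]
      refine ((pos 1 1 0 (by linarith)).mul (pos 1 1 (2 * gam β) (by linarith))).congr fun t => ?_
      congr 2 <;> push_cast <;> simp
    · simp only [hm10, if_false]
      refine ((pos 1 (-1) 0 (by linarith)).mul (pos 1 (-1) (2 * gam β) (by linarith))).congr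
        fun t => ?_
      congr 2 <;> push_cast <;> simp
  · simp only [hm10, if_false]
    simp only [coe_neg_one, zpow_neg, zpow_one]
    rw [← two']
    rcases sign_cases b with rfl | rfl | rfl
    · simp only [if_true]
      refine ((neg (-1) 1 0 (by linarith)).mul (neg (-1) (-1) 0 (by linarith))).congr fun t => ?_
      congr 2 <;> push_cast <;> simp <;> ring
    · simp only [h10, if_false]
      refine ((neg (-1) 1 0 (by linarith)).mul (neg (-1) 1 (2 * gam β) (by linarith))).congr
        fun t => ?_
      congr 2 <;> push_cast <;> simp
    · simp only [hm10, if_false]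
      refine ((neg (-1) (-1) 0 (by linarith)).mul (neg (-1) (-1) (2 * gam β) (by linarith))).congr
        fun t => ?_
      congr 2 <;> push_cast <;> simp

lemma tendsto_cellW_ray (y : ℂⁿ) (K : 𝔓ⁿ) (τ : 𝕊ⁿ) :
    Tendsto (fun t => cellW P β (ray y (dir0 n) t) K τ) atTop (𝓝 (asympW (asympQ P β) K τ)) := by
  have h : Tendsto (fun t => cellW P β (ray y (dir0 n) t) K τ) atTop
      (𝓝 ((∏ j ∈ K, exp (-(β * P.half)) ^ (τ j : ℤ)) *
        pairProd K fun i _ => exp (-(β * P.g)) ^ (τ i : ℤ))) :=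
    (tendsto_finsetProd K fun j _ => tendsto_siteW_ray P β y (τ j) j).mul
      (tendsto_finsetProd _ fun q hq => tendsto_pairW_ray P β y (τ q.1) (τ q.2) (mem_filter.1 hq).2)
  convert h using 2
  rw [pairProd_eq, ← prod_mul_distrib, asympW]
  refine prod_congr rfl fun j _ => ?_
  rw [← prod_filter, prod_const, asympQ, mul_zpow]
  congr 1
  rw [rankIn, ← zpow_natCast, ← zpow_natCast, zpow_comm]

/-- The eigenvalues of the difference operators. -/
def diffEig (r : ℕ) (lam : ℤⁿ) (β : ℝ) : ℝ :=
  E n r (fun j => 2 * cosh (β * shifted P lam j)) fun j => 2 * cosh (β * rho n P j)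

lemma shifted_eq (lam : ℤⁿ) (j : Fin n) :
    shifted P lam j = lam j + P.half + P.g * ((n - 1 - j : ℕ) : ℝ) := by
  have h : ((n - 1 - j : ℕ) : ℝ) = (n : ℝ) - ((j : ℕ) + 1) := by
    rw [Nat.sub_sub, Nat.cast_sub (by omega)]; push_cast; ring
  rw [shifted, rho, h, Couplings.half]; ring

lemma rho_eq (j : Fin n) : rho n P j = P.half + P.g * ((n - 1 - j : ℕ) : ℝ) := by
  have := shifted_eq P (0 : ℤⁿ) j
  simpa [shifted] using this

lemma asympQ_mul (lam : ℤ) (i : ℕ) : asympQ P β i * exp (-(β * lam)) +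
    (asympQ P β i * exp (-(β * lam)))⁻¹ = ((2 * cosh (β * (lam + P.half + P.g * i)) : ℝ) : ℂ) := by
  have : asympQ P β i * exp (-(β * lam)) = exp (-((β * (lam + P.half + P.g * i) : ℝ) : ℂ)) := by
    rw [asympQ, ← exp_nat_mul, ← exp_add, ← exp_add]
    congr 1; push_cast; ring
  rw [this, ← exp_neg, neg_neg, ofReal_mul 2, Complex.ofReal_cosh, Complex.cosh]
  push_cast; ring

lemma asympQ_add_inv (i : ℕ) : asympQ P β i + (asympQ P β i)⁻¹ =
      ((2 * cosh (β * (P.half + P.g * i)) : ℝ) : ℂ) := by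
  simpa using asympQ_mul P β 0 i

lemma expo_shift (ν : ℤⁿ) (τ : 𝕊ⁿ) (y : ℂⁿ) :
    expo ν (shift β τ y) = expo ν y * ∏ j, exp (-(β * ν j)) ^ (τ j : ℤ) := by
  have : shift β τ y = y + fun j => I * β * (τ j : ℂ) := rfl
  rw [this, expo_add]
  congr 1
  rw [expo, lin, mul_sum, Complex.exp_sum]
  refine prod_congr rfl fun j _ => ?_
  rw [← exp_int_mul, sign_cast_int]
  congr 1
  linear_combination ((ν j : ℂ) * β * τ j) * I_mul_I

lemma ofReal_completeSum (a m : ℕ) (p : ℝⁿ) :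
    ((completeSum n a m p : ℝ) : ℂ) = completeSum n a m fun j => (p j : ℂ) := by
  simp [completeSum]

lemma ofReal_E (r : ℕ) (t p : ℝⁿ) : ((E n r t p : ℝ) : ℂ) =
    ∑ s ∈ Finset.range (r + 1), (-1) ^ (r + s) *
      (∑ J ∈ Finset.powersetCard s (Finset.univ : 𝔓ⁿ), ∏ j ∈ J, (t j : ℂ)) *
      completeSum n (r - 1) (r - s) fun j => (p j : ℂ) := by
  classical
  rw [E, ofReal_sum]
  refine sum_congr rfl fun s _ => ?_
  rw [ofReal_mul]
  congr 1
  · push_cast; rfl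
  · rw [← ofReal_completeSum, completeSum]
    simp

lemma sum_asympW_eq_diffEig {r : ℕ} (hr : 1 ≤ r) (hrn : r ≤ n) (lam : ℤⁿ) :
    ∑ τ ∈ cells (Finset.univ : 𝔓ⁿ) r, asympW (asympQ P β) Finset.univ τ *
      chainSum (asympW (asympQ P β)) (r - (supp τ).card) (Finset.univ \ supp τ) *
        ∏ j, exp (-(β * lam j)) ^ (τ j : ℤ) = (diffEig P r lam β : ℂ) := by
  have hd : (n + 1 - r) + r = n + 1 := by omega
  rw [sum_asympW_eq (asympQ P β) hd fun j => exp (-(β * lam j)), diffEig, ofReal_E r,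
    sum_powersetCard_eq_coeff hr hd _ _ (c := fun i => asympQ P β i + (asympQ P β i)⁻¹)
      fun j => by rw [asympQ_add_inv, rho_eq]]
  simp only [asympQ_mul, shifted_eq, rankIn_univ]

lemma pairing_dir0 (ν : ℤⁿ) : pairing ν (dir0 n) = ((∑ k, partSum k ν : ℤ) : ℝ) := by
  have : ∑ k, partSum k ν = ∑ j, ν j * ((n : ℤ) - (j : ℕ)) := by
    simp only [partSum]
    have e : ∀ k, ∑ j ∈ Finset.Iic k, ν j = ∑ j, if j ≤ k then ν j else 0 := by
      intro k; rw [← sum_filter]; congr 1; ext; simp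
    simp only [e]
    rw [sum_comm]
    refine sum_congr rfl fun j _ => ?_
    rw [← sum_filter, sum_const, nsmul_eq_mul, mul_comm]
    have : (Finset.univ.filter fun k => j ≤ k) = Finset.Ici j := by ext; simp
    rw [this, Fin.card_Ici, Nat.cast_sub j.2.le]
  rw [this, pairing]; push_cast; rfl

lemma pairing_dir0_le {lam ν : ℤⁿ} (h : ∀ k, partSum k ν ≤ partSum k lam) :
    pairing ν (dir0 n) ≤ pairing lam (dir0 n) := by
  rw [pairing_dir0, pairing_dir0]
  exact_mod_cast sum_le_sum fun k _ => h k

lemma pairing_dir0_eq_iff {lam ν : ℤⁿ} (h : ∀ k, partSum k ν ≤ partSum k lam) :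
    pairing ν (dir0 n) = pairing lam (dir0 n) ↔ ν = lam := by
  refine ⟨fun e => ?_, fun e => by rw [e]⟩
  rw [pairing_dir0, pairing_dir0, Int.cast_inj, Finset.sum_eq_sum_iff_of_le fun k _ => h k] at e
  exact eq_of_partSum_eq fun k => e k (Finset.mem_univ k)

/-- The indicator direction whose pairing is a partial sum. -/
def dirInd (k : Fin n) (j : Fin n) : ℝ := if j ≤ k then 1 else 0

lemma pairing_dirInd (k : Fin n) (ν : ℤⁿ) : pairing ν (dirInd k) = (partSum k ν : ℝ) := by
  simp only [pairing, dirInd, partSum, mul_ite, mul_one, mul_zero]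
  rw [← sum_filter]
  push_cast
  congr 1; ext; simp

lemma differenceOp_monoC {r : ℕ} (hr : 1 ≤ r) (hrn : r ≤ n) {β : ℝ} (hβ : β ≠ 0)
    (hl : IsDominant lam) :
    ∃ b : ℤⁿ → ℂ, b lam = diffEig P r lam β ∧ ∀ x ∈ regularC n β,
      differenceOp P r β (monoC lam) x = ∑ μ ∈ lower lam, b μ * monoC μ x := by
  have hr0 : r ≠ 0 := by omega
  obtain ⟨G, hG, hDG⟩ := exists_differenceOp_eq P hβ hr0 (monoC_mem lam) (isWeylInv_monoC lam)
  obtain ⟨a, ha⟩ := exists_finsupp_of_mem hG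
  have ha' : ∀ x, G x = a.sum fun ν b => b * expo ν x := ha
  have hinv : IsWeylInv G := by
    intro w x
    have : (fun x => G (weylAct w x)) = G := by
      refine Continuous.ext_on (dense_offWalls (c := wC β) exists_wNu_sq)
        ((continuous_trigPoly hG).comp (continuous_weylAct w)) (continuous_trigPoly hG) fun x hx => ?_
      rw [← hDG x hx]
      rw [← hDG _ (weylAct_mem_regularC hx w), differenceOp_weylAct P hr0 β w (isWeylInv_monoC lam w)]
    exact congrFun this x
  have hbound : ∀ ν ∈ a.support, ∀ k, partSum k ν ≤ partSum k lam := by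
    intro ν hν k
    have := pairing_le_of_tendsto (c := dirInd k) (M := partSum k lam) (a := a) (fun x hx => ?_) ν hν
    · rw [pairing_dirInd] at this; exact_mod_cast this
    · choose W0 hW using fun K τ => exists_tendsto_cellW_ray P β (toC x) (dirInd k) K τ
      refine ⟨_, (tendsto_differenceOp_ray P β hr0 (lam := lam)
        (M := partSum k lam) (fun ν hν => ?_) (toC x) hW).congr
        fun t => ?_⟩
      · rw [pairing_dirInd]; exact_mod_cast partSum_le_of_mem hl hν k
      · rw [hDG _ (ray_mem_regularC hx _ t), ha']
  refine ⟨a, ?_, fun x hx => ?_⟩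
  · have hne : (regularSet n).Nonempty := (dense_regularSet n).nonempty
    obtain ⟨x, hx⟩ := hne
    have h1 := tendsto_differenceOp_ray P β hr0 (c := dir0 n) (M := pairing lam (dir0 n))
      (fun ν hν => pairing_dir0_le (partSum_le_of_mem hl hν)) (toC x)
      (fun K τ => tendsto_cellW_ray P β (toC x) K τ)
    have h2 : Tendsto (fun t : ℝ => (a.sum fun ν b => b * (expo ν (ray (toC x) (dir0 n) t) *
        exp (-((t * pairing lam (dir0 n) : ℝ) : ℂ))))) atTop
        (𝓝 (a.sum fun ν b => b * if pairing ν (dir0 n) = pairing lam (dir0 n)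
          then expo ν (toC x) else 0)) :=
      tendsto_finsetSum _ fun ν hν => (tendsto_expo_ray _ _ (pairing_dir0_le (hbound ν hν))).const_mul _
    have h3 := tendsto_nhds_unique h1 (h2.congr fun t => by
      rw [hDG _ (ray_mem_regularC hx _ t), ha', Finsupp.sum, Finsupp.sum, sum_mul]
      exact sum_congr rfl fun ν _ => (mul_assoc _ _ _).symm)
    have e1 : (a.sum fun ν b => b * if pairing ν (dir0 n) = pairing lam (dir0 n)
          then expo ν (toC x) else 0) = a lam * expo lam (toC x) := by
      rw [Finsupp.sum, sum_eq_single lam]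
      · rw [if_pos rfl]
      · intro ν hν hne
        rw [if_neg fun h => hne ((pairing_dir0_eq_iff (hbound ν hν)).1 h), mul_zero]
      · intro h; rw [Finsupp.notMem_support_iff.1 h, zero_mul]
    have e2 : ∀ τ, (∑ ν ∈ weylOrbit lam, if pairing ν (dir0 n) = pairing lam (dir0 n)
        then expo ν (shift β τ (toC x)) else 0) =
        (∏ j, exp (-(β * lam j)) ^ (τ j : ℤ)) * expo lam (toC x) := by
      intro τ
      rw [sum_eq_single lam, if_pos rfl, expo_shift, mul_comm]
      · intro ν hν hne
        rw [if_neg fun h => hne ((pairing_dir0_eq_iff (partSum_le_of_mem hl hν)).1 h)]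
      · exact fun h => absurd (self_mem_weylOrbit lam) h
    rw [e1] at h3
    simp only [e2, ← mul_assoc] at h3
    rw [← sum_mul, sum_asympW_eq_diffEig P β hr hrn] at h3
    exact (mul_right_cancel₀ (expo_ne_zero _ _) h3).symm
  · rw [hDG x hx]
    exact eq_sum_monoC ha' hinv (fun μ hμ hs => mem_lower.2 ⟨hμ, hbound μ hs⟩)
      (fun μ hμ => (mem_lower.1 hμ).1) x

end triangular

/-! ### Taylor coefficients in the step size -/

/-- The `m`th Taylor coefficient at `0`. -/
def tc (m : ℕ) (F : ℝ → ℂ) : ℂ := iteratedDeriv m F 0 / (m ! : ℂ)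

lemma ContDiffAt.nat {F : ℝ → ℂ} (h : ContDiffAt ℝ ∞ F 0) (m : ℕ) : ContDiffAt ℝ m F 0 :=
  h.of_le (by exact_mod_cast le_top)

lemma tc_sum {ι : Type*} (s : Finset ι) {F : ι → ℝ → ℂ} (hF : ∀ i ∈ s, ContDiffAt ℝ ∞ (F i) 0)
    (m : ℕ) : tc m (fun β => ∑ i ∈ s, F i β) = ∑ i ∈ s, tc m (F i) := by
  simp only [tc]
  rw [iteratedDeriv_fun_sum fun i hi => ContDiffAt.nat (hF i hi) m, sum_div]

lemma tc_mul {F G : ℝ → ℂ} (hF : ContDiffAt ℝ ∞ F 0) (hG : ContDiffAt ℝ ∞ G 0) (m : ℕ) :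
    tc m (fun β => F β * G β) = ∑ q ∈ Finset.HasAntidiagonal.antidiagonal m, tc q.1 F * tc q.2 G := by
  rw [Finset.Nat.sum_antidiagonal_eq_sum_range_succ fun k l => tc k F * tc l G, tc,
    iteratedDeriv_fun_mul (ContDiffAt.nat hF m) (ContDiffAt.nat hG m), sum_div]
  refine sum_congr rfl fun k hk => ?_
  have hk : k ≤ m := Nat.lt_succ_iff.1 (Finset.mem_range.1 hk)
  have h := Nat.choose_mul_factorial_mul_factorial hk
  have h' : ((m.choose k : ℂ)) * (k ! : ℂ) * ((m - k)! : ℂ) = (m ! : ℂ) := by exact_mod_cast h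
  have h1 : ((k ! : ℕ) : ℂ) ≠ 0 := by exact_mod_cast Nat.factorial_ne_zero k
  have h2 : (((m - k)! : ℕ) : ℂ) ≠ 0 := by exact_mod_cast Nat.factorial_ne_zero _
  have h3 : ((m ! : ℕ) : ℂ) ≠ 0 := by exact_mod_cast Nat.factorial_ne_zero m
  rw [tc, tc]
  field_simp
  rw [← h']; ring

lemma tc_const_mul (a : ℂ) (F : ℝ → ℂ) (m : ℕ) : tc m (fun β => a * F β) = a * tc m F := by
  rw [tc, tc, iteratedDeriv_const_mul_field, mul_div_assoc]

lemma tc_const (a : ℂ) (m : ℕ) : tc m (fun _ => a) = if m = 0 then a else 0 := by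
  rw [tc, iteratedDeriv_const]
  split_ifs with h
  · simp [h]
  · simp

lemma tc_sub {F G : ℝ → ℂ} (hF : ContDiffAt ℝ ∞ F 0) (hG : ContDiffAt ℝ ∞ G 0) (m : ℕ) :
    tc m (fun β => F β - G β) = tc m F - tc m G := by
  rw [tc, tc, tc, iteratedDeriv_fun_sub (ContDiffAt.nat hF m) (ContDiffAt.nat hG m), sub_div]

lemma tendsto_taylor {F : ℝ → ℂ} (hF : ContDiffAt ℝ ∞ F 0) (N : ℕ) :
    Tendsto (fun β : ℝ => (β : ℂ)⁻¹ ^ N * (F β - ∑ k ∈ Finset.range (N + 1), tc k F * (β : ℂ) ^ k))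
      (𝓝 0) (𝓝 0) := by
  obtain ⟨u, hu, hFu⟩ := (ContDiffAt.nat hF N).contDiffOn le_rfl (by simp)
  obtain ⟨ε, hε, hb⟩ := Metric.mem_nhds_iff.1 (by simpa using hu)
  have h := taylor_tendsto (convex_ball (0 : ℝ) ε) (Metric.mem_ball_self hε) (hFu.mono hb)
  rw [nhdsWithin_eq_nhds.2 (Metric.ball_mem_nhds _ hε)] at h
  refine h.congr fun β => ?_
  rw [taylor_within_apply, sub_zero, real_smul]
  push_cast
  rw [inv_pow]
  congr 2
  refine sum_congr rfl fun k _ => ?_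
  rw [iteratedDerivWithin_of_isOpen Metric.isOpen_ball (Metric.mem_ball_self hε), real_smul, tc]
  push_cast
  ring

lemma tendsto_of_tc {F : ℝ → ℂ} (hF : ContDiffAt ℝ ∞ F 0) {N : ℕ} (h0 : ∀ m < N, tc m F = 0) :
    Tendsto (fun β : ℝ => (β : ℂ)⁻¹ ^ N * F β) (𝓝[>] 0) (𝓝 (tc N F)) := by
  have h := ((tendsto_taylor hF N).mono_left (nhdsWithin_le_nhds (s := Ioi 0))).add_const (tc N F)
  rw [zero_add] at h
  refine h.congr' ?_
  filter_upwards [self_mem_nhdsWithin] with β hβ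
  have hβ0 : (β : ℂ) ≠ 0 := by exact_mod_cast (ne_of_gt hβ)
  rw [sum_range_succ, sum_eq_zero fun k hk => by
    rw [h0 k (Finset.mem_range.1 hk), zero_mul], inv_pow]
  field_simp
  ring

lemma tc_of_tendsto {F : ℝ → ℂ} (hF : ContDiffAt ℝ ∞ F 0) {N : ℕ} {L : ℂ}
    (h : Tendsto (fun β : ℝ => (β : ℂ)⁻¹ ^ N * F β) (𝓝[>] 0) (𝓝 L)) :
    (∀ m < N, tc m F = 0) ∧ tc N F = L := by
  have key : ∀ m < N, tc m F = 0 := by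
    intro m
    induction m using Nat.strong_induction_on with | _ m ih =>
    intro hm
    have h1 := tendsto_of_tc hF fun k hk => ih k hk (hk.trans hm)
    have h2 : Tendsto (fun β : ℝ => (β : ℂ) ^ (N - m)) (𝓝[>] 0) (𝓝 0) := by
      have : Continuous fun β : ℝ => (β : ℂ) ^ (N - m) := by fun_prop
      have h3 := this.tendsto 0
      simp only [ofReal_zero] at h3
      rw [zero_pow (by omega)] at h3
      exact h3.mono_left nhdsWithin_le_nhds
    have h3 := h2.mul h
    rw [zero_mul] at h3
    refine tendsto_nhds_unique h1 (h3.congr' ?_)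
    filter_upwards [self_mem_nhdsWithin] with β hβ
    have hβ0 : (β : ℂ) ≠ 0 := by exact_mod_cast (ne_of_gt hβ)
    have e : (β : ℂ) ^ N = β ^ (N - m) * β ^ m := by rw [← pow_add]; congr 1; omega
    rw [inv_pow, inv_pow, e]
    field_simp
  exact ⟨key, tendsto_nhds_unique (tendsto_of_tc hF key) h⟩

lemma tc_congr_of_ne {F G : ℝ → ℂ} (hF : ContDiffAt ℝ ∞ F 0) (hG : ContDiffAt ℝ ∞ G 0)
    (h : ∀ β ≠ 0, F β = G β) (m : ℕ) : tc m F = tc m G := by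
  have h0 : F 0 = G 0 := by
    have h1 := hF.continuousAt.tendsto.mono_left (nhdsWithin_le_nhds (s := {0}ᶜ))
    have h2 := hG.continuousAt.tendsto.mono_left (nhdsWithin_le_nhds (s := {0}ᶜ))
    refine tendsto_nhds_unique (h1.congr' ?_) h2
    filter_upwards [self_mem_nhdsWithin] with β hβ using h β hβ
  have : F = G := by grind
  rw [this]

/-! ### The formal expansion -/

lemma contDiffAt_chainCoeff (ε : Fin n → ℤˣ) (s : ℕ)
    (c : Fin (s + 1) → 𝔓ⁿ) (hx : x ∈ regularSet n) :
    ContDiffAt ℝ ∞ (fun β : ℝ => chainCoeff P β ε s c (toC x)) 0 := by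
  have h := (contDiffOn_chainCoeff P ε s c).contDiffAt (x := (x, (0 : ℝ)))
    (((isOpen_regularSet n).prod isOpen_univ).mem_nhds ⟨hx, mem_univ _⟩)
  have h2 : ContDiffAt ℝ ∞ (fun β : ℝ => ((x, β) : ℝⁿ × ℝ)) 0 :=
    contDiffAt_const.prodMk contDiffAt_id
  exact h.comp (0 : ℝ) h2

lemma map_cellSum {M N : Type*} [AddCommMonoid M] [AddCommMonoid N] (φ' : M →+ N) (r : ℕ)
    (F : (Fin n → ℤˣ) → (s : ℕ) → (Fin (s + 1) → 𝔓ⁿ) → M) :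
    φ' (cellSum n r F) = cellSum n r fun ε s c => φ' (F ε s c) := by
  simp only [cellSum, map_sum]

lemma cellSum_congr {M : Type*} [AddCommMonoid M] (r : ℕ)
    {F G : (Fin n → ℤˣ) → (s : ℕ) → (Fin (s + 1) → 𝔓ⁿ) → M}
    (h : ∀ ε s c, F ε s c = G ε s c) : cellSum n r F = cellSum n r G := by
  simp only [cellSum, h]

lemma contDiffAt_cellSum (r : ℕ) {F : (Fin n → ℤˣ) → (s : ℕ) → (Fin (s + 1) → 𝔓ⁿ) → ℝ → ℂ}
    (h : ∀ ε s c, ContDiffAt ℝ ∞ (F ε s c) 0) :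
    ContDiffAt ℝ ∞ (fun β => cellSum n r fun ε s c => F ε s c β) 0 :=
  ContDiffAt.sum fun _ _ => ContDiffAt.sum fun _ _ => ContDiffAt.sum fun _ _ =>
    ContDiffAt.sum fun _ _ => h _ _ _

lemma tc_cellSum (r : ℕ) {F : (Fin n → ℤˣ) → (s : ℕ) → (Fin (s + 1) → 𝔓ⁿ) → ℝ → ℂ}
    (h : ∀ ε s c, ContDiffAt ℝ ∞ (F ε s c) 0) (m : ℕ) :
    tc m (fun β => cellSum n r fun ε s c => F ε s c β) = cellSum n r fun ε s c => tc m (F ε s c) := by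
  unfold cellSum
  rw [tc_sum _ fun _ _ => ContDiffAt.sum fun _ _ => ContDiffAt.sum fun _ _ =>
    ContDiffAt.sum fun _ _ => h _ _ _]
  refine sum_congr rfl fun J _ => ?_
  rw [tc_sum _ fun _ _ => ContDiffAt.sum fun _ _ => ContDiffAt.sum fun _ _ => h _ _ _]
  refine sum_congr rfl fun ε _ => ?_
  rw [tc_sum _ fun _ _ => ContDiffAt.sum fun _ _ => h _ _ _]
  refine sum_congr rfl fun s _ => ?_
  rw [tc_sum _ fun _ _ => h _ _ _]

/-- The direction of `ε` on `J`. -/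
def signDir (ε : Fin n → ℤˣ) (J : 𝔓ⁿ) : ℂⁿ := fun j => if j ∈ J then ((ε j : ℤ) : ℂ) else 0

/-- The operator `θ̂_{εJ}` on functions of complex variables. -/
def thetaC (v : ℂⁿ) (f : ℂⁿ → ℂ) (z : ℂⁿ) : ℂ := 1 / I * fderiv ℂ f z v

lemma analyticOnNhd_thetaC {s : Set ℂⁿ} (hf : AnalyticOnNhd ℂ f s)
    (v : ℂⁿ) : AnalyticOnNhd ℂ (thetaC v f) s := fun z hz =>
  analyticAt_const.mul ((ContinuousLinearMap.apply ℂ ℂ v).analyticAt _ |>.comp (hf z hz).fderiv)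

lemma restrictReal_apply (hf : AnalyticOnNhd ℂ f (toC '' regularSet n)) (hx : x ∈ regularSet n) :
    (restrictReal f hf : ℝⁿ → ℂ) x = f (toC x) := by
  simp [restrictReal, toSmooth, hx]

lemma smoothFn_ext {f h : SmoothFn n}
    (H : ∀ x ∈ regularSet n, (f : ℝⁿ → ℂ) x = (h : ℝⁿ → ℂ) x) : f = h := by
  ext x
  by_cases hx : x ∈ regularSet n
  · exact H x hx
  · rw [f.2.2 x hx, h.2.2 x hx]

lemma fderiv_comp_toC (hf : DifferentiableAt ℂ f (toC x))
    (v : ℝⁿ) : fderiv ℝ (fun x => f (toC x)) x v = fderiv ℂ f (toC x) (toC v) := by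
  have h1 : HasFDerivAt (toC : ℝⁿ → ℂⁿ)
      (ContinuousLinearMap.pi fun j => ofRealCLM.comp (ContinuousLinearMap.proj j)) x :=
    hasFDerivAt_pi.2 fun j => (ofRealCLM.comp (ContinuousLinearMap.proj j : ℝⁿ →L[ℝ] ℝ)).hasFDerivAt
  have h2 := (hf.hasFDerivAt.restrictScalars ℝ).comp x h1
  rw [show (fun x => f (toC x)) = f ∘ toC from rfl, h2.fderiv]
  rfl

lemma partialOp_restrictReal (hf : AnalyticOnNhd ℂ f (toC '' regularSet n))
    (j : Fin n) (hx : x ∈ regularSet n) :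
    (partialOp j (restrictReal f hf) : ℝⁿ → ℂ) x = fderiv ℂ f (toC x) (single j 1) := by
  have e : (restrictReal f hf : ℝⁿ → ℂ) =ᶠ[𝓝 x] fun x => f (toC x) := by
    filter_upwards [(isOpen_regularSet n).mem_nhds hx] with y hy using restrictReal_apply hf hy
  have e2 : toC (single j 1) = (single j 1 : ℂⁿ) := by
    ext i
    by_cases hi : i = j
    · subst hi; simp [toC]
    · simp [toC, hi]
  simp only [partialOp, LinearMap.coe_mk, AddHom.coe_mk, toSmooth]
  rw [indicator_of_mem hx, e.fderiv_eq, fderiv_comp_toC (hf _ ⟨x, hx, rfl⟩).differentiableAt, e2]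

lemma thetaOp_restrictReal (hf : AnalyticOnNhd ℂ f (toC '' regularSet n))
    (ε : Fin n → ℤˣ) (J : 𝔓ⁿ) :
    thetaOp ε J (restrictReal f hf) =
      restrictReal (thetaC (signDir ε J) f) (analyticOnNhd_thetaC hf _) := by
  refine smoothFn_ext fun x hx => ?_
  rw [restrictReal_apply _ hx, thetaC]
  have e : signDir ε J = ∑ j ∈ J, ((ε j : ℤ) : ℂ) • (single j 1 : ℂⁿ) := by
    ext i
    simp [signDir, Finset.sum_apply, single_apply]
  rw [e, map_sum, thetaOp, LinearMap.sum_apply, mul_sum]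
  rw [Submodule.coe_sum, Finset.sum_apply]
  refine sum_congr rfl fun j _ => ?_
  rw [map_smul, ← partialOp_restrictReal hf j hx]
  simp only [LinearMap.smul_apply, Submodule.coe_smul, Pi.smul_apply, smul_eq_mul]
  ring

lemma thetaOp_pow_restrictReal (ε : Fin n → ℤˣ) (J : 𝔓ⁿ) (l : ℕ) :
    ∀ {f : ℂⁿ → ℂ} (hf : AnalyticOnNhd ℂ f (toC '' regularSet n)),
      ∃ hl : AnalyticOnNhd ℂ ((thetaC (signDir ε J))^[l] f) (toC '' regularSet n),
      (thetaOp ε J ^ l) (restrictReal f hf) = restrictReal ((thetaC (signDir ε J))^[l] f) hl := by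
  induction l with
  | zero => exact fun hf => ⟨hf, rfl⟩
  | succ l ih =>
    intro f hf
    obtain ⟨hl, h⟩ := ih (analyticOnNhd_thetaC hf (signDir ε J))
    exact ⟨hl, by rw [pow_succ, End.mul_apply, thetaOp_restrictReal, h]; rfl⟩

lemma contDiffAt_line {z : ℂⁿ} (hf : AnalyticAt ℂ f z)
    (v : ℂⁿ) : ContDiffAt ℝ ∞ (fun β : ℝ => f (z + (I * β) • v)) 0 := by
  have h1 : ContDiffAt ℝ ∞ f (z + (I * ((0 : ℝ) : ℂ)) • v) := by
    simpa using (hf.contDiffAt (n := ∞)).restrict_scalars ℝ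
  have h2 : ContDiff ℝ ∞ fun β : ℝ => z + (I * (β : ℂ)) • v :=
    contDiff_const.add ((contDiff_const.mul ofRealCLM.contDiff).smul contDiff_const)
  exact h1.comp (0 : ℝ) h2.contDiffAt

lemma iteratedDeriv_line (v : ℂⁿ) {z : ℂⁿ} (l : ℕ) : ∀ {f : ℂⁿ → ℂ}, AnalyticAt ℂ f z →
      iteratedDeriv l (fun β : ℝ => f (z + (I * β) • v)) 0 = (-1) ^ l * (thetaC v)^[l] f z := by
  induction l with
  | zero => intro f hf; simp
  | succ l ih =>
    intro f hf
    rw [iteratedDeriv_succ']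
    have hc : Continuous fun β : ℝ => z + (I * (β : ℂ)) • v := by fun_prop
    have e : deriv (fun β : ℝ => f (z + (I * β) • v)) =ᶠ[𝓝 0]
        fun β => -1 * thetaC v f (z + (I * β) • v) := by
      have h1 : ∀ᶠ y in 𝓝 (z + (I * ((0 : ℝ) : ℂ)) • v), AnalyticAt ℂ f y := by
        simpa using hf.eventually_analyticAt
      filter_upwards [hc.continuousAt.eventually h1] with β hβ
      have h2 : HasDerivAt (fun β : ℝ => z + (I * (β : ℂ)) • v) (I • v) β := by
        have := (((hasDerivAt_id β).ofReal_comp.const_mul I).smul_const v).const_add z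
        simpa using this
      have h3 := (hβ.differentiableAt.hasFDerivAt.restrictScalars ℝ).comp_hasDerivAt β h2
      refine h3.deriv.trans ?_
      rw [thetaC]
      simp
    rw [e.iteratedDeriv_eq, iteratedDeriv_const_mul_field, ih (analyticOnNhd_thetaC (s := {z})
      (by simpa [AnalyticOnNhd] using hf) v z rfl), Function.iterate_succ_apply, pow_succ]
    ring

lemma shifted_eq_line (ε : Fin n → ℤˣ) (J : 𝔓ⁿ) (x : ℂⁿ) :
    (fun j => x j + if j ∈ J then I * β * ((ε j : ℤ) : ℂ) else 0) = x + (I * β) • signDir ε J := by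
  ext j; simp [signDir]

lemma contDiffAt_differenceOp (r : ℕ) (hx : x ∈ regularSet n) (hf : AnalyticAt ℂ f (toC x)) :
    ContDiffAt ℝ ∞ (fun β => differenceOp P r β f (toC x)) 0 := by
  unfold differenceOp
  simp only [shifted_eq_line]
  exact contDiffAt_cellSum r fun ε s c => (contDiffAt_chainCoeff P ε s c hx).mul
    ((contDiffAt_line hf _).sub contDiffAt_const)

lemma coeff_expansion_apply (r m : ℕ)
    (hf : AnalyticOnNhd ℂ f (toC '' regularSet n)) (hx : x ∈ regularSet n) :
    (coeff m (expansion n P r) (restrictReal f hf) : ℝⁿ → ℂ) x =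
      tc m fun β => differenceOp P r β f (toC x) := by
  have hfx := hf _ ⟨x, hx, rfl⟩
  unfold differenceOp
  simp only [shifted_eq_line]
  rw [tc_cellSum r fun ε s c => (contDiffAt_chainCoeff P ε s c hx).mul
    ((contDiffAt_line hfx _).sub contDiffAt_const)]
  let ev : End ℂ (SmoothFn n) →+ ℂ :=
    { toFun := fun D => (D (restrictReal f hf) : ℝⁿ → ℂ) x
      map_zero' := rfl
      map_add' := fun _ _ => rfl }
  let φ' : PowerSeries (End ℂ (SmoothFn n)) →+ ℂ := ev.comp (coeff m).toAddMonoidHom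
  change φ' (expansion n P r) = _
  rw [expansion, map_cellSum]
  refine cellSum_congr r fun ε s c => ?_
  rw [tc_mul (contDiffAt_chainCoeff P ε s c hx) ((contDiffAt_line hfx _).sub contDiffAt_const)]
  change (((coeff m ((PowerSeries.mk fun k =>
    mulOp (taylorCoeff P ε s c k) (contDiffOn_taylorCoeff P ε s c k)) *
      (translatorSeries ε (c 1) - 1)) : End ℂ (SmoothFn n)) (restrictReal f hf) :
        SmoothFn n) : ℝⁿ → ℂ) x = _
  rw [coeff_mul, LinearMap.sum_apply, Submodule.coe_sum, Finset.sum_apply]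
  refine sum_congr rfl fun q _ => ?_
  rw [coeff_mk, End.mul_apply, map_sub, translatorSeries, coeff_mk,
    tc_sub (contDiffAt_line hfx _) contDiffAt_const, tc_const, tc, tc,
    iteratedDeriv_line _ _ hfx, coeff_one]
  simp only [mulOp, LinearMap.coe_mk, AddHom.coe_mk, LinearMap.sub_apply]
  obtain ⟨hl, h⟩ := thetaOp_pow_restrictReal ε (c 1) q.2 hf
  rw [LinearMap.smul_apply, h]
  simp only [AddSubgroupClass.coe_sub, Pi.sub_apply, Submodule.coe_smul, Pi.smul_apply, smul_eq_mul]
  rw [restrictReal_apply _ hx, taylorCoeff]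
  congr 2
  · ring
  · split_ifs
    · rw [End.one_apply, restrictReal_apply _ hx]
    · rfl

/-! ### Triangularity of the coefficients of the expansion -/

lemma eq_zero_of_sum_monoC {s : Finset ℤⁿ} (hs : ∀ μ ∈ s, IsDominant μ)
    {b : ℤⁿ → ℂ} (h : ∀ x ∈ regularSet n, ∑ μ ∈ s, b μ * monoC μ (toC x) = 0) :
    ∀ μ ∈ s, b μ = 0 := by
  set a : ℤⁿ →₀ ℂ := ∑ μ ∈ s, ∑ ν ∈ weylOrbit μ, Finsupp.single ν (b μ) with ha
  have h0 : a = 0 := by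
    refine finsupp_eq_zero_of_regular fun x hx => ?_
    have e : ∀ a : ℤⁿ →₀ ℂ, (a.sum fun ν b => b * expo ν (toC x)) =
        Finsupp.linearCombination ℂ (fun ν => expo ν (toC x)) a := fun a => rfl
    rw [e, ha, map_sum, ← h x hx]
    refine sum_congr rfl fun μ _ => ?_
    rw [map_sum, monoC, mul_sum]
    exact sum_congr rfl fun ν _ => by simp
  intro μ hμ
  have h1 := DFunLike.congr_fun h0 μ
  rw [ha, finsetSum_apply, sum_eq_single μ, finsetSum_apply, sum_eq_single μ] at h1
  · simpa using h1
  · intro ν _ hne; exact Finsupp.single_eq_of_ne' hne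
  · exact fun h => absurd (self_mem_weylOrbit μ) h
  · intro μ' hμ' hne
    rw [finsetSum_apply]
    refine sum_eq_zero fun ν hν => ?_
    refine Finsupp.single_eq_of_ne' ?_
    rintro rfl
    exact hne (eq_of_mem_weylOrbit (hs _ hμ') (hs _ hμ) hν).symm
  · exact fun h => absurd hμ h

lemma exists_coeff_functional {s : Finset ℤⁿ} (hs : ∀ μ ∈ s, IsDominant μ) {μ : ℤⁿ} (hμ : μ ∈ s) :
    ∃ w : regularSet n →₀ ℂ, ∀ b : ℤⁿ → ℂ,
      b μ = w.sum fun x t => t * ∑ ν ∈ s, b ν * monoC ν (toC x.1) := by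
  let ev : regularSet n → ((s → ℂ) →ₗ[ℂ] ℂ) := fun x =>
    ∑ ν : s, monoC ν.1 (toC x.1) • proj (R := ℂ) (ι := s) ν
  have hev : ∀ x b, ev x b = ∑ ν : s, b ν * monoC ν.1 (toC x.1) := by
    intro x b
    simp only [ev, LinearMap.sum_apply, LinearMap.smul_apply, proj_apply, smul_eq_mul]
    exact sum_congr rfl fun ν _ => mul_comm _ _
  have htop : span ℂ (range ev) = ⊤ := by
    refine Submodule.span_eq_top_of_ne_zero fun b hb => ?_
    by_contra hcon
    push Not at hcon
    refine hb (funext fun ν => ?_)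
    have := eq_zero_of_sum_monoC hs (b := fun ν => if h : ν ∈ s then b ⟨ν, h⟩ else 0)
      (fun x hx => ?_) ν.1 ν.2
    · simpa using this
    · have h1 := hcon (ev ⟨x, hx⟩) ⟨_, rfl⟩
      rw [hev] at h1
      rw [← h1, ← sum_coe_sort]
      exact sum_congr rfl fun ν _ => by simp
  have hm : (proj (R := ℂ) (ι := s) ⟨μ, hμ⟩ : (s → ℂ) →ₗ[ℂ] ℂ) ∈
      span ℂ (range ev) := htop ▸ Submodule.mem_top
  obtain ⟨w, hw⟩ := Finsupp.mem_span_range_iff_exists_finsupp.1 hm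
  refine ⟨w, fun b => ?_⟩
  have h1 := LinearMap.congr_fun hw fun ν : s => b ν.1
  simp only [Finsupp.sum, LinearMap.sum_apply, LinearMap.smul_apply, proj_apply,
    smul_eq_mul, hev] at h1
  rw [← h1, Finsupp.sum]
  refine sum_congr rfl fun x _ => ?_
  rw [← sum_coe_sort s fun ν => b ν * monoC ν (toC x.1)]

lemma analyticOnNhd_monoC (lam : ℤⁿ) : AnalyticOnNhd ℂ (monoC lam) (toC '' regularSet n) :=
  (analyticOnNhd_trigPoly (monoC_mem lam)).mono (subset_univ _)

/-- The orbit sum as an element of `C^∞(U)`. -/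
def monoFn (lam : ℤⁿ) : SmoothFn n := restrictReal (monoC lam) (analyticOnNhd_monoC lam)

lemma monoFn_apply (lam : ℤⁿ) (hx : x ∈ regularSet n) :
    (monoFn lam : ℝⁿ → ℂ) x = monoC lam (toC x) := restrictReal_apply _ hx

lemma contDiff_diffEig (r : ℕ) (lam : ℤⁿ) : ContDiff ℝ ∞ fun β => (diffEig P r lam β : ℂ) := by
  have hc : ∀ a : ℝ, ContDiff ℝ ∞ fun β : ℝ => 2 * cosh (β * a) := fun a =>
    contDiff_const.mul (Real.contDiff_cosh.comp (contDiff_id.mul contDiff_const))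
  have h : ContDiff ℝ ∞ (diffEig P r lam) := by
    unfold diffEig E
    fun_prop
  exact ofRealCLM.contDiff.comp h

lemma exists_smooth_coeff {r : ℕ} (hr : 1 ≤ r) (hrn : r ≤ n) (hl : IsDominant lam) :
    ∃ b : ℤⁿ → ℝ → ℂ, (∀ μ, ContDiffAt ℝ ∞ (b μ) 0) ∧ (∀ μ ∉ lower lam, b μ = 0) ∧
      (∀ m, tc m (b lam) = tc m (fun β => (diffEig P r lam β : ℂ))) ∧
      (∀ β ≠ 0, ∀ x ∈ regularSet n, differenceOp P r β (monoC lam) (toC x) =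
        ∑ μ ∈ lower lam, b μ β * monoC μ (toC x)) ∧
      ∀ m, coeff m (expansion n P r) (monoFn lam) = ∑ μ ∈ lower lam, tc m (b μ) • monoFn μ := by
  have hs : ∀ μ ∈ lower lam, IsDominant μ := fun μ hμ => (mem_lower.1 hμ).1
  choose w hw using fun μ : lower lam => exists_coeff_functional hs μ.2
  set F : ℝⁿ → ℝ → ℂ := fun x β => differenceOp P r β (monoC lam) (toC x) with hF
  have hFs : ∀ x ∈ regularSet n, ContDiffAt ℝ ∞ (F x) 0 := fun x hx =>
    contDiffAt_differenceOp P r hx (analyticOnNhd_monoC lam _ ⟨x, hx, rfl⟩)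
  set b : ℤⁿ → ℝ → ℂ := fun μ β => if h : μ ∈ lower lam then
    ∑ x ∈ (w ⟨μ, h⟩).support, w ⟨μ, h⟩ x * F x.1 β else 0 with hb
  have hbs : ∀ μ, ContDiffAt ℝ ∞ (b μ) 0 := by
    intro μ
    by_cases h : μ ∈ lower lam
    · simp only [hb, h, dif_pos]
      exact ContDiffAt.sum fun x _ => contDiffAt_const.mul (hFs x.1 x.2)
    · simp only [hb, h]; exact contDiffAt_const
  have hbβ : ∀ β ≠ 0, b lam β = diffEig P r lam β ∧ ∀ x ∈ regularSet n,
      F x β = ∑ μ ∈ lower lam, b μ β * monoC μ (toC x) := by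
    intro β hβ
    obtain ⟨b', h1, h2⟩ := differenceOp_monoC P hr hrn hβ hl
    have h3 : ∀ μ ∈ lower lam, b μ β = b' μ := by
      intro μ hμ
      rw [hw ⟨μ, hμ⟩ b']
      simp only [hb, hμ, dif_pos, Finsupp.sum]
      refine sum_congr rfl fun x _ => ?_
      rw [hF]
      simp only
      rw [h2 _ (toC_mem_regularC x.2)]
    refine ⟨by rw [h3 _ (self_mem_lower hl), h1], fun x hx => ?_⟩
    rw [hF]
    simp only
    rw [h2 _ (toC_mem_regularC hx)]
    exact sum_congr rfl fun μ hμ => by rw [h3 μ hμ]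
  refine ⟨b, hbs, fun μ hμ => funext fun β => by simp [hb, hμ], fun m => ?_,
    fun β hβ => (hbβ β hβ).2, fun m => smoothFn_ext fun x hx => ?_⟩
  · exact tc_congr_of_ne (hbs lam) (contDiff_diffEig P r lam).contDiffAt (fun β hβ => (hbβ β hβ).1) m
  · rw [monoFn, coeff_expansion_apply P r m _ hx,
      tc_congr_of_ne (hFs x hx) (ContDiffAt.sum fun μ _ => (hbs μ).mul contDiffAt_const)
        (fun β hβ => (hbβ β hβ).2 x hx), tc_sum _ fun μ _ => (hbs μ).mul contDiffAt_const,
      Submodule.coe_sum, Finset.sum_apply]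
    refine sum_congr rfl fun μ _ => ?_
    rw [Submodule.coe_smul, Pi.smul_apply, smul_eq_mul, monoFn_apply μ hx]
    simp only [mul_comm (b μ _)]
    rw [tc_const_mul, mul_comm]

/-! ### Taylor coefficients of the eigenvalues -/

lemma E_affine {r : ℕ} (hr : 1 ≤ r) (hrn : r ≤ n) (a s : ℝ) (t p : ℝⁿ) :
    E n r (fun j => s * t j + a) (fun j => s * p j + a) = s ^ r * E n r t p := by
  have hd : (n + 1 - r) + r = n + 1 := by omega
  set t' : ℕ → ℝ := fun i => if h : i < n then t ⟨i, h⟩ else 0 with ht'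
  set c : ℕ → ℝ := fun i => if h : n - 1 - i < n then p ⟨n - 1 - i, h⟩ else 0 with hc
  have hc' : ∀ j : Fin n, p j = c (n - 1 - j) := by grind
  have key : ∀ (t : ℝⁿ) (t' c : ℕ → ℝ), (∀ j : Fin n, t j = t' j) →
      coeff r ((∏ j : Fin n, (1 + PowerSeries.C (t j) * PowerSeries.X)) *
      ∏ i ∈ Finset.range (n + 1 - r), (1 + PowerSeries.C (c i) * PowerSeries.X)⁻¹) =
      coeff r (genSeries n (n + 1 - r) t' c) := by
    intro t t' c h
    rw [genSeries, ← Fin.prod_univ_eq_prod_range (fun i => 1 + PowerSeries.C (t' i) * PowerSeries.X)]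
    simp only [h]
  have htj : ∀ j : Fin n, t j = t' j := fun j => by simp [ht']
  rw [E_eq_coeff hr hd (fun j => s * t j + a) (fun j => s * p j + a) (c := fun i => s * c i + a)
      (fun j => by rw [hc']), E_eq_coeff hr hd t p hc',
    key _ (fun i => s * t' i + a) _ (fun j => by rw [htj]), key _ t' _ htj,
    coeff_genSeries_translate (fun i => s * t' i) (fun i => s * c i) a n r _ hd,
    coeff_genSeries_scale]

lemma tendsto_cosh (a : ℝ) :
    Tendsto (fun β : ℝ => (2 * cosh (β * a) - 2) / β ^ 2) (𝓝[>] 0) (𝓝 (a ^ 2)) := by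
  have h1 : HasDerivAt (fun β : ℝ => sinh (β * (a / 2))) (a / 2) 0 := by
    have := (Real.hasDerivAt_sinh ((0 : ℝ) * (a / 2))).comp (0 : ℝ)
      ((hasDerivAt_id (0 : ℝ)).mul_const (a / 2))
    simpa [comp_def] using this
  have h2 := (h1.tendsto_slope_zero).mono_left
    (nhdsWithin_mono 0 (show Ioi (0 : ℝ) ⊆ {0}ᶜ from fun x hx => ne_of_gt hx))
  have h3 := (h2.pow 2).const_mul 4
  have e : 4 * (a / 2) ^ 2 = a ^ 2 := by ring
  rw [e] at h3
  refine h3.congr fun β => ?_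
  have h4 : cosh (β * a) = 1 + 2 * sinh (β * (a / 2)) ^ 2 := by
    have := Real.cosh_two_mul (β * (a / 2))
    rw [Real.cosh_sq] at this
    rw [show β * a = 2 * (β * (a / 2)) by ring, this]; ring
  rw [h4]
  simp only [zero_add, zero_mul, Real.sinh_zero, sub_zero, smul_eq_mul]
  rw [mul_pow, inv_pow]; ring

/-- The eigenvalues of the leading operators. -/
def leadEig (r : ℕ) (lam : ℤⁿ) : ℝ := E n r (fun j => shifted P lam j ^ 2) fun j => rho n P j ^ 2

lemma tc_diffEig {r : ℕ} (hr : 1 ≤ r) (hrn : r ≤ n) (lam : ℤⁿ) :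
    (∀ m < 2 * r, tc m (fun β => (diffEig P r lam β : ℂ)) = 0) ∧
      tc (2 * r) (fun β => (diffEig P r lam β : ℂ)) = leadEig P r lam := by
  refine tc_of_tendsto (contDiff_diffEig P r lam).contDiffAt ?_
  have h1 : Tendsto (fun β : ℝ => E n r (fun j => (2 * cosh (β * shifted P lam j) - 2) / β ^ 2)
      fun j => (2 * cosh (β * rho n P j) - 2) / β ^ 2) (𝓝[>] 0) (𝓝 (leadEig P r lam)) := by
    unfold leadEig E
    exact tendsto_finsetSum _ fun s _ => (tendsto_const_nhds.mul (tendsto_finsetSum _ fun J _ =>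
      tendsto_finsetProd _ fun j _ => tendsto_cosh _)).mul (tendsto_finsetSum _ fun i _ =>
      tendsto_finsetProd _ fun a _ => tendsto_cosh _)
  refine ((continuous_ofReal.tendsto _).comp h1).congr' ?_
  filter_upwards [self_mem_nhdsWithin] with β hβ
  have hβ0 : β ≠ 0 := ne_of_gt hβ
  have hβ2 : (β : ℂ) ≠ 0 := by exact_mod_cast hβ0
  have e : diffEig P r lam β = (β ^ 2) ^ r *
      E n r (fun j => (2 * cosh (β * shifted P lam j) - 2) / β ^ 2)
      fun j => (2 * cosh (β * rho n P j) - 2) / β ^ 2 := by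
    rw [← E_affine hr hrn 2, diffEig]
    congr 1 <;>
    · ext j
      field_simp
      ring
  simp only [Function.comp]
  rw [e, pow_mul]
  simp_all

/-! ### The inner product and the Jacobi polynomials -/

/-- The box `[-π, π]ⁿ`. -/
def cube (n : ℕ) : Set (Fin n → ℝ) := Icc (fun _ => -Real.pi) fun _ => Real.pi

lemma isCompact_cube (n : ℕ) : IsCompact (cube n) := isCompact_Icc

lemma integrableOn_cube {f : ℝⁿ → ℂ} (hf : Continuous f) : IntegrableOn f (cube n) :=
  hf.continuousOn.integrableOn_compact (isCompact_cube n)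

/-- Periodicity with period `2π` in every coordinate. -/
def IsPeriodic {E : Type*} (f : ℝⁿ → E) : Prop :=
  ∀ x y : ℝⁿ, (∃ j, y = x + single j (2 * Real.pi)) → f y = f x

lemma integral_divergence_eq_zero {F : Fin n → ℝⁿ → ℂ} (hF : ∀ j, ContDiff ℝ 1 (F j))
    (hp : ∀ j, IsPeriodic (F j)) :
    ∫ x in cube n, ∑ j, fderiv ℝ (F j) x (single j 1) = 0 := by
  cases n with
  | zero => simp
  | succ m =>
    have hd : ∀ j x, HasFDerivAt (F j) (fderiv ℝ (F j) x) x := fun j x =>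
      ((hF j).differentiable (by simp) x).hasFDerivAt
    have := integral_divergence_of_hasFDerivAt_off_countable' (fun _ : Fin (m + 1) => -Real.pi)
      (fun _ => Real.pi) (fun _ => by linarith [pi_pos]) F (fun j x => fderiv ℝ (F j) x) ∅
      countable_empty (fun j => (hF j).continuous.continuousOn) (fun x _ j => hd j x)
      ((continuous_finsetSum _ fun j _ => ((hF j).continuous_fderiv (by simp)).clm_apply
        continuous_const).continuousOn.integrableOn_compact isCompact_Icc)
    rw [cube, this]
    refine sum_eq_zero fun j _ => sub_eq_zero.2 ?_
    congr 1
    ext x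
    refine hp j _ _ ⟨j, ?_⟩
    ext i
    refine Fin.succAboveCases j ?_ (fun i => ?_) i
    · simp; ring
    · simp

lemma continuous_weight {P : Couplings} (hg : 0 ≤ P.g) (h0 : 0 ≤ P.g₀ + P.g₀')
    (h1 : 0 ≤ P.g₁ + P.g₁') : Continuous (weight P : ℝⁿ → ℝ) := by
  unfold weight
  refine (continuous_finsetProd _ fun q _ => Continuous.rpow_const (by fun_prop) fun x => Or.inr
    (by positivity)).mul (continuous_finsetProd _ fun j _ => ?_)
  exact (Continuous.rpow_const (by fun_prop) fun x => Or.inr (by positivity)).mul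
    (Continuous.rpow_const (by fun_prop) fun x => Or.inr (by positivity))

lemma weight_nonneg (x : ℝⁿ) : 0 ≤ weight P x := by unfold weight; positivity

lemma weight_pos (hx : x ∈ regularSet n) : 0 < weight P x := by
  refine mul_pos (prod_pos fun q hq => ?_) (prod_pos fun j _ => ?_)
  · have := hx.2 q.1 q.2 (mem_filter.1 hq).2.ne
    exact Real.rpow_pos_of_pos (abs_pos.2 (mul_ne_zero this.1 this.2)) _
  · exact mul_pos (Real.rpow_pos_of_pos (abs_pos.2 (hx.1 j).1) _)
      (Real.rpow_pos_of_pos (abs_pos.2 (hx.1 j).2) _)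

/-- A combination of orbit sums. -/
def comb (s : Finset ℤⁿ) (b : ℤⁿ → ℂ) : ℂⁿ → ℂ := fun z => ∑ μ ∈ s, b μ * monoC μ z

lemma comb_mem (s : Finset ℤⁿ) (b : ℤⁿ → ℂ) : comb s b ∈ trigPoly n := by
  have : comb s b = ∑ μ ∈ s, b μ • monoC μ := by ext z; simp [comb]
  rw [this]
  exact sum_mem fun μ _ => (trigPoly n).smul_mem (monoC_mem μ) _

lemma continuous_comp_toC (hf : f ∈ trigPoly n) :
    Continuous fun x : ℝⁿ => f (toC x) := (continuous_trigPoly hf).comp continuous_toC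

/-- The bilinear form given by the weight function. -/
def bil (f h : ℂⁿ → ℂ) : ℂ := ∫ x in cube n, f (toC x) * h (toC x) * (weight P x : ℂ)

lemma bil_comm (f h : ℂⁿ → ℂ) : bil P f h = bil P h f := by simp only [bil, mul_comm (f _)]

lemma bil_comb_left {P : Couplings} (hw : Continuous (weight P : ℝⁿ → ℝ)) (s : Finset ℤⁿ) (b : ℤⁿ → ℂ) {h : ℂⁿ → ℂ}
    (hh : h ∈ trigPoly n) : bil P (comb s b) h = ∑ μ ∈ s, b μ * bil P (monoC μ) h := by
  simp only [bil, comb]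
  rw [← sum_congr rfl fun μ _ => integral_const_mul _ _, ← integral_finsetSum]
  · congr 1
    ext x
    rw [sum_mul, sum_mul]
    exact sum_congr rfl fun μ _ => by ring
  · intro μ _
    exact (integrableOn_cube (((continuous_comp_toC (monoC_mem μ)).mul
      (continuous_comp_toC hh)).mul (continuous_ofReal.comp
      hw))).const_mul _

lemma conj_monoC (μ : ℤⁿ) (x : ℝⁿ) : (starRingEnd ℂ) (monoC μ (toC x)) = monoC μ (toC x) := by
  have hneg : ∀ ν, ν ∈ weylOrbit μ → -ν ∈ weylOrbit μ := by
    intro ν hν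
    have e : -ν = actZ (1, fun _ => -1) ν := by ext j; simp [actZ]
    rw [e]; exact (actZ_mem_weylOrbit _).2 hν
  rw [monoC, map_sum]
  refine sum_bij' (fun ν _ => -ν) (fun ν _ => -ν) (fun ν h => hneg ν h)
    (fun ν h => hneg ν h) (by simp) (by simp) fun ν _ => ?_
  rw [expo, expo, ← Complex.exp_conj]
  congr 1
  simp [lin, toC]

lemma innerWeight_eq_bil (f : ℂⁿ → ℂ) (μ : ℤⁿ) :
    innerWeight P (fun x => f (toC x)) (monomialSymm μ) = bil P f (monoC μ) := by
  simp only [innerWeight, monomialSymm_eq, conj_monoC]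
  rfl

lemma eq_zero_of_forall_bil {P : Couplings} (hw : Continuous (weight P : ℝⁿ → ℝ)) {s : Finset ℤⁿ} (hs : ∀ μ ∈ s, IsDominant μ)
    {b : ℤⁿ → ℂ} (h : ∀ μ ∈ s, bil P (comb s b) (monoC μ) = 0) :
    ∀ μ ∈ s, b μ = 0 := by
  have hc := continuous_comp_toC (comb_mem s b)
  have hz : bil P (comb s fun μ => (starRingEnd ℂ) (b μ)) (comb s b) = 0 := by
    rw [bil_comb_left hw _ _ (comb_mem s b)]
    exact sum_eq_zero fun μ hμ => by rw [bil_comm, h μ hμ, mul_zero]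
  have hzr : ∫ x in cube n, normSq (comb s b (toC x)) * weight P x = 0 := by
    rw [← Complex.ofReal_eq_zero, ← integral_complex_ofReal, ← hz]
    refine integral_congr_ae (ae_of_all _ fun x => ?_)
    have e : comb s (fun μ => (starRingEnd ℂ) (b μ)) (toC x) =
        (starRingEnd ℂ) (comb s b (toC x)) := by
      simp only [comb, map_sum, map_mul, conj_monoC]
    simp only [e]
    rw [ofReal_mul, Complex.normSq_eq_conj_mul_self]
  have hcn : Continuous fun x : ℝⁿ => normSq (comb s b (toC x)) * weight P x :=
    (Complex.continuous_normSq.comp hc).mul hw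
  have hae := (integral_eq_zero_iff_of_nonneg (fun x => mul_nonneg (Complex.normSq_nonneg _)
    (weight_nonneg P x)) (hcn.continuousOn.integrableOn_compact (isCompact_cube n))).1 hzr
  have hopen : EqOn (fun x : ℝⁿ => normSq (comb s b (toC x)) * weight P x) 0 (interior (cube n)) :=
    Measure.eqOn_open_of_ae_eq (ae_restrict_of_ae_restrict_of_subset interior_subset hae)
      isOpen_interior hcn.continuousOn continuousOn_const
  have hne : (interior (cube n)).Nonempty := by
    refine ⟨0, ?_⟩
    rw [cube, ← Set.pi_univ_Icc, interior_pi_set finite_univ]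
    simp [pi_pos]
  have hreg : IsOpen (interior (cube n) ∩ regularSet n) :=
    isOpen_interior.inter (isOpen_regularSet n)
  have hregne : (interior (cube n) ∩ regularSet n).Nonempty :=
    (dense_regularSet n).inter_open_nonempty _ isOpen_interior hne
  have hzero : ∀ x ∈ interior (cube n) ∩ regularSet n, comb s b (toC x) = 0 := by
    intro x hx
    have := hopen hx.1
    simpa [(weight_pos P hx.2).ne'] using this
  refine eq_zero_of_sum_monoC hs fun x _ => ?_
  by_contra hx0
  have hana : AnalyticOnNhd ℝ (fun x : ℝⁿ => comb s b (toC x)) univ := fun y _ =>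
    ((analyticOnNhd_trigPoly (comb_mem s b) (toC y) (mem_univ _)).restrictScalars (𝕜 := ℝ)).comp
      ((contDiff_toC (m := ω)).contDiffAt.analyticAt)
  obtain ⟨y, hy⟩ := (dense_ne_zero hana (x₀ := x) hx0).inter_open_nonempty _ hreg hregne
  exact hy.2 (hzero y hy.1)

lemma isJacobi_iff {P : Couplings} {p : ℝⁿ → ℂ} :
    IsJacobi P lam p ↔ IsDominant lam ∧ ∃ b : ℤⁿ → ℂ, b lam = 1 ∧
      (p = fun x => comb (lower lam) b (toC x)) ∧
      ∀ μ ∈ (lower lam).erase lam, bil P (comb (lower lam) b) (monoC μ) = 0 := by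
  have hset : {f | ∃ lam', IsDominant lam' ∧ DomLT lam' lam ∧ f = monomialSymm lam'} =
      monomialSymm '' (((lower lam).erase lam : Finset _) : Set ℤⁿ) := by
    ext f
    constructor
    · rintro ⟨μ, h1, h2, rfl⟩
      exact ⟨μ, mem_lower_erase.2 ⟨h1, h2⟩, rfl⟩
    · rintro ⟨μ, hμ, rfl⟩
      exact ⟨μ, (mem_lower_erase.1 hμ).1, (mem_lower_erase.1 hμ).2, rfl⟩
  constructor
  · rintro ⟨h1, h2, h3⟩
    rw [hset, Submodule.mem_span_image_finset_iff_exists_fun'] at h2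
    obtain ⟨c, hc⟩ := h2
    refine ⟨h1, fun μ => if μ = lam then 1 else c μ, if_pos rfl, ?_, ?_⟩
    all_goals
      have hp : p = fun x => comb (lower lam) (fun μ => if μ = lam then 1 else c μ) (toC x) := by
        ext x
        have := congrFun hc x
        rw [comb, ← add_sum_erase _ _ (self_mem_lower h1), if_pos rfl]
        simp only [Finset.sum_apply, Pi.smul_apply, smul_eq_mul, Pi.sub_apply] at this
        rw [one_mul, sum_congr rfl fun μ hμ => by rw [if_neg (ne_of_mem_erase hμ)]]
        simp only [← monomialSymm_eq]
        rw [this]; ring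
    · exact hp
    · intro μ hμ
      rw [← innerWeight_eq_bil, ← hp]
      exact h3 μ (mem_lower_erase.1 hμ).1 (mem_lower_erase.1 hμ).2
  · rintro ⟨h1, b, hb, rfl, h3⟩
    refine ⟨h1, ?_, fun μ h4 h5 => ?_⟩
    · rw [hset, Submodule.mem_span_image_finset_iff_exists_fun']
      refine ⟨b, ?_⟩
      ext x
      rw [Pi.sub_apply, comb, ← add_sum_erase _ _ (self_mem_lower h1), hb]
      simp [monomialSymm_eq]
    · rw [innerWeight_eq_bil]
      exact h3 μ (mem_lower_erase.2 ⟨h4, h5⟩)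

lemma existsUnique_isJacobi {P : Couplings} (hw : Continuous (weight P : ℝⁿ → ℝ)) (hl : IsDominant lam) :
    ∃! p, IsJacobi P lam p := by
  set s := (lower lam).erase lam with hsd
  have hs : ∀ μ ∈ s, IsDominant μ := fun μ hμ => (mem_lower_erase.1 hμ).1
  have hlam : lam ∉ s := Finset.notMem_erase _ _
  let ext0 : (s → ℂ) → ℤⁿ → ℂ := fun c μ => if h : μ ∈ s then c ⟨μ, h⟩ else 0
  let G : (s → ℂ) →ₗ[ℂ] (s → ℂ) :=
    LinearMap.pi fun ν => ∑ μ : s, bil P (monoC μ.1) (monoC ν.1) • proj μ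
  have hG : ∀ c ν, G c ν = bil P (comb s (ext0 c)) (monoC ν.1) := by
    intro c ν
    rw [bil_comb_left hw _ _ (monoC_mem _), ← sum_coe_sort s]
    simp only [G, pi_apply, LinearMap.sum_apply, LinearMap.smul_apply, proj_apply, smul_eq_mul]
    refine sum_congr rfl fun μ _ => ?_
    simp [ext0, mul_comm]
  have hinj : Injective G := by
    refine (injective_iff_map_eq_zero G).2 fun c hc => funext fun ν => ?_
    have := eq_zero_of_forall_bil hw hs (b := ext0 c)
      (fun μ hμ => by rw [← hG c ⟨μ, hμ⟩, hc]; rfl) ν.1 ν.2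
    simpa [ext0] using this
  have hsplit : ∀ (b : ℤⁿ → ℂ), b lam = 1 → ∀ ν, bil P (comb (lower lam) b) (monoC ν) =
        bil P (monoC lam) (monoC ν) + bil P (comb s b) (monoC ν) := by
    intro b hb ν
    rw [bil_comb_left hw _ _ (monoC_mem _), bil_comb_left hw _ _ (monoC_mem _),
      ← add_sum_erase _ _ (self_mem_lower hl), hb, one_mul]
  obtain ⟨c, hc⟩ := LinearMap.injective_iff_surjective.1 hinj
    fun ν => -bil P (monoC lam) (monoC ν.1)
  refine ⟨fun x => comb (lower lam) (fun μ => if μ = lam then 1 else ext0 c μ) (toC x),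
    isJacobi_iff.2 ⟨hl, _, if_pos rfl, rfl, fun μ hμ => ?_⟩, fun p hp => ?_⟩
  · rw [hsplit _ (if_pos rfl)]
    have e : comb s (fun μ => if μ = lam then 1 else ext0 c μ) = comb s (ext0 c) :=
      funext fun z => sum_congr rfl fun ν hν => by simp only [if_neg (ne_of_mem_erase hν)]
    rw [e, ← hG c ⟨μ, hμ⟩, hc]
    ring
  · obtain ⟨-, b, hb, rfl, hb0⟩ := isJacobi_iff.1 hp
    have hbc : (fun ν : s => b ν.1) = c := by
      refine hinj (funext fun ν => ?_)
      rw [hc, hG]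
      have e : comb s (ext0 fun ν : s => b ν.1) = comb s b :=
        funext fun z => sum_congr rfl fun ν hν => by simp [ext0, hν]
      grind
    ext x
    refine sum_congr rfl fun μ hμ => ?_
    grind

/-! ### Mirrors -/

/-- The index type of the positive roots, each short root being counted twice. -/
abbrev Mirror (n : ℕ) := ({q : Fin n × Fin n // q.1 < q.2} × Bool) ⊕ (Fin n × Bool)

/-- The direction of a mirror. -/
def mNu : Mirror n → ℤⁿ
  | .inl (q, e) => single q.1.1 1 + single q.1.2 (if e then 1 else -1)
  | .inr (j, _) => single j 1

/-- The offset of a mirror. -/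
def mC : Mirror n → ℝ
  | .inl _ => 0
  | .inr (_, t) => if t then Real.pi else 0

/-- The multiplicity of a mirror. -/
def mK : Mirror n → ℝ
  | .inl _ => P.g
  | .inr (_, t) => if t then P.g₁ + P.g₁' else P.g₀ + P.g₀'

/-- The angle attached to a mirror. -/
def ang (i : Mirror n) (x : ℝⁿ) : ℝ := ∑ j, (mNu i j : ℝ) * x j + mC i

/-- The squared sine of half the angle. -/
def sq (i : Mirror n) (x : ℝⁿ) : ℝ := (1 - Real.cos (ang i x)) / 2

lemma sq_eq (i : Mirror n) (x : ℝⁿ) : sq i x = Real.sin (ang i x / 2) ^ 2 := by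
  have h1 := Real.cos_two_mul (ang i x / 2)
  have h2 := Real.sin_sq_add_cos_sq (ang i x / 2)
  rw [show 2 * (ang i x / 2) = ang i x by ring] at h1
  rw [sq, h1]; linarith

lemma sq_nonneg' (i : Mirror n) (x : ℝⁿ) : 0 ≤ sq i x := by rw [sq_eq]; positivity

lemma sq_le_one (i : Mirror n) (x : ℝⁿ) : sq i x ≤ 1 := by
  have := Real.neg_one_le_cos (ang i x)
  rw [sq]; linarith

lemma ang_inl (q : {q : Fin n × Fin n // q.1 < q.2}) (e : Bool) (x : ℝⁿ) :
    ang (.inl (q, e)) x = x q.1.1 + (if e then 1 else -1) * x q.1.2 := by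
  simp only [ang, mNu, mC, Pi.add_apply, Int.cast_add, add_mul, sum_add_distrib, single_apply]
  cases e <;> simp

lemma ang_inr (j : Fin n) (t : Bool) (x : ℝⁿ) :
    ang (.inr (j, t)) x = x j + if t then Real.pi else 0 := by
  simp [ang, mNu, mC, single_apply]

lemma weight_eq_prod (x : ℝⁿ) : weight P x = ∏ i : Mirror n, sq i x ^ mK P i := by
  have key : ∀ a k : ℝ, |a| ^ (2 * k) = (a ^ 2) ^ k := fun a k => by
    rw [Real.rpow_mul (abs_nonneg a), Real.rpow_two, sq_abs]
  rw [weight, Fintype.prod_sum_type, prod_prod_type, prod_prod_type]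
  congr 1
  · rw [Finset.prod_subtype (p := fun q : Fin n × Fin n => q.1 < q.2) _ (by simp)]
    refine prod_congr rfl fun q _ => ?_
    rw [prod_bool, sq_eq, sq_eq, ang_inl, ang_inl]
    simp only [mK]
    rw [key, mul_pow, mul_rpow (by positivity) (by positivity)]
    congr 5 <;> simp [sub_eq_add_neg]
  · refine prod_congr rfl fun j _ => ?_
    rw [prod_bool, sq_eq, sq_eq, ang_inr, ang_inr, key, key, mul_comm]
    simp only [mK, if_true, add_div]
    rw [sin_add_pi_div_two]
    simp

lemma ang_add_single (i : Mirror n) (x : ℝⁿ) (j : Fin n) (t : ℝ) :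
    ang i (x + single j t) = ang i x + mNu i j * t := by
  simp only [ang, Pi.add_apply, mul_add, sum_add_distrib]
  simp [single_apply]
  ring

lemma isPeriodic_sq (i : Mirror n) : IsPeriodic (sq i) := by
  rintro x _ ⟨j, rfl⟩
  rw [sq, sq, ang_add_single, Real.cos_add_int_mul_two_pi]

lemma contDiff_sq (i : Mirror n) {m : WithTop ℕ∞} : ContDiff ℝ m (sq i) := by
  unfold sq ang
  fun_prop

/-! ### Derivatives of trigonometric polynomials -/

/-- The `j`th complex partial derivative. -/
def dC (j : Fin n) (f : ℂⁿ → ℂ) (z : ℂⁿ) : ℂ := fderiv ℂ f z (single j 1)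

lemma differentiable_trigPoly (hf : f ∈ trigPoly n) : Differentiable ℂ f :=
  (contDiff_trigPoly hf (m := 1)).differentiable (by simp)

lemma hasDerivAt_line (hf : Differentiable ℂ f) (v z : ℂⁿ) :
    HasDerivAt (fun t : ℂ => f (z + t • v)) (fderiv ℂ f z v) 0 := by
  have h : HasDerivAt (fun t : ℂ => z + t • v) v 0 := by
    simpa using ((hasDerivAt_id (0 : ℂ)).smul_const v).const_add z
  have h2 := (hf (z + (0 : ℂ) • v)).hasFDerivAt.comp_hasDerivAt (0 : ℂ) h
  simpa [comp_def] using h2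

lemma dC_mem (j : Fin n) (hf : f ∈ trigPoly n) : dC j f ∈ trigPoly n := by
  have hadd : ∀ f h, Differentiable ℂ f → Differentiable ℂ h → dC j (f + h) = dC j f + dC j h :=
    fun f h hf hh => funext fun z => by simp [dC, fderiv_add (hf z) (hh z)]
  suffices f ∈ trigPoly n ∧ dC j f ∈ trigPoly n from this.2
  refine trigPoly_induction (p := fun f => f ∈ trigPoly n ∧ dC j f ∈ trigPoly n) hf
    (fun ν => ⟨expo_mem ν, ?_⟩) ⟨zero_mem _, ?_⟩ (fun f h hf hh => ⟨add_mem hf.1 hh.1, ?_⟩)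
    fun a f hf => ⟨(trigPoly n).smul_mem hf.1 a, ?_⟩
  · have e : dC j (expo ν) = (I * ν j) • expo ν := by
      ext z
      have h1 := hasDerivAt_line (differentiable_trigPoly (expo_mem ν)) (single j 1) z
      have h2 : HasDerivAt (fun t : ℂ => expo ν (z + t • single j 1)) (expo ν z * (I * ν j)) 0 := by
        have e : (fun t : ℂ => expo ν (z + t • single j 1)) =
            fun t => expo ν z * exp (t * (I * ν j)) := by
          ext t
          rw [expo_add, expo, expo, lin_smul, lin_single]
          congr 2; ring
        rw [e]
        have := ((hasDerivAt_id (0 : ℂ)).mul_const (I * (ν j : ℂ))).cexp.const_mul (expo ν z)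
        simpa using this
      rw [dC, h1.unique h2, Pi.smul_apply, smul_eq_mul, mul_comm]
    rw [e]
    exact (trigPoly n).smul_mem (expo_mem ν) _
  · have e : dC j (0 : ℂⁿ → ℂ) = 0 := by ext z; simp [dC]
    rw [e]; exact zero_mem _
  · rw [hadd f h (differentiable_trigPoly hf.1) (differentiable_trigPoly hh.1)]
    exact add_mem hf.2 hh.2
  · have e : dC j (a • f) = a • dC j f := by
      ext z
      simp [dC, fderiv_const_smul (differentiable_trigPoly hf.1 z)]
    rw [e]; exact (trigPoly n).smul_mem hf.2 _

/-- The derivative in the direction of a mirror. -/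
def dDir (i : Mirror n) (f : ℂⁿ → ℂ) (z : ℂⁿ) : ℂ := ∑ j, (mNu i j : ℂ) * dC j f z

lemma dDir_mem (i : Mirror n) (hf : f ∈ trigPoly n) : dDir i f ∈ trigPoly n := by
  have : dDir i f = ∑ j, (mNu i j : ℂ) • dC j f := by ext z; simp [dDir]
  rw [this]
  exact sum_mem fun j _ => (trigPoly n).smul_mem (dC_mem j hf) _

lemma dDir_eq (i : Mirror n) (f : ℂⁿ → ℂ) (z : ℂⁿ) :
    dDir i f z = fderiv ℂ f z fun j => (mNu i j : ℂ) := by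
  have : (fun j => (mNu i j : ℂ)) = ∑ j, (mNu i j : ℂ) • (single j 1 : ℂⁿ) := by
    ext k; simp [Finset.sum_apply, single_apply]
  rw [this, map_sum]
  simp [dDir, dC]

lemma lin_mNu_inl (q : {q : Fin n × Fin n // q.1 < q.2}) (e : Bool) (p : ℂⁿ) :
    lin (mNu (.inl (q, e))) p = p q.1.1 + (if e then 1 else -1) * p q.1.2 := by
  simp only [lin, mNu, Pi.add_apply, Int.cast_add, add_mul, sum_add_distrib, single_apply]
  cases e <;> simp

lemma lin_mNu_inr (j : Fin n) (t : Bool) (p : ℂⁿ) : lin (mNu (.inr (j, t))) p = p j := by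
  simp [lin, mNu, single_apply]

lemma even_of_isWeylInv (hf : f ∈ trigPoly n) (hW : IsWeylInv f)
    (i : Mirror n) {p : ℂⁿ} (hp : lin (mNu i) p + mC i = 0) (t : ℂ) :
    f (p + (-t) • fun j => (mNu i j : ℂ)) = f (p + t • fun j => (mNu i j : ℂ)) := by
  rcases i with ⟨⟨⟨j, k⟩, hjk⟩, e⟩ | ⟨j, b⟩
  · simp only at hjk
    rw [lin_mNu_inl] at hp
    refine apply_eq_of_reflection hf hW (swapWith j k (if e then -1 else 1)) 0 ?_
    ext l
    by_cases hlj : l = j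
    · subst hlj
      rw [Pi.add_apply (weylAct _ _), weylAct_swapWith_left]
      cases e <;> simp [mNu, mC, period, single_apply, hjk.ne, hjk.ne'] at hp ⊢ <;>
        linear_combination hp
    by_cases hlk : l = k
    · subst hlk
      rw [Pi.add_apply (weylAct _ _), weylAct_swapWith_right]
      cases e <;> simp [mNu, mC, period, single_apply, hjk.ne, hjk.ne'] at hp ⊢
      · linear_combination -hp
      · linear_combination hp
    · rw [Pi.add_apply (weylAct _ _), weylAct_swapWith_of_ne _ hlj hlk]
      simp [mNu, period, single_apply, hlj, hlk]
  · rw [lin_mNu_inr] at hp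
    refine apply_eq_of_reflection hf hW (flipAt j) (if b then single j (-1) else 0) ?_
    ext l
    by_cases hlj : l = j
    · subst hlj
      rw [Pi.add_apply (weylAct _ _), weylAct_flipAt_self]
      cases b <;> simp [mNu, mC, period] at hp ⊢
      · linear_combination 2 * hp
      · linear_combination 2 * hp
    · rw [Pi.add_apply (weylAct _ _), weylAct_flipAt_of_ne hlj]
      cases b <;> simp [mNu, period, single_apply, hlj]

lemma exists_mNu_sq (i : Mirror n) : ∃ j, mNu i j * mNu i j = 1 := by
  rcases i with ⟨⟨⟨j, k⟩, hjk⟩, e⟩ | ⟨j, b⟩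
  · simp only at hjk
    exact ⟨j, by simp [mNu, hjk.ne]⟩
  · exact ⟨j, by simp [mNu]⟩

lemma ofReal_ang (i : Mirror n) (x : ℝⁿ) : ((ang i x : ℝ) : ℂ) = lin (mNu i) (toC x) + mC i := by
  simp [ang, lin, toC]

lemma exists_radial (hf : f ∈ trigPoly n) (hW : IsWeylInv f)
    (i : Mirror n) : ∃ H ∈ trigPoly n, ∀ x : ℝⁿ,
      (Real.sin (ang i x) : ℂ) * dDir i f (toC x) = 2 * sq i x * H (toC x) := by
  obtain ⟨j, hj⟩ := exists_mNu_sq i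
  obtain ⟨h, hh, he⟩ := exists_factor (c := mC i) hj (dDir_mem i hf) fun p hp => by
    have h1 := hasDerivAt_line (differentiable_trigPoly hf) (fun j => (mNu i j : ℂ)) p
    have h2 : HasDerivAt (fun t : ℂ => f (p + t • fun j => (mNu i j : ℂ)))
        (-fderiv ℂ f p fun j => (mNu i j : ℂ)) 0 := by
      have h3 := HasDerivAt.scomp (0 : ℂ) (h := fun t : ℂ => -t) (h' := -1)
        (g₁ := fun t : ℂ => f (p + t • fun j => (mNu i j : ℂ))) (by simpa using h1)
        (hasDerivAt_neg (0 : ℂ))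
      simp only [comp_def, even_of_isWeylInv hf hW i hp] at h3
      simpa using h3
    have := h1.unique h2
    rw [dDir_eq]
    linear_combination this / 2
  refine ⟨fun z => I * (exp (I * (lin (mNu i) z + mC i)) + 1) * h z, ?_, fun x => ?_⟩
  · exact mul_mem (mul_mem (const_mem_trigPoly _) (add_mem (exp_lin_mem _ _) (one_mem _))) hh
  · beta_reduce
    rw [he, wallZ, ← ofReal_ang, mul_comm I ((ang i x : ℝ) : ℂ), Complex.exp_mul_I, sq]
    push_cast
    linear_combination (I * h (toC x)) * Complex.sin_sq_add_cos_sq (ang i x : ℂ) +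
      (sin (ang i x) * h (toC x) * (cos (ang i x) - 1)) * I_sq

/-! ### Symmetry of the radial Laplacian -/

/-- The weight function with regularized factors. -/
def regWeight (δ : ℝ) (x : ℝⁿ) : ℝ := ∏ i : Mirror n, (sq i x + δ) ^ mK P i

lemma sq_add_pos {δ : ℝ} (hδ : 0 < δ) (i : Mirror n) (x : ℝⁿ) :
    0 < sq i x + δ := by linarith [sq_nonneg' i x]

lemma contDiff_regWeight {δ : ℝ} (hδ : 0 < δ) : ContDiff ℝ ∞ (regWeight P δ : ℝⁿ → ℝ) :=
  contDiff_prod fun i _ => ((contDiff_sq i).add contDiff_const).rpow_const_of_ne fun x =>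
    (sq_add_pos hδ i x).ne'

lemma regWeight_le {P : Couplings} (hk : ∀ i : Mirror n, 0 ≤ mK P i) {δ : ℝ} (hδ : 0 < δ)
    (hδ1 : δ ≤ 1) (x : ℝⁿ) : |regWeight P δ x| ≤ ∏ i : Mirror n, (2 : ℝ) ^ mK P i := by
  rw [regWeight, abs_of_nonneg (prod_nonneg fun i _ => Real.rpow_nonneg (sq_add_pos hδ i x).le _)]
  exact Finset.prod_le_prod (fun i _ => Real.rpow_nonneg (sq_add_pos hδ i x).le _) fun i _ =>
    Real.rpow_le_rpow (sq_add_pos hδ i x).le (by linarith [sq_le_one i x]) (hk i)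

lemma hasDerivAt_ang (i : Mirror n) (x : ℝⁿ) (j : Fin n) :
    HasDerivAt (fun t : ℝ => sq i (x + t • single j 1)) (Real.sin (ang i x) * mNu i j / 2) 0 := by
  have e : ∀ t : ℝ, ang i (x + t • single j 1) = ang i x + mNu i j * t := fun t => by
    rw [← ang_add_single, ← Pi.single_smul, smul_eq_mul, mul_one]
  have h1 : HasDerivAt (fun t : ℝ => ang i x + mNu i j * t) (mNu i j) 0 := by
    simpa using ((hasDerivAt_id (0 : ℝ)).const_mul (mNu i j : ℝ)).const_add (ang i x)
  have h2 := (h1.cos.const_sub 1).div_const 2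
  simpa only [sq, e, mul_zero, add_zero, neg_mul, neg_neg] using h2

lemma hasDerivAt_regWeight {δ : ℝ} (hδ : 0 < δ) (x : ℝⁿ) (j : Fin n) :
    HasDerivAt (fun t : ℝ => regWeight P δ (x + t • single j 1)) (regWeight P δ x *
      ∑ i : Mirror n, mK P i * (Real.sin (ang i x) * mNu i j / 2 / (sq i x + δ))) 0 := by
  have e : ∀ y : ℝⁿ, regWeight P δ y =
      Real.exp (∑ i : Mirror n, mK P i * Real.log (sq i y + δ)) := fun y => by
    rw [Real.exp_sum]
    exact prod_congr rfl fun i _ => by rw [Real.rpow_def_of_pos (sq_add_pos hδ i y), mul_comm]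
  simp only [e]
  have h := HasDerivAt.exp (HasDerivAt.fun_sum (u := Finset.univ) fun (i : Mirror n) _ =>
    (((hasDerivAt_ang i x j).add_const δ).log (by
      simpa using (sq_add_pos hδ i x).ne')).const_mul (mK P i))
  simpa using h

lemma toC_add_smul (x : ℝⁿ) (t : ℝ) (j : Fin n) :
    toC (x + t • single j 1) = toC x + (t : ℂ) • single j 1 := by
  ext k; by_cases h : k = j <;> simp [toC, h]

lemma hasDerivAt_toC (hf : f ∈ trigPoly n) (x : ℝⁿ) (j : Fin n) :
    HasDerivAt (fun t : ℝ => f (toC (x + t • single j 1))) (dC j f (toC x)) 0 := by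
  simp only [toC_add_smul]
  exact HasDerivAt.comp_ofReal (e := fun t : ℂ => f (toC x + t • single j 1)) (z := 0)
    (by simpa using hasDerivAt_line (differentiable_trigPoly hf) (single j 1) (toC x))

lemma isPeriodic_trigPoly (hf : f ∈ trigPoly n) : IsPeriodic fun x : ℝⁿ => f (toC x) := by
  rintro x _ ⟨j, rfl⟩
  beta_reduce
  rw [← trigPoly_period hf (toC x) (single j 1)]
  congr 1
  ext k
  by_cases h : k = j
  · subst h; simp [toC, period]
  · simp [toC, period, h]

/-- The radial part of the Laplacian, in terms of the radial parts at the mirrors. -/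
def radialOp (f : ℂⁿ → ℂ) (H : Mirror n → ℂⁿ → ℂ)
    (z : ℂⁿ) : ℂ := ∑ j, dC j (dC j f) z + ∑ i, mK P i * H i z

section radial

variable {P : Couplings} {f h : (Fin n → ℂ) → ℂ} {H : Mirror n → (Fin n → ℂ) → ℂ}

lemma integral_regWeight (hf : f ∈ trigPoly n) (hh : h ∈ trigPoly n) (hH : ∀ i, ∀ x : ℝⁿ,
      (Real.sin (ang i x) : ℂ) * dDir i f (toC x) = 2 * sq i x * H i (toC x))
    {δ : ℝ} (hδ : 0 < δ) :
    ∫ x in cube n, (regWeight P δ x : ℂ) *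
      ((∑ j, dC j (dC j f) (toC x) + ∑ i : Mirror n, mK P i * ((sq i x / (sq i x + δ) : ℝ) : ℂ) *
        H i (toC x)) * h (toC x) + ∑ j, dC j f (toC x) * dC j h (toC x)) = 0 := by
  have hs : ∀ {u : ℂⁿ → ℂ}, u ∈ trigPoly n → ContDiff ℝ 1 fun x : ℝⁿ => u (toC x) := fun hu =>
    ((contDiff_trigPoly hu).restrict_scalars ℝ).comp contDiff_toC
  have hF : ∀ j, ContDiff ℝ 1 fun x : ℝⁿ =>
      (regWeight P δ x : ℂ) * (dC j f (toC x) * h (toC x)) := fun j =>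
    (ofRealCLM.contDiff.comp ((contDiff_regWeight P hδ).of_le (by simp))).mul
      ((hs (dC_mem j hf)).mul (hs hh))
  have hp : ∀ j, IsPeriodic fun x : ℝⁿ =>
      (regWeight P δ x : ℂ) * (dC j f (toC x) * h (toC x)) := fun j x y hxy => by
    simp only [regWeight]
    have h1 := isPeriodic_trigPoly (dC_mem j hf) x y hxy
    have h2 := isPeriodic_trigPoly hh x y hxy
    beta_reduce at h1 h2
    rw [h1, h2, prod_congr rfl fun i _ => by rw [isPeriodic_sq i x y hxy]]
  rw [← integral_divergence_eq_zero hF hp]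
  refine integral_congr_ae (ae_of_all _ fun x => ?_)
  have hd : ∀ j, fderiv ℝ (fun x : ℝⁿ =>
      (regWeight P δ x : ℂ) * (dC j f (toC x) * h (toC x))) x (single j 1) =
      (regWeight P δ x : ℂ) * ((∑ i : Mirror n, mK P i *
        (Real.sin (ang i x) * mNu i j / 2 / (sq i x + δ))) * (dC j f (toC x) * h (toC x)) +
        (dC j (dC j f) (toC x) * h (toC x) + dC j f (toC x) * dC j h (toC x))) := by
    intro j
    have h1 := ((hF j).differentiable (by simp) x).hasFDerivAt.hasLineDerivAt (single j 1)
    have h2 := (hasDerivAt_regWeight P hδ x j).ofReal_comp.mul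
      ((hasDerivAt_toC (dC_mem j hf) x j).mul (hasDerivAt_toC hh x j))
    rw [h1.unique h2]
    push_cast
    simp only [zero_smul, add_zero, Pi.mul_apply]
    ring
  simp only [hd]
  rw [← mul_sum, sum_add_distrib, sum_add_distrib, ← sum_mul]
  congr 1
  have e1 : ∑ j, (∑ i : Mirror n, (mK P i : ℂ) *
      (Real.sin (ang i x) * mNu i j / 2 / (sq i x + δ))) * (dC j f (toC x) * h (toC x)) =
      (∑ i : Mirror n, mK P i * ((sq i x / (sq i x + δ) : ℝ) : ℂ) * H i (toC x)) * h (toC x) := by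
    simp only [sum_mul]
    rw [sum_comm]
    refine sum_congr rfl fun i _ => ?_
    have h2 : (sq i x : ℂ) * H i (toC x) = Real.sin (ang i x) * dDir i f (toC x) / 2 := by
      rw [hH]; ring
    push_cast
    rw [show (mK P i : ℂ) * (sq i x / (sq i x + δ)) * H i (toC x) * h (toC x) =
      (mK P i : ℂ) * (sq i x * H i (toC x)) / (sq i x + δ) * h (toC x) by ring, h2, dDir,
      mul_sum, sum_div, mul_sum, sum_div, sum_mul]
    exact sum_congr rfl fun j _ => by push_cast; ring
  push_cast at e1 ⊢
  rw [e1]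
  ring

lemma bil_radialOp (hk : ∀ i : Mirror n, 0 ≤ mK P i) (hf : f ∈ trigPoly n) (hh : h ∈ trigPoly n)
    (hHm : ∀ i, H i ∈ trigPoly n) (hH : ∀ i, ∀ x : ℝⁿ,
      (Real.sin (ang i x) : ℂ) * dDir i f (toC x) = 2 * sq i x * H i (toC x)) :
    bil P (radialOp P f H) h =
      -∫ x in cube n, (weight P x : ℂ) * ∑ j, dC j f (toC x) * dC j h (toC x) := by
  have hcw : Continuous (weight P : ℝⁿ → ℝ) := by
    simp only [funext (weight_eq_prod P)]
    exact continuous_finsetProd _ fun i _ => (contDiff_sq i (m := 0)).continuous.rpow_const fun x =>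
      Or.inr (hk i)
  have hcf := fun j => continuous_comp_toC (dC_mem j hf)
  have hcff := fun j => continuous_comp_toC (dC_mem j (dC_mem j hf))
  have hch := fun j => continuous_comp_toC (dC_mem j hh)
  have hch0 := continuous_comp_toC hh
  have hcH := fun i => continuous_comp_toC (hHm i)
  have hcR : Continuous fun x : ℝⁿ => radialOp P f H (toC x) :=
    (continuous_finsetSum _ fun j _ => hcff j).add
      (continuous_finsetSum _ fun i _ => continuous_const.mul (hcH i))
  have hcG : Continuous fun x : ℝⁿ => ∑ j, dC j f (toC x) * dC j h (toC x) :=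
    continuous_finsetSum _ fun j _ => (hcf j).mul (hch j)
  have hcW : Continuous fun x : ℝⁿ => (weight P x : ℂ) := continuous_ofReal.comp hcw
  suffices hmain : ∫ x in cube n, (weight P x : ℂ) * (radialOp P f H (toC x) * h (toC x) +
      ∑ j, dC j f (toC x) * dC j h (toC x)) = 0 by
    rw [eq_neg_iff_add_eq_zero, ← hmain, bil, ← integral_add]
    · exact integral_congr_ae (ae_of_all _ fun x => by ring)
    · exact integrableOn_cube ((hcR.mul hch0).mul hcW)
    · exact integrableOn_cube (hcW.mul hcG)
  set δ : ℕ → ℝ := fun N => 1 / ((N : ℝ) + 1) with hδd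
  have hδ : ∀ N, 0 < δ N := fun N => Nat.one_div_pos_of_nat
  have hδ1 : ∀ N, δ N ≤ 1 := fun N => by
    rw [hδd]; exact div_le_one_of_le₀ (by linarith [Nat.cast_nonneg (α := ℝ) N]) (by positivity)
  have hδt : Tendsto δ atTop (𝓝 0) := tendsto_one_div_add_atTop_nhds_zero_nat
  set C : ℝ := ∏ i : Mirror n, (2 : ℝ) ^ mK P i
  have hC : 0 ≤ C := prod_nonneg fun i _ => by positivity
  have hratio : ∀ N (i : Mirror n) x, 0 ≤ sq i x / (sq i x + δ N) ∧ sq i x / (sq i x + δ N) ≤ 1 :=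
    fun N i x => ⟨div_nonneg (sq_nonneg' i x) (sq_add_pos (hδ N) i x).le,
      div_le_one_of_le₀ (by linarith [hδ N]) (sq_add_pos (hδ N) i x).le⟩
  refine tendsto_nhds_unique (tendsto_integral_of_dominated_convergence
    (F := fun N x => (regWeight P (δ N) x : ℂ) * ((∑ j, dC j (dC j f) (toC x) + ∑ i : Mirror n,
        mK P i * ((sq i x / (sq i x + δ N) : ℝ) : ℂ) * H i (toC x)) * h (toC x) +
        ∑ j, dC j f (toC x) * dC j h (toC x)))
    (fun x => C * ((∑ j, ‖dC j (dC j f) (toC x)‖ + ∑ i : Mirror n, mK P i * ‖H i (toC x)‖) *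
      ‖h (toC x)‖ + ‖∑ j, dC j f (toC x) * dC j h (toC x)‖)) ?_ ?_ ?_ ?_) ?_
  · intro N
    refine Continuous.aestronglyMeasurable ?_
    refine (continuous_ofReal.comp (contDiff_regWeight P (hδ N)).continuous).mul
      ((((continuous_finsetSum _ fun j _ => hcff j).add (continuous_finsetSum _ fun i _ =>
        (continuous_const.mul (continuous_ofReal.comp ?_)).mul (hcH i))).mul hch0).add hcG)
    exact (contDiff_sq i (m := 0)).continuous.div
      ((contDiff_sq i (m := 0)).continuous.add continuous_const)
      fun x => (sq_add_pos (hδ N) i x).ne'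
  · refine Continuous.integrableOn_Icc ?_
    exact continuous_const.mul ((((continuous_finsetSum _ fun j _ => (hcff j).norm).add
      (continuous_finsetSum _ fun i _ => continuous_const.mul (hcH i).norm)).mul hch0.norm).add
      hcG.norm)
  · refine fun N => ae_of_all _ fun x => ?_
    rw [norm_mul, norm_real, Real.norm_eq_abs]
    refine mul_le_mul (regWeight_le hk (hδ N) (hδ1 N) x) ((norm_add_le _ _).trans ?_)
      (norm_nonneg _) hC
    rw [norm_mul]
    refine add_le_add_left (mul_le_mul_of_nonneg_right ((norm_add_le _ _).trans
      (add_le_add (norm_sum_le _ _) ((norm_sum_le _ _).trans (sum_le_sum fun i _ => ?_))))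
      (norm_nonneg _)) _
    rw [norm_mul, norm_mul, norm_real, norm_real, Real.norm_of_nonneg (hk i),
      Real.norm_of_nonneg (hratio N i x).1]
    exact mul_le_mul_of_nonneg_right (mul_le_of_le_one_right (hk i) (hratio N i x).2)
      (norm_nonneg _)
  · refine ae_of_all _ fun x => ?_
    have hw : Tendsto (fun N => regWeight P (δ N) x) atTop (𝓝 (weight P x)) := by
      rw [weight_eq_prod]
      refine tendsto_finsetProd _ fun i _ => ?_
      have := (Real.continuous_rpow_const (hk i)).tendsto (sq i x + 0)
      rw [add_zero] at this
      exact this.comp (by simpa using hδt.const_add (sq i x))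
    have hw' : Tendsto (fun N => (regWeight P (δ N) x : ℂ)) atTop (𝓝 (weight P x : ℂ)) :=
      (continuous_ofReal.tendsto _).comp hw
    have hterm : ∀ i : Mirror n, Tendsto (fun N => (regWeight P (δ N) x : ℂ) *
        (mK P i * ((sq i x / (sq i x + δ N) : ℝ) : ℂ) * H i (toC x))) atTop
        (𝓝 ((weight P x : ℂ) * (mK P i * H i (toC x)))) := by
      intro i
      by_cases h0 : sq i x = 0
      · have e : (weight P x : ℂ) * (mK P i * H i (toC x)) = 0 := by
          by_cases hki : mK P i = 0
          · simp [hki]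
          · have : weight P x = 0 := by
              rw [weight_eq_prod]
              exact prod_eq_zero (Finset.mem_univ i) (by rw [h0, Real.zero_rpow hki])
            simp [this]
        rw [e]
        simp [h0]
      · have h1 : Tendsto (fun N => sq i x / (sq i x + δ N)) atTop (𝓝 1) := by
          have := (tendsto_const_nhds (x := sq i x) (f := atTop)).div (hδt.const_add (sq i x))
            (by simpa using h0)
          simpa [div_self h0, Pi.div_def] using this
        have h2 := (continuous_ofReal.tendsto _).comp h1
        have := hw'.mul ((h2.const_mul (mK P i : ℂ)).mul_const (H i (toC x)))
        simpa using this
    have key : ∀ (w A B G : ℂ) (T : Mirror n → ℂ),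
        w * ((A + ∑ i, T i) * B + G) = (w * A + ∑ i, w * T i) * B + w * G := fun w A B G T => by
      rw [← mul_sum]; ring
    simp only [radialOp, key]
    exact (((hw'.mul_const _).add (tendsto_finsetSum _ fun i _ => hterm i)).mul_const _).add
      (hw'.mul_const _)
  · simp only [integral_regWeight hf hh hH (hδ _)]
    exact tendsto_const_nhds

end radial

/-! ### The leading operator for `r = 1` -/

/-- The sign configuration supported on one index. -/
def oneSign (p : Fin n × ℤˣ) : 𝕊ⁿ := single p.1 (if p.2 = 1 then 1 else -1)

lemma oneSign_self (p : Fin n × ℤˣ) : oneSign p p.1 = if p.2 = 1 then 1 else -1 := by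
  simp [oneSign]

lemma oneSign_of_ne (p : Fin n × ℤˣ) {j : Fin n} (h : j ≠ p.1) : oneSign p j = 0 := by
  simp [oneSign, h]

lemma oneSign_cast (p : Fin n × ℤˣ) : (oneSign p p.1 : ℂ) = ((p.2 : ℤ) : ℂ) := by
  rw [oneSign_self]
  rcases units_eq_one_or p.2 with h | h <;> simp [h]

lemma oneSign_ne_zero (p : Fin n × ℤˣ) : oneSign p p.1 ≠ 0 := by
  rw [oneSign_self]; split_ifs <;> decide

lemma supp_oneSign (p : Fin n × ℤˣ) : supp (oneSign p) = {p.1} := by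
  ext j
  rw [mem_supp, Finset.mem_singleton]
  exact ⟨fun h => by_contra fun h' => h (oneSign_of_ne p h'), fun h => h ▸ oneSign_ne_zero p⟩

lemma sum_cells_one {M : Type*} [AddCommMonoid M] (F : 𝕊ⁿ → M) :
    ∑ τ ∈ (cells Finset.univ 1).erase 0, F τ = ∑ p : Fin n × ℤˣ, F (oneSign p) := by
  symm
  refine Finset.sum_bij (fun p _ => oneSign p) (fun p _ => ?_) (fun p _ q _ h => ?_)
    (fun τ hτ => ?_) fun _ _ => rfl
  · refine mem_erase.2 ⟨fun h => ?_, mem_cells.2 ⟨Finset.subset_univ _, ?_⟩⟩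
    · exact oneSign_ne_zero p (congrFun h p.1)
    · rw [supp_oneSign, Finset.card_singleton]
  · have h1 : p.1 = q.1 := by
      have := congrArg supp h
      rwa [supp_oneSign, supp_oneSign, Finset.singleton_inj] at this
    have h2 := oneSign_cast p
    rw [h, h1, oneSign_cast] at h2
    exact Prod.ext h1 (Units.ext (by exact_mod_cast h2.symm))
  · obtain ⟨h0, h1⟩ := mem_erase.1 hτ
    have hc : (supp τ).card = 1 := le_antisymm (mem_cells.1 h1).2
      (card_pos.2 (Finset.nonempty_iff_ne_empty.2 fun h => h0 (supp_eq_empty.1 h)))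
    obtain ⟨j, hj⟩ := Finset.card_eq_one.1 hc
    have hjn : τ j ≠ 0 := mem_supp.1 (hj ▸ Finset.mem_singleton_self j)
    refine ⟨(j, if τ j = 1 then 1 else -1), Finset.mem_univ _, funext fun k => ?_⟩
    by_cases hk : k = j
    · subst hk
      have := oneSign_self (k, if τ k = 1 then 1 else -1)
      have hdec : ∀ a : SignType, a ≠ 0 →
          (if (if a = 1 then (1 : ℤˣ) else -1) = 1 then (1 : SignType) else -1) = a := by decide
      exact this.trans (hdec _ hjn)
    · rw [oneSign_of_ne _ hk]
      by_contra hne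
      exact hk (Finset.mem_singleton.1 (hj ▸ mem_supp.2 (Ne.symm hne)))

lemma cellW_oneSign (x : ℂⁿ) (p : Fin n × ℤˣ) :
    cellW P β x Finset.univ (oneSign p) = vB P β (((p.2 : ℤ) : ℂ) * x p.1) *
      ∏ k ∈ Finset.univ.erase p.1, vA P β (((p.2 : ℤ) : ℂ) * x p.1 + x k) *
        vA P β (((p.2 : ℤ) : ℂ) * x p.1 - x k) := by
  have hu : (Finset.univ : 𝔓ⁿ) = {p.1} ∪ Finset.univ.erase p.1 := by ext j; simp
  conv_lhs => rw [hu]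
  rw [cellW_union P β x (by simp), cellW_singleton, siteW, if_neg (oneSign_ne_zero p),
    Finset.prod_singleton, oneSign_cast]
  have h1 : cellW P β x (Finset.univ.erase p.1) (oneSign p) = 1 := by
    rw [cellW_congr P β (τ' := 0) (fun _ _ => rfl) fun j hj =>
      oneSign_of_ne p (ne_of_mem_erase hj), cellW_zero]
  rw [h1, mul_one]
  congr 1
  refine prod_congr rfl fun k hk => ?_
  rw [pairW, if_neg (oneSign_ne_zero p), if_pos (oneSign_of_ne p (ne_of_mem_erase hk)),
    oneSign_cast]

/-- The cotangent of half the argument. -/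
def hcot (z : ℂ) : ℂ := cos (z / 2) / sin (z / 2)

lemma hcot_neg (z : ℂ) : hcot (-z) = -hcot z := by
  rw [hcot, hcot, neg_div, Complex.cos_neg, Complex.sin_neg, div_neg]

lemma hcot_pi_sub (z : ℂ) : hcot (-z + Real.pi) = -hcot (z + Real.pi) := by
  have h1 : (-z + Real.pi) / 2 = Real.pi / 2 - z / 2 := by ring
  have h2 : (z + Real.pi) / 2 = z / 2 + Real.pi / 2 := by ring
  rw [hcot, hcot, h1, h2, Complex.cos_pi_div_two_sub, Complex.sin_pi_div_two_sub,
    Complex.cos_add_pi_div_two, Complex.sin_add_pi_div_two, neg_div, neg_neg]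

/-- Functions with value `1` and derivative `c` at `0`. -/
def UnitDeriv (F : ℝ → ℂ) (c : ℂ) : Prop := F 0 = 1 ∧ HasDerivAt F c 0

lemma UnitDeriv.mul {F G : ℝ → ℂ} {c d : ℂ} (hF : UnitDeriv F c) (hG : UnitDeriv G d) :
    UnitDeriv (fun β => F β * G β) (c + d) :=
  ⟨by simp [hF.1, hG.1], (hF.2.fun_mul hG.2).congr_deriv (by rw [hF.1, hG.1]; ring)⟩

lemma UnitDeriv.prod {ι : Type*} (s : Finset ι) {F : ι → ℝ → ℂ} {c : ι → ℂ}
    (h : ∀ i ∈ s, UnitDeriv (F i) (c i)) :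
    UnitDeriv (fun β => ∏ i ∈ s, F i β) (∑ i ∈ s, c i) := by
  classical
  induction s using Finset.induction_on with
  | empty => exact ⟨by simp, by simpa using hasDerivAt_const (0 : ℝ) (1 : ℂ)⟩
  | insert i s hi ih =>
    simp only [Finset.prod_insert hi, sum_insert hi]
    exact (h i (mem_insert_self _ _)).mul (ih fun j hj => h j (Finset.mem_insert_of_mem hj))

lemma unitDeriv_sineRatio (κ : ℝ) (s : ℂ) {z : ℂ} (hz : sin (z / 2) ≠ 0) :
    UnitDeriv (fun β => sineRatio β κ (z + s * gam β)) (I / 2 * κ * hcot z) := by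
  have hl : ∀ t : ℂ, HasDerivAt (fun β : ℝ => sin (((β : ℂ) * t + z) / 2))
      (cos (z / 2) * (t / 2)) 0 := fun t => by
    have h1 : HasDerivAt (fun β : ℂ => (β * t + z) / 2) (t / 2) ((0 : ℝ) : ℂ) := by
      simpa using (((hasDerivAt_id (((0 : ℝ) : ℂ))).mul_const t).add_const z).div_const 2
    have := h1.csin.comp_ofReal
    simpa using this
  have e : ∀ β : ℝ, sineRatio β κ (z + s * gam β) = sin (((β : ℂ) * (I * κ + s * I / 2) + z) / 2) /
        sin (((β : ℂ) * (s * I / 2) + z) / 2) := fun β => by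
    rw [sineRatio, gam]
    congr 3 <;> ring
  refine ⟨by simp only [e]; simp [hz], ?_⟩
  simp only [e]
  refine ((hl (I * κ + s * I / 2)).fun_div (hl (s * I / 2)) (by simpa using hz)).congr_deriv ?_
  rw [hcot]
  simp only [ofReal_zero, zero_mul, zero_add]
  field_simp
  ring

lemma unitDeriv_vA {z : ℂ} (hz : sin (z / 2) ≠ 0) :
    UnitDeriv (fun β => vA P β z) (I / 2 * P.g * hcot z) := by
  simpa [vA_eq] using unitDeriv_sineRatio P.g 0 hz

lemma unitDeriv_vB {z : ℂ} (hz : sin (z / 2) ≠ 0) (hz' : cos (z / 2) ≠ 0) :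
    UnitDeriv (fun β => vB P β z) (I / 2 * ((P.g₀ + P.g₀' : ℝ) * hcot z +
      (P.g₁ + P.g₁' : ℝ) * hcot (z + Real.pi))) := by
  rw [cos_eq_sin_half] at hz'
  have h1 := unitDeriv_sineRatio P.g₀ 0 hz
  have h2 := unitDeriv_sineRatio P.g₁ 0 hz'
  have h3 := unitDeriv_sineRatio P.g₀' 1 hz
  have h4 := unitDeriv_sineRatio P.g₁' 1 hz'
  have h := ((h1.mul h2).mul h3).mul h4
  simp only [zero_mul, add_zero, one_mul] at h
  have e : (fun β => vB P β z) = fun β => sineRatio β P.g₀ z * sineRatio β P.g₁ (z + Real.pi) *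
      sineRatio β P.g₀' (z + gam β) * sineRatio β P.g₁' (z + Real.pi + gam β) := by
    ext β
    rw [vB_eq, add_right_comm z (Real.pi : ℂ)]
  rw [e]
  convert h using 1
  push_cast
  ring

/-- The drift coefficient of the leading operator for `r = 1`. -/
def drift (z : ℂⁿ) (j : Fin n) (w : ℂ) : ℂ :=
  (P.g₀ + P.g₀' : ℝ) * hcot w + (P.g₁ + P.g₁' : ℝ) * hcot (w + Real.pi) +
    ∑ k ∈ Finset.univ.erase j, P.g * (hcot (w + z k) + hcot (w - z k))

lemma drift_neg (z : ℂⁿ) (j : Fin n) (w : ℂ) : drift P z j (-w) = -drift P z j w := by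
  rw [drift, drift, hcot_neg, hcot_pi_sub]
  have : ∀ k, hcot (-w + z k) + hcot (-w - z k) = -(hcot (w + z k) + hcot (w - z k)) := fun k => by
    rw [show -w + z k = -(w - z k) by ring, show -w - z k = -(w + z k) by ring, hcot_neg, hcot_neg]
    ring
  simp only [this, mul_neg, sum_neg_distrib]
  ring

lemma unit_drift (z : ℂⁿ) (j : Fin n) (e : ℤˣ) (w : ℂ) :
    drift P z j (((e : ℤ) : ℂ) * w) = ((e : ℤ) : ℂ) * drift P z j w := by
  rcases units_eq_one_or e with h | h <;> simp [h, drift_neg]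

lemma unitDeriv_cellW (hx : x ∈ regularSet n) (p : Fin n × ℤˣ) :
    UnitDeriv (fun β => cellW P β (toC x) Finset.univ (oneSign p))
      (I / 2 * (((p.2 : ℤ) : ℂ) * drift P (toC x) p.1 (toC x p.1))) := by
  simp only [cellW_oneSign]
  have hs := regular_signed hx (fun _ => p.2) p.1
  have h := (unitDeriv_vB P (z := ((p.2 : ℤ) : ℂ) * toC x p.1) (sin_ne_zero_of_re ?_)
    (cos_ne_zero_of_re ?_)).mul (UnitDeriv.prod (Finset.univ.erase p.1)
    (F := fun k β => vA P β (((p.2 : ℤ) : ℂ) * toC x p.1 + toC x k) *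
        vA P β (((p.2 : ℤ) : ℂ) * toC x p.1 - toC x k)) fun k hk =>
      (unitDeriv_vA P (sin_ne_zero_of_re ?_)).mul (unitDeriv_vA P (sin_ne_zero_of_re ?_)))
  · rw [← unit_drift]
    convert h using 1
    rw [drift, mul_add, mul_sum]
    congr 1
    exact sum_congr rfl fun k _ => by ring
  · simpa [signed] using hs.1
  · simpa [signed] using hs.2
  · simpa [signed] using (regular_add hx (fun _ => p.2) (ne_of_mem_erase hk).symm).1
  · simpa [signed] using (regular_add hx (fun _ => p.2) (ne_of_mem_erase hk).symm).2

lemma contDiffAt_cellW (hx : x ∈ regularSet n) (p : Fin n × ℤˣ) :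
    ContDiffAt ℝ ∞ (fun β => cellW P β (toC x) Finset.univ (oneSign p)) 0 := by
  have hs := contDiffOn_V P (fun _ => p.2) {p.1} (Finset.univ.erase p.1) (by simp)
  have h2 : ContDiffAt ℝ ∞ (fun β : ℝ => ((x, β) : ℝⁿ × ℝ)) 0 :=
    contDiffAt_const.prodMk contDiffAt_id
  have h3 := ContDiffAt.comp (0 : ℝ) (hs.contDiffAt (x := (x, 0))
    (((isOpen_regularSet n).prod isOpen_univ).mem_nhds ⟨hx, mem_univ _⟩)) h2
  refine h3.congr_of_eventuallyEq (Eventually.of_forall fun β => ?_)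
  rw [Function.comp]
  have := V_eq_cellW P β (fun _ => p.2) (L := {p.1}) (K := Finset.univ) (τ := oneSign p)
    (Finset.subset_univ _) (fun j => by rw [← mem_supp, supp_oneSign])
    (fun j hj => by rw [Finset.mem_singleton.1 hj, oneSign_cast]) (toC x)
  rw [Finset.erase_eq]
  exact this.symm

lemma differenceOp_one (f : ℂⁿ → ℂ) (x : ℂⁿ) :
    differenceOp P 1 β f x = ∑ p : Fin n × ℤˣ, cellW P β x Finset.univ (oneSign p) *
      (f (x + (I * β) • single p.1 ((p.2 : ℤ) : ℂ)) - f x) := by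
  rw [differenceOp_eq, sum_cells_one]
  refine sum_congr rfl fun p _ => ?_
  have hs : shift β (oneSign p) x = x + (I * β) • single p.1 ((p.2 : ℤ) : ℂ) := by
    ext k
    by_cases hk : k = p.1
    · subst hk; simp [shift, oneSign_cast]
    · simp [shift, oneSign_of_ne p hk, hk]
  rw [supp_oneSign, Finset.card_singleton, Nat.sub_self, chainSum_zero, mul_one, hs]

lemma tc_two_differenceOp (hf : f ∈ trigPoly n) (hx : x ∈ regularSet n) :
    tc 2 (fun β => differenceOp P 1 β f (toC x)) = -(∑ j, dC j (dC j f) (toC x) +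
      ∑ j, drift P (toC x) j (toC x j) * dC j f (toC x)) := by
  have hfa : ∀ {u : ℂⁿ → ℂ}, u ∈ trigPoly n → AnalyticAt ℂ u (toC x) := fun hu =>
    analyticOnNhd_trigPoly hu _ (mem_univ _)
  have hline := fun p : Fin n × ℤˣ => contDiffAt_line (hfa hf) (single p.1 ((p.2 : ℤ) : ℂ))
  have hth : ∀ (u : ℂⁿ → ℂ) (p : Fin n × ℤˣ), thetaC (single p.1 ((p.2 : ℤ) : ℂ)) u =
      fun z => 1 / I * (((p.2 : ℤ) : ℂ) * dC p.1 u z) := by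
    intro u p
    ext z
    have : (single p.1 ((p.2 : ℤ) : ℂ) : ℂⁿ) = ((p.2 : ℤ) : ℂ) • single p.1 1 := by
      rw [← Pi.single_smul, smul_eq_mul, mul_one]
    rw [thetaC, this, map_smul, dC, smul_eq_mul]
  have hterm : ∀ p : Fin n × ℤˣ, tc 2 (fun β => cellW P β (toC x) Finset.univ (oneSign p) *
      (f (toC x + (I * β) • single p.1 ((p.2 : ℤ) : ℂ)) - f (toC x))) =
      -(dC p.1 (dC p.1 f) (toC x) / 2 +
        drift P (toC x) p.1 (toC x p.1) * dC p.1 f (toC x) / 2) := by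
    intro p
    have hu : ((p.2 : ℤ) : ℂ) * ((p.2 : ℤ) : ℂ) = 1 := by
      exact_mod_cast congrArg (Int.cast (R := ℂ)) (units_mul_self p.2)
    have h1 := unitDeriv_cellW P hx p
    have h0 : tc 0 (fun β => cellW P β (toC x) Finset.univ (oneSign p)) = 1 := by simp [tc, h1.1]
    have h1' : tc 1 (fun β => cellW P β (toC x) Finset.univ (oneSign p)) =
        I / 2 * (((p.2 : ℤ) : ℂ) * drift P (toC x) p.1 (toC x p.1)) := by
      rw [tc, iteratedDeriv_one, h1.2.deriv]; simp
    have hd0 : tc 0 (fun β : ℝ => f (toC x + (I * β) •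
        single p.1 ((p.2 : ℤ) : ℂ)) - f (toC x)) = 0 := by simp [tc]
    have hd1 : tc 1 (fun β : ℝ => f (toC x + (I * β) • single p.1 ((p.2 : ℤ) : ℂ)) - f (toC x)) =
        I * (((p.2 : ℤ) : ℂ) * dC p.1 f (toC x)) := by
      rw [tc_sub (hline p) contDiffAt_const, tc_const, if_neg one_ne_zero, tc,
        iteratedDeriv_line _ 1 (hfa hf), iterate_one, hth]
      simp
    have hd2 : tc 2 (fun β : ℝ => f (toC x + (I * β) •
        single p.1 ((p.2 : ℤ) : ℂ)) - f (toC x)) = -(dC p.1 (dC p.1 f) (toC x) / 2) := by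
      rw [tc_sub (hline p) contDiffAt_const, tc_const, if_neg two_ne_zero, tc,
        iteratedDeriv_line _ 2 (hfa hf), Function.iterate_succ, iterate_one,
        Function.comp, hth, hth]
      have e : dC p.1 (fun z => 1 / I * (((p.2 : ℤ) : ℂ) * dC p.1 f z)) (toC x) =
          1 / I * (((p.2 : ℤ) : ℂ) * dC p.1 (dC p.1 f) (toC x)) := by
        have hd := differentiable_trigPoly (dC_mem p.1 hf) (toC x)
        simp only [← mul_assoc]
        rw [dC, fderiv_const_mul hd, _root_.smul_apply, smul_eq_mul]
        rfl
      simp only [e]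
      have hI : 1 / I = -I := by simp
      rw [hI, Nat.factorial_two]
      push_cast
      linear_combination (1 / 2 * dC p.1 (dC p.1 f) (toC x) * I * I) * hu +
        (1 / 2 * dC p.1 (dC p.1 f) (toC x)) * I_mul_I
    have hanti : Finset.HasAntidiagonal.antidiagonal 2 = {((0 : ℕ), (2 : ℕ)), (1, 1), (2, 0)} := rfl
    rw [tc_mul (contDiffAt_cellW P hx p) ((hline p).sub contDiffAt_const), hanti,
      sum_insert (by decide), sum_insert (by decide), Finset.sum_singleton]
    simp only
    rw [h0, h1', hd0, hd1, hd2]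
    linear_combination (1 / 2 * drift P (toC x) p.1 (toC x p.1) * dC p.1 f (toC x) * I * I) * hu +
      (1 / 2 * drift P (toC x) p.1 (toC x p.1) * dC p.1 f (toC x)) * I_mul_I
  simp only [differenceOp_one]
  rw [tc_sum _ fun p _ => (contDiffAt_cellW P hx p).mul ((hline p).sub contDiffAt_const),
    sum_congr rfl fun p _ => hterm p, sum_prod_type, ← sum_add_distrib,
    ← sum_neg_distrib]
  refine sum_congr rfl fun j _ => ?_
  simp only [sum_const, card_univ, Fintype.card_units_int, nsmul_eq_mul]
  push_cast
  ring

lemma sum_offDiag {M : Type*} [AddCommMonoid M] (A : Fin n → Fin n → M) :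
    ∑ j, ∑ k ∈ Finset.univ.erase j, A j k =
      ∑ q : {q : Fin n × Fin n // q.1 < q.2}, (A q.1.1 q.1.2 + A q.1.2 q.1.1) := by
  have h1 : ∀ j, ∑ k ∈ Finset.univ.erase j, A j k =
      ∑ k, ((if j < k then A j k else 0) + if k < j then A j k else 0) := by
    intro j
    rw [← add_sum_erase _ _ (Finset.mem_univ j)]
    simp only [lt_self_iff_false, if_false, add_zero, zero_add]
    refine sum_congr rfl fun k hk => ?_
    grind
  simp only [h1, sum_add_distrib]
  rw [sum_comm (f := fun j k => if k < j then A j k else 0),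
    ← sum_product', ← sum_product', Finset.univ_product_univ,
    ← sum_filter, ← sum_filter,
    sum_subtype (p := fun q : Fin n × Fin n => q.1 < q.2) _ (by simp),
    sum_subtype (p := fun q : Fin n × Fin n => q.1 < q.2) _ (by simp)]

lemma tc_two_eq_radialOp (hf : f ∈ trigPoly n) {H : Mirror n → ℂⁿ → ℂ} (hH : ∀ i, ∀ x : ℝⁿ,
      (Real.sin (ang i x) : ℂ) * dDir i f (toC x) = 2 * sq i x * H i (toC x))
    (hx : x ∈ regularSet n) :
    tc 2 (fun β => differenceOp P 1 β f (toC x)) = -radialOp P f H (toC x) := by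
  have hHe : ∀ i : Mirror n, sin (((ang i x : ℝ) : ℂ) / 2) ≠ 0 →
      H i (toC x) = hcot (ang i x : ℝ) * dDir i f (toC x) := by
    intro i hs
    have h1 := hH i x
    have h2 := Complex.sin_two_mul (((ang i x : ℝ) : ℂ) / 2)
    rw [mul_div_cancel₀ _ two_ne_zero] at h2
    rw [sq_eq, ofReal_sin, h2] at h1
    push_cast at h1
    rw [hcot]
    grind
  rw [tc_two_differenceOp P hf hx, radialOp]
  congr 2
  simp only [drift, add_mul, sum_add_distrib, sum_mul]
  rw [sum_offDiag, Fintype.sum_sum_type, sum_prod_type, sum_prod_type,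
    add_comm (∑ q : {q : Fin n × Fin n // q.1 < q.2}, _)]
  have hc : ∀ j, toC x j = (x j : ℂ) := fun _ => rfl
  have hdl : ∀ (q : {q : Fin n × Fin n // q.1 < q.2}) e, dDir (.inl (q, e)) f (toC x) =
      dC q.1.1 f (toC x) + (if e then 1 else -1) * dC q.1.2 f (toC x) := fun q e =>
    lin_mNu_inl q e fun j => dC j f (toC x)
  have hdr : ∀ j t, dDir (.inr (j, t)) f (toC x) = dC j f (toC x) := fun j t =>
    lin_mNu_inr j t fun j => dC j f (toC x)
  have hreg : ∀ i : Mirror n, sin (((ang i x : ℝ) : ℂ) / 2) ≠ 0 := by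
    have key : ∀ a : ℝ, Real.sin (a / 2) ≠ 0 → sin ((a : ℂ) / 2) ≠ 0 := fun a h =>
      sin_ne_zero_of_re (by simpa using h)
    rintro (⟨q, e⟩ | ⟨j, t⟩)
    · refine key _ ?_
      rw [ang_inl]
      cases e
      · simpa [sub_eq_add_neg] using (hx.2 _ _ q.2.ne).2
      · simpa using (hx.2 _ _ q.2.ne).1
    · refine key _ ?_
      rw [ang_inr]
      cases t
      · simpa using (hx.1 j).1
      · simpa [add_div, sin_add_pi_div_two] using (hx.1 j).2
  congr 1
  · rw [← sum_add_distrib]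
    refine sum_congr rfl fun j _ => ?_
    rw [sum_bool, hHe _ (hreg _), hHe _ (hreg _), hdr, hdr, ang_inr, ang_inr, hc]
    simp only [mK, if_true]
    push_cast
    simp only [add_zero]
    ring
  · refine sum_congr rfl fun q _ => ?_
    rw [sum_bool, hHe _ (hreg _), hHe _ (hreg _), hdl, hdl, ang_inl, ang_inl, hc, hc,
      show (x q.1.2 : ℂ) - x q.1.1 = -(x q.1.1 - x q.1.2) by ring, hcot_neg,
      add_comm (x q.1.2 : ℂ)]
    simp only [mK, if_true]
    push_cast
    simp only [one_mul, neg_mul, ← sub_eq_add_neg]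
    ring

/-! ### Triangular operators -/

lemma lower_antisymm {μ ν : ℤⁿ} (h1 : μ ∈ lower ν) (h2 : ν ∈ lower μ) : μ = ν :=
  eq_of_partSum_eq fun k => le_antisymm ((mem_lower.1 h1).2 k) ((mem_lower.1 h2).2 k)

lemma lower_subset {lam μ : ℤⁿ} (h : μ ∈ lower lam) : lower μ ⊆ lower lam :=
  fun _ h1 => lower_trans h1 h

/-- A combination of orbit sums as an element of `C^∞(U)`. -/
def combFn (lam : ℤⁿ) (b : ℤⁿ → ℂ) : SmoothFn n := ∑ μ ∈ lower lam, b μ • monoFn μ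

lemma combFn_apply (lam : ℤⁿ) (b : ℤⁿ → ℂ) (hx : x ∈ regularSet n) :
    (combFn lam b : ℝⁿ → ℂ) x = comb (lower lam) b (toC x) := by
  rw [combFn, Submodule.coe_sum, Finset.sum_apply, comb]
  exact sum_congr rfl fun μ _ => by
    rw [Submodule.coe_smul, Pi.smul_apply, smul_eq_mul, monoFn_apply μ hx]

lemma combFn_inj {b c : ℤⁿ → ℂ} (h : combFn lam b = combFn lam c) :
    ∀ μ ∈ lower lam, b μ = c μ := fun μ hμ => sub_eq_zero.1 <|
  eq_zero_of_sum_monoC (b := fun μ => b μ - c μ) (fun μ hμ => (mem_lower.1 hμ).1) (fun x hx => by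
    have h1 : comb (lower lam) b (toC x) = comb (lower lam) c (toC x) := by
      rw [← combFn_apply lam b hx, h, combFn_apply lam c hx]
    simp only [sub_mul, sum_sub_distrib]
    exact sub_eq_zero.2 h1) μ hμ

lemma combFn_congr {b c : ℤⁿ → ℂ} (h : ∀ μ ∈ lower lam, b μ = c μ) :
    combFn lam b = combFn lam c := sum_congr rfl fun μ hμ => by rw [h μ hμ]

lemma combFn_smul (lam : ℤⁿ) (a : ℂ) (b : ℤⁿ → ℂ) :
    combFn lam (fun μ => a * b μ) = a • combFn lam b := by
  simp only [combFn, smul_sum, mul_smul]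

/-- `M` is the triangular matrix of `T` with respect to the orbit sums. -/
def IsTri (T : End ℂ (SmoothFn n)) (M : ℤⁿ → ℤⁿ → ℂ) : Prop :=
  ∀ lam, IsDominant lam → (∀ μ ∉ lower lam, M lam μ = 0) ∧ T (monoFn lam) = combFn lam (M lam)

/-- The action of a matrix on coefficients. -/
def matAct (lam : ℤⁿ) (M : ℤⁿ → ℤⁿ → ℂ) (b : ℤⁿ → ℂ) :
    ℤⁿ → ℂ := fun μ => ∑ ν ∈ lower lam, b ν * M ν μ

variable {T T' : End ℂ (SmoothFn n)} {M M' : (Fin n → ℤ) → (Fin n → ℤ) → ℂ}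
  {lam : Fin n → ℤ} {b : (Fin n → ℤ) → ℂ}

lemma IsTri.apply_combFn (h : IsTri T M) (lam : ℤⁿ) (b : ℤⁿ → ℂ) :
    T (combFn lam b) = combFn lam (matAct lam M b) := by
  rw [combFn, map_sum, combFn]
  simp only [matAct, Finset.sum_smul]
  rw [sum_comm]
  refine sum_congr rfl fun ν hν => ?_
  obtain ⟨h1, h2⟩ := h ν (mem_lower.1 hν).1
  rw [map_smul, h2, combFn, smul_sum]
  simp only [smul_smul]
  exact sum_subset (lower_subset hν) fun μ _ hμ => by rw [h1 μ hμ, mul_zero, zero_smul]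

lemma IsTri.matAct_of_maximal (h : IsTri T M) {μ : ℤⁿ} (hμ : μ ∈ lower lam)
    (hb : ∀ ν ∈ lower lam, ν ≠ μ → μ ∈ lower ν → b ν = 0) : matAct lam M b μ = b μ * M μ μ := by
  refine sum_eq_single μ (fun ν hν hne => ?_) fun h => absurd hμ h
  by_cases h1 : μ ∈ lower ν
  · rw [hb ν hν hne h1, zero_mul]
  · rw [(h ν (mem_lower.1 hν).1).1 μ h1, mul_zero]

lemma IsTri.matAct_self (h : IsTri T M) (hl : IsDominant lam) (b : ℤⁿ → ℂ) :
    matAct lam M b lam = b lam * M lam lam :=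
  h.matAct_of_maximal (self_mem_lower hl) fun _ hν hne h1 => absurd (lower_antisymm hν h1) hne

lemma IsTri.eigen {P : Couplings} (hw : Continuous (weight P : ℝⁿ → ℝ)) (h : IsTri T M)
    (hs : ∀ μ ν, IsDominant μ → IsDominant ν →
      bil P (comb (lower μ) (M μ)) (monoC ν) = bil P (monoC μ) (comb (lower ν) (M ν)))
    (hl : IsDominant lam) (hb : b lam = 1)
    (ho : ∀ μ ∈ (lower lam).erase lam, bil P (comb (lower lam) b) (monoC μ) = 0) :
    T (combFn lam b) = M lam lam • combFn lam b := by
  rw [h.apply_combFn, ← combFn_smul]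
  refine combFn_congr ?_
  set q : ℤⁿ → ℂ := fun μ => matAct lam M b μ - M lam lam * b μ with hq
  have hqlam : q lam = 0 := by rw [hq]; simp [h.matAct_self hl, hb]
  have hcomb : ∀ c, c lam = (0 : ℂ) → comb ((lower lam).erase lam) c = comb (lower lam) c := by
    intro c hc
    ext z
    rw [comb, comb, ← add_sum_erase _ _ (self_mem_lower hl), hc, zero_mul, zero_add]
  have hact : comb (lower lam) (matAct lam M b) =
      fun z => ∑ ν ∈ lower lam, b ν * comb (lower ν) (M ν) z := by
    ext z
    simp only [comb, matAct, sum_mul]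
    rw [sum_comm]
    refine sum_congr rfl fun ν hν => ?_
    rw [mul_sum]
    simp only [mul_assoc]
    exact (sum_subset (lower_subset hν) fun μ _ hμ => by
      rw [(h ν (mem_lower.1 hν).1).1 μ hμ, zero_mul, mul_zero]).symm
  have hz : ∀ μ ∈ (lower lam).erase lam, q μ = 0 := by
    refine eq_zero_of_forall_bil hw (fun μ hμ => (mem_lower_erase.1 hμ).1) fun μ hμ => ?_
    have hμl := mem_of_mem_erase hμ
    have hμd := (mem_lower.1 hμl).1
    rw [hcomb q hqlam, bil_comb_left hw _ _ (monoC_mem μ)]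
    simp only [hq, sub_mul, sum_sub_distrib, mul_assoc, ← mul_sum]
    rw [← bil_comb_left hw _ _ (monoC_mem μ), ← bil_comb_left hw _ _ (monoC_mem μ), ho μ hμ,
      mul_zero, sub_zero, bil_comb_left hw _ _ (monoC_mem μ)]
    simp only [matAct, sum_mul]
    rw [sum_comm]
    have h1 : ∀ ν ∈ lower lam, ∑ κ ∈ lower lam, b ν * M ν κ * bil P (monoC κ) (monoC μ) =
        ∑ κ ∈ lower μ, M μ κ * (b ν * bil P (monoC ν) (monoC κ)) := by
      intro ν hν
      have e1 := hs ν μ (mem_lower.1 hν).1 hμd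
      rw [bil_comb_left hw _ _ (monoC_mem μ), bil_comm, bil_comb_left hw _ _ (monoC_mem ν)] at e1
      simp only [mul_assoc]
      rw [← mul_sum, ← sum_subset (lower_subset hν) fun κ _ hκ => by
        rw [(h ν (mem_lower.1 hν).1).1 κ hκ, zero_mul], e1, mul_sum]
      exact sum_congr rfl fun κ _ => by rw [bil_comm P (monoC κ)]; ring
    rw [sum_congr rfl h1, sum_comm]
    refine sum_eq_zero fun κ hκ => ?_
    rw [← mul_sum, ← bil_comb_left hw _ _ (monoC_mem κ), ho κ, mul_zero]
    refine mem_erase.2 ⟨?_, lower_trans hκ hμl⟩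
    rintro rfl
    exact ne_of_mem_erase hμ (lower_antisymm hμl hκ)
  grind

lemma IsTri.eigen_of_commute (h : IsTri T M) (h' : IsTri T' M') (hl : IsDominant lam)
    (hsep : ∀ μ ∈ (lower lam).erase lam, M μ μ ≠ M lam lam)
    (hc : T (T' (combFn lam b)) = T' (T (combFn lam b))) (hb : b lam = 1)
    (hT : T (combFn lam b) = M lam lam • combFn lam b) :
    T' (combFn lam b) = M' lam lam • combFn lam b := by
  set d : ℤⁿ → ℂ := fun μ => matAct lam M' b μ - M' lam lam * b μ with hd
  have hdlam : d lam = 0 := by rw [hd]; simp [h'.matAct_self hl, hb]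
  have hdf : combFn lam d = T' (combFn lam b) - M' lam lam • combFn lam b := by
    rw [h'.apply_combFn, ← combFn_smul]
    rw [combFn, combFn, combFn, ← sum_sub_distrib]
    exact sum_congr rfl fun μ _ => sub_smul (matAct lam M' b μ) (M' lam lam * b μ) (monoFn μ)
  have hTd : T (combFn lam d) = M lam lam • combFn lam d := by
    rw [hdf, map_sub, hc, map_smul, hT, map_smul, smul_sub, smul_comm]
  rw [← sub_eq_zero, ← hdf]
  by_contra hne
  have hS : ((lower lam).filter fun μ => d μ ≠ 0).Nonempty := by
    by_contra hS
    rw [Finset.not_nonempty_iff_eq_empty, Finset.filter_eq_empty_iff] at hS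
    refine hne (sum_eq_zero fun μ hμ => ?_)
    rw [not_not.1 (hS hμ), zero_smul]
  obtain ⟨κ, hκ, hmax⟩ := Finset.exists_max_image _ (fun μ => ∑ k, partSum k μ) hS
  obtain ⟨hκl, hκ0⟩ := mem_filter.1 hκ
  rw [h.apply_combFn, ← combFn_smul] at hTd
  have h1 := combFn_inj hTd κ hκl
  rw [h.matAct_of_maximal hκl, mul_comm] at h1
  · refine hsep κ (mem_erase.2 ⟨?_, hκl⟩) (mul_right_cancel₀ hκ0 h1)
    rintro rfl; exact hκ0 hdlam
  · intro ν hν hne' hκν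
    by_contra hν0
    have h2 := hmax ν (mem_filter.2 ⟨hν, hν0⟩)
    have h3 := (mem_lower.1 hκν).2
    have h4 := (Finset.sum_eq_sum_iff_of_le fun k _ => h3 k).1
      (le_antisymm (sum_le_sum fun k _ => h3 k) h2)
    exact hne' (eq_of_partSum_eq fun k => (h4 k (Finset.mem_univ k)).symm)

lemma apply_monoFn_eq_zero (D : End ℂ (SmoothFn n)) (h : ∀ lam : ℤⁿ, IsDominant lam →
      ∃ b : ℤⁿ → ℂ, b lam = 1 ∧ D (combFn lam b) = 0) :
    ∀ lam, IsDominant lam → D (monoFn lam) = 0 := by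
  suffices ∀ N, ∀ lam : ℤⁿ, (lower lam).card < N → IsDominant lam → D (monoFn lam) = 0 from
    fun lam => this _ lam (Nat.lt_succ_self _)
  intro N
  induction N with
  | zero => intro lam h; exact absurd h (Nat.not_lt_zero _)
  | succ N ih =>
    intro lam hN hl
    obtain ⟨b, hb, h0⟩ := h lam hl
    rw [combFn, ← add_sum_erase _ _ (self_mem_lower hl), hb, one_smul, map_add, map_sum,
      sum_eq_zero, add_zero] at h0
    · exact h0
    · intro μ hμ
      have hμl := mem_of_mem_erase hμ
      rw [map_smul, ih μ ?_ (mem_lower.1 hμl).1, smul_zero]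
      refine lt_of_lt_of_le (Finset.card_lt_card ?_) (Nat.lt_succ_iff.1 hN)
      refine Finset.ssubset_iff_subset_ne.2 ⟨lower_subset hμl, fun he => ?_⟩
      exact ne_of_mem_erase hμ (lower_antisymm hμl (he ▸ self_mem_lower hl))

/-- The matrices of the difference operators and of the coefficients of their expansions. -/
lemma exists_isTri (n : ℕ) (P : Couplings) {r : ℕ} (hr : 1 ≤ r) (hrn : r ≤ n) :
    ∃ B : (Fin n → ℤ) → (Fin n → ℤ) → ℝ → ℂ,
      (∀ lam, IsDominant lam → ∀ μ, ContDiffAt ℝ ∞ (B lam μ) 0) ∧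
      (∀ lam, IsDominant lam → ∀ β ≠ 0, ∀ x ∈ regularSet n,
        differenceOp P r β (monoC lam) (toC x) = comb (lower lam) (fun μ => B lam μ β) (toC x)) ∧
      ∀ m, IsTri (coeff m (expansion n P r)) (fun lam μ => tc m (B lam μ)) ∧
        ∀ lam, IsDominant lam → tc m (B lam lam) = tc m (fun β => (diffEig P r lam β : ℂ)) := by
  choose b h1 h2 h3 h4 h5 using fun lam : {lam : Fin n → ℤ // IsDominant lam} =>
    exists_smooth_coeff P hr hrn lam.2
  classical
  refine ⟨fun lam μ => if h : IsDominant lam then b ⟨lam, h⟩ μ else 0, fun lam hl μ => ?_,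
    fun lam hl β hβ x hx => ?_, fun m => ⟨fun lam hl => ⟨fun μ hμ => ?_, ?_⟩, fun lam hl => ?_⟩⟩
  · simpa [hl] using h1 ⟨lam, hl⟩ μ
  · simpa [hl, comb] using h4 ⟨lam, hl⟩ β hβ x hx
  · simp only [hl, dif_pos, h2 ⟨lam, hl⟩ μ hμ]
    exact (tc_const 0 m).trans (ite_self _)
  · simpa [hl, combFn] using h5 ⟨lam, hl⟩ m
  · simpa [hl] using h3 ⟨lam, hl⟩ m

/-! ### Separation of the eigenvalues for `r = 1` -/

lemma abel_nonneg {d a : ℝⁿ} (hd : ∀ k, 0 ≤ ∑ j ∈ Finset.Iic k, d j) (ha : Antitone a)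
    (h0 : ∀ j, 0 ≤ a j) : 0 ≤ ∑ j, d j * a j := by
  cases n with
  | zero => simp
  | succ m =>
    have key : ∀ k : Fin (m + 1), a k * ∑ j ∈ Finset.Iic k, d j ≤ ∑ j ∈ Finset.Iic k, d j * a j := by
      intro k
      induction k using Fin.induction with
      | zero =>
        have : Finset.Iic (0 : Fin (m + 1)) = {0} := by ext j; simp
        rw [this]; simp [mul_comm]
      | succ k ih =>
        have hI : Finset.Iic k.succ = insert k.succ (Finset.Iic k.castSucc) := by grind
        rw [hI, sum_insert, sum_insert]
        · have h1 := mul_le_mul_of_nonneg_right (ha (Fin.castSucc_lt_succ (i := k)).le)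
            (hd k.castSucc)
          linarith
        all_goals simp
    have hI : Finset.Iic (Fin.last m) = Finset.univ := by ext j; simp [Fin.le_last]
    have := key (Fin.last m)
    have h2 := mul_nonneg (h0 (Fin.last m)) (hd (Fin.last m))
    rw [hI] at this h2
    exact h2.trans this

lemma E_one (t p : ℝⁿ) : E n 1 t p = ∑ j, t j - ∑ j, p j := by
  classical
  rw [E, sum_range_succ, Finset.sum_range_one]
  have h1 : ∑ i ∈ (Finset.univ : Finset (Fin (1 - 0) → Fin n)).filter
      (fun i : Fin (1 - 0) → Fin n => Monotone i ∧ ∀ a, 1 ≤ (i a : ℕ) + 1), ∏ a, p (i a) = ∑ j, p j := by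
    rw [filter_true_of_mem]
    · exact (Equiv.funUnique (Fin 1) (Fin n)).sum_comp (fun j => p j) ▸
        sum_congr rfl fun i _ => by simp
    · exact fun i _ => ⟨Subsingleton.monotone (α := Fin 1) i, fun a => by omega⟩
  have h2 : ∑ i ∈ (Finset.univ : Finset (Fin (1 - 1) → Fin n)).filter
      (fun i : Fin (1 - 1) → Fin n => Monotone i ∧ ∀ a, 1 ≤ (i a : ℕ) + 1), ∏ a, p (i a) = 1 := by
    rw [filter_true_of_mem]
    · simp
    · exact fun i _ => ⟨Subsingleton.monotone (α := Fin 0) i, fun a => by omega⟩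
  rw [h1, h2]
  simp [Finset.powersetCard_one]
  ring

lemma leadEig_one_ne {P : Couplings} (hg : 0 ≤ P.g)
    (hs : 0 ≤ P.g₀ + P.g₁ + P.g₀' + P.g₁') {μ : ℤⁿ} (hμ : μ ∈ (lower lam).erase lam) :
    leadEig P 1 μ ≠ leadEig P 1 lam := by
  have hμl := mem_of_mem_erase hμ
  obtain ⟨hμd, hle⟩ := mem_lower.1 hμl
  rw [leadEig, leadEig, E_one, E_one]
  have h1 : 0 ≤ ∑ j, ((lam j : ℝ) - μ j) * shifted P μ j := by
    refine abel_nonneg (fun k => ?_) (fun i j hij => ?_) fun j => ?_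
    · have := hle k
      rw [sum_sub_distrib, sub_nonneg]
      exact_mod_cast this
    · have h2 : (μ j : ℝ) ≤ μ i := by exact_mod_cast hμd.1 hij
      have h3 : ((i : ℕ) : ℝ) ≤ (j : ℕ) := by exact_mod_cast hij
      simp only [shifted, rho]
      nlinarith
    · have h2 : (0 : ℝ) ≤ μ j := by exact_mod_cast hμd.2 j
      have h3 : ((j : ℕ) : ℝ) + 1 ≤ n := by exact_mod_cast j.2
      have h4 := mul_nonneg (sub_nonneg.2 h3) hg
      simp only [shifted, rho]
      linarith
  have h2 : 0 < ∑ j, ((lam j : ℝ) - μ j) ^ 2 := by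
    obtain ⟨j, hj⟩ : ∃ j, μ j ≠ lam j := by
      by_contra! hall
      exact ne_of_mem_erase hμ (funext hall)
    have : (lam j : ℝ) - μ j ≠ 0 := sub_ne_zero.2 (by exact_mod_cast hj.symm)
    exact Finset.sum_pos' (fun j _ => _root_.sq_nonneg _) ⟨j, Finset.mem_univ j, by positivity⟩
  have h3 : ∑ j, shifted P lam j ^ 2 - ∑ j, shifted P μ j ^ 2 =
      ∑ j, ((lam j : ℝ) - μ j) ^ 2 + 2 * ∑ j, ((lam j : ℝ) - μ j) * shifted P μ j := by
    rw [← sum_sub_distrib, mul_sum, ← sum_add_distrib]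
    exact sum_congr rfl fun j _ => by simp only [shifted]; ring
  intro h
  linarith

/-! ### Symmetry of the leading operator for `r = 1` -/

lemma eq_of_eq_on_regular {f h : ℂⁿ → ℂ} (hf : f ∈ trigPoly n) (hh : h ∈ trigPoly n)
    (H : ∀ x ∈ regularSet n, f (toC x) = h (toC x)) (x : ℝⁿ) : f (toC x) = h (toC x) :=
  congrFun (Continuous.ext_on (dense_regularSet n) (continuous_comp_toC hf)
    (continuous_comp_toC hh) H) x

lemma symm_of_isTri_two {P : Couplings} (hk : ∀ i : Mirror n, 0 ≤ mK P i)
    (h : IsTri (coeff 2 (expansion n P 1)) M) {μ ν : ℤⁿ} (hμ : IsDominant μ)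
    (hν : IsDominant ν) :
    bil P (comb (lower μ) (M μ)) (monoC ν) = bil P (monoC μ) (comb (lower ν) (M ν)) := by
  have key : ∀ μ ν, IsDominant μ → bil P (comb (lower μ) (M μ)) (monoC ν) =
      ∫ x in cube n, (weight P x : ℂ) * ∑ j, dC j (monoC μ) (toC x) * dC j (monoC ν) (toC x) := by
    intro μ ν hμ
    choose H hH1 hH2 using exists_radial (monoC_mem μ) (isWeylInv_monoC μ)
    have hR : (fun z => -radialOp P (monoC μ) H z) ∈ trigPoly n := by
      have e : (fun z => -radialOp P (monoC μ) H z) =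
          -(∑ j, dC j (dC j (monoC μ)) + ∑ i, (mK P i : ℂ) • H i) := by
        ext z; simp [radialOp]
      rw [e]
      exact neg_mem (add_mem (sum_mem fun j _ => dC_mem j (dC_mem j (monoC_mem μ)))
        (sum_mem fun i _ => (trigPoly n).smul_mem (hH1 i) _))
    have he : ∀ x : ℝⁿ, comb (lower μ) (M μ) (toC x) = -radialOp P (monoC μ) H (toC x) := by
      refine eq_of_eq_on_regular (comb_mem _ _) hR fun x hx => ?_
      rw [← tc_two_eq_radialOp P (monoC_mem μ) hH2 hx, ← combFn_apply _ _ hx, ← (h μ hμ).2, monoFn,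
        coeff_expansion_apply P 1 2 _ hx]
    have h1 := bil_radialOp hk (monoC_mem μ) (monoC_mem ν) hH1 hH2
    rw [← neg_eq_iff_eq_neg] at h1
    rw [← h1, bil, bil, ← integral_neg]
    grind
  rw [key μ ν hμ, bil_comm, key ν μ hν]
  grind

/-! ### The weight function for integral couplings -/

/-- A finite `q`-product, `q = exp(-β)`. -/
def qProd (κ : ℕ) (z : ℂ) : ℂ := ∏ m ∈ Finset.range κ, (1 - exp (-(β * m)) * exp (I * z))

lemma sineRatio_mul_qProd (κ : ℕ) {z : ℂ} (hz : Real.sin (z.re / 2) ≠ 0) :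
    sineRatio β κ z * qProd β κ z = exp (β * κ / 2) * qProd β κ (z + I * β) := by
  have h1 : qProd β κ (z + I * β) * (1 - exp (I * z)) =
      qProd β κ z * (1 - exp (-(β * κ)) * exp (I * z)) := by
    rw [qProd, qProd, ← prod_range_succ]
    rw [Finset.prod_range_succ' (fun m : ℕ => 1 - exp (-(β * m)) * exp (I * z))]
    congr 1
    · refine prod_congr rfl fun m _ => ?_
      rw [← exp_add, ← exp_add]
      congr 2
      push_cast
      linear_combination (β : ℂ) * I_sq
    · simp
  have h2 : exp (I * z) - 1 ≠ 0 := by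
    have := sin_ne_zero_of_re (z := z / 2) (by simpa using hz)
    rw [sin_half_eq] at this
    exact fun h => this (by rw [h, zero_mul])
  have h3 : exp (-(β * κ)) = exp (-(β * κ / 2)) * exp (-(β * κ / 2)) := by
    rw [← exp_add]; congr 1; ring
  have h4 : exp (-(β * κ / 2)) * exp (β * κ / 2) = 1 := by rw [← exp_add]; simp
  rw [sineRatio_eq_exp, div_mul_eq_mul_div, div_eq_iff (by simpa using h2)]
  rw [h3] at h1
  linear_combination exp (β * κ / 2) * h1 - exp (-(β * κ / 2)) * exp (I * z) * qProd β κ z * h4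

lemma qProd_mem (κ : ℕ) {u : ℂⁿ → ℂ} (ν : ℤⁿ) (c : ℂ)
    (hu : ∀ x, u x = lin ν x + c) : (fun x => qProd β κ (u x)) ∈ trigPoly n := by
  have e : (fun x => qProd β κ (u x)) = ∏ m ∈ Finset.range κ, fun x =>
      1 - exp (-(β * m)) * exp (I * (lin ν x + c)) := by
    ext x; simp [qProd, hu]
  rw [e]
  exact prod_mem fun m _ => sub_mem (one_mem _) (mul_mem (const_mem_trigPoly _) (exp_lin_mem ν c))

lemma continuous_qProd {X : Type*} [TopologicalSpace X] (κ : ℕ) {b : X → ℝ} {u : X → ℂ}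
    (hb : Continuous b) (hu : Continuous u) : Continuous fun x => qProd (b x) κ (u x) := by
  unfold qProd; fun_prop

/-- The numerator of a weight that depends on `u` and `-u`, with the shift `m` of `u`. -/
def dblN (κ : ℕ) (c : ℂ) (m : ℤ) (u : ℂ) : ℂ := exp (β * κ / 2) ^ m.natAbs *
  (qProd β κ (u + c + (m.toNat : ℂ) * (I * β)) * qProd β κ (-u + c + ((-m).toNat : ℂ) * (I * β)))

lemma dblN_neg (κ : ℕ) (c : ℂ) (m : ℤ) (u : ℂ) : dblN β κ c (-m) (-u) = dblN β κ c m u := by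
  rw [dblN, dblN, Int.natAbs_neg, neg_neg, neg_neg, mul_comm (qProd ..)]

lemma dblN_shift (κ : ℕ) (c : ℂ) (m : ℤ) {u v : ℂ} (h : v = u - m * (I * β)) :
    dblN β κ c m v = dblN β κ c (-m) u := by
  have h1 : (m.toNat : ℂ) = m + (-m).toNat := by exact_mod_cast (by omega)
  rw [dblN, dblN, Int.natAbs_neg, neg_neg, h, h1]
  congr 3 <;> ring

lemma dblN_succ (κ : ℕ) {c u : ℂ} (m : ℕ) (h : Real.sin ((u + c).re / 2) ≠ 0) :
    sineRatio β κ (u + c + m * (I * β)) * dblN β κ c m u = dblN β κ c (m + 1 : ℕ) u := by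
  have h1 := sineRatio_mul_qProd β κ (z := u + c + m * (I * β)) (by simpa using h)
  have h2 : u + c + ((m + 1 : ℕ) : ℂ) * (I * β) = u + c + m * (I * β) + I * β := by push_cast; ring
  simp only [dblN, Int.natAbs_natCast, Int.toNat_natCast, Int.toNat_neg_natCast, pow_succ, h2]
  linear_combination exp (β * κ / 2) ^ m * qProd β κ (-u + c + (0 : ℕ) * (I * β)) * h1

lemma dblN_mul_one (κ : ℕ) {c x : ℂ} {a : SignType} (ha : a ≠ 0)
    (h : Real.sin (((a : ℂ) * x + c).re / 2) ≠ 0) :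
    sineRatio β κ ((a : ℂ) * x + c) * dblN β κ c 0 x = dblN β κ c a x := by
  have h1 := dblN_succ β κ 0 h
  rcases SignType.trichotomy a with rfl | rfl | rfl
  · simpa [← dblN_neg β κ c 0 x, ← dblN_neg β κ c (-1) x] using h1
  · exact absurd rfl ha
  · simpa using h1

lemma dblN_mul_two (κ : ℕ) {x : ℂ} {a : SignType} (ha : a ≠ 0)
    (h : Real.sin (((a : ℂ) * x).re / 2) ≠ 0) :
    sineRatio β κ ((a : ℂ) * x) * sineRatio β κ ((a : ℂ) * x + I * β) * dblN β κ 0 0 x =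
      dblN β κ 0 (2 * a) x := by
  have h1 := dblN_mul_one β κ (c := 0) (x := x) ha (by simpa using h)
  have h2 := dblN_succ β κ (c := 0) (u := (a : ℂ) * x) 1 (by simpa using h)
  rw [add_zero] at h1
  rw [mul_right_comm, h1, mul_comm]
  rcases SignType.trichotomy a with rfl | rfl | rfl
  · simpa [← dblN_neg β κ 0 (-1) x, ← dblN_neg β κ 0 (-2) x] using h2
  · exact absurd rfl ha
  · simpa using h2

lemma dblN_mem (κ : ℕ) (c : ℂ) (m : ℤ) (ν : ℤⁿ) {u : ℂⁿ → ℂ} (hu : ∀ x, u x = lin ν x) :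
    (fun x => dblN β κ c m (u x)) ∈ trigPoly n := by
  have h1 := qProd_mem β κ ν (c + (m.toNat : ℂ) * (I * β))
    (u := fun x => u x + c + (m.toNat : ℂ) * (I * β)) fun x => by rw [hu, add_assoc]
  have h2 := qProd_mem β κ (-ν) (c + ((-m).toNat : ℂ) * (I * β))
    (u := fun x => -u x + c + ((-m).toNat : ℂ) * (I * β)) fun x => by
      rw [hu, lin_neg_left, add_assoc]
  exact mul_mem (const_mem_trigPoly _) (mul_mem h1 h2)

/-- The numerator of a site weight. -/
def siteN (k : Fin 5 → ℕ) (a : SignType) (x : ℂ) : ℂ :=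
  dblN β (k 1) 0 a x * dblN β (k 2) Real.pi a x *
    dblN β (k 3) (gam β) a x * dblN β (k 4) (gam β + Real.pi) a x

/-- The numerator of a pair weight. -/
def pairN (κ : ℕ) (a b : SignType) (x y : ℂ) : ℂ :=
  dblN β κ 0 (a + b) (x + y) * dblN β κ 0 (a - b) (x - y)

lemma siteN_shift (k : Fin 5 → ℕ) (a : SignType) (x : ℂ) :
    siteN β k a (x + I * β * ((-a : SignType) : ℂ)) = siteN β k (-a) x := by
  have h : ∀ κ c, dblN β κ c a (x + I * β * ((-a : SignType) : ℂ)) =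
      dblN β κ c ((-a : SignType) : ℤ) x := fun κ c => by
    rw [dblN_shift β κ c a (u := x)] <;> cases a <;> simp <;> ring_nf
  simp only [siteN, h]

lemma pairN_comm (κ : ℕ) (a b : SignType) (x y : ℂ) : pairN β κ a b x y = pairN β κ b a y x := by
  rw [pairN, pairN, add_comm x, add_comm (a : ℤ), ← neg_sub y, ← neg_sub (b : ℤ), dblN_neg]

lemma pairN_shift (κ : ℕ) (a b : SignType) (x y : ℂ) :
    pairN β κ a b (x + I * β * ((-a : SignType) : ℂ))
      (y + I * β * ((-b : SignType) : ℂ)) = pairN β κ (-a) (-b) x y := by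
  refine congrArg₂ _ ((dblN_shift β κ 0 _ (u := x + y) ?_).trans ?_)
    ((dblN_shift β κ 0 _ (u := x - y) ?_).trans ?_) <;>
  cases a <;> cases b <;> simp <;> ring_nf

lemma pairN_mem (κ : ℕ) (a b : SignType) (i j : Fin n) :
    (fun x => pairN β κ a b (x i) (x j)) ∈ trigPoly n :=
  mul_mem (dblN_mem β κ 0 _ (single i 1 + single j 1) fun x => by simp [lin_add_left, lin_single_left])
    (dblN_mem β κ 0 _ (single i 1 + -single j 1) fun x => by
      simp [lin_add_left, lin_neg_left, lin_single_left, sub_eq_add_neg])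

lemma siteN_mem (k : Fin 5 → ℕ) (a : SignType) (j : Fin n) :
    (fun x => siteN β k a (x j)) ∈ trigPoly n := by
  have h := fun κ c => dblN_mem (n := n) β κ c a (single j 1) (u := fun x => x j) fun x => by
    simp [lin_single_left]
  exact mul_mem (mul_mem (mul_mem (h _ _) (h _ _)) (h _ _)) (h _ _)

/-- Integral coupling constants. -/
def natCoup (k : Fin 5 → ℕ) : Couplings := ⟨k 0, k 1, k 2, k 3, k 4⟩

lemma pairN_mul (k : Fin 5 → ℕ) (a b : SignType) {x y : ℝ}
    (hp : Real.sin ((x + y) / 2) ≠ 0) (hm : Real.sin ((x - y) / 2) ≠ 0) :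
    pairW (natCoup k) β a b x y * pairN β (k 0) 0 0 x y = pairN β (k 0) a b x y := by
  have hg : 2 * gam β = I * β := by rw [gam]; ring
  have key : ∀ u : ℝ, Real.sin (u / 2) ≠ 0 → ∀ s : SignType, s ≠ 0 →
      dblN β (k 0) 0 s u = sineRatio β (k 0) ((s : ℂ) * u) * dblN β (k 0) 0 0 u ∧
      dblN β (k 0) 0 (2 * s) u = sineRatio β (k 0) ((s : ℂ) * u) *
        sineRatio β (k 0) ((s : ℂ) * u + I * β) * dblN β (k 0) 0 0 u := fun u hu s hs => by
    have h : Real.sin (((s : ℂ) * u).re / 2) ≠ 0 := by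
      rcases SignType.trichotomy s with rfl | rfl | rfl <;> simp_all [neg_div]
    exact ⟨by simpa using (dblN_mul_one β (k 0) (c := 0) hs (by simpa using h)).symm,
      (dblN_mul_two β _ hs h).symm⟩
  have p := key _ hp
  have m := key _ hm
  have p1 := p 1 (by decide)
  have p2 := p (-1) (by decide)
  have m1 := m 1 (by decide)
  have m2 := m (-1) (by decide)
  push_cast at p1 p2 m1 m2
  norm_num at p1 p2 m1 m2
  rcases SignType.trichotomy a with rfl | rfl | rfl <;>
    rcases SignType.trichotomy b with rfl | rfl | rfl <;>
    norm_num [pairN, pairW, vA_eq, natCoup, hg, p1, p2, m1, m2, -mul_eq_mul_left_iff,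
      -mul_eq_mul_right_iff] <;> ring_nf

lemma siteN_mul (k : Fin 5 → ℕ) (a : SignType) {x : ℝ}
    (hs : Real.sin (x / 2) ≠ 0) (hc : Real.cos (x / 2) ≠ 0) :
    siteW (natCoup k) β a x * siteN β k 0 x = siteN β k a x := by
  by_cases ha : a = 0
  · simp [ha, siteW]
  have h1 : Real.sin (((a : ℂ) * x).re / 2) ≠ 0 := by
    rcases SignType.trichotomy a with rfl | rfl | rfl <;> simp_all [neg_div]
  have h2 : Real.sin ((((a : ℂ) * x).re + Real.pi) / 2) ≠ 0 := by
    rw [add_div, sin_add_pi_div_two]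
    rcases SignType.trichotomy a with rfl | rfl | rfl <;> simp_all [neg_div]
  have hg : (gam β).re = 0 := by simp [gam]
  have e1 := dblN_mul_one β (k 1) (c := 0) ha (x := x) (by simpa using h1)
  have e2 := dblN_mul_one β (k 2) (c := Real.pi) ha (x := x) (by simpa using h2)
  have e3 := dblN_mul_one β (k 3) (c := gam β) ha (x := x) (by simpa [hg] using h1)
  have e4 := dblN_mul_one β (k 4) (c := gam β + Real.pi) ha (x := x) (by simpa [hg] using h2)
  rw [add_zero] at e1
  simp only [siteN, ← e1, ← e2, ← e3, ← e4, siteW, if_neg ha, vB_eq, natCoup, add_assoc]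
  simp
  ring

/-- The product of a weight of a cell with the weight function of the variables in `K`. -/
def cellN (k : Fin 5 → ℕ) (K : 𝔓ⁿ) (τ : 𝕊ⁿ) (z : ℂⁿ) : ℂ := (∏ j ∈ K, siteN β k (τ j) (z j)) *
    pairProd K fun i j => pairN β (k 0) (τ i) (τ j) (z i) (z j)

lemma cellN_mul (k : Fin 5 → ℕ) (hx : x ∈ regularSet n) (K : 𝔓ⁿ) (τ : 𝕊ⁿ) :
    cellW (natCoup k) β (toC x) K τ * cellN β k K 0 (toC x) = cellN β k K τ (toC x) := by
  rw [cellW, cellN, cellN, mul_mul_mul_comm, ← prod_mul_distrib, ← pairProd_mul]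
  congr 1
  · exact prod_congr rfl fun j _ => siteN_mul β k _ (hx.1 j).1 (hx.1 j).2
  · exact pairProd_congr fun i _ j _ hij =>
      pairN_mul β k _ _ (hx.2 i j hij.ne).1 (hx.2 i j hij.ne).2

/-- The part of `cellN` that involves the variables in the support of the cell. -/
def crossN (k : Fin 5 → ℕ) (K : 𝔓ⁿ) (τ : 𝕊ⁿ) (z : ℂⁿ) : ℂ := cellN β k (supp τ) τ z *
    ∏ s ∈ supp τ, ∏ t ∈ K \ supp τ, pairN β (k 0) (τ s) (τ t) (z s) (z t)

lemma cellN_eq_crossN (k : Fin 5 → ℕ) (h : supp τ ⊆ K) (z : ℂⁿ) :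
    cellN β k K τ z = crossN β k K τ z * cellN β k (K \ supp τ) 0 z := by
  have h0 : ∀ j ∈ K \ supp τ, τ j = 0 := fun j hj => by simpa using (Finset.mem_sdiff.1 hj).2
  have e : cellN β k (K \ supp τ) 0 z = cellN β k (K \ supp τ) τ z := by
    rw [cellN, cellN]
    congr 1
    · exact prod_congr rfl fun j hj => by rw [h0 j hj]; rfl
    · exact pairProd_congr fun i hi j hj _ => by rw [h0 i hi, h0 j hj]; rfl
  rw [e]
  conv_lhs => rw [← union_sdiff_of_subset h]
  rw [cellN, Finset.prod_union disjoint_sdiff, pairProd_union disjoint_sdiff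
    fun i j => pairN_comm .., crossN, cellN, cellN]
  ring

lemma supp_neg (τ : 𝕊ⁿ) : supp (-τ) = supp τ := by ext j; simp

lemma crossN_shift (k : Fin 5 → ℕ) (K : 𝔓ⁿ) (τ : 𝕊ⁿ)
    (z : ℂⁿ) : crossN β k K τ (shift β (-τ) z) = crossN β k K (-τ) z := by
  simp only [crossN, cellN, supp_neg, shift, Pi.neg_apply, siteN_shift, pairN_shift]

lemma cellN_mem (k : Fin 5 → ℕ) (K : 𝔓ⁿ) (τ : 𝕊ⁿ) : cellN β k K τ ∈ trigPoly n := by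
  have e : cellN β k K τ = (∏ j ∈ K, fun z => siteN β k (τ j) (z j)) *
      pairProd K fun i j => fun z => pairN β (k 0) (τ i) (τ j) (z i) (z j) := by
    ext z; simp [cellN, pairProd, Finset.prod_apply]
  rw [e]
  exact mul_mem (prod_mem fun j _ => siteN_mem _ _ _ _) (prod_mem fun q _ => pairN_mem _ _ _ _ _ _)

lemma crossN_mem (k : Fin 5 → ℕ) (K : 𝔓ⁿ) (τ : 𝕊ⁿ) : crossN β k K τ ∈ trigPoly n := by
  have e : crossN β k K τ = cellN β k (supp τ) τ * ∏ s ∈ supp τ, ∏ t ∈ K \ supp τ,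
      fun z => pairN β (k 0) (τ s) (τ t) (z s) (z t) := by
    ext z; simp [crossN, Finset.prod_apply]
  rw [e]
  exact mul_mem (cellN_mem _ _ _ _) (prod_mem fun s _ => prod_mem fun t _ => pairN_mem _ _ _ _ _ _)

lemma cellN_congr (k : Fin 5 → ℕ) (τ : 𝕊ⁿ)
    {z z' : ℂⁿ} (h : ∀ j ∈ K, z j = z' j) : cellN β k K τ z = cellN β k K τ z' := by
  rw [cellN, cellN]
  congr 1
  · exact prod_congr rfl fun j hj => by rw [h j hj]
  · exact pairProd_congr fun i hi j hj _ => by rw [h i hi, h j hj]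

lemma crossN_congr (k : Fin 5 → ℕ) (hτ : supp τ ⊆ K) {z z' : ℂⁿ} (h : ∀ j ∈ K, z j = z' j) :
    crossN β k K τ z = crossN β k K τ z' := by
  rw [crossN, crossN, cellN_congr β k τ fun j hj => h j (hτ hj)]
  congr 1
  refine prod_congr rfl fun s hs => prod_congr rfl fun t ht => ?_
  rw [h s (hτ hs), h t (Finset.mem_sdiff.1 ht).1]

/-- The product of a chain sum with the weight function is a trigonometric polynomial in the
variables in `K`. -/
lemma exists_chainSum_mul (k : Fin 5 → ℕ) (m : ℕ) : ∀ K : Finset (Fin n),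
    ∃ N ∈ trigPoly n, (∀ x ∈ regularSet n, chainSum (cellW (natCoup k) β (toC x)) m K *
      cellN β k K 0 (toC x) = N (toC x)) ∧ ∀ z z', (∀ j ∈ K, z j = z' j) → N z = N z' := by
  induction m using Nat.strong_induction_on with | _ m ih =>
  intro K
  rcases Nat.eq_zero_or_pos m with rfl | hm
  · exact ⟨_, cellN_mem β k K 0, fun x _ => by rw [chainSum_zero, one_mul],
      fun z z' h => cellN_congr β k 0 h⟩
  have hlt : ∀ τ ∈ (cells K m).erase 0, m - (supp τ).card < m := fun τ hτ =>
    Nat.sub_lt hm (card_pos.2 (Finset.nonempty_iff_ne_empty.2 fun h =>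
      (mem_erase.1 hτ).1 (supp_eq_empty.1 h)))
  choose! N h1 h2 h3 using fun τ hτ => ih (m - (supp τ).card) (hlt τ hτ) (K \ supp τ)
  have hs : ∀ τ ∈ (cells K m).erase 0, supp τ ⊆ K := fun τ hτ => (mem_cells.1 (mem_erase.1 hτ).2).1
  refine ⟨-∑ τ ∈ (cells K m).erase 0, crossN β k K τ * N τ,
    neg_mem (sum_mem fun τ hτ => mul_mem (crossN_mem _ _ _ _) (h1 τ hτ)), fun x hx => ?_,
    fun z z' h => ?_⟩
  · rw [chainSum_eq_neg _ hm.ne', neg_mul, sum_mul]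
    simp only [Pi.neg_apply, Finset.sum_apply, Pi.mul_apply]
    congr 1
    refine sum_congr rfl fun τ hτ => ?_
    rw [mul_right_comm, cellN_mul β k hx, cellN_eq_crossN β k (hs τ hτ), ← h2 τ hτ x hx]
    ring
  · simp only [Pi.neg_apply, Finset.sum_apply, Pi.mul_apply]
    exact congrArg _ (sum_congr rfl fun τ hτ => congrArg₂ _ (crossN_congr β k (hs τ hτ) h)
      (h3 τ hτ z z' fun j hj => h j (Finset.mem_sdiff.1 hj).1))

/-! ### Symmetry for integral couplings -/

lemma integral_expo {ν : ℤⁿ} (hν : ν ≠ 0) : ∫ x in cube n, expo ν (toC x) = 0 := by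
  obtain ⟨j, hj⟩ := ne_iff.1 hν
  have hj' : I * (ν j : ℂ) ≠ 0 := mul_ne_zero I_ne_zero (by exact_mod_cast hj)
  have hd : ∀ x : ℝⁿ, fderiv ℝ (fun x => expo ν (toC x)) x (single j 1) =
      I * ν j * expo ν (toC x) := fun x => by
    have h1 : HasDerivAt (fun t : ℂ => expo ν (toC x + t • single j 1))
        (I * ν j * expo ν (toC x)) 0 := by
      have e : ∀ t : ℂ, expo ν (toC x + t • single j 1) =
          exp (I * (lin ν (toC x) + t * ν j)) := fun t => by
        rw [expo, lin_add]; simp [lin, single_apply, mul_comm]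
      simp only [e]
      refine ((((hasDerivAt_id (0 : ℂ)).mul_const (ν j : ℂ)).const_add _).const_mul
        I).cexp.congr_deriv ?_
      simp [expo]; ring
    have h2 := (hasDerivAt_line (differentiable_trigPoly (expo_mem ν)) (single j 1)
      (toC x)).unique h1
    rw [fderiv_comp_toC (differentiable_trigPoly (expo_mem ν) _), ← h2]
    congr 1
    ext i
    by_cases h : i = j <;> simp [toC, h]
  have h := integral_divergence_eq_zero (n := n)
    (F := fun i x => if i = j then expo ν (toC x) else 0) (fun i => ?_) (fun i => ?_)
  · have e : ∀ x : ℝⁿ, ∑ i, fderiv ℝ (fun x => if i = j then expo ν (toC x) else 0) x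
        (single i 1) = I * ν j * expo ν (toC x) := fun x => by
      rw [sum_eq_single j (fun i _ hi => by simp [hi]) (by simp)]
      simpa using hd x
    simp only [e] at h
    rw [integral_const_mul] at h
    exact (mul_eq_zero.1 h).resolve_left hj'
  · by_cases h : i = j
    · simp only [h, if_true]
      exact ((contDiff_trigPoly (expo_mem ν)).restrict_scalars ℝ).comp contDiff_toC
    · simp only [h, if_false]; exact contDiff_const
  · by_cases h : i = j
    · simp only [h, if_true]; exact isPeriodic_trigPoly (expo_mem ν)
    · simp only [h, if_false]; exact fun _ _ _ => rfl

lemma integral_translate (hf : f ∈ trigPoly n) (y : ℂⁿ) :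
    ∫ x in cube n, f (toC x + y) = ∫ x in cube n, f (toC x) := by
  have key : ∀ f : ℂⁿ → ℂ, f ∈ trigPoly n → f ∈ trigPoly n ∧
      ∫ x in cube n, f (toC x + y) = ∫ x in cube n, f (toC x) := fun f hf => by
    refine trigPoly_induction (p := fun f => f ∈ trigPoly n ∧
      ∫ x in cube n, f (toC x + y) = ∫ x in cube n, f (toC x)) hf (fun ν => ⟨expo_mem ν, ?_⟩)
      ⟨zero_mem _, rfl⟩ (fun f h hf hh => ⟨add_mem hf.1 hh.1, ?_⟩)
      fun a f hf => ⟨Subalgebra.smul_mem _ hf.1 a, ?_⟩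
    · simp only [expo_add]
      rw [integral_mul_const]
      by_cases h : ν = 0
      · simp [h]
      · rw [integral_expo h, zero_mul]
    · have i1 := fun {f : ℂⁿ → ℂ} (hf : f ∈ trigPoly n) =>
        integrableOn_cube (continuous_comp_toC hf)
      simp only [Pi.add_apply]
      rw [integral_add (i1 (trigPoly_translate hf.1 y)) (i1 (trigPoly_translate hh.1 y)),
        integral_add (i1 hf.1) (i1 hh.1), hf.2, hh.2]
    · simp only [Pi.smul_apply, integral_smul, hf.2]
  exact (key f hf).2

/-- The bilinear form of the difference operators with integral couplings. -/
def bilN (k : Fin 5 → ℕ) (f h : ℂⁿ → ℂ) : ℂ :=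
  ∫ x in cube n, f (toC x) * h (toC x) * cellN β k Finset.univ 0 (toC x)

lemma bilN_comb_left (k : Fin 5 → ℕ) (s : Finset ℤⁿ) (b : ℤⁿ → ℂ)
    {h : ℂⁿ → ℂ} (hh : h ∈ trigPoly n) :
    bilN β k (comb s b) h = ∑ μ ∈ s, b μ * bilN β k (monoC μ) h := by
  simp only [bilN, comb, sum_mul]
  rw [integral_finsetSum]
  · exact sum_congr rfl fun μ _ => by rw [← integral_const_mul]; simp only [mul_assoc]
  · exact fun μ _ => integrableOn_cube (continuous_comp_toC (mul_mem (mul_mem (mul_mem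
      (const_mem_trigPoly (b μ)) (monoC_mem μ)) hh) (cellN_mem β k Finset.univ 0)))

lemma bilN_comm (k : Fin 5 → ℕ) (f h : ℂⁿ → ℂ) : bilN β k f h = bilN β k h f := by
  simp only [bilN, mul_comm (f _)]

lemma shift_mem (hf : f ∈ trigPoly n) (β : ℝ) (τ : 𝕊ⁿ) :
    (fun z => f (shift β τ z)) ∈ trigPoly n :=
  trigPoly_translate hf fun j => I * β * (τ j : ℂ)

lemma bilN_symm (k : Fin 5 → ℕ) {r : ℕ} (hr : r ≠ 0) {f h F H : ℂⁿ → ℂ}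
    (hf : f ∈ trigPoly n) (hh : h ∈ trigPoly n) (hF : F ∈ trigPoly n) (hH : H ∈ trigPoly n)
    (h1 : ∀ x ∈ regularSet n, differenceOp (natCoup k) r β f (toC x) = F (toC x))
    (h2 : ∀ x ∈ regularSet n, differenceOp (natCoup k) r β h (toC x) = H (toC x)) :
    bilN β k F h = bilN β k f H := by
  choose N hN1 hN2 hN3 using fun S : 𝔓ⁿ =>
    exists_chainSum_mul (n := n) β k (r - S.card) (Finset.univ \ S)
  have key : ∀ {f h F : ℂⁿ → ℂ}, f ∈ trigPoly n → h ∈ trigPoly n → F ∈ trigPoly n →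
      (∀ x ∈ regularSet n, differenceOp (natCoup k) r β f (toC x) = F (toC x)) →
      bilN β k F h = ∑ τ ∈ cells Finset.univ r, ∫ x in cube n,
        (crossN β k Finset.univ τ * N (supp τ) * (fun z => f (shift β τ z)) * h) (toC x) := by
    intro f h F hf hh hF hfF
    have hm := fun τ : 𝕊ⁿ => mul_mem (mul_mem (mul_mem
      (crossN_mem β k Finset.univ τ) (hN1 (supp τ))) (shift_mem hf β τ)) hh
    rw [bilN, ← integral_finsetSum _ fun τ _ => integrableOn_cube (continuous_comp_toC (hm τ))]
    congr 1
    ext x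
    have := eq_of_eq_on_regular (mul_mem (mul_mem hF hh) (cellN_mem β k Finset.univ 0))
      (sum_mem fun τ (_ : τ ∈ cells Finset.univ r) => hm τ) (fun x hx => ?_) x
    · simpa using this
    · simp only [Pi.mul_apply, Finset.sum_apply]
      rw [← hfF x hx, differenceOp_eq_sum _ hr, sum_mul, sum_mul]
      refine sum_congr rfl fun τ _ => ?_
      rw [← hN2 (supp τ) x hx]
      have e1 := cellN_mul β k hx Finset.univ τ
      rw [cellN_eq_crossN β k (τ := τ) (Finset.subset_univ _)] at e1
      linear_combination chainSum (cellW (natCoup k) β (toC x)) (r - (supp τ).card)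
        (Finset.univ \ supp τ) * f (shift β τ (toC x)) * h (toC x) * e1
  rw [bilN_comm β k f H, key hf hh hF h1, key hh hf hH h2]
  refine Finset.sum_nbij' (fun τ => -τ) (fun τ => -τ) ?_ ?_ (by simp) (by simp) fun τ _ => ?_
  · exact fun τ hτ => by simpa [mem_cells, supp_neg] using hτ
  · exact fun τ hτ => by simpa [mem_cells, supp_neg] using hτ
  rw [← integral_translate (mul_mem (mul_mem (mul_mem (crossN_mem β k Finset.univ τ)
    (hN1 (supp τ))) (shift_mem hf β τ)) hh) fun j => I * β * (((-τ) j : SignType) : ℂ)]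
  congr 1
  ext x
  change crossN β k Finset.univ τ (shift β (-τ) (toC x)) * N (supp τ) (shift β (-τ) (toC x)) *
    f (shift β τ (shift β (-τ) (toC x))) * h (shift β (-τ) (toC x)) = crossN β k Finset.univ (-τ)
      (toC x) * N (supp (-τ)) (toC x) * h (shift β (-τ) (toC x)) * f (toC x)
  have e1 : shift β τ (shift β (-τ) (toC x)) = toC x := by ext j; simp [shift]
  have e2 : N (supp τ) (shift β (-τ) (toC x)) = N (supp τ) (toC x) := hN3 _ _ _ fun j hj => by
    have : τ j = 0 := by simpa using hj
    simp [shift, this]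
  rw [crossN_shift, e1, e2, supp_neg]
  ring

lemma dblN_zero (κ : ℕ) (y : ℝ) : dblN 0 κ 0 0 y =
    ((4 ^ κ * |Real.sin (y / 2)| ^ (2 * (κ : ℝ)) : ℝ) : ℂ) := by
  have e : (1 - exp (I * y)) * (1 - exp (I * -y)) = ((4 * |Real.sin (y / 2)| ^ 2 : ℝ) : ℂ) := by
    have h1 : exp (I * y) * exp (I * -y) = 1 := by rw [← exp_add]; simp
    have h2 : 4 * |Real.sin (y / 2)| ^ 2 = 2 - 2 * Real.cos y := by
      have := Real.cos_sq' (y / 2)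
      have h3 := Real.cos_two_mul (y / 2)
      rw [show 2 * (y / 2) = y by ring] at h3
      rw [sq_abs]; linarith
    have h3 : 2 * cos y = exp (I * y) + exp (I * -y) := by
      rw [Complex.two_cos, mul_comm, mul_neg, mul_comm I, neg_mul]
    rw [h2]
    push_cast
    linear_combination h1 + h3
  rw [show (2 * (κ : ℝ)) = ((2 * κ : ℕ) : ℝ) by push_cast; ring, Real.rpow_natCast, pow_mul,
    ← mul_pow, Complex.ofReal_pow, ← e, mul_pow]
  simp [dblN, qProd]

lemma dblN_zero_pi (κ : ℕ) (y : ℝ) : dblN 0 κ Real.pi 0 y =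
    ((4 ^ κ * |Real.cos (y / 2)| ^ (2 * (κ : ℝ)) : ℝ) : ℂ) := by
  have h3 : exp (I * (2 * Real.pi)) = 1 := by rw [mul_comm]; exact Complex.exp_two_pi_mul_I
  have h2 : -(y : ℂ) + Real.pi = -(y + Real.pi) + 2 * Real.pi := by ring
  rw [← sin_add_pi_div_two, ← add_div, ← dblN_zero]
  simp [dblN, qProd, h2, mul_add, exp_add, h3]

lemma cellN_zero (k : Fin 5 → ℕ) : ∃ C : ℂ, C ≠ 0 ∧ ∀ x : ℝⁿ,
    cellN 0 k Finset.univ 0 (toC x) = C * weight (natCoup k) x := by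
  refine ⟨(∏ _j : Fin n, ((4 ^ (k 1 + k 3) * 4 ^ (k 2 + k 4) : ℝ) : ℂ)) *
    ∏ _q ∈ (Finset.univ : Finset (Fin n × Fin n)).filter (fun q => q.1 < q.2),
      ((4 ^ k 0 * 4 ^ k 0 : ℝ) : ℂ), ?_, fun x => ?_⟩
  · exact mul_ne_zero (prod_ne_zero_iff.2 fun _ _ => by norm_num)
      (prod_ne_zero_iff.2 fun _ _ => by norm_num)
  have hpair : ∀ x y : ℝ, pairN 0 (k 0) 0 0 x y = ((4 ^ k 0 * 4 ^ k 0 : ℝ) : ℂ) *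
      ((|Real.sin ((x + y) / 2) * Real.sin ((x - y) / 2)| ^ (2 * (k 0 : ℝ)) : ℝ) : ℂ) := by
    intro x y
    rw [abs_mul, mul_rpow (abs_nonneg _) (abs_nonneg _), ← ofReal_mul,
      mul_mul_mul_comm, ofReal_mul, ← dblN_zero, ← dblN_zero]
    simp [pairN]
  have hsite : ∀ x : ℝ, siteN 0 k 0 x = ((4 ^ (k 1 + k 3) * 4 ^ (k 2 + k 4) : ℝ) : ℂ) *
      ((|Real.sin (x / 2)| ^ (2 * ((k 1 : ℝ) + k 3)) *
        |Real.cos (x / 2)| ^ (2 * ((k 2 : ℝ) + k 4)) : ℝ) : ℂ) := by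
    intro x
    have hp : ∀ (a : ℝ) (p q : ℕ), |a| ^ (2 * ((p : ℝ) + q)) =
        |a| ^ (2 * (p : ℝ)) * |a| ^ (2 * (q : ℝ)) := fun a p q => by
      rw [mul_add, Real.rpow_add_of_nonneg (abs_nonneg a) (by positivity) (by positivity)]
    have hg : gam 0 = 0 := by simp [gam]
    simp only [siteN, hg, zero_add, SignType.coe_zero, dblN_zero, dblN_zero_pi, hp, pow_add]
    push_cast
    ring
  rw [weight, cellN, pairProd, Finset.univ_product_univ]
  simp only [Pi.zero_apply, toC, hpair, hsite, prod_mul_distrib, ofReal_mul,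
    Complex.ofReal_prod, natCoup]
  ring

lemma continuous_bilN (k : Fin 5 → ℕ) {f h : ℂⁿ → ℂ} (hf : f ∈ trigPoly n)
    (hh : h ∈ trigPoly n) : Continuous fun β => bilN β k f h := by
  have hq : Continuous fun p : ℝ × ℝⁿ => cellN p.1 k Finset.univ 0 (toC p.2) := by
    have hx : ∀ j : Fin n, Continuous fun p : ℝ × ℝⁿ => toC p.2 j := fun j => by
      unfold toC; fun_prop
    have hF : ∀ (κ : ℕ) {c u : ℝ × ℝⁿ → ℂ}, Continuous c → Continuous u →
        Continuous fun p => dblN p.1 κ (c p) 0 (u p) := fun κ c u hc hu => by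
      simp only [dblN, Int.natAbs_zero, pow_zero, one_mul, Int.toNat_zero, neg_zero, Nat.cast_zero,
        zero_mul, add_zero]
      exact (continuous_qProd κ continuous_fst (hu.add hc)).mul
        (continuous_qProd κ continuous_fst (hu.neg.add hc))
    have hg : Continuous fun p : ℝ × ℝⁿ => gam p.1 := by unfold gam; fun_prop
    have hc := fun c : ℂ => continuous_const (X := ℝ × ℝⁿ) (y := c)
    unfold cellN siteN pairProd
    exact (continuous_finsetProd _ fun j _ => (((hF _ (hc _) (hx j)).mul
      (hF _ (hc _) (hx j))).mul (hF _ hg (hx j))).mul (hF _ (hg.add (hc _)) (hx j))).mul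
      (continuous_finsetProd _ fun q _ => (hF _ (hc _) ((hx _).add (hx _))).mul
        (hF _ (hc _) ((hx _).sub (hx _))))
  exact continuous_parametric_integral_of_continuous
    (f := fun β x => f (toC x) * h (toC x) * cellN β k Finset.univ 0 (toC x))
    ((((continuous_comp_toC hf).comp continuous_snd).mul
      ((continuous_comp_toC hh).comp continuous_snd)).mul hq) (isCompact_cube n)

section natCoup

variable {k : Fin 5 → ℕ} {r m : ℕ} {B : (Fin n → ℤ) → (Fin n → ℤ) → ℝ → ℂ}

lemma symm_of_natCoup (hr : 1 ≤ r) (hB : ∀ lam, IsDominant lam → ∀ μ, ContDiffAt ℝ ∞ (B lam μ) 0)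
    (hD : ∀ lam, IsDominant lam → ∀ β ≠ 0, ∀ x ∈ regularSet n,
      differenceOp (natCoup k) r β (monoC lam) (toC x) =
        comb (lower lam) (fun μ => B lam μ β) (toC x))
    (h0 : ∀ j < m, ∀ lam, IsDominant lam → ∀ μ, tc j (B lam μ) = 0) {μ ν : ℤⁿ}
    (hμ : IsDominant μ) (hν : IsDominant ν) :
    bil (natCoup k) (comb (lower μ) fun κ => tc m (B μ κ)) (monoC ν) =
      bil (natCoup k) (monoC μ) (comb (lower ν) fun κ => tc m (B ν κ)) := by
  obtain ⟨C, hC, hC'⟩ := cellN_zero (n := n) k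
  have hb : ∀ f h : ℂⁿ → ℂ, bilN 0 k f h = C * bil (natCoup k) f h := fun f h => by
    rw [bilN, bil, ← integral_const_mul]
    congr 1
    ext x
    rw [hC']; ring
  have key : ∀ {μ ν : ℤⁿ}, IsDominant μ → Tendsto (fun β : ℝ => (β : ℂ)⁻¹ ^ m *
      bilN β k (comb (lower μ) fun κ => B μ κ β) (monoC ν)) (𝓝[>] 0)
      (𝓝 (C * bil (natCoup k) (comb (lower μ) fun κ => tc m (B μ κ)) (monoC ν))) := by
    intro μ ν hμ
    rw [← hb]
    simp only [bilN_comb_left _ _ _ _ (monoC_mem ν), mul_sum, ← mul_assoc]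
    exact tendsto_finsetSum _ fun κ _ => (tendsto_of_tc (hB μ hμ κ) fun j hj => h0 j hj μ hμ κ).mul
      (((continuous_bilN k (monoC_mem κ) (monoC_mem ν)).tendsto 0).mono_left nhdsWithin_le_nhds)
  refine mul_left_cancel₀ hC (tendsto_nhds_unique (key hμ) ?_)
  rw [bil_comm]
  refine (key hν).congr' ?_
  filter_upwards [self_mem_nhdsWithin] with β hβ
  rw [bilN_symm β k (Nat.one_le_iff_ne_zero.1 hr) (monoC_mem ν) (monoC_mem μ) (comb_mem _ _)
    (comb_mem _ _) (hD ν hν β (ne_of_gt hβ)) (hD μ hμ β (ne_of_gt hβ)), bilN_comm]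

lemma continuous_weight_natCoup (k : Fin 5 → ℕ) : Continuous (weight (natCoup k) : ℝⁿ → ℝ) :=
  continuous_weight (Nat.cast_nonneg _) (add_nonneg (Nat.cast_nonneg _) (Nat.cast_nonneg _))
    (add_nonneg (Nat.cast_nonneg _) (Nat.cast_nonneg _))

lemma exists_orthogonal {P : Couplings} (hw : Continuous (weight P : ℝⁿ → ℝ))
    (hl : IsDominant lam) : ∃ b : ℤⁿ → ℂ, b lam = 1 ∧
      ∀ μ ∈ (lower lam).erase lam, bil P (comb (lower lam) b) (monoC μ) = 0 := by
  obtain ⟨p, hp, -⟩ := existsUnique_isJacobi hw hl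
  obtain ⟨-, b, h1, -, h2⟩ := isJacobi_iff.1 hp
  exact ⟨b, h1, h2⟩

lemma expansion_natCoup (k : Fin 5 → ℕ) (hr : 1 ≤ r) (hrn : r ≤ n) :
    (∀ m < 2 * r, ∀ lam : ℤⁿ, IsDominant lam →
      coeff m (expansion n (natCoup k) r) (monoFn lam) = 0) ∧
    ∀ lam : ℤⁿ, IsDominant lam → ∀ b : ℤⁿ → ℂ, b lam = 1 →
      (∀ μ ∈ (lower lam).erase lam, bil (natCoup k) (comb (lower lam) b) (monoC μ) = 0) →
      ∃ e : ℂ, coeff (2 * r) (expansion n (natCoup k) r) (combFn lam b) = e • combFn lam b := by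
  have hw := continuous_weight_natCoup (n := n) k
  obtain ⟨B, hB, hD, hT⟩ := exists_isTri n (natCoup k) hr hrn
  have h0 : ∀ m < 2 * r, (∀ lam, IsDominant lam → ∀ μ, tc m (B lam μ) = 0) ∧
      ∀ lam : ℤⁿ, IsDominant lam → coeff m (expansion n (natCoup k) r) (monoFn lam) = 0 := by
    intro m
    induction m using Nat.strong_induction_on with | _ m ih =>
    intro hm
    have h1 : ∀ lam : ℤⁿ, IsDominant lam →
        coeff m (expansion n (natCoup k) r) (monoFn lam) = 0 := by
      refine apply_monoFn_eq_zero _ fun lam hl => ?_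
      obtain ⟨b, hb, ho⟩ := exists_orthogonal hw hl
      refine ⟨b, hb, ?_⟩
      rw [(hT m).1.eigen hw (fun μ ν => symm_of_natCoup hr hB hD
        fun j hj => (ih j hj (hj.trans hm)).1) hl hb ho]
      beta_reduce
      rw [(hT m).2 lam hl, (tc_diffEig _ hr hrn lam).1 m hm, zero_smul]
    refine ⟨fun lam hl μ => ?_, h1⟩
    by_cases hμ : μ ∈ lower lam
    · have h2 := ((hT m).1 lam hl).2.symm.trans (h1 lam hl)
      refine combFn_inj (c := 0) (h2.trans ?_) μ hμ
      simp [combFn]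
    · exact ((hT m).1 lam hl).1 μ hμ
  exact ⟨fun m hm => (h0 m hm).2, fun lam hl b hb ho => ⟨_, (hT (2 * r)).1.eigen hw
    (fun μ ν => symm_of_natCoup hr hB hD fun j hj => (h0 j hj).1) hl hb ho⟩⟩

lemma commute_natCoup (k : Fin 5 → ℕ) (hr : 1 ≤ r) (hrn : r ≤ n) (hl : IsDominant lam) :
    (coeff 2 (expansion n (natCoup k) 1) * coeff (2 * r) (expansion n (natCoup k) r) -
      coeff (2 * r) (expansion n (natCoup k) r) *
        coeff 2 (expansion n (natCoup k) 1)) (monoFn lam) = 0 := by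
  refine apply_monoFn_eq_zero _ (fun lam hl => ?_) lam hl
  obtain ⟨b, hb, ho⟩ := exists_orthogonal (continuous_weight_natCoup k) hl
  obtain ⟨e, he⟩ := (expansion_natCoup k hr hrn).2 lam hl b hb ho
  obtain ⟨e', he'⟩ := (expansion_natCoup k le_rfl (hr.trans hrn)).2 lam hl b hb ho
  rw [mul_one] at he'
  refine ⟨b, hb, ?_⟩
  rw [LinearMap.sub_apply, End.mul_apply, End.mul_apply, he, he', map_smul, map_smul,
    he, he', smul_comm, sub_self]

end natCoup

/-! ### Polynomial dependence on the coupling constants -/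

/-- The coupling constants as a family indexed by the coordinates of a vector. -/
def coup (κ : Fin 5 → ℝ) : Couplings := ⟨κ 0, κ 1, κ 2, κ 3, κ 4⟩

/-- The polynomial functions of five real variables. -/
def polyFn : Subalgebra ℂ ((Fin 5 → ℝ) → ℂ) :=
  (aeval (R := ℂ) fun (i : Fin 5) (κ : Fin 5 → ℝ) => (κ i : ℂ)).range

lemma coord_mem_polyFn (i : Fin 5) : (fun κ : Fin 5 → ℝ => (κ i : ℂ)) ∈ polyFn :=
  ⟨MvPolynomial.X i, by simp⟩

lemma const_mem_polyFn (a : ℂ) : (fun _ => a) ∈ polyFn := polyFn.algebraMap_mem a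

lemma polyFn_eq_zero {F : (Fin 5 → ℝ) → ℂ} (hF : F ∈ polyFn)
    (h : ∀ k : Fin 5 → ℕ, F (fun i => k i) = 0) : F = 0 := by
  obtain ⟨p, rfl⟩ := hF
  have he : ∀ κ : Fin 5 → ℝ, aeval (R := ℂ) (fun (i : Fin 5) (κ : Fin 5 → ℝ) => (κ i : ℂ)) p κ =
      eval (fun i => (κ i : ℂ)) p := fun κ => by
    rw [← coe_aeval_eq_eval]
    exact congrArg (fun f => f p) (algHom_ext (A := ℂ)
      (f := (Pi.evalAlgHom ℂ (fun _ : Fin 5 → ℝ => ℂ) κ).comp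
        (aeval fun i (κ : Fin 5 → ℝ) => (κ i : ℂ)))
      (g := aeval fun i => (κ i : ℂ)) fun i => by simp)
  have hp : p = 0 := by
    refine funext_set (fun _ => range (Nat.cast : ℕ → ℂ))
      (fun _ => infinite_range_of_injective Nat.cast_injective) fun x hx => ?_
    choose k hk using fun i => hx i (mem_univ i)
    have := h k
    simp_all
  simp [hp]

/-- The functions of the couplings and of `β` whose Taylor coefficients at `β = 0` are polynomials
in the couplings. -/
def polyTaylor : Subalgebra ℂ ((Fin 5 → ℝ) → ℝ → ℂ) where
  carrier := {F | (∀ κ, ContDiffAt ℝ ∞ (F κ) 0) ∧ ∀ m, (fun κ => tc m (F κ)) ∈ polyFn}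
  mul_mem' := by
    rintro F G ⟨hF, hF'⟩ ⟨hG, hG'⟩
    refine ⟨fun κ => (hF κ).mul (hG κ), fun m => ?_⟩
    have e : (fun κ => tc m ((F * G) κ)) = ∑ q ∈ Finset.HasAntidiagonal.antidiagonal m,
        (fun κ => tc q.1 (F κ)) * fun κ => tc q.2 (G κ) := by
      ext κ
      rw [Finset.sum_apply]
      exact tc_mul (hF κ) (hG κ) m
    rw [e]
    exact sum_mem fun q _ => mul_mem (hF' _) (hG' _)
  add_mem' := by
    rintro F G ⟨hF, hF'⟩ ⟨hG, hG'⟩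
    refine ⟨fun κ => (hF κ).add (hG κ), fun m => ?_⟩
    have e : (fun κ => tc m ((F + G) κ)) = (fun κ => tc m (F κ)) + fun κ => tc m (G κ) := by
      ext κ
      have := tc_sum Finset.univ (F := fun b : Bool => if b then F κ else G κ) (by
        rintro (_ | _) _ <;> simp [hF, hG]) m
      simp only [sum_bool, if_true, Bool.false_eq_true, if_false] at this
      exact this
    rw [e]
    exact add_mem (hF' m) (hG' m)
  algebraMap_mem' a := ⟨fun κ => contDiffAt_const, fun m => const_mem_polyFn (tc m fun _ => a)⟩

lemma const_mem_polyTaylor {f : ℝ → ℂ} (hf : ContDiffAt ℝ ∞ f 0) : (fun _ => f) ∈ polyTaylor :=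
  ⟨fun _ => hf, fun m => const_mem_polyFn (tc m f)⟩

lemma exp_mem_polyTaylor (c : ℂ) (i : Fin 5) :
    (fun (κ : Fin 5 → ℝ) (β : ℝ) => exp (c * κ i * β)) ∈ polyTaylor := by
  have hd : ∀ (a : ℂ) (m : ℕ), iteratedDeriv m (fun β : ℝ => exp (a * β)) =
      fun β : ℝ => a ^ m * exp (a * β) := fun a m => by
    induction m with
    | zero => simp
    | succ m ih =>
      rw [iteratedDeriv_succ, ih]
      ext β
      have h : HasDerivAt (fun t : ℂ => exp (a * t)) (exp (a * β) * a) (β : ℂ) := by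
        simpa using ((hasDerivAt_id (β : ℂ)).const_mul a).cexp
      rw [(h.comp_ofReal.const_mul (a ^ m)).deriv, pow_succ]
      ring
  refine ⟨fun κ => (contDiff_const.mul ofRealCLM.contDiff).cexp.contDiffAt, fun m => ?_⟩
  have e : (fun κ : Fin 5 → ℝ => tc m fun β : ℝ => exp (c * κ i * β)) =
      (fun _ => c ^ m / (m ! : ℂ)) * (fun κ => (κ i : ℂ)) ^ m := by
    ext κ
    simp [tc, hd, mul_pow, mul_div_right_comm]
  rw [e]
  exact mul_mem (const_mem_polyFn _) (pow_mem (coord_mem_polyFn i) m)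

lemma sineRatio_mem_polyTaylor (i : Fin 5) {z : ℂ} (t : ℂ) (hz : Real.sin (z.re / 2) ≠ 0) :
    (fun (κ : Fin 5 → ℝ) (β : ℝ) => sineRatio β (κ i) (z + t * (I * β))) ∈ polyTaylor := by
  have hs : ContDiffAt ℝ ∞ (fun β : ℝ => exp (I * (z + t * (I * β)))) 0 :=
    (contDiff_const.mul (contDiff_const.add (contDiff_const.mul (contDiff_const.mul
      ofRealCLM.contDiff)))).cexp.contDiffAt
  have hd : ContDiffAt ℝ ∞ (fun β : ℝ => (exp (I * (z + t * (I * β))) - 1)⁻¹) 0 := by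
    refine (hs.sub contDiffAt_const).inv ?_
    have := sin_ne_zero_of_re (z := z / 2) (by simpa using hz)
    rw [sin_half_eq] at this
    simpa using left_ne_zero_of_mul this
  have e : (fun (κ : Fin 5 → ℝ) (β : ℝ) => sineRatio β (κ i) (z + t * (I * β))) =
      ((fun (κ : Fin 5 → ℝ) (β : ℝ) => exp (-(1 / 2) * κ i * β)) *
        (fun _ (β : ℝ) => exp (I * (z + t * (I * β)))) -
        fun (κ : Fin 5 → ℝ) (β : ℝ) => exp (1 / 2 * κ i * β)) *
      fun _ (β : ℝ) => (exp (I * (z + t * (I * β))) - 1)⁻¹ := by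
    ext κ β
    simp only [sineRatio_eq_exp, Pi.mul_apply, Pi.sub_apply, div_eq_mul_inv]
    congr 3 <;> ring_nf
  rw [e]
  exact mul_mem (sub_mem (mul_mem (exp_mem_polyTaylor _ i) (const_mem_polyTaylor hs))
    (exp_mem_polyTaylor _ i)) (const_mem_polyTaylor hd)

lemma siteW_mem_polyTaylor (a : SignType) {x : ℝ} (hs : Real.sin (x / 2) ≠ 0)
    (hc : Real.cos (x / 2) ≠ 0) :
    (fun (κ : Fin 5 → ℝ) (β : ℝ) => siteW (coup κ) β a x) ∈ polyTaylor := by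
  by_cases ha : a = 0
  · simp only [siteW, ha, if_true]; exact one_mem polyTaylor
  have h1 : Real.sin (((a : ℂ) * x).re / 2) ≠ 0 := by
    rcases SignType.trichotomy a with rfl | rfl | rfl <;> simp_all [neg_div]
  have h2 : Real.sin (((a : ℂ) * x + Real.pi).re / 2) ≠ 0 := by
    rw [add_re, ofReal_re, add_div, sin_add_pi_div_two]
    rcases SignType.trichotomy a with rfl | rfl | rfl <;> simp_all [neg_div]
  have e : (fun (κ : Fin 5 → ℝ) (β : ℝ) => siteW (coup κ) β a x) =
      (fun κ β => sineRatio β (κ 1) ((a : ℂ) * x + 0 * (I * β))) *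
      (fun κ β => sineRatio β (κ 2) ((a : ℂ) * x + Real.pi + 0 * (I * β))) *
      (fun κ β => sineRatio β (κ 3) ((a : ℂ) * x + 1 / 2 * (I * β))) *
      (fun κ β => sineRatio β (κ 4) ((a : ℂ) * x + Real.pi + 1 / 2 * (I * β))) := by
    ext κ β
    simp only [siteW, if_neg ha, vB_eq, coup, Pi.mul_apply, gam]
    congr 2 <;> ring_nf
  rw [e]
  exact mul_mem (mul_mem (mul_mem (sineRatio_mem_polyTaylor 1 0 h1)
    (sineRatio_mem_polyTaylor 2 0 h2)) (sineRatio_mem_polyTaylor 3 (1 / 2) h1))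
    (sineRatio_mem_polyTaylor 4 (1 / 2) h2)

lemma pairW_mem_polyTaylor (a b : SignType) {x y : ℝ} (hp : Real.sin ((x + y) / 2) ≠ 0)
    (hm : Real.sin ((x - y) / 2) ≠ 0) :
    (fun (κ : Fin 5 → ℝ) (β : ℝ) => pairW (coup κ) β a b x y) ∈ polyTaylor := by
  have H : ∀ c d : SignType, c ≠ 0 → d ≠ 0 →
      Real.sin (((c : ℂ) * x + (d : ℂ) * y).re / 2) ≠ 0 := fun c d hc hd => by
    have hp' : Real.sin ((-x - y) / 2) ≠ 0 := by
      rwa [show (-x - y) / 2 = -((x + y) / 2) by ring, sin_neg, neg_ne_zero]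
    have hm' : Real.sin ((-x + y) / 2) ≠ 0 := by
      rwa [show (-x + y) / 2 = -((x - y) / 2) by ring, sin_neg, neg_ne_zero]
    rcases SignType.trichotomy c with rfl | rfl | rfl <;>
      rcases SignType.trichotomy d with rfl | rfl | rfl <;> simp_all [sub_eq_add_neg]
  have h2 : ∀ u v : ℂ, Real.sin (u.re / 2) ≠ 0 → Real.sin (v.re / 2) ≠ 0 → ∀ t : ℂ,
      (fun (κ : Fin 5 → ℝ) (β : ℝ) => sineRatio β (κ 0) u *
        sineRatio β (κ 0) (v + t * (I * β))) ∈ polyTaylor := fun u v hu hv t => by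
    have := mul_mem (sineRatio_mem_polyTaylor 0 0 hu) (sineRatio_mem_polyTaylor 0 t hv)
    simp only [zero_mul, add_zero] at this
    exact this
  by_cases ha : a = 0 <;> by_cases hb : b = 0
  · simp only [pairW, ha, hb, if_true]; exact one_mem polyTaylor
  · have := h2 _ _ (H 1 b (by decide) hb) (H (-1) b (by decide) hb) 0
    simpa [pairW, ha, hb, vA_eq, coup, add_comm, sub_eq_add_neg] using this
  · have := h2 _ _ (H a 1 ha (by decide)) (H a (-1) ha (by decide)) 0
    simpa [pairW, ha, hb, vA_eq, coup, sub_eq_add_neg] using this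
  · have := h2 _ _ (H a b ha hb) (H a b ha hb) 1
    have hg : ∀ β, 2 * gam β = I * β := fun β => by rw [gam]; ring
    simpa [pairW, ha, hb, vA_eq, coup, hg] using this

lemma cellW_mem_polyTaylor (hx : x ∈ regularSet n) (K : 𝔓ⁿ) (τ : 𝕊ⁿ) :
    (fun (κ : Fin 5 → ℝ) (β : ℝ) => cellW (coup κ) β (toC x) K τ) ∈ polyTaylor := by
  have e : (fun (κ : Fin 5 → ℝ) (β : ℝ) => cellW (coup κ) β (toC x) K τ) =
      (∏ j ∈ K, fun κ β => siteW (coup κ) β (τ j) (x j)) *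
      ∏ q ∈ (K ×ˢ K).filter (fun q => q.1 < q.2), fun κ β =>
        pairW (coup κ) β (τ q.1) (τ q.2) (x q.1) (x q.2) := by
    ext κ β; simp [cellW, pairProd, Finset.prod_apply, toC]
  rw [e]
  refine mul_mem (prod_mem fun j _ => siteW_mem_polyTaylor _ (hx.1 j).1 (hx.1 j).2)
    (prod_mem fun q hq => ?_)
  have := hx.2 q.1 q.2 (mem_filter.1 hq).2.ne
  exact pairW_mem_polyTaylor _ _ this.1 this.2

lemma chainSum_mem_polyTaylor (hx : x ∈ regularSet n) (m : ℕ) : ∀ K : 𝔓ⁿ,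
      (fun (κ : Fin 5 → ℝ) (β : ℝ) => chainSum (cellW (coup κ) β (toC x)) m K) ∈ polyTaylor := by
  induction m using Nat.strong_induction_on with | _ m ih =>
  intro K
  rcases Nat.eq_zero_or_pos m with rfl | hm
  · simp only [chainSum_zero]; exact one_mem polyTaylor
  have e : (fun (κ : Fin 5 → ℝ) (β : ℝ) => chainSum (cellW (coup κ) β (toC x)) m K) =
      -∑ τ ∈ (cells K m).erase 0, (fun κ β => cellW (coup κ) β (toC x) K τ) *
        fun κ β => chainSum (cellW (coup κ) β (toC x)) (m - (supp τ).card) (K \ supp τ) := by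
    ext κ β
    simp [chainSum_eq_neg _ hm.ne', Finset.sum_apply]
  rw [e]
  exact neg_mem (sum_mem fun τ hτ => mul_mem (cellW_mem_polyTaylor hx K τ) (ih _
    (Nat.sub_lt hm (card_pos.2 (Finset.nonempty_iff_ne_empty.2 fun h =>
      (mem_erase.1 hτ).1 (supp_eq_empty.1 h)))) _))

lemma coeff_monoFn_mem_polyFn (r m : ℕ) (lam : ℤⁿ)
    (hx : x ∈ regularSet n) : (fun κ => (coeff m (expansion n (coup κ) r) (monoFn lam) :
      ℝⁿ → ℂ) x) ∈ polyFn := by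
  have hc : ∀ τ : 𝕊ⁿ,
      ContDiffAt ℝ ∞ (fun β => monoC lam (shift β τ (toC x)) - monoC lam (toC x)) 0 := fun τ =>
    (contDiffAt_line (analyticOnNhd_monoC lam _ ⟨x, hx, rfl⟩) fun j => (τ j : ℂ)).sub
      contDiffAt_const
  have h : (fun κ β => differenceOp (coup κ) r β (monoC lam) (toC x)) ∈ polyTaylor := by
    have e : (fun κ β => differenceOp (coup κ) r β (monoC lam) (toC x)) =
        ∑ τ ∈ (cells Finset.univ r).erase 0, (fun κ β => cellW (coup κ) β (toC x) Finset.univ τ) *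
        (fun κ β => chainSum (cellW (coup κ) β (toC x)) (r - (supp τ).card)
          (Finset.univ \ supp τ)) *
        fun _ β => monoC lam (shift β τ (toC x)) - monoC lam (toC x) := by
      ext κ β
      simp [differenceOp_eq, Finset.sum_apply]
    rw [e]
    exact sum_mem fun τ _ => mul_mem (mul_mem (cellW_mem_polyTaylor hx _ τ)
      (chainSum_mem_polyTaylor hx _ _)) (const_mem_polyTaylor (hc τ))
  simpa only [monoFn, coeff_expansion_apply _ _ _ _ hx] using h.2 m

lemma coeff_mul_monoFn_mem_polyFn {s : ℕ} (hs : 1 ≤ s) (hsn : s ≤ n) (r m l : ℕ)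
    (hl : IsDominant lam) (hx : x ∈ regularSet n) :
    (fun κ => ((coeff m (expansion n (coup κ) r) *
      coeff l (expansion n (coup κ) s)) (monoFn lam) : ℝⁿ → ℂ) x) ∈ polyFn := by
  choose B hB hD hT using fun κ => exists_isTri n (coup κ) hs hsn
  have hM : ∀ μ ∈ lower lam, (fun κ => tc l (B κ lam μ)) ∈ polyFn := fun μ hμ => by
    obtain ⟨w, hw⟩ := exists_coeff_functional (fun μ h => (mem_lower.1 h).1) hμ
    have e : (fun κ => tc l (B κ lam μ)) = ∑ x ∈ w.support, (fun _ => w x) * fun κ =>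
        (coeff l (expansion n (coup κ) s) (monoFn lam) : ℝⁿ → ℂ) x.1 := by
      ext κ
      rw [hw fun μ => tc l (B κ lam μ), Finsupp.sum, Finset.sum_apply]
      refine sum_congr rfl fun x _ => ?_
      rw [Pi.mul_apply, ((hT κ l).1 lam hl).2, combFn_apply _ _ x.2, comb]
    rw [e]
    exact sum_mem fun x _ => mul_mem (const_mem_polyFn _) (coeff_monoFn_mem_polyFn s l lam x.2)
  have e : (fun κ => ((coeff m (expansion n (coup κ) r) *
      coeff l (expansion n (coup κ) s)) (monoFn lam) : ℝⁿ → ℂ) x) =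
      ∑ μ ∈ lower lam, (fun κ => tc l (B κ lam μ)) * fun κ =>
        (coeff m (expansion n (coup κ) r) (monoFn μ) : ℝⁿ → ℂ) x := by
    ext κ
    rw [End.mul_apply, ((hT κ l).1 lam hl).2, combFn, map_sum, Finset.sum_apply,
      Submodule.coe_sum, Finset.sum_apply]
    exact sum_congr rfl fun μ _ => by rw [map_smul]; rfl
  rw [e]
  exact sum_mem fun μ hμ => mul_mem (hM μ hμ) (coeff_monoFn_mem_polyFn r m μ hx)

lemma coup_surjective : Surjective coup := fun P => ⟨![P.g, P.g₀, P.g₁, P.g₀', P.g₁'], rfl⟩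

lemma coeff_expansion_monoFn_eq_zero {r m : ℕ} (hr : 1 ≤ r) (hrn : r ≤ n)
    (hm : m < 2 * r) (hl : IsDominant lam) :
    coeff m (expansion n P r) (monoFn lam) = 0 := by
  obtain ⟨κ, rfl⟩ := coup_surjective P
  refine smoothFn_ext fun x hx => congrFun (polyFn_eq_zero (coeff_monoFn_mem_polyFn r m lam hx)
    fun k => ?_) κ
  exact congrFun (congrArg Subtype.val ((expansion_natCoup k hr hrn).1 m hm lam hl)) x

lemma commute_monoFn {r : ℕ} (hr : 1 ≤ r) (hrn : r ≤ n) (hl : IsDominant lam) :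
    (coeff 2 (expansion n P 1) * coeff (2 * r) (expansion n P r) -
      coeff (2 * r) (expansion n P r) * coeff 2 (expansion n P 1))
      (monoFn lam) = 0 := by
  obtain ⟨κ, rfl⟩ := coup_surjective P
  refine smoothFn_ext fun x hx => congrFun (polyFn_eq_zero (sub_mem
    (coeff_mul_monoFn_mem_polyFn hr hrn 1 2 (2 * r) hl hx)
    (coeff_mul_monoFn_mem_polyFn le_rfl (hr.trans hrn) r (2 * r) 2 hl hx)) fun k => ?_) κ
  exact congrFun (congrArg Subtype.val (commute_natCoup k hr hrn hl)) x

/-! ### Differential operators that vanish on the invariant trigonometric polynomials -/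

lemma partialOp_apply (j : Fin n) (f : SmoothFn n) (hx : x ∈ regularSet n) :
    (partialOp j f : ℝⁿ → ℂ) x = fderiv ℝ (f : ℝⁿ → ℂ) x (single j 1) := by
  change (regularSet n).indicator (fun x => fderiv ℝ (f : ℝⁿ → ℂ) x (single j 1)) x = _
  exact indicator_of_mem hx _

lemma partialOp_comm (j k : Fin n) (f : SmoothFn n) :
    partialOp j (partialOp k f) = partialOp k (partialOp j f) := by
  refine smoothFn_ext fun x hx => ?_
  have hn := (isOpen_regularSet n).mem_nhds hx
  have hf := f.2.1.contDiffAt hn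
  have key : ∀ j k : Fin n, (partialOp j (partialOp k f) : ℝⁿ → ℂ) x =
      fderiv ℝ (fderiv ℝ (f : ℝⁿ → ℂ)) x (single j 1) (single k 1) := fun j k => by
    have e : (partialOp k f : ℝⁿ → ℂ) =ᶠ[𝓝 x] fun y => fderiv ℝ (f : ℝⁿ → ℂ) y (single k 1) := by
      filter_upwards [hn] with y hy using partialOp_apply k f hy
    have hd : DifferentiableAt ℝ (fderiv ℝ (f : ℝⁿ → ℂ)) x :=
      (hf.fderiv_right (m := ∞) (by simp)).differentiableAt (by simp)
    rw [partialOp_apply j _ hx, e.fderiv_eq,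
      (hd.hasFDerivAt.clm_apply (hasFDerivAt_const _ _)).fderiv]
    simp
  rw [key, key]
  exact hf.isSymmSndFDerivAt (by simpa using WithTop.coe_le_coe.2 (le_top : (2 : ℕ∞) ≤ ⊤)) _ _

/-- Multiplication by an element of `C^∞(U)`. -/
def mulFn (a : SmoothFn n) : End ℂ (SmoothFn n) := mulOp a a.2.1

lemma mulFn_apply (a f : SmoothFn n) (x : ℝⁿ) : (mulFn a f : ℝⁿ → ℂ) x =
    (a : ℝⁿ → ℂ) x * (f : ℝⁿ → ℂ) x := rfl

lemma partialOp_mulFn (j : Fin n) (a f : SmoothFn n) :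
    partialOp j (mulFn a f) = mulFn (partialOp j a) f + mulFn a (partialOp j f) := by
  refine smoothFn_ext fun x hx => ?_
  rw [Submodule.coe_add, Pi.add_apply, mulFn_apply, mulFn_apply, partialOp_apply j _ hx,
    partialOp_apply j _ hx, partialOp_apply j _ hx]
  change fderiv ℝ (fun y => (a : ℝⁿ → ℂ) y * (f : ℝⁿ → ℂ) y) x _ = _
  rw [fderiv_fun_mul (differentiableAt_smoothFn a hx) (differentiableAt_smoothFn f hx)]
  simp
  ring

/-- Evaluation at a point. -/
def evalFn (x : ℝⁿ) : SmoothFn n →ₗ[ℂ] ℂ := (proj x).comp (SmoothFn n).subtype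

/-- The functions that vanish to order `N` at `x`. -/
def vanish (x : ℝⁿ) : ℕ → Submodule ℂ (SmoothFn n)
  | 0 => ⊤
  | N + 1 => LinearMap.ker (evalFn x) ⊓ ⨅ j, (vanish x N).comap (partialOp j)

section vanish

variable {x : Fin n → ℝ}

lemma mem_vanish_succ {N : ℕ} {f : SmoothFn n} : f ∈ vanish x (N + 1) ↔
    (f : ℝⁿ → ℂ) x = 0 ∧ ∀ j, partialOp j f ∈ vanish x N := by
  simp [vanish, evalFn]

lemma vanish_antitone : Antitone (vanish x) := by
  refine antitone_nat_of_succ_le fun N => ?_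
  induction N with
  | zero => exact le_top
  | succ N ih => exact fun f hf => mem_vanish_succ.2 ⟨(mem_vanish_succ.1 hf).1, fun j =>
      ih ((mem_vanish_succ.1 hf).2 j)⟩

lemma mulFn_mem_vanish {N : ℕ} : ∀ (a : SmoothFn n) {f : SmoothFn n}, f ∈ vanish x N →
    mulFn a f ∈ vanish x N := by
  induction N with
  | zero => exact fun _ _ _ => Submodule.mem_top
  | succ N ih =>
    intro a f hf
    have h := mem_vanish_succ.1 hf
    refine mem_vanish_succ.2 ⟨by rw [mulFn_apply, h.1, mul_zero], fun j => ?_⟩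
    rw [partialOp_mulFn]
    exact add_mem (ih _ (vanish_antitone N.le_succ hf)) (ih _ (h.2 j))

lemma mulFn_mem_vanish_succ {a : SmoothFn n} (ha : (a : ℝⁿ → ℂ) x = 0) {N : ℕ} :
    ∀ {f : SmoothFn n}, f ∈ vanish x N → mulFn a f ∈ vanish x (N + 1) := by
  induction N with
  | zero => exact fun _ => mem_vanish_succ.2 ⟨by rw [mulFn_apply, ha, zero_mul],
      fun _ => Submodule.mem_top⟩
  | succ N ih =>
    intro f hf
    refine mem_vanish_succ.2 ⟨by rw [mulFn_apply, ha, zero_mul], fun j => ?_⟩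
    rw [partialOp_mulFn]
    exact add_mem (mulFn_mem_vanish _ hf) (ih ((mem_vanish_succ.1 hf).2 j))

lemma euler_mem_vanish {u : Fin n → SmoothFn n} (hu : ∀ j, (u j : ℝⁿ → ℂ) x = 0)
    (hd : ∀ j k, (partialOp k (u j) : ℝⁿ → ℂ) x = if j = k then 1 else 0)
    (one : SmoothFn n) (h1 : ∀ y ∈ regularSet n, (one : ℝⁿ → ℂ) y = 1)
    (hx : x ∈ regularSet n) {N : ℕ} : ∀ {f : SmoothFn n}, f ∈ vanish x N →
      (N : ℂ) • f - ∑ j, mulFn (u j) (partialOp j f) ∈ vanish x (N + 1) := by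
  induction N with
  | zero =>
    exact fun {f} _ => mem_vanish_succ.2 ⟨by simp [mulFn_apply, hu], fun _ => Submodule.mem_top⟩
  | succ N ih =>
    intro f hf
    have h := mem_vanish_succ.1 hf
    refine mem_vanish_succ.2 ⟨by simp [mulFn_apply, hu, h.1], fun k => ?_⟩
    have e : partialOp k (((N + 1 : ℕ) : ℂ) • f - ∑ j, mulFn (u j) (partialOp j f)) =
        ((N : ℂ) • partialOp k f - ∑ j, mulFn (u j) (partialOp j (partialOp k f))) -
        ∑ j, mulFn (partialOp k (u j) - if j = k then one else 0) (partialOp j f) := by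
      have e1 : ∑ j, mulFn (partialOp k (u j) - if j = k then one else 0) (partialOp j f) =
          ∑ j, mulFn (partialOp k (u j)) (partialOp j f) - partialOp k f := by
        have e2 : partialOp k f = ∑ j, if j = k then partialOp j f else 0 := by simp
        rw [e2, ← sum_sub_distrib]
        refine sum_congr rfl fun j _ => smoothFn_ext fun y hy => ?_
        split_ifs with hjk <;> simp [mulFn_apply, h1 y hy, sub_mul]
      rw [e1, map_sub, map_sum, map_smul]
      simp only [partialOp_mulFn, sum_add_distrib, partialOp_comm k]
      push_cast
      rw [add_smul, one_smul]
      abel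
    rw [e]
    refine sub_mem (ih (h.2 k)) (sum_mem fun j _ => mulFn_mem_vanish_succ ?_ (h.2 j))
    rw [Submodule.coe_sub, Pi.sub_apply, hd]
    split_ifs
    · rw [h1 x hx, sub_self]
    · simp

end vanish

/-- The restrictions to `U` of the invariant trigonometric polynomials. -/
def IsInvFn (h : SmoothFn n) : Prop := ∃ F ∈ trigPoly n, IsWeylInv F ∧
  ∀ x ∈ regularSet n, (h : ℝⁿ → ℂ) x = F (toC x)

lemma IsInvFn.add {f h : SmoothFn n} : IsInvFn f → IsInvFn h → IsInvFn (f + h) := by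
  rintro ⟨F, hF, hF1, hF2⟩ ⟨H, hH, hH1, hH2⟩
  exact ⟨F + H, add_mem hF hH, fun w z => by simp [hF1 w z, hH1 w z],
    fun x hx => by simp [hF2 x hx, hH2 x hx]⟩

lemma IsInvFn.mul {f h : SmoothFn n} : IsInvFn f → IsInvFn h → IsInvFn (mulFn f h) := by
  rintro ⟨F, hF, hF1, hF2⟩ ⟨H, hH, hH1, hH2⟩
  exact ⟨F * H, mul_mem hF hH, fun w z => by simp [hF1 w z, hH1 w z],
    fun x hx => by simp [mulFn_apply, hF2 x hx, hH2 x hx]⟩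

lemma IsInvFn.smul {f : SmoothFn n} (a : ℂ) : IsInvFn f → IsInvFn (a • f) := by
  rintro ⟨F, hF, hF1, hF2⟩
  exact ⟨a • F, Subalgebra.smul_mem _ hF a, fun w z => by simp [hF1 w z],
    fun x hx => by simp [hF2 x hx]⟩

lemma exists_isInvFn (F : ℂⁿ → ℂ) (hF : F ∈ trigPoly n) (hF' : IsWeylInv F) :
    IsInvFn (restrictReal F fun z _ => analyticOnNhd_trigPoly hF z (mem_univ z)) :=
  ⟨F, hF, hF', fun _ hx => restrictReal_apply _ hx⟩

lemma cos_mem_trigPoly (i : Fin n) : (fun z : ℂⁿ => cos (z i)) ∈ trigPoly n := by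
  have e : (fun z : ℂⁿ => cos (z i)) =
      (1 / 2 : ℂ) • (expo (single i 1) + expo (single i (-1))) := by
    ext z
    simp [expo, lin, single_apply, cos, mul_comm]
    ring
  rw [e]
  exact Subalgebra.smul_mem _ (add_mem (expo_mem _) (expo_mem _)) _

lemma exists_coordinates (hx : x ∈ regularSet n) : ∃ u : Fin n → SmoothFn n,
    (∀ j, IsInvFn (u j)) ∧ (∀ j, (u j : ℝⁿ → ℂ) x = 0) ∧
    ∀ j k, (partialOp k (u j) : ℝⁿ → ℂ) x = if j = k then 1 else 0 := by
  have hsin : ∀ j, sin (x j) ≠ 0 := fun j => by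
    rw [← ofReal_sin, ofReal_ne_zero, show x j = 2 * (x j / 2) by ring, Real.sin_two_mul]
    exact mul_ne_zero (mul_ne_zero two_ne_zero (hx.1 j).1) (hx.1 j).2
  have hcos : ∀ j k, j ≠ k → cos (x j) - cos (x k) ≠ 0 := fun j k h => by
    rw [← ofReal_cos, ← ofReal_cos, ← Complex.ofReal_sub, ofReal_ne_zero, Real.cos_sub_cos]
    exact mul_ne_zero (mul_ne_zero (by norm_num) (hx.2 j k h).1) (hx.2 j k h).2
  let b : Fin n → ℂ → ℂ := fun j y => ∏ k ∈ Finset.univ.erase j, (cos y - cos (x k))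
  let q : Fin n → ℂ → ℂ := fun j y => (cos y - cos (x j)) * b j y ^ 2
  have hb : ∀ j k, j ≠ k → b j (x k) = 0 := fun j k h =>
    prod_eq_zero (mem_erase.2 ⟨h.symm, Finset.mem_univ k⟩) (sub_self _)
  have hbj : ∀ j, b j (x j) ≠ 0 := fun j =>
    prod_ne_zero_iff.2 fun k hk => hcos j k (mem_erase.1 hk).1.symm
  have hq0 : ∀ j k, q j (x k) = 0 := fun j k => by
    by_cases h : j = k
    · subst h; simp [q]
    · simp [q, hb j k h]
  have hqd : ∀ j k, HasDerivAt (q j) (if j = k then -sin (x j) * b j (x j) ^ 2 else 0)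
      (x k) := fun j k => by
    have h1 : DifferentiableAt ℂ (b j) (x k) := by fun_prop
    refine (((Complex.hasDerivAt_cos (x k : ℂ)).sub_const _).fun_mul
      (h1.hasDerivAt.fun_pow 2)).congr_deriv ?_
    by_cases h : j = k
    · subst h; simp
    · simp [h, hb j k h]
  let F : Fin n → ℂⁿ → ℂ := fun j z => (-sin (x j) * b j (x j) ^ 2)⁻¹ * ∑ i, q j (z i)
  have hF : ∀ j, F j ∈ trigPoly n := fun j => by
    have e : F j = (-sin (x j) * b j (x j) ^ 2)⁻¹ • ∑ i,
        ((fun z : ℂⁿ => cos (z i)) - fun _ => cos (x j)) *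
        (∏ k ∈ Finset.univ.erase j, ((fun z : ℂⁿ => cos (z i)) - fun _ => cos (x k))) ^ 2 := by
      ext z; simp [F, q, b, Finset.sum_apply, Finset.prod_apply]
    have hc := fun i (a : ℂ) => sub_mem (cos_mem_trigPoly (n := n) i) (const_mem_trigPoly a)
    rw [e]
    exact Subalgebra.smul_mem _ (sum_mem fun i _ => mul_mem (hc i _)
      (pow_mem (prod_mem fun k _ => hc i _) 2)) _
  have hFinv : ∀ j, IsWeylInv (F j) := fun j w z => by
    have hc : ∀ i, q j (weylAct w z i) = q j (z (w.1 i)) := fun i => by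
      have : cos (weylAct w z i) = cos (z (w.1 i)) := by
        rcases units_eq_one_or (w.2 i) with h | h <;> simp [weylAct, h]
      simp only [q, b, this]
    simp only [F, hc]
    rw [sum_comp w.1 fun i => q j (z i)]
  have hA : ∀ j, AnalyticOnNhd ℂ (F j) (toC '' regularSet n) := fun j z _ =>
    analyticOnNhd_trigPoly (hF j) z (mem_univ z)
  refine ⟨fun j => restrictReal (F j) (hA j),
    fun j => exists_isInvFn _ (hF j) (hFinv j), fun j => ?_, fun j k => ?_⟩
  · exact (restrictReal_apply (hA j) hx).trans (by simp [F, toC, hq0])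
  · refine (partialOp_restrictReal (hA j) k hx).trans ?_
    rw [← (hasDerivAt_line (differentiable_trigPoly (hF j)) (single k 1) (toC x)).deriv]
    have h1 : HasDerivAt (fun t : ℂ => F j (toC x + t • single k 1))
        ((-sin (x j) * b j (x j) ^ 2)⁻¹ * ∑ i, if i = k then
          (if j = k then -sin (x j) * b j (x j) ^ 2 else 0) else 0) 0 := by
      refine HasDerivAt.const_mul _ (HasDerivAt.fun_sum fun i _ => ?_)
      by_cases h : i = k
      · subst h
        simp only [Pi.add_apply, Pi.smul_apply, single_eq_same, smul_eq_mul, mul_one, if_true]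
        exact HasDerivAt.comp_const_add (x i : ℂ) 0 (by simpa using hqd j i)
      · simp only [Pi.add_apply, Pi.smul_apply, single_eq_of_ne h, smul_zero, add_zero, if_neg h]
        exact hasDerivAt_const _ _
    rw [h1.deriv]
    by_cases h : j = k
    · simp only [h, Finset.sum_ite_eq', Finset.mem_univ, if_true]
      grind
    · simp [h]

lemma exists_jet (hx : x ∈ regularSet n) (N : ℕ) :
    ∀ f : SmoothFn n, ∃ h, IsInvFn h ∧ f - h ∈ vanish x N := by
  obtain ⟨u, hu, hu0, hud⟩ := exists_coordinates hx
  obtain ⟨one, hone, h1⟩ : ∃ one : SmoothFn n, IsInvFn one ∧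
      ∀ y ∈ regularSet n, (one : ℝⁿ → ℂ) y = 1 :=
    ⟨_, exists_isInvFn (fun _ => 1) (one_mem _) fun _ _ => rfl, fun y hy => restrictReal_apply _ hy⟩
  induction N with
  | zero => exact fun f => ⟨one, hone, Submodule.mem_top⟩
  | succ N ih =>
    intro f
    rcases N.eq_zero_or_pos with rfl | hN
    · refine ⟨(f : ℝⁿ → ℂ) x • one, hone.smul _, mem_vanish_succ.2 ⟨?_, fun _ => Submodule.mem_top⟩⟩
      simp [h1 x hx]
    obtain ⟨h₀, hh₀, hf⟩ := ih f
    choose h hh hv using fun j => ih (partialOp j (f - h₀))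
    have hsum : ∀ s : 𝔓ⁿ, IsInvFn (∑ j ∈ s, mulFn (u j) (h j)) := fun s => by
      refine Finset.sum_induction _ _ (fun _ _ => IsInvFn.add) ?_ fun j _ => (hu j).mul (hh j)
      simpa using hone.smul 0
    refine ⟨h₀ + (N : ℂ)⁻¹ • ∑ j, mulFn (u j) (h j), hh₀.add ((hsum _).smul _), ?_⟩
    have e : f - (h₀ + (N : ℂ)⁻¹ • ∑ j, mulFn (u j) (h j)) =
        (N : ℂ)⁻¹ • (((N : ℂ) • (f - h₀) - ∑ j, mulFn (u j) (partialOp j (f - h₀))) +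
          ∑ j, mulFn (u j) (partialOp j (f - h₀) - h j)) := by
      have hN' : (N : ℂ) ≠ 0 := by exact_mod_cast hN.ne'
      simp only [map_sub, sum_sub_distrib, smul_add, smul_sub, smul_smul,
        inv_mul_cancel₀ hN', one_smul]
      abel
    rw [e]
    exact smul_mem _ _ (add_mem (euler_mem_vanish hu0 hud one h1 hx hf)
      (sum_mem fun j _ => mulFn_mem_vanish_succ (hu0 j) (hv j)))

/-- The algebra of partial differential operators on the regular set. -/
def diffOps (n : ℕ) : Subalgebra ℂ (End ℂ (SmoothFn n)) :=
  adjoin ℂ ({D | ∃ a ha, D = mulOp a ha} ∪ range partialOp)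

lemma sub_mem_diffOps {D D' : End ℂ (SmoothFn n)} (h : D ∈ diffOps n)
    (h' : D' ∈ diffOps n) : D - D' ∈ diffOps n := by
  rw [show D - D' = D + (-1 : ℂ) • D' by ext; simp [sub_eq_add_neg]]
  exact add_mem h (Subalgebra.smul_mem _ h' _)

lemma exists_order (x : ℝⁿ) {D : End ℂ (SmoothFn n)}
    (hD : D ∈ diffOps n) : ∃ k, ∀ N, ∀ f ∈ vanish x (N + k), D f ∈ vanish x N := by
  refine Algebra.adjoin_induction ?_ (fun a => ⟨0, fun N f hf => smul_mem _ a hf⟩) ?_ ?_ hD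
  · rintro _ (⟨a, ha, rfl⟩ | ⟨j, rfl⟩)
    · refine ⟨0, fun N f hf => ?_⟩
      have e : mulOp a ha f = mulFn (toSmooth a ha) f := smoothFn_ext fun y hy => by
        simp [mulFn_apply, toSmooth, hy, mulOp]
      rw [e]
      exact mulFn_mem_vanish _ hf
    · exact ⟨1, fun N f hf => (mem_vanish_succ.1 hf).2 j⟩
  · rintro D D' - - ⟨k, hk⟩ ⟨k', hk'⟩
    exact ⟨k + k', fun N f hf => add_mem (hk N f (vanish_antitone (by omega) hf))
      (hk' N f (vanish_antitone (by omega) hf))⟩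
  · rintro D D' - - ⟨k, hk⟩ ⟨k', hk'⟩
    exact ⟨k + k', fun N f hf => hk N _ (hk' _ f (by rwa [add_assoc]))⟩

lemma eq_zero_of_monoFn {D : End ℂ (SmoothFn n)} (hD : D ∈ diffOps n)
    (h : ∀ lam, IsDominant lam → D (monoFn lam) = 0) : D = 0 := by
  have h0 : ∀ f, IsInvFn f → D f = 0 := by
    rintro f ⟨F, hF, hF1, hF2⟩
    obtain ⟨a, ha⟩ := exists_finsupp_of_mem hF
    have e : f = ∑ μ ∈ a.support.image domRep, a μ • monoFn μ := smoothFn_ext fun x hx => by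
      rw [hF2 x hx, eq_sum_monoC (s := a.support.image domRep) ha hF1 (fun μ hμ hm =>
        Finset.mem_image.2 ⟨μ, hm, (domRep_eq_iff hμ).2 (self_mem_weylOrbit μ)⟩) (fun μ hμ => by
        obtain ⟨ν, -, rfl⟩ := Finset.mem_image.1 hμ
        exact isDominant_domRep ν), Submodule.coe_sum, Finset.sum_apply]
      exact sum_congr rfl fun μ _ => by
        rw [Submodule.coe_smul, Pi.smul_apply, monoFn_apply μ hx, smul_eq_mul]
    rw [e, map_sum]
    refine sum_eq_zero fun μ hμ => ?_
    obtain ⟨ν, -, rfl⟩ := Finset.mem_image.1 hμ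
    rw [map_smul, h _ (isDominant_domRep ν), smul_zero]
  ext1 f
  refine smoothFn_ext fun x hx => ?_
  obtain ⟨k, hk⟩ := exists_order x hD
  obtain ⟨g, hg, hfg⟩ := exists_jet hx (1 + k) f
  have := (mem_vanish_succ.1 (hk (0 + 1) _ (by simpa using hfg))).1
  rwa [map_sub, h0 g hg, sub_zero] at this

lemma coeff_expansion_mem (r m : ℕ) : coeff m (expansion n P r) ∈ diffOps n := by
  have hmul : ∀ a ha, mulOp a ha ∈ diffOps n := fun a ha => subset_adjoin (Or.inl ⟨a, ha, rfl⟩)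
  have hp : ∀ j, partialOp j ∈ diffOps n := fun j => subset_adjoin (Or.inr ⟨j, rfl⟩)
  have hth : ∀ ε (J : 𝔓ⁿ), thetaOp ε J ∈ diffOps n := fun ε J =>
    sum_mem fun j _ => Subalgebra.smul_mem _ (Subalgebra.smul_mem _ (hp j) _) _
  have e := map_cellSum (n := n) (coeff (R := End ℂ (SmoothFn n)) m).toAddMonoidHom
    r fun ε s c => (PowerSeries.mk fun k => mulOp (taylorCoeff P ε s c k)
      (contDiffOn_taylorCoeff P ε s c k)) * (translatorSeries ε (c 1) - 1)
  rw [show coeff m (expansion n P r) = _ from e]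
  refine sum_mem fun J _ => sum_mem fun ε _ => sum_mem fun s _ => sum_mem fun c _ => ?_
  change coeff m ((PowerSeries.mk fun k => mulOp (taylorCoeff P ε s c k)
    (contDiffOn_taylorCoeff P ε s c k)) * (translatorSeries ε (c 1) - 1)) ∈ _
  rw [coeff_mul]
  refine sum_mem fun q _ => mul_mem ?_ ?_
  · rw [coeff_mk]; exact hmul _ _
  · rw [map_sub, translatorSeries, coeff_mk, coeff_one]
    refine sub_mem_diffOps (Subalgebra.smul_mem _ (pow_mem (hth _ _) _) _) ?_
    split_ifs
    exacts [one_mem _, zero_mem _]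

/-! ### The eigenvalues as polynomials -/

lemma eq_zero_of_shifted {S : MvPolynomial (Fin n) ℝ}
    (h : ∀ lam : ℤⁿ, IsDominant lam → eval (shifted P lam) S = 0) : S = 0 := by
  let f : Fin n → MvPolynomial (Fin n) ℝ := fun j =>
    ∑ k ∈ Finset.Ici j, MvPolynomial.X k + MvPolynomial.C (rho n P j)
  have he : ∀ y : ℝⁿ, eval y (bind₁ f S) =
      eval (fun j => ∑ k ∈ Finset.Ici j, y k + rho n P j) S := fun y => by
    rw [← coe_aeval_eq_eval, ← coe_aeval_eq_eval, RingHom.coe_coe, RingHom.coe_coe, aeval_bind₁]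
    simp [f]
  have h0 : bind₁ f S = 0 := by
    refine funext_set (fun _ => range (Nat.cast : ℕ → ℝ))
      (fun _ => infinite_range_of_injective Nat.cast_injective) fun y hy => ?_
    choose a ha using fun i => hy i (mem_univ i)
    rw [he, map_zero, ← h (fun j => ∑ k ∈ Finset.Ici j, (a k : ℤ)) ⟨fun i j hij =>
      Finset.sum_le_sum_of_subset_of_nonneg (Finset.Ici_subset_Ici.2 hij) fun _ _ _ =>
        Int.natCast_nonneg _, fun j => Finset.sum_nonneg fun _ _ => Int.natCast_nonneg _⟩]
    congr 2
    ext j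
    simp [shifted, ← ha]
  have hL : Surjective (LinearMap.pi fun j : Fin n =>
      ∑ k ∈ Finset.Ici j, (proj k : ℝⁿ →ₗ[ℝ] ℝ)) := by
    rw [← LinearMap.injective_iff_surjective, injective_iff_map_eq_zero]
    intro y hy
    ext j
    induction j using WellFoundedGT.induction with
    | _ j ih =>
    have := congrFun hy j
    simp only [pi_apply, LinearMap.sum_apply, proj_apply] at this
    rwa [← Finset.Ioi_insert, sum_insert (by simp), sum_eq_zero fun k hk =>
      ih k (Finset.mem_Ioi.1 hk), add_zero] at this
  refine MvPolynomial.funext fun θ => ?_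
  obtain ⟨y, hy⟩ := hL fun j => θ j - rho n P j
  have h1 := he y
  rw [h0, map_zero] at h1
  rw [map_zero, h1]
  congr 2
  ext j
  have := congrFun hy j
  simp only [pi_apply, LinearMap.sum_apply, proj_apply] at this
  linarith

/-- The eigenvalues of the leading operators, as polynomials in `λ + ρ`. -/
def eigPoly (n : ℕ) (P : Couplings) (r : ℕ) : MvPolynomial (Fin n) ℝ :=
  ∑ s ∈ Finset.range (r + 1), MvPolynomial.C ((-1) ^ (r + s) *
    completeSum n (r - 1) (r - s) fun j => rho n P j ^ 2) * expand 2 (esymm (Fin n) ℝ s)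

lemma leadEig_eq_eval {r : ℕ} (hr : 1 ≤ r) (lam : ℤⁿ) :
    leadEig P r lam = eval (shifted P lam) (eigPoly n P r) := by
  rw [leadEig, E, eigPoly, map_sum]
  refine sum_congr rfl fun s _ => ?_
  have e : eval (shifted P lam) (expand 2 (esymm _ ℝ s)) =
      ∑ J ∈ Finset.powersetCard s Finset.univ, ∏ j ∈ J, shifted P lam j ^ 2 := by
    simp [esymm]
  rw [map_mul, eval_C, e, mul_right_comm]
  congr 2
  rw [completeSum]
  refine sum_congr (filter_congr fun i _ => and_congr_right fun _ =>
    forall_congr' fun a => ?_) fun _ _ => rfl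
  omega

lemma expand_esymm_eq (r : ℕ) : expand 2 (esymm (Fin n) ℝ r) = eigPoly n P r -
      ∑ s ∈ Finset.range r, MvPolynomial.C ((-1) ^ (r + s) *
        completeSum n (r - 1) (r - s) fun j => rho n P j ^ 2) * expand 2 (esymm (Fin n) ℝ s) := by
  rw [eigPoly, sum_range_succ, Nat.sub_self, completeSum_zero, ← two_mul, pow_mul]
  simp

lemma expand_esymm_mem (s : ℕ) : expand 2 (esymm (Fin n) ℝ s) ∈ symmSquares n :=
  ⟨_, MvPolynomial.esymm_isSymmetric _ _ s, rfl⟩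

lemma eigPoly_mem (r : ℕ) : eigPoly n P r ∈ symmSquares n :=
  sum_mem fun s _ => mul_mem ((symmSquares n).algebraMap_mem _) (expand_esymm_mem s)

lemma symmSquares_le {A : Subalgebra ℝ (MvPolynomial (Fin n) ℝ)}
    (hA : ∀ r, 1 ≤ r → r ≤ n → eigPoly n P r ∈ A) : symmSquares n ≤ A := by
  have h : ∀ r ≤ n, expand 2 (esymm (Fin n) ℝ r) ∈ A := by
    intro r
    induction r using Nat.strong_induction_on with | _ r ih =>
    intro hrn
    rcases r.eq_zero_or_pos with rfl | hr
    · simp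
    · rw [expand_esymm_eq P r]
      exact sub_mem (hA r hr hrn) (sum_mem fun s hs => mul_mem (A.algebraMap_mem _)
        (ih s (Finset.mem_range.1 hs) ((Finset.mem_range.1 hs).le.trans hrn)))
  rintro _ ⟨p, hp, rfl⟩
  obtain ⟨q, hq⟩ := MvPolynomial.esymmAlgHom_fin_surjective ℝ (le_refl n) ⟨p, hp⟩
  have h2 : p = aeval (fun i : Fin n => esymm (Fin n) ℝ (i + 1)) q := by
    rw [← MvPolynomial.esymmAlgHom_apply, hq]
  have h3 : ∀ q, expand 2 (aeval (fun i : Fin n => esymm (Fin n) ℝ (i + 1)) q) ∈ A := fun q => by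
    induction q using MvPolynomial.induction_on with
    | C a => exact (algHom_C (expand 2 |>.comp
        (aeval fun i : Fin n => esymm (Fin n) ℝ (i + 1))) a).symm ▸ A.algebraMap_mem a
    | add f g hf hg => rw [map_add, map_add]; exact add_mem hf hg
    | mul_X f i hf =>
      rw [map_mul, map_mul, aeval_X]
      exact mul_mem hf (h _ i.2)
  exact h2 ▸ h3 q

/-! ### The eigenvalue equations -/

section eigen

variable {P : Couplings} {lam : Fin n → ℤ} {p : (Fin n → ℝ) → ℂ}

/-- The coupling constants are nonnegative. -/
def Couplings.Nonneg (P : Couplings) : Prop := 0 ≤ P.g ∧ 0 ≤ P.g₀ ∧ 0 ≤ P.g₁ ∧ 0 ≤ P.g₀' ∧ 0 ≤ P.g₁'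

lemma Couplings.Nonneg.continuous_weight (h : P.Nonneg) : Continuous (weight P : ℝⁿ → ℝ) :=
  BCn.continuous_weight h.1 (add_nonneg h.2.1 h.2.2.2.1) (add_nonneg h.2.2.1 h.2.2.2.2)

lemma IsJacobi.exists_combFn (hp : IsJacobi P lam p) : ∃ b, b lam = 1 ∧
    hp.fn = combFn lam b ∧ ∀ μ ∈ (lower lam).erase lam, bil P (comb (lower lam) b) (monoC μ) = 0 := by
  obtain ⟨-, b, hb, h, ho⟩ := isJacobi_iff.1 hp
  refine ⟨b, hb, smoothFn_ext fun x hx => ?_, ho⟩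
  rw [combFn_apply _ _ hx]
  exact (indicator_of_mem hx p).trans (congrFun h x)

lemma IsJacobi.fn_ne_zero (hp : IsJacobi P lam p) : hp.fn ≠ 0 := fun h => by
  obtain ⟨b, hb, h1, -⟩ := hp.exists_combFn
  have h2 := combFn_inj (c := 0) ((h1.symm.trans h).trans (by simp [combFn])) lam
    (self_mem_lower hp.dominant)
  simp [hb] at h2

lemma eq_zero_of_jacobi (h : P.Nonneg) {D : End ℂ (SmoothFn n)} (hD : D ∈ diffOps n)
    (hp : ∀ lam p, ∀ hp : IsJacobi P lam p, D hp.fn = 0) : D = 0 := by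
  refine eq_zero_of_monoFn hD (apply_monoFn_eq_zero D fun lam hl => ?_)
  obtain ⟨p, hJ, -⟩ := existsUnique_isJacobi h.continuous_weight hl
  obtain ⟨b, hb, h1, -⟩ := hJ.exists_combFn
  exact ⟨b, hb, h1 ▸ hp lam p hJ⟩

lemma coeff_expansion_eq_zero (P : Couplings) {r m : ℕ} (hr : 1 ≤ r) (hrn : r ≤ n)
    (hm : m < 2 * r) : coeff m (expansion n P r) = 0 :=
  eq_zero_of_monoFn (coeff_expansion_mem P r m)
    fun _ hl => coeff_expansion_monoFn_eq_zero P hr hrn hm hl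

lemma coeff_expansion_jacobi (h : P.Nonneg) {r : ℕ} (hr : 1 ≤ r) (hrn : r ≤ n)
    (hp : IsJacobi P lam p) : coeff (2 * r) (expansion n P r) hp.fn =
      ((leadEig P r lam : ℝ) : ℂ) • hp.fn := by
  obtain ⟨b, hb, h1, ho⟩ := hp.exists_combFn
  have hl := hp.dominant
  have hn1 := hr.trans hrn
  obtain ⟨B, -, -, hT⟩ := exists_isTri n P le_rfl hn1
  obtain ⟨B', -, -, hT'⟩ := exists_isTri n P hr hrn
  have hE : ∀ μ, IsDominant μ → tc 2 (B μ μ) = leadEig P 1 μ := fun μ hμ =>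
    ((hT 2).2 μ hμ).trans (tc_diffEig P le_rfl hn1 μ).2
  have hE' := ((hT' (2 * r)).2 lam hl).trans (tc_diffEig P hr hrn lam).2
  have hk : ∀ i : Mirror n, 0 ≤ mK P i := by
    rintro (q | ⟨j, t⟩)
    · exact h.1
    · cases t
      · exact add_nonneg h.2.1 h.2.2.2.1
      · exact add_nonneg h.2.2.1 h.2.2.2.2
  have hc : ∀ μ, IsDominant μ → _ := fun μ hμ => commute_monoFn P hr hrn hμ
  rw [h1, ← hE']
  refine (hT 2).1.eigen_of_commute (hT' (2 * r)).1 hl (fun μ hμ => ?_) ?_ hb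
    ((hT 2).1.eigen h.continuous_weight (fun μ ν hμ hν => symm_of_isTri_two hk (hT 2).1 hμ hν) hl hb ho)
  · rw [hE μ (mem_lower.1 (mem_erase.1 hμ).2).1, hE lam hl]
    exact_mod_cast leadEig_one_ne h.1 (by
      have := h.2; linarith [h.2.1, h.2.2.1, h.2.2.2.1, h.2.2.2.2]) hμ
  · rw [← sub_eq_zero, ← End.mul_apply, ← End.mul_apply, ← LinearMap.sub_apply, combFn, map_sum]
    exact sum_eq_zero fun μ hμ => by
      rw [map_smul, commute_monoFn P hr hrn (mem_lower.1 hμ).1, smul_zero]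

lemma leadingOrder_eq (h : P.Nonneg) {r : ℕ} (hr : 1 ≤ r) (hrn : r ≤ n) :
    leadingOrder n P r = 2 * r := by
  refine (IsLeast.csInf_eq ⟨fun h0 => ?_, fun m hm => le_of_not_gt fun hlt =>
    hm (coeff_expansion_eq_zero P hr hrn hlt)⟩)
  have h1 : eigPoly n P r = 0 := eq_zero_of_shifted P fun lam hl => by
    obtain ⟨p, hp, -⟩ := existsUnique_isJacobi h.continuous_weight hl
    have h2 := coeff_expansion_jacobi h hr hrn hp
    rw [h0, LinearMap.zero_apply, eq_comm, smul_eq_zero_iff_left hp.fn_ne_zero] at h2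
    rw [← leadEig_eq_eval P hr]
    exact_mod_cast h2
  have h2 : ∀ s, esymm (Fin n) ℝ s ∈ MvPolynomial.homogeneousSubmodule (Fin n) ℝ s :=
    fun s => IsHomogeneous.sum _ _ _ fun J hJ => by
      have := IsHomogeneous.prod J MvPolynomial.X _ fun i _ => MvPolynomial.isHomogeneous_X ℝ i
      simpa [(mem_powersetCard.1 hJ).2] using this
  have h3 : expand 2 (∑ s ∈ Finset.range (r + 1), MvPolynomial.C ((-1) ^ (r + s) *
      completeSum n (r - 1) (r - s) fun j => rho n P j ^ 2) * esymm (Fin n) ℝ s) = 0 := by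
    rw [← h1, eigPoly, map_sum]
    exact sum_congr rfl fun s _ => by rw [map_mul, expand_C]
  have h4 := congrArg (MvPolynomial.homogeneousComponent r)
    ((MvPolynomial.expand_eq_zero two_pos).1 h3)
  simp_rw [map_sum, MvPolynomial.homogeneousComponent_C_mul,
    MvPolynomial.homogeneousComponent_of_mem (h2 _), mul_ite, mul_zero, Finset.sum_ite_eq] at h4
  have h5 := congrArg (eval 1) h4
  rw [if_pos (by simp), Nat.sub_self, completeSum_zero] at h5
  simp [esymm, (Nat.choose_pos hrn).ne'] at h5

lemma leadingPDO_eq (h : P.Nonneg) {r : ℕ} (hr : 1 ≤ r) (hrn : r ≤ n) :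
    leadingPDO n P r = coeff (2 * r) (expansion n P r) := by
  rw [leadingPDO, leadingOrder_eq h hr hrn]

/-- `S(λ + ρ)` is the eigenvalue of `D` on the Jacobi polynomial attached to `λ`. -/
def HasEig (P : Couplings) (D : End ℂ (SmoothFn n)) (S : MvPolynomial (Fin n) ℝ) : Prop :=
  ∀ (lam : ℤⁿ) (p : ℝⁿ → ℂ) (hp : IsJacobi P lam p),
    D hp.fn = ((eval (shifted P lam) S : ℝ) : ℂ) • hp.fn

variable {D D' : End ℂ (SmoothFn n)} {S S' : MvPolynomial (Fin n) ℝ}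

lemma HasEig.add (h : HasEig P D S) (h' : HasEig P D' S') : HasEig P (D + D') (S + S') :=
  fun lam p hp => by
    rw [LinearMap.add_apply, h lam p hp, h' lam p hp, map_add, Complex.ofReal_add, add_smul]

lemma HasEig.mul (h : HasEig P D S) (h' : HasEig P D' S') : HasEig P (D * D') (S * S') :=
  fun lam p hp => by
    rw [End.mul_apply, h' lam p hp, map_smul, h lam p hp, map_mul, ofReal_mul, smul_smul, mul_comm]

lemma hasEig_algebraMap (a : ℝ) : HasEig (n := n) P (algebraMap ℝ _ a) (algebraMap ℝ _ a) :=
  fun lam p hp => by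
    rw [MvPolynomial.algebraMap_eq, eval_C]
    rfl

lemma HasEig.unique_right (hP : P.Nonneg) (h : HasEig P D S) (h' : HasEig P D S') : S = S' := by
  refine sub_eq_zero.1 (eq_zero_of_shifted P fun lam hl => ?_)
  obtain ⟨p, hp, -⟩ := existsUnique_isJacobi hP.continuous_weight hl
  have := (h lam p hp).symm.trans (h' lam p hp)
  rw [map_sub, sub_eq_zero]
  exact_mod_cast smul_left_injective ℂ hp.fn_ne_zero this

lemma hasEig_leadingPDO (h : P.Nonneg) {r : ℕ} (hr : 1 ≤ r) (hrn : r ≤ n) :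
    HasEig P (leadingPDO n P r) (eigPoly n P r) := fun lam p hp => by
  rw [leadingPDO_eq h hr hrn, coeff_expansion_jacobi h hr hrn hp, leadEig_eq_eval P hr]

lemma pdoAlgebra_le (P : Couplings) : pdoAlgebra n P ≤ (diffOps n).restrictScalars ℝ :=
  Algebra.adjoin_le fun _ ⟨r, _, _, h⟩ => h ▸ coeff_expansion_mem P r _

lemma HasEig.unique_left (hP : P.Nonneg) (hD : D ∈ diffOps n) (hD' : D' ∈ diffOps n)
    (h : HasEig P D S) (h' : HasEig P D' S) : D = D' :=
  sub_eq_zero.1 (eq_zero_of_jacobi hP (sub_mem_diffOps hD hD') fun lam p hp => by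
    rw [LinearMap.sub_apply, h lam p hp, h' lam p hp, sub_self])

lemma exists_eigPoly (h : P.Nonneg) (hD : D ∈ pdoAlgebra n P) :
    ∃ S ∈ symmSquares n, HasEig P D S := by
  refine Algebra.adjoin_induction ?_ (fun a => ⟨_, (symmSquares n).algebraMap_mem a,
    hasEig_algebraMap a⟩) ?_ ?_ hD
  · rintro _ ⟨r, hr, hrn, rfl⟩
    exact ⟨_, eigPoly_mem P r, hasEig_leadingPDO h hr hrn⟩
  · rintro D D' - - ⟨S, hS, hE⟩ ⟨S', hS', hE'⟩
    exact ⟨_, add_mem hS hS', hE.add hE'⟩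
  · rintro D D' - - ⟨S, hS, hE⟩ ⟨S', hS', hE'⟩
    exact ⟨_, mul_mem hS hS', hE.mul hE'⟩

lemma exists_pdo (h : P.Nonneg) (hS : S ∈ symmSquares n) : ∃ D ∈ pdoAlgebra n P, HasEig P D S := by
  let A : Subalgebra ℝ (MvPolynomial (Fin n) ℝ) :=
    { carrier := {S | ∃ D ∈ pdoAlgebra n P, HasEig P D S}
      mul_mem' := fun ⟨D, hD, hE⟩ ⟨D', hD', hE'⟩ => ⟨_, mul_mem hD hD', hE.mul hE'⟩
      add_mem' := fun ⟨D, hD, hE⟩ ⟨D', hD', hE'⟩ => ⟨_, add_mem hD hD', hE.add hE'⟩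
      algebraMap_mem' := fun a => ⟨_, (pdoAlgebra n P).algebraMap_mem a, hasEig_algebraMap a⟩ }
  exact symmSquares_le P (A := A) (fun r hr hrn => ⟨_, subset_adjoin ⟨r, hr, hrn, rfl⟩,
    hasEig_leadingPDO h hr hrn⟩) hS

lemma exists_harishChandra (h : P.Nonneg) : ∃ HC : pdoAlgebra n P ≃ₐ[ℝ] symmSquares n,
    ∀ D : pdoAlgebra n P, HasEig P (D : End ℂ (SmoothFn n)) (HC D) := by
  choose S hS hE using fun D : pdoAlgebra n P => exists_eigPoly h D.2
  let f : pdoAlgebra n P →ₐ[ℝ] symmSquares n :=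
    { toFun := fun D => ⟨S D, hS D⟩
      map_one' := Subtype.ext ((hE 1).unique_right h (by simpa using hasEig_algebraMap (P := P) 1))
      map_mul' := fun D D' => Subtype.ext ((hE _).unique_right h ((hE D).mul (hE D')))
      map_zero' := Subtype.ext ((hE 0).unique_right h (by simpa using hasEig_algebraMap (P := P) 0))
      map_add' := fun D D' => Subtype.ext ((hE _).unique_right h ((hE D).add (hE D')))
      commutes' := fun a => Subtype.ext ((hE _).unique_right h (hasEig_algebraMap a)) }
  refine ⟨AlgEquiv.ofBijective f ⟨fun D D' hDD' => Subtype.ext ?_, fun T => ?_⟩, hE⟩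
  · have := congrArg Subtype.val hDD'
    exact (hE D).unique_left h (pdoAlgebra_le P D.2) (pdoAlgebra_le P D'.2)
      (by rw [show S D = S D' from this]; exact hE D')
  · obtain ⟨D, hD, hDE⟩ := exists_pdo h T.2
    exact ⟨⟨D, hD⟩, Subtype.ext ((hE ⟨D, hD⟩).unique_right h hDE)⟩

end eigen

end

end BCn

theorem mainTheorem8 (n : ℕ) (P : BCn.Couplings) (hg : 0 ≤ P.g) (hg₀ : 0 ≤ P.g₀) (hg₁ : 0 ≤ P.g₁)
    (hg₀' : 0 ≤ P.g₀') (hg₁' : 0 ≤ P.g₁') :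
    -- the Jacobi polynomials are well defined
    (∀ lam : Fin n → ℤ, BCn.IsDominant lam → ∃! p, BCn.IsJacobi P lam p) ∧
    (∀ r : ℕ, 1 ≤ r → r ≤ n →
      -- the leading order is `2r`
      BCn.leadingOrder n P r = 2 * r ∧
      -- the leading coefficient is the limit of `β^{-2r} D_{r,β}` on analytic functions
      (∀ (f : (Fin n → ℂ) → ℂ) (hf : AnalyticOnNhd ℂ f (BCn.toC '' BCn.regularSet n)),
        ∀ x ∈ BCn.regularSet n,
          Filter.Tendsto (fun β : ℝ => (β : ℂ)⁻¹ ^ (2 * r) * BCn.differenceOp P r β f (BCn.toC x))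
            (nhdsWithin 0 (Set.Ioi 0))
            (nhds ((BCn.leadingPDO n P r (BCn.restrictReal f hf) : (Fin n → ℝ) → ℂ) x))) ∧
      -- the Jacobi polynomials are eigenfunctions
      (∀ (lam : Fin n → ℤ) (p : (Fin n → ℝ) → ℂ) (hp : BCn.IsJacobi P lam p),
        BCn.leadingPDO n P r hp.fn =
          ((BCn.E n r (fun j => BCn.shifted P lam j ^ 2) (fun j => BCn.rho n P j ^ 2) : ℝ) : ℂ) •
            hp.fn)) ∧
    -- the leading operators commute
    (∀ r r' : ℕ, 1 ≤ r → r ≤ n → 1 ≤ r' → r' ≤ n →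
      Commute (BCn.leadingPDO n P r) (BCn.leadingPDO n P r')) ∧
    -- every symmetric polynomial in the squares is the eigenvalue of a unique operator
    (∀ S ∈ BCn.symmSquares n, ∃! D : Module.End ℂ (BCn.SmoothFn n), D ∈ BCn.pdoAlgebra n P ∧
      ∀ (lam : Fin n → ℤ) (p : (Fin n → ℝ) → ℂ) (hp : BCn.IsJacobi P lam p),
        D hp.fn = ((MvPolynomial.eval (BCn.shifted P lam) S : ℝ) : ℂ) • hp.fn) ∧
    -- and this gives an isomorphism of algebras
    (∃ HC : BCn.pdoAlgebra n P ≃ₐ[ℝ] BCn.symmSquares n, ∀ D : BCn.pdoAlgebra n P,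
      ∀ (lam : Fin n → ℤ) (p : (Fin n → ℝ) → ℂ) (hp : BCn.IsJacobi P lam p),
        (D : Module.End ℂ (BCn.SmoothFn n)) hp.fn =
          ((MvPolynomial.eval (BCn.shifted P lam) (HC D : MvPolynomial (Fin n) ℝ) : ℝ) : ℂ) •
            hp.fn) := by
  have h : P.Nonneg := ⟨hg, hg₀, hg₁, hg₀', hg₁'⟩
  refine ⟨fun lam hl => BCn.existsUnique_isJacobi h.continuous_weight hl, fun r hr hrn =>
    ⟨BCn.leadingOrder_eq h hr hrn, fun f hf x hx => ?_, fun lam p hp => ?_⟩,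
    fun r r' hr hrn hr' hrn' => ?_, fun S hS => ?_, BCn.exists_harishChandra h⟩
  · rw [BCn.leadingPDO_eq h hr hrn, BCn.coeff_expansion_apply P r (2 * r) hf hx]
    exact BCn.tendsto_of_tc (BCn.contDiffAt_differenceOp P r hx (hf _ ⟨x, hx, rfl⟩)) fun m hm => by
      rw [← BCn.coeff_expansion_apply P r m hf hx, BCn.coeff_expansion_eq_zero P hr hrn hm]
      rfl
  · rw [BCn.leadingPDO_eq h hr hrn, BCn.coeff_expansion_jacobi h hr hrn hp]
    rfl
  · have h1 := BCn.hasEig_leadingPDO h hr hrn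
    have h2 := BCn.hasEig_leadingPDO h hr' hrn'
    have hA : ∀ {r}, 1 ≤ r → r ≤ n → BCn.leadingPDO n P r ∈ BCn.pdoAlgebra n P :=
      fun {r} hr hrn => Algebra.subset_adjoin ⟨r, hr, hrn, rfl⟩
    exact (h1.mul h2).unique_left h (BCn.pdoAlgebra_le P (mul_mem (hA hr hrn) (hA hr' hrn')))
      (BCn.pdoAlgebra_le P (mul_mem (hA hr' hrn') (hA hr hrn))) (by
        rw [mul_comm]; exact h2.mul h1)
  · obtain ⟨D, hD, hE⟩ := BCn.exists_pdo h hS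
    exact ⟨D, ⟨hD, hE⟩, fun D' hD' => BCn.HasEig.unique_left h (BCn.pdoAlgebra_le P hD'.1)
      (BCn.pdoAlgebra_le P hD) hD'.2 hE⟩
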